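/- **Setting.** Let $(\xi_t)_{t\in\mathbb Z}$ be a real-valued time series, and let $r_n\in\mathbb N$ be block sizes with $r_n\to\infty$ and $k_n=\lfloor n/r_n\rfloor\to\infty$. For a block size $r$ and $i\ge1$ let $M_{r,i}\ge S_{r,i}$ be the largest and the second largest order statistic (ties counted with multiplicity) of $\xi_t$, $t\in\{(i-1)r+1,\dots,ir\}$, and put $M_r=M_{r,1}$, $S_r=S_{r,1}$. *Fréchet–Welsch distribution.* Call $\rho:[0,1]\to[0,1]$ admissible if it is concave, non-increasing and $\rho(0)(1-\eta)\le\rho(\eta)\le1-\eta$ on $[0,1]$; write $\rho_0=\rho(0)$. For admissible $\rho$ and $\alpha,\sigma>0$, $\mathcal W(\rho,\alpha,\sigma)$ is the distribution on $(0,\infty)^2$ with cdf $$H_{\rho,\alpha,\sigma}(x,y)=\begin{cases}\exp(-(x/\sigma)^{-\alpha}),& y\ge x>0,\\ \exp(-(y/\sigma)^{-\alpha})\{1+\rho((y/x)^\alpha)(y/\sigma)^{-\alpha}\},& x>y>0.\end{cases}$$ *Constants.* With $\gamma$ the Euler–Mascheroni constant, let $\Upsilon_{\rho_0}(x)=\rho_0\Gamma(x+2)+(1-\rho_0)\Gamma(x+1)$,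 let $\varpi_{\rho_0}$ be the unique zero in $(0,\infty)$ of $\Pi_{\rho_0}(y)=\frac1y-\frac{\Upsilon_{\rho_0}'(y)}{\Upsilon_{\rho_0}(y)}+\frac{\rho_0}2-\gamma$, and for $\alpha_0>0$ let $$\alpha_1=\varpi_{\rho_0}\alpha_0,\qquad s_1=\{2/\Upsilon_{\rho_0}(\varpi_{\rho_0})\}^{1/\alpha_1}.$$ Writing $\Upsilon,\Upsilon',\Upsilon''$ for the values of $\Upsilon_{\rho_0}$ and its derivatives at $\varpi_{\rho_0}$, $z_0=\Upsilon/2$ and $\dot\Psi=-\frac{2}{\alpha_1^2}-2\,\frac{\Upsilon''\Upsilon-(\Upsilon')^2}{\alpha_0^2\Upsilon^2}$, let $M_{\rho_0}(\alpha_0)=(\beta_{jk})\in\mathbb R^{2\times4}$ with $$(\beta_{11},\dots,\beta_{14})=\frac1{\dot\Psi}\Big(-\frac2\Upsilon,\,-\frac{2\Upsilon'}{\alpha_0\Upsilon^2},\,1,\,1\Big),\qquad \beta_{21}=\frac{z_0^{-1/\alpha_1}}{\alpha_1\dot\Psi}\Big\{\frac{\Upsilon'}{2\alpha_0z_0^2}-\frac{\log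 z_0}{\alpha_1z_0}\Big\},$$ $$\beta_{22}=\frac{z_0^{-1/\alpha_1}}{\alpha_1\dot\Psi}\Big\{\frac{(\Upsilon')^2}{4\alpha_0^2z_0^3}-\frac{\Upsilon'\log z_0}{2\alpha_0\alpha_1z_0^2}\Big\}-\frac{z_0^{-1/\alpha_1-1}}{2\alpha_1},\qquad \beta_{23}=\beta_{24}=\frac{z_0^{-1/\alpha_1}}{\alpha_1\dot\Psi}\Big\{\frac{\log z_0}{\alpha_1}-\frac{\Upsilon'}{2\alpha_0z_0}\Big\}.$$ Finally let $f_1(x,y)=y^{-\alpha_1}\log y$, $f_2(x,y)=y^{-\alpha_1}$, $f_3(x,y)=\log y$, $f_4(x,y)=\log x$. *Estimator.* For a sample $z=((x_1,y_1),\dots,(x_k,y_k))$ in $(0,\infty)^2$ let $\hat\theta(z)=(\hat\alpha(z),\hat\sigma(z))$ be the maximizer over $(0,\infty)^2$ of $$\ell(\alpha,\sigma|z)=2k\log\alpha+2k\alpha\log\sigma-\sum_{i=1}^k\{(\alpha+1)\log(x_iy_i)+\sigma^\alpha y_i^{-\alpha}\}.$$ For $c>0$ let $(\hat\alpha_n,\hat\sigma_n)=\hat\theta\big((M_{r_n,i}\vee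 c,S_{r_n,i}\vee c)_{i=1,\dots,k_n}\big)$. *Mixing.* $\alpha(\ell)=\sup|\mathbb P(A\cap B)-\mathbb P(A)\mathbb P(B)|$ over $A\in\sigma(\xi_t:t\le0)$, $B\in\sigma(\xi_t:t\ge\ell)$. **Assumptions.** 1. (Domain of attraction) $(\xi_t)$ is strictly stationary with continuous marginal cdf, and there are an admissible $\rho$, $\alpha_0>0$ and $\sigma_r>0$ with $\sigma_r\to\infty$ and $(M_r/\sigma_r,S_r/\sigma_r)\rightsquigarrow\mathcal W(\rho,\alpha_0,1)$ as $r\to\infty$; moreover $(\sigma_r)_r$ is regularly varying with index $1/\alpha_0$. 2. (Divergence) $\mathbb P(\min\{S_{r_n,1},\dots,S_{r_n,k_n}\}\le c')\to0$ for every $c'>0$. 3. ($\alpha$-mixing rate) $\alpha(\ell)\to0$; there is $\omega>0$ with $(n/r_n)^{1+\omega}\alpha(r_n)\to0$; and there are integers $\ell_n\to\infty$ with $\ell_n=o(r_n)$, $(n/r_n)\alpha(\ell_n)\to0$ and $(r_n/\ell_n)\alpha(\ell_n)\to0$. 4. (Integrability) For some $\nu>1/\omega$, $\limsup_{r}\mathbb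 E[h_\nu((M_r\vee1)/\sigma_r)]<\infty$ and $\limsup_r\mathbb E[h_{\nu,\alpha_1}((S_r\vee1)/\sigma_r)]<\infty$, where $h_\nu(x)=(\log x\,\mathbf 1(x>e))^{2+\nu}$ and $h_{\nu,\alpha_1}(x)=(x^{-\alpha_1}\mathbf 1(x\le e))^{2+\nu}$. 5. (Bias) For some $c_0>0$ the limits $B(f_j)=\lim_n\sqrt{n/r_n}\big(\mathbb E[f_j((M_{r_n}\vee c_0)/\sigma_{r_n},(S_{r_n}\vee c_0)/\sigma_{r_n})]-\int f_j\,dH_{\rho,\alpha_0,1}\big)$, $j=1,\dots,4$, exist in $\mathbb R$. **Theorem.** Under assumptions 1–5, for every $c>0$, with probability tending to one the log-likelihood of the sample $(M_{r_n,i}\vee c,S_{r_n,i}\vee c)_{i\le k_n}$ has a unique maximizer, so that $(\hat\alpha_n,\hat\sigma_n)$ is well-defined and unique, and, as $n\to\infty$, $$\sqrt{n/r_n}\begin{pmatrix}\hat\alpha_n-\alpha_1\\ \hat\sigma_n/\sigma_{r_n}-s_1\end{pmatrix}=M_{\rho_0}(\alpha_0)\,W_n+o_{\mathbb P}(1)\rightsquigarrow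 M_{\rho_0}(\alpha_0)\,\mathcal N_4(B,\Sigma),$$ where $W_n=(\mathbb G_nf_1,\dots,\mathbb G_nf_4)^\top$ with $$\mathbb G_nf=\sqrt{n/r_n}\Big\{\frac1{k_n}\sum_{i=1}^{k_n}f\Big(\frac{M_{r_n,i}\vee c}{\sigma_{r_n}},\frac{S_{r_n,i}\vee c}{\sigma_{r_n}}\Big)-\int f\,dH_{\rho,\alpha_0,1}\Big\},$$ $B=(B(f_1),\dots,B(f_4))^\top$, and $\Sigma_{ij}=\operatorname{Cov}(f_i(X,Y),f_j(X,Y))$ for $(X,Y)\sim\mathcal W(\rho,\alpha_0,1)$. If $\rho(\eta)=1-\eta$ on $[0,1]$, then $\alpha_1=\alpha_0$, $s_1=1$, $$\Sigma=\frac1{\alpha_0^2}\begin{pmatrix}3-10\gamma+2\gamma^2+\pi^2&\alpha_0(2\gamma-5)&\frac{\pi^2}3-1-\gamma&\frac{\pi^2}3-1-\gamma\\ \alpha_0(2\gamma-5)&2\alpha_0^2&-\alpha_0&-\alpha_0\\ \frac{\pi^2}3-1-\gamma&-\alpha_0&\frac{\pi^2}6-1&\frac{\pi^2}6-1\\ \frac{\pi^2}3-1-\gamma&-\alpha_0&\frac{\pi^2}6-1&\frac{\pi^2}6\end{pmatrix},$$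 $$M_{\rho_0}(\alpha_0)=\frac6{2\pi^2-3}\begin{pmatrix}\alpha_0^2&\frac{3-2\gamma}2\alpha_0&-\alpha_0^2&-\alpha_0^2\\ \frac{2\gamma-3}2&\frac{3-2\pi^2-3(3-2\gamma)^2}{12\alpha_0}&\frac{3-2\gamma}2&\frac{3-2\gamma}2\end{pmatrix}.$$ -/

import Mathlib

open MeasureTheory ProbabilityTheory Filter Set
open scoped Topology ENNReal

noncomputable section

/-! ### The Fréchet–Welsch distribution -/

/-- Admissible functions `ρ : [0,1] → [0,1]` (only the values on `[0,1]` matter): concave,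
non-increasing, with `ρ(0)(1-η) ≤ ρ(η) ≤ 1-η`. -/
structure IsWelschFunction (ρ : ℝ → ℝ) : Prop where
  mapsTo : MapsTo ρ (Icc 0 1) (Icc 0 1)
  concave : ConcaveOn ℝ (Icc 0 1) ρ
  antitone : AntitoneOn ρ (Icc 0 1)
  lower : ∀ η ∈ Icc (0 : ℝ) 1, ρ 0 * (1 - η) ≤ ρ η
  upper : ∀ η ∈ Icc (0 : ℝ) 1, ρ η ≤ 1 - η

/-- The joint cdf `H_{ρ,α,σ}`, equal to zero outside of `(0,∞)²`. -/
def welschCDF (ρ : ℝ → ℝ) (α σ x y : ℝ) : ℝ :=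
  if x ≤ 0 ∨ y ≤ 0 then 0
  else if x ≤ y then Real.exp (-(x / σ) ^ (-α))
  else Real.exp (-(y / σ) ^ (-α)) * (1 + ρ ((y / x) ^ α) * (y / σ) ^ (-α))

/-- `W` is a probability measure on `ℝ²` with joint cdf `H_{ρ,α,σ}`. -/
def HasWelschCDF (ρ : ℝ → ℝ) (α σ : ℝ) (W : Measure (ℝ × ℝ)) : Prop :=
  IsProbabilityMeasure W ∧
    ∀ x y : ℝ, W (Iic x ×ˢ Iic y) = ENNReal.ofReal (welschCDF ρ α σ x y)

lemma IsWelschFunction.apply_one {ρ : ℝ → ℝ} (h : IsWelschFunction ρ) : ρ 1 = 0 := by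
  have h1 := h.upper 1 (by simp)
  have h2 := (h.mapsTo (x := 1) (by simp)).1
  linarith

lemma IsWelschFunction.sub_le {ρ : ℝ → ℝ} (h : IsWelschFunction ρ) {x y : ℝ} (hx : 0 ≤ x)
    (hxy : x ≤ y) (hy : y ≤ 1) : ρ x - ρ y ≤ y - x := by
  rcases eq_or_lt_of_le (hxy.trans hy) with rfl | hx1
  · have : y = 1 := le_antisymm hy hxy
    simp [this]
  have hc := h.concave.2 (show x ∈ Icc (0 : ℝ) 1 from ⟨hx, hx1.le⟩)
    (show (1 : ℝ) ∈ Icc (0 : ℝ) 1 by simp)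
    (show 0 ≤ (1 - y) / (1 - x) by apply div_nonneg <;> linarith)
    (show 0 ≤ (y - x) / (1 - x) by apply div_nonneg <;> linarith) (by rw [← add_div, div_eq_one_iff_eq] <;> linarith)
  have hne : (1 - x) ≠ 0 := by linarith
  have e : ((1 - y) / (1 - x)) • x + ((y - x) / (1 - x)) • (1 : ℝ) = y := by
    simp only [smul_eq_mul]; field_simp; ring
  rw [e, h.apply_one] at hc
  simp only [smul_eq_mul, mul_zero, add_zero] at hc
  have hu := h.upper x ⟨hx, hx1.le⟩
  have e2 : (1 - y) / (1 - x) * ρ x = ρ x - (y - x) / (1 - x) * ρ x := by field_simp; ring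
  have : (y - x) / (1 - x) * ρ x ≤ (y - x) / (1 - x) * (1 - x) :=
    mul_le_mul_of_nonneg_left hu (by apply div_nonneg <;> linarith)
  rw [div_mul_cancel₀ _ hne] at this
  linarith

lemma IsWelschFunction.lipschitz {ρ : ℝ → ℝ} (h : IsWelschFunction ρ) :
    LipschitzOnWith 1 ρ (Icc 0 1) := by
  apply LipschitzOnWith.of_dist_le_mul
  intro x hx y hy
  rw [NNReal.coe_one, one_mul, Real.dist_eq, Real.dist_eq]
  rcases le_total x y with hxy | hxy
  · have h1 := h.sub_le hx.1 hxy hy.2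
    have h2 := h.antitone hx hy hxy
    rw [abs_of_nonneg (by linarith), abs_sub_comm, abs_of_nonneg (by linarith)]
    exact h1
  · have h1 := h.sub_le hy.1 hxy hx.2
    have h2 := h.antitone hy hx hxy
    rw [abs_sub_comm, abs_of_nonneg (by linarith), abs_of_nonneg (by linarith)]
    exact h1

/-- A mixture representation: `ρ(η) = E[1 - max(η, q)]` for a random variable `q` in `[0,1]`. -/
lemma IsWelschFunction.exists_mixture {ρ : ℝ → ℝ} (h : IsWelschFunction ρ) :
    ∃ G : Measure ℝ, IsProbabilityMeasure G ∧ (∀ᵐ q ∂G, q ∈ Icc (0 : ℝ) 1) ∧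
      ∀ η ∈ Icc (0 : ℝ) 1, ∫⁻ q, ENNReal.ofReal (1 - max η q) ∂G = ENNReal.ofReal (ρ η) := by
  classical
  set f : ℝ → ℝ := fun x => -ρ x with hf
  have hconv : ConvexOn ℝ (Icc 0 1) f := h.concave.neg
  set R : ℝ → ℝ := fun z => derivWithin f (Ioi z) z with hR
  have hmono : MonotoneOn R (Ioo 0 1) := by
    have := hconv.monotoneOn_rightDeriv
    rwa [interior_Icc] at this
  have hderiv : ∀ z ∈ Ioo (0 : ℝ) 1, HasDerivWithinAt f (R z) (Ioi z) z := fun z hz =>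
    hconv.hasDerivWithinAt_rightDeriv_of_mem_interior (by rwa [interior_Icc])
  have hslope : ∀ z ∈ Ioo (0 : ℝ) 1, 0 ≤ R z ∧ R z ≤ 1 := by
    intro z hz
    have ht := (hasDerivWithinAt_iff_tendsto_slope' (by simp)).1 (hderiv z hz)
    have hev : ∀ᶠ w in 𝓝[>] z, w ∈ Ioo z 1 := Ioo_mem_nhdsGT hz.2
    constructor
    · refine ge_of_tendsto ht ?_
      filter_upwards [hev] with w hw
      rw [slope_def_field]
      have := h.antitone ⟨hz.1.le, hz.2.le⟩ ⟨(hz.1.trans hw.1).le, hw.2.le⟩ hw.1.le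
      apply div_nonneg
      · simp only [hf]; linarith
      · linarith [hw.1]
    · refine le_of_tendsto ht ?_
      filter_upwards [hev] with w hw
      rw [slope_def_field]
      have := h.sub_le hz.1.le hw.1.le hw.2.le
      rw [div_le_one (by linarith [hw.1])]
      simp only [hf]; linarith
  set D : ℝ → ℝ := fun z => if z ≤ 0 then 0 else if z < 1 then R z else 1 with hD
  have hDm : Monotone D := by
    intro a b hab
    simp only [hD]
    split_ifs with h1 h2 h3 h4 h5 h6 h7
    all_goals first
      | linarith
      | skip
    · exact (hslope b ⟨not_le.1 h2, h3⟩).1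
    · exact hmono ⟨not_le.1 h1, h4⟩ ⟨not_le.1 h5, h6⟩ hab
    · exact (hslope a ⟨not_le.1 h1, h4⟩).2
  set s := hDm.stieltjesFunction with hs
  have hs0 : ∀ z < 0, s z = 0 := by
    intro z hz
    rw [hs, Monotone.stieltjesFunction_eq]
    have : Tendsto D (𝓝[>] z) (𝓝 0) := by
      refine tendsto_const_nhds.congr' ?_
      filter_upwards [Ioo_mem_nhdsGT hz] with w hw
      simp [hD, hw.2.le]
    exact rightLim_eq_of_tendsto this
  have hs1 : ∀ z, 1 ≤ z → s z = 1 := by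
    intro z hz
    rw [hs, Monotone.stieltjesFunction_eq]
    have : Tendsto D (𝓝[>] z) (𝓝 1) := by
      refine tendsto_const_nhds.congr' ?_
      filter_upwards [self_mem_nhdsWithin] with w hw
      have : z < w := hw
      simp [hD, show ¬ w ≤ 0 by linarith, show ¬ w < 1 by linarith]
    exact rightLim_eq_of_tendsto this
  have hbot : Tendsto s atBot (𝓝 0) := by
    refine tendsto_const_nhds.congr' ?_
    filter_upwards [Iio_mem_atBot 0] with z hz using (hs0 z hz).symm
  have htop : Tendsto s atTop (𝓝 1) := by
    refine tendsto_const_nhds.congr' ?_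
    filter_upwards [Ici_mem_atTop 1] with z hz using (hs1 z hz).symm
  have hG : ∀ z, s.measure (Iic z) = ENNReal.ofReal (s z) := by
    intro z; rw [s.measure_Iic hbot, sub_zero]
  have hprob : IsProbabilityMeasure s.measure :=
    ⟨by rw [s.measure_univ hbot htop]; simp⟩
  have hsupp : ∀ᵐ q ∂s.measure, q ∈ Icc (0 : ℝ) 1 := by
    have h1 : s.measure (Iio 0) = 0 := by
      rw [s.measure_Iio hbot]
      have : Tendsto s (𝓝[<] 0) (𝓝 0) := by
        refine tendsto_const_nhds.congr' ?_
        filter_upwards [self_mem_nhdsWithin] with w hw using (hs0 w hw).symm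
      rw [leftLim_eq_of_tendsto this]; simp
    have h2 : s.measure (Ioi 1) = 0 := by
      rw [s.measure_Ioi htop, hs1 1 le_rfl]; simp
    rw [ae_iff]
    refine measure_mono_null (t := Iio 0 ∪ Ioi 1) ?_ (measure_union_null h1 h2)
    intro q hq
    simp only [mem_Icc, not_and_or, not_le, mem_ofPred_eq] at hq
    exact hq
  refine ⟨s.measure, hprob, hsupp, fun η hη => ?_⟩
  have hsub : uIcc η 1 ⊆ Icc 0 1 := by rw [uIcc_of_le hη.2]; exact Icc_subset_Icc_left hη.1
  have hac : AbsolutelyContinuousOnInterval ρ η 1 :=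
    (h.lipschitz.mono hsub).absolutelyContinuousOnInterval
  have hint := hac.integral_deriv_eq_sub
  rw [h.apply_one] at hint
  have hae : ∀ᵐ z : ℝ, z ∈ Ioc η 1 → -deriv ρ z = s z := by
    have hcount : ∀ᵐ z : ℝ, ContinuousAt D z := by
      have := hDm.countable_not_continuousAt.measure_zero (volume : Measure ℝ)
      rwa [ae_iff]
    have hone : ∀ᵐ z : ℝ, z ≠ 1 := by simp [ae_iff]
    filter_upwards [hac.ae_differentiableAt, hcount, hone] with z hz1 hz2 hz3 hz
    have hzz : z ∈ Ioo (0 : ℝ) 1 := ⟨lt_of_le_of_lt hη.1 hz.1, lt_of_le_of_ne hz.2 hz3⟩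
    have hd := hz1 (by rw [uIcc_of_le hη.2]; exact ⟨hz.1.le, hz.2⟩)
    have e1 : s z = D z := by
      rw [hs, Monotone.stieltjesFunction_eq]
      exact rightLim_eq_of_tendsto (hz2.tendsto.mono_left nhdsWithin_le_nhds)
    have e2 : D z = R z := by simp [hD, not_le.2 hzz.1, hzz.2]
    rw [e1, e2]
    have := (hd.hasDerivAt.neg.hasDerivWithinAt (s := Ioi z)).derivWithin
      (uniqueDiffWithinAt_Ioi z)
    exact this.symm
  set J : ℝ × ℝ → ℝ≥0∞ := {p : ℝ × ℝ | p.1 ≤ p.2}.indicator 1 with hJ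
  have hfub : ∫⁻ q, ENNReal.ofReal (1 - max η q) ∂s.measure
      = ∫⁻ z in Ioc η 1, ENNReal.ofReal (s z) := by
    calc ∫⁻ q, ENNReal.ofReal (1 - max η q) ∂s.measure
        = ∫⁻ q, (∫⁻ z in Ioc η 1, J (q, z)) ∂s.measure := by
          refine lintegral_congr fun q => ?_
          have : (fun z => J (q, z))
              = (Ici q).indicator 1 := by
            ext z; simp [hJ, indicator]
          rw [this, lintegral_indicator_one measurableSet_Ici,
            Measure.restrict_apply measurableSet_Ici]
          rcases le_or_gt q η with hq | hq
          · rw [max_eq_left hq, inter_eq_right.2 (show Ioc η 1 ⊆ Ici q from fun z hz => hq.trans hz.1.le), Real.volume_Ioc]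
          · rw [max_eq_right hq.le]
            have : Ici q ∩ Ioc η 1 = Icc q 1 := by
              ext z; simp only [mem_inter_iff, mem_Ici, mem_Ioc, mem_Icc]
              exact ⟨fun h => ⟨h.1, h.2.2⟩, fun h => ⟨h.1, lt_of_lt_of_le hq h.1, h.2⟩⟩
            rw [this, Real.volume_Icc]
      _ = ∫⁻ z in Ioc η 1, ∫⁻ q, J (q, z) ∂s.measure := by
          refine lintegral_lintegral_swap (Measurable.aemeasurable ?_)
          exact measurable_one.indicator (measurableSet_le measurable_fst measurable_snd)
      _ = ∫⁻ z in Ioc η 1, ENNReal.ofReal (s z) := by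
          refine lintegral_congr fun z => ?_
          have : (fun q => J (q, z))
              = (Iic z).indicator 1 := by
            ext z; simp [hJ, indicator]
          rw [this, lintegral_indicator_one measurableSet_Iic, hG]
  rw [hfub]
  have hIoc : ∫⁻ z in Ioc η 1, ENNReal.ofReal (s z) = ∫⁻ z in Ioc η 1, ENNReal.ofReal (-deriv ρ z) := by
    refine lintegral_congr_ae ?_
    rw [EventuallyEq, ae_restrict_iff' measurableSet_Ioc]
    filter_upwards [hae] with z hz hz2
    rw [hz hz2]
  have hnn : ∀ z, 0 ≤ s z := fun z => by
    have := s.mono (min_le_left z (-1))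
    rwa [hs0 _ (lt_of_le_of_lt (min_le_right z (-1)) (by norm_num))] at this
  rw [hIoc, ← ofReal_integral_eq_lintegral_ofReal]
  · rw [← intervalIntegral.integral_of_le hη.2, intervalIntegral.integral_neg, hint]
    simp
  · exact ((intervalIntegrable_iff_integrableOn_Ioc_of_le hη.2).1
      hac.intervalIntegrable_deriv).neg
  · rw [EventuallyLE, ae_restrict_iff' measurableSet_Ioc]
    filter_upwards [hae] with z hz hz2
    rw [hz hz2]; exact hnn z

lemma expMeasure_Iic_zero : expMeasure 1 (Iic 0) = 0 := by
  have := isProbabilityMeasure_expMeasure (r := 1) one_pos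
  rw [← ofReal_cdf, cdf_expMeasure_eq one_pos]
  simp

lemma expMeasure_Ici (v : ℝ) :
    expMeasure 1 (Ici v) = ENNReal.ofReal (Real.exp (-(max v 0))) := by
  have := isProbabilityMeasure_expMeasure (r := 1) one_pos
  have hna : expMeasure 1 {v} = 0 := by
    rw [expMeasure, gammaMeasure, withDensity_apply _ (measurableSet_singleton v)]
    simp
  have h1 : expMeasure 1 (Iic v) = ENNReal.ofReal (if 0 ≤ v then 1 - Real.exp (-(1 * v)) else 0) := by
    rw [← ofReal_cdf, cdf_expMeasure_eq one_pos]
  have h2 : expMeasure 1 (Ioi v) = ENNReal.ofReal (Real.exp (-(max v 0))) := by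
    rw [← compl_Iic, prob_compl_eq_one_sub measurableSet_Iic, h1, ← ENNReal.ofReal_one,
      ← ENNReal.ofReal_sub]
    · congr 1
      split_ifs with h
      · rw [max_eq_left h]; ring_nf
      · rw [max_eq_right (by linarith)]; simp
    · split_ifs with h
      · have : Real.exp (-(1 * v)) ≤ 1 := Real.exp_le_one_iff.2 (by linarith)
        linarith
      · exact le_rfl
  rw [← Ioi_union_left, measure_union (by simp) (measurableSet_singleton v), hna, h2, add_zero]

/-- For independent standard exponential `s, m`: the probability of `s ≥ a`, `s + m ≥ u`. -/
lemma expMeasure_prod {a u : ℝ} (ha : 0 ≤ a) :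
    ((expMeasure 1).prod (expMeasure 1)) {p | a ≤ p.1 ∧ u ≤ p.1 + p.2} =
      ENNReal.ofReal (if u ≤ a then Real.exp (-a) else Real.exp (-u) * (1 + u - a)) := by
  have := isProbabilityMeasure_expMeasure (r := 1) one_pos
  have hm : MeasurableSet {p : ℝ × ℝ | a ≤ p.1 ∧ u ≤ p.1 + p.2} :=
    (measurableSet_le measurable_const measurable_fst).inter
      (measurableSet_le measurable_const (measurable_fst.add measurable_snd))
  have hsec : ∀ s : ℝ, expMeasure 1 (Prod.mk s ⁻¹' {p : ℝ × ℝ | a ≤ p.1 ∧ u ≤ p.1 + p.2}) =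
      (Ici a).indicator (fun s => ENNReal.ofReal (Real.exp (-(max (u - s) 0)))) s := by
    intro s
    by_cases hs : a ≤ s
    · rw [indicator_of_mem (show s ∈ Ici a from hs), ← expMeasure_Ici]
      congr 1
      ext m; simp [hs, add_comm]
    · rw [indicator_of_notMem (show s ∉ Ici a from hs)]
      convert measure_empty (μ := expMeasure 1)
      ext m; simp [hs]
  rw [Measure.prod_apply hm]
  simp_rw [hsec]
  rw [lintegral_indicator measurableSet_Ici]
  have hU : ∀ b, u ≤ b → ∫⁻ s in Ici b, ENNReal.ofReal (Real.exp (-(max (u - s) 0))) ∂expMeasure 1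
      = ENNReal.ofReal (Real.exp (-(max b 0))) := by
    intro b hb
    rw [← expMeasure_Ici, ← setLIntegral_one]
    refine setLIntegral_congr_fun measurableSet_Ici fun s hs => ?_
    have : u - s ≤ 0 := by have : b ≤ s := hs; linarith
    simp [max_eq_right this]
  split_ifs with h
  · rw [hU a h, max_eq_left ha]
  · push Not at h
    rw [← Ico_union_Ici_eq_Ici h.le, lintegral_union measurableSet_Ici
      (by rw [Set.disjoint_left]; intro x hx hx2; exact absurd hx.2 (not_lt.2 hx2)),
      hU u le_rfl, max_eq_left (ha.trans h.le)]
    have : ∫⁻ s in Ico a u, ENNReal.ofReal (Real.exp (-(max (u - s) 0))) ∂expMeasure 1 =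
        ENNReal.ofReal (Real.exp (-u) * (u - a)) := by
      rw [expMeasure, gammaMeasure, restrict_withDensity measurableSet_Ico,
        lintegral_withDensity_eq_lintegral_mul _
          (show Measurable (gammaPDF 1 1) from (measurable_gammaPDFReal 1 1).ennreal_ofReal)
          (by fun_prop)]
      calc _ = ∫⁻ s in Ico a u, ENNReal.ofReal (Real.exp (-u)) := by
            refine setLIntegral_congr_fun measurableSet_Ico fun s hs => ?_
            have h0 : 0 ≤ s := ha.trans hs.1
            have e : gammaPDF 1 1 s = ENNReal.ofReal (Real.exp (-s)) := by
              have := exponentialPDF_eq 1 s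
              rw [exponentialPDF, exponentialPDFReal] at this
              rw [gammaPDF, this, if_pos h0]; simp
            simp only [Pi.mul_apply]
            rw [e,
              ← ENNReal.ofReal_mul (Real.exp_pos _).le,
              ← Real.exp_add, max_eq_left (by linarith [hs.2])]
            congr 2; ring
        _ = _ := by
            rw [setLIntegral_const, Real.volume_Ico, ← ENNReal.ofReal_mul (Real.exp_pos _).le]
    rw [this, ← ENNReal.ofReal_add (mul_nonneg (Real.exp_pos _).le (by linarith))
      (Real.exp_pos _).le]
    congr 1; ring

/-- `H_{ρ,α,σ}` is a cdf for every admissible `ρ`. -/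
theorem IsWelschFunction.exists_hasWelschCDF {ρ : ℝ → ℝ} (h : IsWelschFunction ρ) {α σ : ℝ}
    (hα : 0 < α) (hσ : 0 < σ) : ∃ W, HasWelschCDF ρ α σ W := by
  have hE := isProbabilityMeasure_expMeasure (r := 1) one_pos
  obtain ⟨G, hG, hsupp, hmix⟩ := h.exists_mixture
  set E2 := (expMeasure 1).prod (expMeasure 1) with hE2
  set U : ℝ × (ℝ × ℝ) → ℝ := fun p =>
    if p.1 = 0 then p.2.1 + p.2.2 else min (p.2.1 + p.2.2) (p.2.1 / p.1) with hU
  have hUm : Measurable U := by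
    refine Measurable.ite (measurable_fst (measurableSet_singleton 0)) ?_ ?_ <;> fun_prop
  set T : ℝ × (ℝ × ℝ) → ℝ × ℝ := fun p =>
    (σ * p.2.1 ^ (-(1 / α)), σ * U p ^ (-(1 / α))) with hT
  have hTm : Measurable T := by
    refine Measurable.prodMk ?_ ?_
    · exact ((measurable_fst.comp measurable_snd).pow_const _).const_mul _
    · exact (hUm.pow_const _).const_mul _
  refine ⟨(G.prod E2).map T, Measure.isProbabilityMeasure_map hTm.aemeasurable, fun x y => ?_⟩
  have hms : MeasurableSet (Iic x ×ˢ Iic y) := measurableSet_Iic.prod measurableSet_Iic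
  rw [Measure.map_apply hTm hms, Measure.prod_apply (hTm hms)]
  have hposE : ∀ᵐ p ∂E2, 0 < p.1 ∧ 0 < p.2 := by
    have h0 : ∀ᵐ s ∂(expMeasure 1), 0 < s := by
      rw [ae_iff]; simp only [not_lt]; exact expMeasure_Iic_zero
    have h1 : ∀ᵐ p ∂E2, 0 < p.1 := Measure.quasiMeasurePreserving_fst.ae h0
    have h2 : ∀ᵐ p ∂E2, 0 < p.2 := Measure.quasiMeasurePreserving_snd.ae h0
    filter_upwards [h1, h2] with p a b using ⟨a, b⟩
  have hinv : ∀ {v z : ℝ}, 0 < v → 0 < z → (σ * v ^ (-(1 / α)) ≤ z ↔ (z / σ) ^ (-α) ≤ v) := by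
    intro v z hv hz
    have hzs : 0 < z / σ := div_pos hz hσ
    rw [mul_comm, ← le_div_iff₀ hσ]
    constructor
    · intro hle
      have := Real.rpow_le_rpow_of_nonpos (Real.rpow_pos_of_pos hv _) hle (neg_nonpos.2 hα.le)
      rwa [← Real.rpow_mul hv.le, show -(1 / α) * -α = 1 by field_simp, Real.rpow_one] at this
    · intro hle
      have := Real.rpow_le_rpow_of_nonpos (Real.rpow_pos_of_pos hzs _) hle
        (show -(1 / α) ≤ 0 by rw [neg_nonpos]; positivity)
      rwa [← Real.rpow_mul hzs.le, show -α * -(1 / α) = 1 by field_simp, Real.rpow_one] at this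
  have hUpos : ∀ q ∈ Icc (0 : ℝ) 1, ∀ p : ℝ × ℝ, 0 < p.1 ∧ 0 < p.2 → 0 < U (q, p) := by
    intro q hq p hp
    simp only [hU]
    split_ifs with h0
    · linarith [hp.1, hp.2]
    · exact lt_min (by linarith [hp.1, hp.2]) (div_pos hp.1 (lt_of_le_of_ne hq.1 (Ne.symm h0)))
  have hUle : ∀ q ∈ Icc (0 : ℝ) 1, ∀ p : ℝ × ℝ, 0 < p.1 ∧ 0 < p.2 → ∀ u : ℝ,
      (u ≤ U (q, p) ↔ u ≤ p.1 + p.2 ∧ q * u ≤ p.1) := by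
    intro q hq p hp u
    simp only [hU]
    split_ifs with h0
    · simp [h0, hp.1.le]
    · rw [le_min_iff, le_div_iff₀ (lt_of_le_of_ne hq.1 (Ne.symm h0)), mul_comm u]
  by_cases hxy : x ≤ 0 ∨ y ≤ 0
  · rw [welschCDF, if_pos hxy, ENNReal.ofReal_zero]
    rw [lintegral_eq_zero_iff (measurable_measure_prodMk_left (hTm hms))]
    filter_upwards [hsupp] with q hq
    refine measure_mono_null (t := {p | ¬ (0 < p.1 ∧ 0 < p.2)}) ?_ hposE
    intro p hp hpos
    have hp' : σ * p.1 ^ (-(1 / α)) ≤ x ∧ σ * U (q, p) ^ (-(1 / α)) ≤ y := hp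
    have a1 := mul_pos hσ (Real.rpow_pos_of_pos hpos.1 (-(1 / α)))
    have a2 := mul_pos hσ (Real.rpow_pos_of_pos (hUpos q hq p hpos) (-(1 / α)))
    rcases hxy with hh | hh <;> linarith [hp'.1, hp'.2]
  push Not at hxy
  obtain ⟨hx, hy⟩ := hxy
  set t := (x / σ) ^ (-α) with ht
  set u := (y / σ) ^ (-α) with hu
  have htp : 0 < t := Real.rpow_pos_of_pos (div_pos hx hσ) _
  have hup : 0 < u := Real.rpow_pos_of_pos (div_pos hy hσ) _
  have hsec : ∀ q ∈ Icc (0 : ℝ) 1, E2 (Prod.mk q ⁻¹' (T ⁻¹' (Iic x ×ˢ Iic y))) =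
      ENNReal.ofReal (if u ≤ max t (q * u) then Real.exp (-max t (q * u))
        else Real.exp (-u) * (1 + u - max t (q * u))) := by
    intro q hq
    rw [← expMeasure_prod (le_max_of_le_left htp.le)]
    refine measure_congr ?_
    filter_upwards [hposE] with p hp
    refine propext ?_
    change (σ * p.1 ^ (-(1 / α)) ≤ x ∧ σ * U (q, p) ^ (-(1 / α)) ≤ y) ↔ _
    rw [hinv hp.1 hx, hinv (hUpos q hq p hp) hy, hUle q hq p hp]
    change _ ↔ (max t (q * u) ≤ p.1 ∧ u ≤ p.1 + p.2)
    rw [max_le_iff]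
    tauto
  have hqu : ∀ q ∈ Icc (0 : ℝ) 1, q * u ≤ u := fun q hq => by nlinarith [hq.2]
  rw [welschCDF, if_neg (by push Not; exact ⟨hx, hy⟩)]
  by_cases hle : x ≤ y
  · rw [if_pos hle]
    have hut : u ≤ t :=
      Real.rpow_le_rpow_of_nonpos (div_pos hx hσ) (by gcongr) (neg_nonpos.2 hα.le)
    have : ∀ᵐ q ∂G, E2 (Prod.mk q ⁻¹' (T ⁻¹' (Iic x ×ˢ Iic y))) =
        ENNReal.ofReal (Real.exp (-t)) := by
      filter_upwards [hsupp] with q hq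
      rw [hsec q hq, max_eq_left ((hqu q hq).trans hut), if_pos hut]
    rw [lintegral_congr_ae this]
    simp [ht]
  · rw [if_neg hle]
    push Not at hle
    have htu : t < u :=
      Real.rpow_lt_rpow_of_neg (div_pos hy hσ) (by gcongr) (neg_neg_iff_pos.2 hα)
    set η := (y / x) ^ α with hη
    have hηu : η * u = t := by
      rw [hη, hu, ht, Real.div_rpow hy.le hx.le, Real.rpow_neg (div_pos hy hσ).le,
        Real.rpow_neg (div_pos hx hσ).le, Real.div_rpow hy.le hσ.le, Real.div_rpow hx.le hσ.le]
      have := (Real.rpow_pos_of_pos hy α).ne'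
      have := (Real.rpow_pos_of_pos hx α).ne'
      have := (Real.rpow_pos_of_pos hσ α).ne'
      field_simp
    have hη0 : 0 ≤ η := by rw [hη]; positivity
    have hη1 : η ≤ 1 := by
      by_contra hc
      push Not at hc
      nlinarith
    have : ∀ᵐ q ∂G, E2 (Prod.mk q ⁻¹' (T ⁻¹' (Iic x ×ˢ Iic y))) =
        ENNReal.ofReal (Real.exp (-u)) +
          ENNReal.ofReal (Real.exp (-u) * u) * ENNReal.ofReal (1 - max η q) := by
      filter_upwards [hsupp] with q hq
      have hmx : max t (q * u) = max η q * u := by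
        rw [← hηu, max_mul_of_nonneg _ _ hup.le]
      have hm1 : max η q ≤ 1 := max_le hη1 hq.2
      have e0 : 0 ≤ 1 - max η q := by linarith
      rw [hsec q hq, hmx, ← ENNReal.ofReal_mul (by positivity),
        ← ENNReal.ofReal_add (by positivity) (by positivity)]
      congr 1
      split_ifs with hc
      · have : max η q = 1 := le_antisymm hm1 (by
          by_contra hlt; push Not at hlt; nlinarith)
        rw [this]; simp
      · ring
    rw [lintegral_congr_ae this, lintegral_add_left measurable_const, lintegral_const,
      measure_univ, mul_one, lintegral_const_mul _ (by fun_prop), hmix η ⟨hη0, hη1⟩,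
      ← ENNReal.ofReal_mul (by positivity), ← ENNReal.ofReal_add (by positivity)]
    · congr 1; ring
    · exact mul_nonneg (by positivity) (h.mapsTo ⟨hη0, hη1⟩).1

open scoped Classical in
/-- The Fréchet–Welsch distribution `W(ρ,α,σ)`: the probability measure on `ℝ²` with joint cdf
`H_{ρ,α,σ}` (with an irrelevant default value for parameters for which `H_{ρ,α,σ}` is not a cdf;
for admissible `ρ` and `α, σ > 0` see `hasWelschCDF_frechetWelsch`). -/
def frechetWelsch (ρ : ℝ → ℝ) (α σ : ℝ) : Measure (ℝ × ℝ) :=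
  if h : ∃ W, HasWelschCDF ρ α σ W then h.choose else Measure.dirac 0

instance instIsProbabilityMeasureFrechetWelsch (ρ : ℝ → ℝ) (α σ : ℝ) :
    IsProbabilityMeasure (frechetWelsch ρ α σ) := by
  unfold frechetWelsch
  split_ifs with h
  · exact h.choose_spec.1
  · infer_instance

theorem hasWelschCDF_frechetWelsch {ρ : ℝ → ℝ} (h : IsWelschFunction ρ) {α σ : ℝ}
    (hα : 0 < α) (hσ : 0 < σ) : HasWelschCDF ρ α σ (frechetWelsch ρ α σ) := by
  have hex := h.exists_hasWelschCDF hα hσ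
  rw [frechetWelsch, dif_pos hex]
  exact hex.choose_spec

/-! ### Constants: `Υ`, `Π`, `ϖ`, `α₁`, `s₁` and the matrix `M` -/

/-- `Υ_{ρ₀}(x) = ρ₀ Γ(x+2) + (1-ρ₀) Γ(x+1)`. -/
def Upsilon (ρ₀ x : ℝ) : ℝ := ρ₀ * Real.Gamma (x + 2) + (1 - ρ₀) * Real.Gamma (x + 1)

/-- `Π_{ρ₀}(y) = 1/y - Υ'(y)/Υ(y) + ρ₀/2 - γ`, with `γ` the Euler–Mascheroni constant. -/
def PiFun (ρ₀ y : ℝ) : ℝ :=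
  1 / y - deriv (Upsilon ρ₀) y / Upsilon ρ₀ y + ρ₀ / 2 - Real.eulerMascheroniConstant

/-- `ϖ_{ρ₀}`: the zero of the (strictly decreasing) function `Π_{ρ₀}` on `(0,∞)`. The set below
is a singleton for `ρ₀ ∈ [0,1]`. -/
def varpi (ρ₀ : ℝ) : ℝ := sInf {y : ℝ | 0 < y ∧ PiFun ρ₀ y = 0}

/-- `α₁ = ϖ_{ρ₀} α₀`. -/
def alphaOne (ρ₀ α₀ : ℝ) : ℝ := varpi ρ₀ * α₀

/-- `s₁ = (2 / Υ_{ρ₀}(ϖ_{ρ₀}))^{1/α₁}`. -/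
def sOne (ρ₀ α₀ : ℝ) : ℝ := (2 / Upsilon ρ₀ (varpi ρ₀)) ^ (1 / alphaOne ρ₀ α₀)

/-- `Ψ̇ = -2/α₁² - 2 (Υ''Υ - (Υ')²) / (α₀² Υ²)`, evaluated at `ϖ_{ρ₀}`. -/
def psiDot (ρ₀ α₀ : ℝ) : ℝ :=
  -2 / alphaOne ρ₀ α₀ ^ 2 -
    2 * (deriv (deriv (Upsilon ρ₀)) (varpi ρ₀) * Upsilon ρ₀ (varpi ρ₀)
        - deriv (Upsilon ρ₀) (varpi ρ₀) ^ 2)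
      / (α₀ ^ 2 * Upsilon ρ₀ (varpi ρ₀) ^ 2)

/-- The `2 × 4` matrix `M_{ρ₀}(α₀)`. -/
def matM (ρ₀ α₀ : ℝ) : Matrix (Fin 2) (Fin 4) ℝ :=
  let α₁ := alphaOne ρ₀ α₀
  let U := Upsilon ρ₀ (varpi ρ₀)
  let U' := deriv (Upsilon ρ₀) (varpi ρ₀)
  let D := psiDot ρ₀ α₀
  let z₀ := U / 2
  let K := z₀ ^ (-1 / α₁) / (α₁ * D)
  !![-2 / (D * U), -2 * U' / (D * α₀ * U ^ 2), 1 / D, 1 / D;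
     K * (U' / (2 * α₀ * z₀ ^ 2) - Real.log z₀ / (α₁ * z₀)),
     K * (U' ^ 2 / (4 * α₀ ^ 2 * z₀ ^ 3) - U' * Real.log z₀ / (2 * α₀ * α₁ * z₀ ^ 2))
       - z₀ ^ (-1 / α₁ - 1) / (2 * α₁),
     K * (Real.log z₀ / α₁ - U' / (2 * α₀ * z₀)),
     K * (Real.log z₀ / α₁ - U' / (2 * α₀ * z₀))]

/-- The functions `f₁, …, f₄`: `y^{-a} log y`, `y^{-a}`, `log y`, `log x`. -/
def fct (a : ℝ) : Fin 4 → ℝ × ℝ → ℝ :=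
  ![fun p => p.2 ^ (-a) * Real.log p.2, fun p => p.2 ^ (-a),
    fun p => Real.log p.2, fun p => Real.log p.1]

/-- `Σ^{db}`: the covariance matrix of `(f₁,…,f₄)(X,Y)` for `(X,Y) ∼ W(ρ,α₀,1)`. -/
def sigmaDB (ρ : ℝ → ℝ) (α₀ : ℝ) : Matrix (Fin 4) (Fin 4) ℝ :=
  Matrix.of fun i j => covariance (fct (alphaOne (ρ 0) α₀) i) (fct (alphaOne (ρ 0) α₀) j)
    (frechetWelsch ρ α₀ 1)

/-- Explicit form of `M_1(α₀)`. -/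
def matMIid (α₀ : ℝ) : Matrix (Fin 2) (Fin 4) ℝ :=
  let γ := Real.eulerMascheroniConstant
  (6 / (2 * Real.pi ^ 2 - 3)) •
    !![α₀ ^ 2, (3 - 2 * γ) / 2 * α₀, -α₀ ^ 2, -α₀ ^ 2;
       (2 * γ - 3) / 2, (3 - 2 * Real.pi ^ 2 - 3 * (3 - 2 * γ) ^ 2) / (12 * α₀),
         (3 - 2 * γ) / 2, (3 - 2 * γ) / 2]

/-- Explicit form of the covariance matrix for `ρ(η) = 1 - η`. -/
def sigmaIid (α : ℝ) : Matrix (Fin 4) (Fin 4) ℝ :=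
  let γ := Real.eulerMascheroniConstant
  let q := Real.pi ^ 2
  (1 / α ^ 2) •
    !![3 - 10 * γ + 2 * γ ^ 2 + q, α * (2 * γ - 5), q / 3 - 1 - γ, q / 3 - 1 - γ;
       α * (2 * γ - 5), 2 * α ^ 2, -α, -α;
       q / 3 - 1 - γ, -α, q / 6 - 1, q / 6 - 1;
       q / 3 - 1 - γ, -α, q / 6 - 1, q / 6]

/-! ### The pseudo maximum likelihood estimator -/

/-- The independence log-likelihood of a sample `z = ((x₁,y₁),…,(x_k,y_k))`. -/
def logLik {k : ℕ} (z : Fin k → ℝ × ℝ) (α σ : ℝ) : ℝ :=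
  2 * k * Real.log α + 2 * k * α * Real.log σ
    - ∑ i, ((α + 1) * Real.log ((z i).1 * (z i).2) + σ ^ α * (z i).2 ^ (-α))

/-- `θ = (α,σ)` maximizes the log-likelihood over `(0,∞)²`. -/
def IsMLE {k : ℕ} (z : Fin k → ℝ × ℝ) (θ : ℝ × ℝ) : Prop :=
  0 < θ.1 ∧ 0 < θ.2 ∧ ∀ α σ : ℝ, 0 < α → 0 < σ → logLik z α σ ≤ logLik z θ.1 θ.2

open scoped Classical in
/-- The estimator `θ̂(z) = (α̂(z), σ̂(z))`: the unique maximizer, whenever there is one. -/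
def mle {k : ℕ} (z : Fin k → ℝ × ℝ) : ℝ × ℝ :=
  if h : ∃! θ, IsMLE z θ then h.choose else 0

/-! ### Block order statistics of a time series -/

section TimeSeries

variable {Ω : Type*}

/-- The `j`-th largest value (`j = 1, 2, …`, counted with multiplicity) of `x_t`, `t ∈ I`. -/
def orderStat (x : ℤ → ℝ) (I : Finset ℤ) (j : ℕ) : ℝ :=
  ((I.val.map x).sort (· ≥ ·)).getD (j - 1) 0

/-- The block `{i r + 1, …, (i + 1) r}`; blocks are numbered from `i = 0`. -/
def block (r i : ℕ) : Finset ℤ := Finset.Icc ((i : ℤ) * r + 1) (((i : ℤ) + 1) * r)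

/-- Largest observation of block number `i` (blocks numbered from `0`) of length `r`. -/
def blockMax (ξ : ℤ → Ω → ℝ) (r i : ℕ) (w : Ω) : ℝ := orderStat (fun t => ξ t w) (block r i) 1

/-- Second largest observation of block number `i` (blocks numbered from `0`) of length `r`. -/
def blockSnd (ξ : ℤ → Ω → ℝ) (r i : ℕ) (w : Ω) : ℝ := orderStat (fun t => ξ t w) (block r i) 2

/-- The sample `(M_{r,i} ∨ c, S_{r,i} ∨ c)` over the `⌊n/r⌋` disjoint blocks of length `r`. -/
def blockSample (ξ : ℤ → Ω → ℝ) (c : ℝ) (n r : ℕ) (w : Ω) : Fin (n / r) → ℝ × ℝ :=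
  fun i => (max (blockMax ξ r i w) c, max (blockSnd ξ r i w) c)

/-- The empirical process `v (k⁻¹ ∑ f(x_i/σ, y_i/σ) - ∫ f dQ)` of a sample `z`. -/
def empProcess {k : ℕ} (v σ : ℝ) (Q : Measure (ℝ × ℝ)) (z : Fin k → ℝ × ℝ)
    (f : ℝ × ℝ → ℝ) : ℝ :=
  v * ((k : ℝ)⁻¹ * ∑ i, f ((z i).1 / σ, (z i).2 / σ) - ∫ p, f p ∂Q)

/-- Rosenblatt's coefficient `α(ℓ)` between `σ(ξ_t : t ≤ 0)` and `σ(ξ_t : t ≥ ℓ)`. -/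
def alphaMixing [MeasurableSpace Ω] (P : Measure Ω) (ξ : ℤ → Ω → ℝ) (l : ℕ) : ℝ :=
  sSup {v : ℝ | ∃ A B : Set Ω,
    MeasurableSet[⨆ t : {t : ℤ // t ≤ 0}, (borel ℝ).comap (ξ t)] A ∧
    MeasurableSet[⨆ t : {t : ℤ // (l : ℤ) ≤ t}, (borel ℝ).comap (ξ t)] B ∧
    v = |P.real (A ∩ B) - P.real A * P.real B|}

/-! ### The conditions -/

/-- Domain of attraction: strict stationarity, continuous marginal cdf, weak convergence of
`(M_r, S_r)/σ_r` to `W(ρ,α₀,1)`, and regular variation of `σ` with index `1/α₀`. -/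
structure DomainOfAttraction [MeasurableSpace Ω] (P : Measure Ω) [IsProbabilityMeasure P]
    (ξ : ℤ → Ω → ℝ) (ρ : ℝ → ℝ) (α₀ : ℝ) (σ : ℕ → ℝ) : Prop where
  stationary : ∀ h : ℤ, P.map (fun w t => ξ (t + h) w) = P.map (fun w t => ξ t w)
  continuous_cdf : Continuous fun x : ℝ => P.real {w | ξ 0 w ≤ x}
  welsch : IsWelschFunction ρ
  alpha_pos : 0 < α₀
  sigma_pos : ∀ m, 1 ≤ m → 0 < σ m
  sigma_tendsto : Tendsto σ atTop atTop
  weak_limit : TendstoInDistribution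
    (fun (m : ℕ) w => (blockMax ξ m 0 w / σ m, blockSnd ξ m 0 w / σ m)) atTop
    (id : ℝ × ℝ → ℝ × ℝ) (fun _ => P) (frechetWelsch ρ α₀ 1)
  regularly_varying : ∀ s : ℝ, 0 < s →
    Tendsto (fun m : ℕ => σ ⌊s * m⌋₊ / σ m) atTop (𝓝 (s ^ (1 / α₀)))

/-- All second largest order statistics diverge. -/
def AllDiverge [MeasurableSpace Ω] (P : Measure Ω) (ξ : ℤ → Ω → ℝ) (r : ℕ → ℕ) : Prop :=
  ∀ c : ℝ, 0 < c →
    Tendsto (fun n => P {w | ∃ i < n / r n, blockSnd ξ (r n) i w ≤ c}) atTop (𝓝 0)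

/-- The `α`-mixing rate condition with exponent `ω`. -/
structure AlphaMixingRate [MeasurableSpace Ω] (P : Measure Ω) (ξ : ℤ → Ω → ℝ) (r : ℕ → ℕ)
    (ω : ℝ) : Prop where
  omega_pos : 0 < ω
  mixing : Tendsto (alphaMixing P ξ) atTop (𝓝 0)
  rate : Tendsto (fun n : ℕ => ((n : ℝ) / r n) ^ (1 + ω) * alphaMixing P ξ (r n)) atTop (𝓝 0)
  exists_gap : ∃ l : ℕ → ℕ, Tendsto l atTop atTop ∧
    Tendsto (fun n => (l n : ℝ) / r n) atTop (𝓝 0) ∧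
    Tendsto (fun n : ℕ => (n : ℝ) / r n * alphaMixing P ξ (l n)) atTop (𝓝 0) ∧
    Tendsto (fun n => (r n : ℝ) / l n * alphaMixing P ξ (l n)) atTop (𝓝 0)

/-- The integrability condition; `α₁` is the exponent used for the left tail of `S_r`. -/
def IntegrabilityCondition [MeasurableSpace Ω] (P : Measure Ω) (ξ : ℤ → Ω → ℝ) (σ : ℕ → ℝ)
    (α₁ ω : ℝ) : Prop :=
  ∃ ν : ℝ, 1 / ω < ν ∧
    limsup (fun m : ℕ => ∫⁻ w, ENNReal.ofReal
      ((Ioi (Real.exp 1)).indicator Real.log (max (blockMax ξ m 0 w) 1 / σ m) ^ (2 + ν)) ∂P)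
      atTop < ∞ ∧
    limsup (fun m : ℕ => ∫⁻ w, ENNReal.ofReal
      ((Iic (Real.exp 1)).indicator (fun x => x ^ (-α₁))
        (max (blockSnd ξ m 0 w) 1 / σ m) ^ (2 + ν)) ∂P)
      atTop < ∞

/-- The bias condition: the limits `B(f₁), …, B(f₄)` exist and are the entries of `B`. -/
def BiasCondition [MeasurableSpace Ω] (P : Measure Ω) (ξ : ℤ → Ω → ℝ) (ρ : ℝ → ℝ) (α₀ : ℝ)
    (σ : ℕ → ℝ) (r : ℕ → ℕ) (B : Fin 4 → ℝ) : Prop :=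
  ∃ c₀ : ℝ, 0 < c₀ ∧ ∀ j : Fin 4,
    Tendsto (fun n : ℕ => √((n : ℝ) / r n) *
      ((∫ w, fct (alphaOne (ρ 0) α₀) j (max (blockMax ξ (r n) 0 w) c₀ / σ (r n),
          max (blockSnd ξ (r n) 0 w) c₀ / σ (r n)) ∂P)
        - ∫ p, fct (alphaOne (ρ 0) α₀) j p ∂(frechetWelsch ρ α₀ 1)))
      atTop (𝓝 (B j))

/-! ### The two sides of the expansion -/

/-- The rescaled estimation error `√(n/r_n) (α̂_n - α₁, σ̂_n/σ_{r_n} - s₁)`. -/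
def estimationError (ξ : ℤ → Ω → ℝ) (ρ₀ α₀ : ℝ) (σ : ℕ → ℝ) (r : ℕ → ℕ) (c : ℝ) (n : ℕ)
    (w : Ω) : EuclideanSpace ℝ (Fin 2) :=
  √((n : ℝ) / r n) • !₂[(mle (blockSample ξ c n (r n) w)).1 - alphaOne ρ₀ α₀,
    (mle (blockSample ξ c n (r n) w)).2 / σ (r n) - sOne ρ₀ α₀]

/-- The vector `W_n = (𝔾_n f₁, …, 𝔾_n f₄)`. -/
def empVector (ξ : ℤ → Ω → ℝ) (ρ : ℝ → ℝ) (α₀ : ℝ) (σ : ℕ → ℝ) (r : ℕ → ℕ) (c : ℝ) (n : ℕ)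
    (w : Ω) : EuclideanSpace ℝ (Fin 4) :=
  WithLp.toLp 2 fun j => empProcess √((n : ℝ) / r n) (σ (r n)) (frechetWelsch ρ α₀ 1)
    (blockSample ξ c n (r n) w) (fct (alphaOne (ρ 0) α₀) j)

end TimeSeries

/-- The linear map `ℝ⁴ → ℝ²` given by a matrix. -/
def applyMat (M : Matrix (Fin 2) (Fin 4) ℝ) (v : EuclideanSpace ℝ (Fin 4)) :
    EuclideanSpace ℝ (Fin 2) :=
  WithLp.toLp 2 (M.mulVec v.ofLp)

end

/-! For a fixed shape the log-likelihood is maximized in the scale in closed form. The derivative of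
the resulting profile likelihood, divided by the sample size, is `score`: 2/a + 2 ∑ y^(-a) log y / ∑
y^(-a) minus the mean of log(xy). Cauchy–Schwarz makes it strictly decreasing, so the maximizer is
unique as soon as the score changes sign (`isMLE_iff`, `mle_of_score_sign`). The score is unchanged
by rescaling, so the sample may be divided by σ_{r_n}.

By a law of large numbers over blocks (`BlockSetting.tendsto_average`) the score at b tends to
(2/α₀) Π(b/α₀) (`BlockSetting.tendsto_score`). This limit is strictly decreasing because Υ is
log-convex, and α₁ is its zero. Signs of the score at two points around α₁ trap the estimator, which
gives existence and consistency without uniform convergence. The block averages of y^(-a) and y^(-a)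
log y are then expanded in the exponent around α₁, and the score equation is linearized
(`isLittleO_of_likelihood_equation`). Its slope Ψ̇ is negative, the matrix M collects the
coefficients of the linearization, and the error is small relative to W_n, hence o_P(1) once W_n is
tight.

The central limit theorem for W_n goes through characteristic functions
(`tendsto_integral_exp_blockSum`). All functions involved are bounded by a power q > 1 of the
envelope 1 + |log x| + |log y| + y^(-α₁), which has bounded moments of some order s > 2q. They are
truncated, and the last ℓ_n observations of each block are discarded; consecutive blocks are then
separated by a gap, the characteristic function of the sum factorizes up to a multiple of k_n
α(ℓ_n), and bounded variables satisfy a Lindeberg expansion. Neither replacement is controlled by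
summing covariances: E|e^{iS} - 1| is bounded through 1 - E e^{iS}, which factorizes after a split
into even and odd blocks and costs only k_n α(r_n) and one second moment
(`integral_norm_exp_sum_adjacent_sub_one_le`). Discarding the end of a block is harmless because the
maximum over ℓ_n = o(r_n) observations is of smaller order than σ_{r_n}
(`DomainOfAttraction.tendsto_measureReal_clip`).

The constants arise because Y^(-α₀) is a mixture of the Gamma laws with shapes 1 and 2, whose moment
function is Υ; derivatives of Υ are therefore moments with logarithms. For ρ(η) = 1 - η one has
Y^(-α) = V and X^(-α) = VB with V of Gamma law and B an independent uniform variable, and the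
covariances reduce to Γ, Γ', Γ'' at small integers. Divergence of the second largest order
statistics makes the truncation level irrelevant, so the bias condition, posed at level c₀, serves
every level c. -/

noncomputable section

/-! ### Path space and mixing inequalities -/

section Mixing

variable {Ω : Type*}

/-- The trajectory of the time series. -/
def trajectory (ξ : ℤ → Ω → ℝ) (w : Ω) : ℤ → ℝ := fun t => ξ t w

/-- The time shift. -/
def timeShift (a : ℤ) (x : ℤ → ℝ) : ℤ → ℝ := fun t => x (t + a)

/-- The `σ`-algebra generated by the coordinates in `s`. -/
abbrev coordSigma (s : Set ℤ) : MeasurableSpace (ℤ → ℝ) :=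
  ⨆ t : s, (borel ℝ).comap fun x => x t

lemma coordSigma_mono {s s' : Set ℤ} (h : s ⊆ s') : coordSigma s ≤ coordSigma s' :=
  iSup_le fun t => le_iSup (fun t : s' => (borel ℝ).comap fun x : ℤ → ℝ => x t) ⟨t, h t.2⟩

lemma coordSigma_le (s : Set ℤ) : coordSigma s ≤ MeasurableSpace.pi := by
  refine iSup_le fun t => ?_
  rw [← BorelSpace.measurable_eq (α := ℝ)]
  exact (measurable_pi_apply (t : ℤ)).comap_le

lemma measurable_coord {s : Set ℤ} {t : ℤ} (ht : t ∈ s) :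
    Measurable[coordSigma s] fun x : ℤ → ℝ => x t := by
  rw [measurable_iff_comap_le]
  have := le_iSup (fun t : s => (borel ℝ).comap fun x : ℤ → ℝ => x t) ⟨t, ht⟩
  rwa [← BorelSpace.measurable_eq (α := ℝ)] at this

lemma measurable_timeShift {s s' : Set ℤ} {a : ℤ} (h : ∀ t ∈ s, t + a ∈ s') :
    @Measurable _ _ (coordSigma s') (coordSigma s) (timeShift a) := by
  rw [measurable_iff_comap_le, coordSigma, MeasurableSpace.comap_iSup]
  refine iSup_le fun t => ?_
  rw [MeasurableSpace.comap_comp]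
  exact le_iSup (fun t : s' => (borel ℝ).comap fun x : ℤ → ℝ => x t) ⟨t + a, h t t.2⟩

lemma measurable_timeShift_pi (a : ℤ) : Measurable (timeShift a) :=
  measurable_pi_lambda _ fun t => measurable_pi_apply (t + a)

lemma timeShift_zero (x : ℤ → ℝ) : timeShift 0 x = x := by
  ext t; simp [timeShift]

/-- `alphaMixing` is defined by σ-algebras on Ω, whereas block functionals live on path space.
Pullback commutes with suprema of σ-algebras, so the two descriptions agree. -/
lemma measurableSet_preimage_trajectory (ξ : ℤ → Ω → ℝ) {s : Set ℤ} {A : Set (ℤ → ℝ)}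
    (hA : MeasurableSet[coordSigma s] A) :
    MeasurableSet[⨆ t : s, (borel ℝ).comap (ξ t)] (trajectory ξ ⁻¹' A) := by
  have : (coordSigma s).comap (trajectory ξ) = ⨆ t : s, (borel ℝ).comap (ξ t) := by
    rw [coordSigma, MeasurableSpace.comap_iSup]
    simp_rw [MeasurableSpace.comap_comp]
    rfl
  rw [← this]
  exact ⟨A, hA, rfl⟩

variable [MeasurableSpace Ω] {P : Measure Ω} {ξ : ℤ → Ω → ℝ}

lemma measurable_trajectory (hξ : ∀ t, Measurable (ξ t)) : Measurable (trajectory ξ) :=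
  measurable_pi_lambda _ hξ

/-- Strict stationarity. -/
def IsStationarySeries (P : Measure Ω) (ξ : ℤ → Ω → ℝ) : Prop :=
  ∀ h : ℤ, P.map (fun w t => ξ (t + h) w) = P.map (fun w t => ξ t w)

lemma IsStationarySeries.map_timeShift (h : IsStationarySeries P ξ) (a : ℤ) :
    P.map (fun w => timeShift a (trajectory ξ w)) = P.map (trajectory ξ) := h a

lemma IsStationarySeries.measureReal_preimage (h : IsStationarySeries P ξ)
    (hξ : ∀ t, Measurable (ξ t)) (a : ℤ) {A : Set (ℤ → ℝ)} (hA : MeasurableSet A) :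
    P.real (trajectory ξ ⁻¹' (timeShift a ⁻¹' A)) = P.real (trajectory ξ ⁻¹' A) := by
  have h1 := h.map_timeShift a
  have hm := measurable_trajectory hξ
  rw [measureReal_def, measureReal_def, ← Measure.map_apply hm hA, ← h1,
    Measure.map_apply (f := fun w => timeShift a (trajectory ξ w))
      ((measurable_timeShift_pi a).comp hm) hA]
  rfl

lemma IsStationarySeries.integral_comp {E : Type*} [NormedAddCommGroup E] [NormedSpace ℝ E]
    (h : IsStationarySeries P ξ)
    (hξ : ∀ t, Measurable (ξ t)) (a : ℤ) {F : (ℤ → ℝ) → E} (hF : StronglyMeasurable F) :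
    ∫ w, F (timeShift a (trajectory ξ w)) ∂P = ∫ w, F (trajectory ξ w) ∂P := by
  have hm := measurable_trajectory hξ
  rw [← integral_map hm.aemeasurable hF.aestronglyMeasurable, ← h.map_timeShift a,
    integral_map (φ := fun w => timeShift a (trajectory ξ w))
      ((measurable_timeShift_pi a).comp hm).aemeasurable hF.aestronglyMeasurable]

/-- The real supremum of an unbounded set has the default value zero, so boundedness is needed
before `alphaMixing` dominates individual covariances. -/
lemma alphaMixing_bddAbove [IsProbabilityMeasure P] (l : ℕ) :
    BddAbove {v : ℝ | ∃ A B : Set Ω,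
    MeasurableSet[⨆ t : {t : ℤ // t ≤ 0}, (borel ℝ).comap (ξ t)] A ∧
    MeasurableSet[⨆ t : {t : ℤ // (l : ℤ) ≤ t}, (borel ℝ).comap (ξ t)] B ∧
    v = |P.real (A ∩ B) - P.real A * P.real B|} := by
  refine ⟨1, ?_⟩
  rintro v ⟨A, B, -, -, rfl⟩
  have h1 := measureReal_nonneg (μ := P) (s := A ∩ B)
  have h2 := measureReal_nonneg (μ := P) (s := A)
  have h3 := measureReal_nonneg (μ := P) (s := B)
  have h4 := measureReal_le_one (μ := P) (s := A ∩ B)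
  have h5 := measureReal_le_one (μ := P) (s := A)
  have h6 := measureReal_le_one (μ := P) (s := B)
  rw [abs_le]
  constructor <;> nlinarith

lemma alphaMixing_nonneg [IsProbabilityMeasure P] (l : ℕ) : 0 ≤ alphaMixing P ξ l := by
  refine Real.sSup_nonneg ?_
  rintro v ⟨A, B, -, -, rfl⟩
  exact abs_nonneg _

/-- Shifting time by -s moves the past before s to the past before 0; stationarity leaves the three
probabilities unchanged. -/
lemma abs_sub_le_alphaMixing [IsProbabilityMeasure P] (hst : IsStationarySeries P ξ)
    (hξ : ∀ t, Measurable (ξ t)) (s : ℤ) (l : ℕ)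
    {A B : Set (ℤ → ℝ)} (hA : MeasurableSet[coordSigma (Iic s)] A)
    (hB : MeasurableSet[coordSigma (Ici (s + l))] B) :
    |P.real (trajectory ξ ⁻¹' (A ∩ B))
      - P.real (trajectory ξ ⁻¹' A) * P.real (trajectory ξ ⁻¹' B)| ≤ alphaMixing P ξ l := by
  have hA' : MeasurableSet[coordSigma (Iic 0)] (timeShift (-s) ⁻¹' A) :=
    measurable_timeShift (fun t ht => by simp only [mem_Iic] at *; omega) hA
  have hB' : MeasurableSet[coordSigma (Ici (l : ℤ))] (timeShift (-s) ⁻¹' B) :=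
    measurable_timeShift (fun t ht => by simp only [mem_Ici] at *; omega) hB
  have hA0 := coordSigma_le _ _ hA
  have hB0 := coordSigma_le _ _ hB
  rw [← hst.measureReal_preimage hξ (-s) hA0, ← hst.measureReal_preimage hξ (-s) hB0,
    ← hst.measureReal_preimage hξ (-s) (hA0.inter hB0)]
  refine le_csSup (alphaMixing_bddAbove l) ⟨_, _,
    measurableSet_preimage_trajectory ξ hA', measurableSet_preimage_trajectory ξ hB', ?_⟩
  rfl

/-- A bound of `E[1_A Z]`, uniform over `A` in a `σ`-algebra, extends to `[0,1]`-valued functions. -/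
lemma norm_integral_smul_le_of_indicator {Ω : Type*} {m m0 : MeasurableSpace Ω}
    {P : Measure Ω} [IsProbabilityMeasure P] (hm : m ≤ m0) {Z : Ω → ℂ} (hZ : Integrable Z P) {a : ℝ}
    (h : ∀ A, MeasurableSet[m] A → ‖∫ w in A, Z w ∂P‖ ≤ a) {X : Ω → ℝ}
    (hX : Measurable[m] X) (hX01 : ∀ w, X w ∈ Icc (0 : ℝ) 1) :
    ‖∫ w, (X w : ℂ) * Z w ∂P‖ ≤ a := by
  have hXm : Measurable X := hX.mono hm le_rfl
  -- Layer-cake formula: X is the integral over u in (0,1] of the indicator of {u ≤ X}. After Fubini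
  -- each slice is an integral of Z over a set of the σ-algebra.
  have e1 : ∀ w, (X w : ℂ) * Z w = ∫ u in Ioc (0 : ℝ) 1, (Iic (X w)).indicator (fun _ => Z w) u := by
    intro w
    rw [setIntegral_indicator measurableSet_Iic, setIntegral_const]
    have : Ioc (0 : ℝ) 1 ∩ Iic (X w) = Ioc 0 (X w) := by
      ext q; simp only [mem_inter_iff, mem_Ioc, mem_Iic]
      exact ⟨fun h => ⟨h.1.1, h.2⟩, fun h => ⟨⟨h.1, h.2.trans (hX01 w).2⟩, h.2⟩⟩
    rw [this, measureReal_def, Real.volume_Ioc, ENNReal.toReal_ofReal (by linarith [(hX01 w).1])]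
    simp
  have hint : Integrable (fun q : Ω × ℝ => {q : Ω × ℝ | q.2 ≤ X q.1}.indicator (fun q => Z q.1) q)
      (P.prod (volume.restrict (Ioc (0 : ℝ) 1))) := by
    refine Integrable.indicator ?_ (measurableSet_le measurable_snd (hXm.comp measurable_fst))
    have := hZ.mul_prod (integrable_const (1 : ℂ) (μ := volume.restrict (Ioc (0 : ℝ) 1)))
    simpa using this
  have e2 : ∫ w, (X w : ℂ) * Z w ∂P
      = ∫ u in Ioc (0 : ℝ) 1, ∫ w, {q : Ω × ℝ | q.2 ≤ X q.1}.indicator (fun q => Z q.1) (w, u) ∂P := by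
    rw [← integral_integral_swap (f := fun w u => {q : Ω × ℝ | q.2 ≤ X q.1}.indicator (fun q => Z q.1) (w, u)) hint]
    refine integral_congr_ae (ae_of_all _ fun w => ?_)
    simp only [e1 w]
    rfl
  rw [e2]
  have := norm_setIntegral_le_of_norm_le_const (μ := volume) (s := Ioc (0 : ℝ) 1) (C := a)
    (f := fun u => ∫ w, {q : Ω × ℝ | q.2 ≤ X q.1}.indicator (fun q => Z q.1) (w, u) ∂P)
    (by simp) (fun u _ => ?_)
  · simpa using this
  · have hms : MeasurableSet[m] {w | u ≤ X w} := measurableSet_le measurable_const hX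
    have := h _ hms
    rw [← integral_indicator (hm _ hms)] at this
    exact this

/-- With U = (Re X + 1)/2 and V = (Im X + 1)/2, both valued in [0,1], one has X = 2U + 2iV - (1 +
i). Each of the three terms contributes at most 2a. -/
lemma norm_integral_mul_le_of_indicator {Ω : Type*} {m m0 : MeasurableSpace Ω}
    {P : Measure Ω} [IsProbabilityMeasure P] (hm : m ≤ m0) {Z : Ω → ℂ} (hZ : Integrable Z P) {a : ℝ}
    (h : ∀ A, MeasurableSet[m] A → ‖∫ w in A, Z w ∂P‖ ≤ a) {X : Ω → ℂ}
    (hX : Measurable[m] X) (hX1 : ∀ w, ‖X w‖ ≤ 1) :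
    ‖∫ w, X w * Z w ∂P‖ ≤ 6 * a := by
  have hre : Measurable[m] fun w => ((X w).re + 1) / 2 :=
    ((Complex.measurable_re.comp hX).add_const 1).div_const 2
  have him : Measurable[m] fun w => ((X w).im + 1) / 2 :=
    ((Complex.measurable_im.comp hX).add_const 1).div_const 2
  have h1 := norm_integral_smul_le_of_indicator hm hZ h hre (fun w => by
    have := abs_le.1 ((Complex.abs_re_le_norm (X w)).trans (hX1 w))
    constructor <;> linarith [this.1, this.2])
  have h2 := norm_integral_smul_le_of_indicator hm hZ h him (fun w => by
    have := abs_le.1 ((Complex.abs_im_le_norm (X w)).trans (hX1 w))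
    constructor <;> linarith [this.1, this.2])
  have h3 := h univ MeasurableSet.univ
  rw [setIntegral_univ] at h3
  have hb : ∀ {Y : Ω → ℝ}, Measurable[m] Y → (∀ w, |Y w| ≤ 1) →
      Integrable (fun w => (Y w : ℂ) * Z w) P := fun hY hY1 =>
    hZ.bdd_mul (c := 1) (Complex.measurable_ofReal.comp (hY.mono hm le_rfl)).aestronglyMeasurable
      (ae_of_all _ fun w => by simpa using hY1 w)
  have i1 := hb hre (fun w => by
    have := abs_le.1 ((Complex.abs_re_le_norm (X w)).trans (hX1 w))
    rw [abs_le]; constructor <;> linarith [this.1, this.2])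
  have i2 := hb him (fun w => by
    have := abs_le.1 ((Complex.abs_im_le_norm (X w)).trans (hX1 w))
    rw [abs_le]; constructor <;> linarith [this.1, this.2])
  have e : ∀ w, X w * Z w = (2 * ((((X w).re + 1) / 2 : ℝ) * Z w)
      + 2 * Complex.I * ((((X w).im + 1) / 2 : ℝ) * Z w)) - (1 + Complex.I) * Z w := by
    intro w
    conv_lhs => rw [← Complex.re_add_im (X w)]
    push_cast
    ring
  simp_rw [e]
  rw [integral_sub (f := fun w => 2 * ((((X w).re + 1) / 2 : ℝ) * Z w)
      + 2 * Complex.I * ((((X w).im + 1) / 2 : ℝ) * Z w)) ((i1.const_mul _).add (i2.const_mul _))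
      (hZ.const_mul _), integral_add (i1.const_mul _) (i2.const_mul _), integral_const_mul, integral_const_mul,
    integral_const_mul]
  have hI : ‖(1 : ℂ) + Complex.I‖ ≤ 2 := (norm_add_le _ _).trans (by simp; norm_num)
  calc _ ≤ ‖(2 : ℂ) * ∫ w, (((((X w).re + 1) / 2 : ℝ) : ℂ) * Z w) ∂P‖
        + ‖2 * Complex.I * ∫ w, (((((X w).im + 1) / 2 : ℝ) : ℂ) * Z w) ∂P‖
        + ‖(1 + Complex.I) * ∫ w, Z w ∂P‖ := (norm_sub_le _ _).trans (by gcongr; exact norm_add_le _ _)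
    _ ≤ 2 * a + 2 * a + 2 * a := by
        simp only [norm_mul, Complex.norm_I, mul_one, Complex.norm_ofNat]
        gcongr
    _ = 6 * a := by ring

/-- The covariance inequality for `α`-mixing `σ`-algebras and bounded complex functions. -/
lemma norm_integral_mul_sub_le_alphaMixing [IsProbabilityMeasure P]
    (hst : IsStationarySeries P ξ) (hξ : ∀ t, Measurable (ξ t)) (s : ℤ) (l : ℕ)
    {F G : (ℤ → ℝ) → ℂ} (hF : Measurable[coordSigma (Iic s)] F)
    (hG : Measurable[coordSigma (Ici (s + l))] G) (hF1 : ∀ x, ‖F x‖ ≤ 1) (hG1 : ∀ x, ‖G x‖ ≤ 1) :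
    ‖∫ w, F (trajectory ξ w) * G (trajectory ξ w) ∂P
      - (∫ w, F (trajectory ξ w) ∂P) * ∫ w, G (trajectory ξ w) ∂P‖
      ≤ 36 * alphaMixing P ξ l := by
  have hm := measurable_trajectory hξ
  set Q := P.map (trajectory ξ) with hQ
  have : IsProbabilityMeasure Q := Measure.isProbabilityMeasure_map hm.aemeasurable
  have hF0 : Measurable F := hF.mono (coordSigma_le _) le_rfl
  have hG0 : Measurable G := hG.mono (coordSigma_le _) le_rfl
  rw [← integral_map (φ := trajectory ξ) (f := fun x => F x * G x) hm.aemeasurable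
    (hF0.mul hG0).aestronglyMeasurable, ← integral_map (φ := trajectory ξ) hm.aemeasurable
    hF0.aestronglyMeasurable, ← integral_map (φ := trajectory ξ) hm.aemeasurable
    hG0.aestronglyMeasurable, ← hQ]
  have iF : Integrable F Q := Integrable.of_bound hF0.aestronglyMeasurable 1 (ae_of_all _ hF1)
  have iG : Integrable G Q := Integrable.of_bound hG0.aestronglyMeasurable 1 (ae_of_all _ hG1)
  have hAB : ∀ A B, MeasurableSet[coordSigma (Iic s)] A → MeasurableSet[coordSigma (Ici (s + l))] B →
      |Q.real (A ∩ B) - Q.real A * Q.real B| ≤ alphaMixing P ξ l := by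
    intro A B hA hB
    have hA0 := coordSigma_le _ _ hA
    have hB0 := coordSigma_le _ _ hB
    have := abs_sub_le_alphaMixing hst hξ s l hA hB
    simpa only [hQ, map_measureReal_apply hm hA0, map_measureReal_apply hm hB0,
      map_measureReal_apply hm (hA0.inter hB0)] using this
  -- The passage from events to functions is made twice. Here B stays an event and F is general,
  -- with test variable 1_B - Q(B), at the cost of a factor 6. Below, G becomes general with test
  -- variable F - ∫ F, and the factors multiply to 36.
  have hB : ∀ B, MeasurableSet[coordSigma (Ici (s + l))] B →
      ‖∫ x in B, (F x - ∫ y, F y ∂Q) ∂Q‖ ≤ 6 * alphaMixing P ξ l := by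
    intro B hB
    have hB0 := coordSigma_le _ _ hB
    have i1 : Integrable (fun x => B.indicator (fun _ => (1 : ℂ)) x - (Q.real B : ℂ)) Q :=
      ((integrable_const _).indicator hB0).sub (integrable_const _)
    have h1 := norm_integral_mul_le_of_indicator (m0 := MeasurableSpace.pi)
      (a := alphaMixing P ξ l) (coordSigma_le _) i1
      (fun A hA => ?_) hF hF1
    · convert h1 using 2
      have e : ∀ x, F x * (B.indicator (fun _ => (1 : ℂ)) x - (Q.real B : ℂ))
          = B.indicator F x - F x * (Q.real B : ℂ) := by
        intro x; by_cases hx : x ∈ B <;> simp [hx, mul_sub]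
      simp_rw [e]
      rw [integral_sub (iF.indicator hB0) (iF.mul_const _), integral_indicator hB0,
        integral_mul_const, integral_sub iF.integrableOn (integrable_const _).integrableOn,
        setIntegral_const]
      simp [mul_comm]
    · have hA0 := coordSigma_le _ _ hA
      have i2 : Integrable (B.indicator fun _ => (1 : ℂ)) Q := (integrable_const _).indicator hB0
      rw [integral_sub i2.integrableOn (integrable_const _).integrableOn,
        setIntegral_indicator hB0, setIntegral_const, setIntegral_const]
      have := hAB A B hA hB
      have e : Q.real (A ∩ B) • (1 : ℂ) - Q.real A • (Q.real B : ℂ)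
          = ((Q.real (A ∩ B) - Q.real A * Q.real B : ℝ) : ℂ) := by simp
      rw [e, Complex.norm_real]
      exact this
  have h2 : ‖∫ x, G x * (F x - ∫ y, F y ∂Q) ∂Q‖ ≤ 6 * (6 * alphaMixing P ξ l) :=
    norm_integral_mul_le_of_indicator (m0 := MeasurableSpace.pi) (coordSigma_le _)
      (iF.sub (integrable_const _)) hB hG hG1
  have e : ∀ x, G x * (F x - ∫ y, F y ∂Q) = F x * G x - (∫ y, F y ∂Q) * G x := by
    intro x; ring
  simp_rw [e] at h2
  rw [integral_sub _ (iG.const_mul _), integral_const_mul] at h2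
  · linarith
  · exact Integrable.of_bound (hF0.mul hG0).aestronglyMeasurable 1 (ae_of_all _ fun x => by
      simp only [norm_mul]; exact mul_le_one₀ (hF1 x) (norm_nonneg _) (hG1 x))

end Mixing

/-! ### Characteristic functions of block sums -/

/-- The generous constant lets the Taylor bound cover |x| ≤ 1 and the triangle inequality cover |x|
≥ 1. The second order version below works in the same way. -/
lemma norm_exp_I_sub_one_sub_le (x : ℝ) :
    ‖Complex.exp (Complex.I * x) - 1 - Complex.I * x‖ ≤ 2 * x ^ 2 := by
  have hn : ‖Complex.I * (x : ℂ)‖ = |x| := by simp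
  rcases le_total |x| 1 with h | h
  · have := Complex.norm_exp_sub_one_sub_id_le (x := Complex.I * x) (by rw [hn]; exact h)
    rw [hn, sq_abs] at this
    nlinarith [sq_nonneg x]
  · have h1 := Real.norm_exp_I_mul_ofReal_sub_one_le (x := x)
    rw [Real.norm_eq_abs] at h1
    have h2 := norm_sub_le (Complex.exp (Complex.I * x) - 1) (Complex.I * x)
    rw [hn] at h2
    nlinarith [sq_abs x]

lemma norm_exp_I_sub_quadratic_le (x : ℝ) :
    ‖Complex.exp (Complex.I * x) - (1 + Complex.I * x - (x : ℂ) ^ 2 / 2)‖ ≤ 3 * |x| ^ 3 := by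
  have hn : ‖Complex.I * (x : ℂ)‖ = |x| := by simp
  rcases le_total |x| 1 with h | h
  · have := Complex.exp_bound (x := Complex.I * x) (by rw [hn]; exact h) (n := 3) (by norm_num)
    rw [hn] at this
    simp only [Finset.sum_range_succ, Finset.sum_range_zero, Nat.factorial] at this
    refine le_trans (le_of_eq ?_) (this.trans ?_)
    · congr 1
      push_cast
      rw [mul_pow Complex.I _ 2, Complex.I_sq]
      simp only [pow_zero, pow_one]
      norm_num
      ring
    have := pow_nonneg (abs_nonneg x) 3
    norm_num
    nlinarith
  · have h1 := norm_exp_I_sub_one_sub_le x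
    have e : Complex.exp (Complex.I * x) - (1 + Complex.I * x - (x : ℂ) ^ 2 / 2)
      = (Complex.exp (Complex.I * x) - 1 - Complex.I * x) + (x : ℂ) ^ 2 / 2 := by ring
    rw [e]
    have h2 := norm_add_le (Complex.exp (Complex.I * x) - 1 - Complex.I * x) ((x : ℂ) ^ 2 / 2)
    have h3 : ‖(x : ℂ) ^ 2 / 2‖ = |x| ^ 2 / 2 := by simp
    rw [h3] at h2
    rw [← sq_abs x] at h1
    nlinarith [sq_nonneg |x|]

/-- Telescoping. It turns an estimate for the characteristic function of one block into one for the
k-fold product. -/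
lemma norm_pow_sub_pow_le_of_norm_le_one {z w : ℂ} (hz : ‖z‖ ≤ 1) (hw : ‖w‖ ≤ 1) (k : ℕ) :
    ‖z ^ k - w ^ k‖ ≤ k * ‖z - w‖ := by
  induction k with
  | zero => simp
  | succ k ih =>
    have e : z ^ (k + 1) - w ^ (k + 1) = z ^ k * (z - w) + (z ^ k - w ^ k) * w := by ring
    rw [e]
    refine (norm_add_le _ _).trans ?_
    rw [norm_mul, norm_mul, norm_pow]
    have h1 : ‖z‖ ^ k ≤ 1 := pow_le_one₀ (norm_nonneg _) hz
    have h2 := norm_nonneg (z - w)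
    have h3 := norm_nonneg (z ^ k - w ^ k)
    push_cast
    nlinarith

lemma norm_cexp_I_mul_real (x : ℝ) : ‖Complex.exp (Complex.I * x)‖ = 1 := by
  rw [mul_comm]; exact Complex.norm_exp_ofReal_mul_I x

section BlockSums

variable {Ω : Type*} [MeasurableSpace Ω] {P : Measure Ω} {ξ : ℤ → Ω → ℝ}

/-- Approximate factorization of products over blocks of width `b`, spacing `s`, gap `l`. -/
lemma norm_integral_prod_sub_pow_le [IsProbabilityMeasure P]
    (hst : IsStationarySeries P ξ) (hξ : ∀ t, Measurable (ξ t)) (a : ℤ) {s b l : ℕ}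
    (hgap : b + l ≤ s + 1) {F : (ℤ → ℝ) → ℂ} (hF : Measurable[coordSigma (Icc 1 (b : ℤ))] F)
    (hF1 : ∀ x, ‖F x‖ ≤ 1) (k : ℕ) :
    ‖∫ w, ∏ j ∈ Finset.range k, F (timeShift (a + s * j) (trajectory ξ w)) ∂P
      - (∫ w, F (trajectory ξ w) ∂P) ^ k‖ ≤ k * (36 * alphaMixing P ξ l) := by
  have hFp : Measurable F := hF.mono (coordSigma_le _) le_rfl
  have hshift : ∀ j : ℕ, Measurable[coordSigma (Icc (1 + (a + s * j)) (b + (a + s * j)))]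
      fun x => F (timeShift (a + s * j) x) := fun j =>
    hF.comp (measurable_timeShift fun t ht => by simp only [mem_Icc] at *; omega)
  have hF01 : ‖∫ w, F (trajectory ξ w) ∂P‖ ≤ 1 := by
    have := norm_integral_le_of_norm_le_const (μ := P) (f := fun w => F (trajectory ξ w)) (C := 1)
      (ae_of_all _ fun w => hF1 _)
    simpa using this
  induction k with
  | zero => simp
  | succ k ih =>
    -- The right end of the window number k - 1. The next window starts at 1 + a + s k, which lies
    -- at distance at least l beyond it precisely because b + l ≤ s + 1.
    have hprod : Measurable[coordSigma (Iic ((b : ℤ) + a + s * k - s))]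
        fun x => ∏ j ∈ Finset.range k, F (timeShift (a + s * j) x) := by
      refine Finset.measurable_fun_prod _ fun j hj => ?_
      refine (hshift j).mono (coordSigma_mono fun t ht => ?_) le_rfl
      simp only [mem_Icc, mem_Iic] at *
      have hj' : j + 1 ≤ k := Finset.mem_range.1 hj
      have : s * (j + 1) ≤ s * k := Nat.mul_le_mul_left s hj'
      zify at this
      linarith [ht.2]
    have hG : Measurable[coordSigma (Ici ((b : ℤ) + a + s * k - s + l))]
        fun x => F (timeShift (a + s * k) x) := by
      refine (hshift k).mono (coordSigma_mono fun t ht => ?_) le_rfl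
      simp only [mem_Icc, mem_Ici] at *
      zify at hgap
      linarith [ht.1]
    have h1 := norm_integral_mul_sub_le_alphaMixing hst hξ _ l hprod hG
      (fun x => by rw [norm_prod]; exact Finset.prod_le_one (fun _ _ => norm_nonneg _) fun _ _ => hF1 _)
      (fun x => hF1 _)
    rw [hst.integral_comp hξ _ hFp.stronglyMeasurable] at h1
    simp_rw [Finset.prod_range_succ]
    set A := ∫ w, (∏ j ∈ Finset.range k, F (timeShift (a + s * j) (trajectory ξ w))) *
      F (timeShift (a + s * k) (trajectory ξ w)) ∂P
    set B := ∫ w, ∏ j ∈ Finset.range k, F (timeShift (a + s * j) (trajectory ξ w)) ∂P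
    set φ := ∫ w, F (trajectory ξ w) ∂P
    have e : A - φ ^ (k + 1) = (A - B * φ) + (B - φ ^ k) * φ := by ring
    rw [e]
    refine (norm_add_le _ _).trans ?_
    rw [norm_mul]
    have h3 := norm_nonneg (B - φ ^ k)
    push_cast
    nlinarith

lemma norm_integral_exp_sum_sub_pow_le [IsProbabilityMeasure P]
    (hst : IsStationarySeries P ξ) (hξ : ∀ t, Measurable (ξ t)) (a : ℤ) {s b l : ℕ}
    (hgap : b + l ≤ s + 1) {X : (ℤ → ℝ) → ℝ} (hX : Measurable[coordSigma (Icc 1 (b : ℤ))] X) (k : ℕ) :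
    ‖∫ w, Complex.exp (Complex.I *
        (∑ j ∈ Finset.range k, X (timeShift (a + s * j) (trajectory ξ w)) : ℝ)) ∂P
      - (∫ w, Complex.exp (Complex.I * X (trajectory ξ w)) ∂P) ^ k‖
      ≤ k * (36 * alphaMixing P ξ l) := by
  have hm : Measurable[coordSigma (Icc 1 (b : ℤ))] fun x => Complex.exp (Complex.I * X x) :=
    (Complex.measurable_exp.comp ((Complex.measurable_ofReal.comp hX).const_mul _))
  have := norm_integral_prod_sub_pow_le hst hξ a hgap hm (fun x => (norm_cexp_I_mul_real _).le) k
  convert this using 5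
  rw [← Complex.exp_sum]
  push_cast
  rw [Finset.mul_sum]

/-- Centring removes the linear term of the exponential, and what remains is of second order. -/
lemma norm_integral_exp_sub_one_le [IsProbabilityMeasure P] {X : Ω → ℝ}
    (hX : Integrable (fun w => X w ^ 2) P) (hXm : AEMeasurable X P) (hX0 : ∫ w, X w ∂P = 0) :
    ‖∫ w, Complex.exp (Complex.I * X w) ∂P - 1‖ ≤ 2 * ∫ w, X w ^ 2 ∂P := by
  have hL2 : MemLp X 2 P := (memLp_two_iff_integrable_sq hXm.aestronglyMeasurable).2 hX
  have hXi : Integrable X P := hL2.integrable (by norm_num)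
  have hexp : Integrable (fun w => Complex.exp (Complex.I * X w)) P :=
    Integrable.of_bound (Complex.measurable_exp.comp_aemeasurable
      ((Complex.measurable_ofReal.comp_aemeasurable hXm).const_mul _)).aestronglyMeasurable 1
      (ae_of_all _ fun w => (norm_cexp_I_mul_real _).le)
  have e : ∫ w, Complex.exp (Complex.I * X w) ∂P - 1
      = ∫ w, (Complex.exp (Complex.I * X w) - 1 - Complex.I * X w) ∂P := by
    have h1 : Integrable (fun w => Complex.exp (Complex.I * X w) - 1) P :=
      hexp.sub (integrable_const _)
    have h2 : Integrable (fun w => Complex.I * (X w : ℂ)) P := hXi.ofReal.const_mul _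
    rw [integral_sub h1 h2,
      integral_sub hexp (integrable_const _), integral_const_mul, integral_complex_ofReal, hX0]
    simp
  rw [e, ← integral_const_mul]
  exact norm_integral_le_of_norm_le (hX.const_mul 2)
    (ae_of_all _ fun w => norm_exp_I_sub_one_sub_le (X w))

/-- `E|e^{iS} - 1|` is controlled by the characteristic function. -/
lemma integral_norm_exp_sub_one_le [IsProbabilityMeasure P] {S : Ω → ℝ} (hS : AEMeasurable S P) :
    ∫ w, ‖Complex.exp (Complex.I * S w) - 1‖ ∂P
      ≤ √(2 * ‖∫ w, Complex.exp (Complex.I * S w) ∂P - 1‖) := by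
  have hm : AEStronglyMeasurable (fun w => Complex.exp (Complex.I * S w)) P :=
    (Complex.measurable_exp.comp_aemeasurable
      ((Complex.measurable_ofReal.comp_aemeasurable hS).const_mul _)).aestronglyMeasurable
  have hexp : Integrable (fun w => Complex.exp (Complex.I * S w)) P :=
    Integrable.of_bound hm 1 (ae_of_all _ fun w => (norm_cexp_I_mul_real _).le)
  have hb : ∀ w, ‖Complex.exp (Complex.I * S w) - 1‖ ≤ 2 := fun w =>
    (norm_sub_le _ _).trans (by rw [norm_cexp_I_mul_real]; norm_num)
  have hL2 : MemLp (fun w => ‖Complex.exp (Complex.I * S w) - 1‖) 2 P :=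
    MemLp.of_bound (hm.sub aestronglyMeasurable_const).norm 2 (ae_of_all _ fun w => by
      simpa using hb w)
  have hvar := variance_nonneg (fun w => ‖Complex.exp (Complex.I * S w) - 1‖) P
  rw [variance_eq_sub hL2] at hvar
  -- Since |e^{iS}| = 1, the square equals -2 Re(e^{iS} - 1), which is linear in e^{iS}. The square
  -- root in the statement comes from E|·| ≤ (E|·|²)^{1/2}, used here as nonnegativity of a
  -- variance.
  have hsq : ∀ w, ‖Complex.exp (Complex.I * S w) - 1‖ ^ 2
      = -2 * (Complex.exp (Complex.I * S w) - 1).re := by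
    intro w
    have h1 := norm_cexp_I_mul_real (S w)
    have h2 : ‖Complex.exp (Complex.I * S w)‖ ^ 2 = 1 := by rw [h1]; norm_num
    rw [← Complex.normSq_eq_norm_sq, Complex.normSq_apply] at h2 ⊢
    simp only [Complex.sub_re, Complex.sub_im, Complex.one_re, Complex.one_im, sub_zero]
    nlinarith
  refine Real.le_sqrt_of_sq_le ?_
  have e : ∫ w, ((fun w => ‖Complex.exp (Complex.I * S w) - 1‖) ^ 2) w ∂P
      = -2 * (∫ w, Complex.exp (Complex.I * S w) ∂P - 1).re := by
    simp only [Pi.pow_apply]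
    simp_rw [hsq]
    rw [integral_const_mul]
    congr 1
    have := integral_re (𝕜 := ℂ) (hexp.sub (integrable_const 1))
    simp only [Pi.sub_apply, RCLike.re_eq_complex_re] at this
    rw [this, integral_sub hexp (integrable_const _)]
    simp
  rw [e] at hvar
  have h3 := (abs_le.1 (Complex.abs_re_le_norm (∫ w, Complex.exp (Complex.I * S w) ∂P - 1))).1
  linarith

/-- This plays the role of a variance bound for sums of dependent variables. It requires the second
moment of one summand and the mixing coefficient at one lag, but no summation of covariances and no
moment inequality for mixing sequences. -/
lemma integral_norm_exp_sum_sub_one_le [IsProbabilityMeasure P]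
    (hst : IsStationarySeries P ξ) (hξ : ∀ t, Measurable (ξ t)) (a : ℤ) {s b l : ℕ}
    (hgap : b + l ≤ s + 1) {X : (ℤ → ℝ) → ℝ} (hX : Measurable[coordSigma (Icc 1 (b : ℤ))] X)
    (hX2 : Integrable (fun w => X (trajectory ξ w) ^ 2) P)
    (hX0 : ∫ w, X (trajectory ξ w) ∂P = 0) (k : ℕ) :
    ∫ w, ‖Complex.exp (Complex.I *
        (∑ j ∈ Finset.range k, X (timeShift (a + s * j) (trajectory ξ w)) : ℝ)) - 1‖ ∂P
      ≤ √(2 * (k * (2 * ∫ w, X (trajectory ξ w) ^ 2 ∂P) + k * (36 * alphaMixing P ξ l))) := by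
  have hXp : Measurable X := hX.mono (coordSigma_le _) le_rfl
  have hm := measurable_trajectory hξ
  have hS : Measurable fun w => ∑ j ∈ Finset.range k, X (timeShift (a + s * j) (trajectory ξ w)) :=
    Finset.measurable_fun_sum _ fun j _ => hXp.comp ((measurable_timeShift_pi _).comp hm)
  refine (integral_norm_exp_sub_one_le hS.aemeasurable).trans (Real.sqrt_le_sqrt ?_)
  gcongr
  have h1 := norm_integral_exp_sum_sub_pow_le hst hξ a hgap hX k
  set φ := ∫ w, Complex.exp (Complex.I * X (trajectory ξ w)) ∂P
  have hφ : ‖φ‖ ≤ 1 := by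
    have := norm_integral_le_of_norm_le_const (μ := P)
      (f := fun w => Complex.exp (Complex.I * X (trajectory ξ w))) (C := 1)
      (ae_of_all _ fun w => (norm_cexp_I_mul_real _).le)
    simpa using this
  have h2 := norm_pow_sub_pow_le_of_norm_le_one hφ (w := 1) (by simp) k
  rw [one_pow] at h2
  have h3 := norm_integral_exp_sub_one_le hX2 (hXp.comp hm).aemeasurable hX0
  have h4 := norm_sub_le_norm_sub_add_norm_sub (∫ w, Complex.exp (Complex.I *
        (∑ j ∈ Finset.range k, X (timeShift (a + s * j) (trajectory ξ w)) : ℝ)) ∂P) (φ ^ k) 1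
  have h5 : (k : ℝ) * ‖φ - 1‖ ≤ k * (2 * ∫ w, X (trajectory ξ w) ^ 2 ∂P) := by gcongr
  linarith

/-- Sums over adjacent blocks, split into even and odd blocks. -/
lemma integral_norm_exp_sum_adjacent_sub_one_le [IsProbabilityMeasure P]
    (hst : IsStationarySeries P ξ) (hξ : ∀ t, Measurable (ξ t)) {r : ℕ}
    {X : (ℤ → ℝ) → ℝ} (hX : Measurable[coordSigma (Icc 1 (r : ℤ))] X)
    (hX2 : Integrable (fun w => X (trajectory ξ w) ^ 2) P)
    (hX0 : ∫ w, X (trajectory ξ w) ∂P = 0) (k : ℕ) :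
    ∫ w, ‖Complex.exp (Complex.I *
        (∑ j ∈ Finset.range k, X (timeShift (r * j) (trajectory ξ w)) : ℝ)) - 1‖ ∂P
      ≤ 2 * √(2 * (k * (2 * ∫ w, X (trajectory ξ w) ^ 2 ∂P) + k * (36 * alphaMixing P ξ r))) := by
  have hXp : Measurable X := hX.mono (coordSigma_le _) le_rfl
  have hm := measurable_trajectory hξ
  have hsplit : ∀ (f : ℕ → ℝ) (k : ℕ), ∑ j ∈ Finset.range k, f j
      = (∑ j ∈ Finset.range ((k + 1) / 2), f (2 * j)) + ∑ j ∈ Finset.range (k / 2), f (2 * j + 1) := by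
    intro f k
    induction k with
    | zero => simp
    | succ k ih =>
      rw [Finset.sum_range_succ, ih]
      rcases Nat.even_or_odd' k with ⟨m, rfl | rfl⟩
      · rw [show (2 * m + 1 + 1) / 2 = m + 1 by omega, show (2 * m + 1) / 2 = m by omega,
          show 2 * m / 2 = m by omega, Finset.sum_range_succ]; ring
      · rw [show (2 * m + 1 + 1 + 1) / 2 = m + 1 by omega, show (2 * m + 1 + 1) / 2 = m + 1 by omega,
          show (2 * m + 1) / 2 = m by omega, Finset.sum_range_succ (n := m) (f := fun j => f (2 * j + 1))]
        ring
  -- Subadditivity of x ↦ |e^{ix} - 1|, which allows the even and the odd blocks to be estimated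
  -- separately.
  have hpt : ∀ x y : ℝ, ‖Complex.exp (Complex.I * (x + y : ℝ)) - 1‖
      ≤ ‖Complex.exp (Complex.I * x) - 1‖ + ‖Complex.exp (Complex.I * y) - 1‖ := by
    intro x y
    have e : Complex.exp (Complex.I * (x + y : ℝ)) - 1
      = Complex.exp (Complex.I * x) * (Complex.exp (Complex.I * y) - 1)
        + (Complex.exp (Complex.I * x) - 1) := by
      push_cast; rw [mul_add, Complex.exp_add]; ring
    rw [e]
    refine (norm_add_le _ _).trans ?_
    rw [norm_mul, norm_cexp_I_mul_real, one_mul, add_comm]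
  have hint : ∀ S : Ω → ℝ, Measurable S →
      Integrable (fun w => ‖Complex.exp (Complex.I * S w) - 1‖) P := fun S hS =>
    Integrable.of_bound (C := 2) ((Complex.measurable_exp.comp
      ((Complex.measurable_ofReal.comp hS).const_mul _)).sub_const _).norm.aestronglyMeasurable
      (ae_of_all _ fun w => by
        rw [norm_norm]
        exact (norm_sub_le _ _).trans (by rw [norm_cexp_I_mul_real]; norm_num))
  have hSm : ∀ (c : ℕ → ℤ) (k : ℕ),
      Measurable fun w => ∑ j ∈ Finset.range k, X (timeShift (c j) (trajectory ξ w)) := fun c k =>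
    Finset.measurable_fun_sum _ fun j _ => hXp.comp ((measurable_timeShift_pi _).comp hm)
  -- Blocks of one parity have width r and spacing 2r, so a whole block of length r serves as the
  -- gap.
  have hk2 : ∀ m, m ≤ k → ∀ a : ℤ, ∫ w, ‖Complex.exp (Complex.I *
        (∑ j ∈ Finset.range m, X (timeShift (a + (2 * r : ℕ) * j) (trajectory ξ w)) : ℝ)) - 1‖ ∂P
      ≤ √(2 * (k * (2 * ∫ w, X (trajectory ξ w) ^ 2 ∂P) + k * (36 * alphaMixing P ξ r))) := by
    intro m hmk a
    refine (integral_norm_exp_sum_sub_one_le hst hξ a (s := 2 * r) (b := r) (l := r) (by omega)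
      hX hX2 hX0 m).trans (Real.sqrt_le_sqrt ?_)
    have h1 : 0 ≤ ∫ w, X (trajectory ξ w) ^ 2 ∂P := integral_nonneg fun w => sq_nonneg _
    have h2 := alphaMixing_nonneg (P := P) (ξ := ξ) r
    gcongr
  have h1 := hk2 ((k + 1) / 2) (by omega) 0
  have h2 := hk2 (k / 2) (by omega) r
  refine le_trans ?_ ((add_le_add h1 h2).trans_eq (by ring))
  rw [← integral_add (hint _ (hSm _ _)) (hint _ (hSm _ _))]
  refine integral_mono (hint _ (hSm _ _)) ((hint _ (hSm _ _)).add (hint _ (hSm _ _))) fun w => ?_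
  refine le_trans (le_of_eq ?_) (hpt _ _)
  rw [hsplit]
  congr 6 <;>
  · refine Finset.sum_congr rfl fun j _ => ?_
    congr 2; push_cast; ring

end BlockSums

/-! ### Central limit theorem and weak law for block sums, by characteristic functions. -/

section BlockLimits

variable {Ω : Type*} [MeasurableSpace Ω] {P : Measure Ω} {ξ : ℤ → Ω → ℝ}

lemma integrable_exp_I [IsProbabilityMeasure P] {S : Ω → ℝ} (hS : AEMeasurable S P) :
    Integrable (fun w => Complex.exp (Complex.I * S w)) P :=
  Integrable.of_bound (Complex.measurable_exp.comp_aemeasurable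
    ((Complex.measurable_ofReal.comp_aemeasurable hS).const_mul _)).aestronglyMeasurable 1
    (ae_of_all _ fun _ => (norm_cexp_I_mul_real _).le)

lemma norm_integral_exp_le_one [IsProbabilityMeasure P] (S : Ω → ℝ) :
    ‖∫ w, Complex.exp (Complex.I * S w) ∂P‖ ≤ 1 := by
  have := norm_integral_le_of_norm_le_const (μ := P)
    (f := fun w => Complex.exp (Complex.I * S w)) (C := 1)
    (ae_of_all _ fun _ => (norm_cexp_I_mul_real _).le)
  simpa using this

lemma norm_integral_exp_sub_integral_exp_le [IsProbabilityMeasure P] {S T : Ω → ℝ}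
    (hS : AEMeasurable S P) (hT : AEMeasurable T P) :
    ‖∫ w, Complex.exp (Complex.I * S w) ∂P - ∫ w, Complex.exp (Complex.I * T w) ∂P‖
      ≤ ∫ w, ‖Complex.exp (Complex.I * (S w - T w : ℝ)) - 1‖ ∂P := by
  rw [← integral_sub (integrable_exp_I hS) (integrable_exp_I hT)]
  refine (norm_integral_le_integral_norm _).trans (le_of_eq (integral_congr_ae (ae_of_all _ fun w => ?_)))
  have e : Complex.exp (Complex.I * S w) - Complex.exp (Complex.I * T w)
      = Complex.exp (Complex.I * T w) * (Complex.exp (Complex.I * (S w - T w : ℝ)) - 1) := by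
    rw [mul_sub, ← Complex.exp_add]; push_cast; ring_nf
  simp only
  rw [e, norm_mul, norm_cexp_I_mul_real, one_mul]

/-- The Lindeberg step for uniformly bounded centred variables. -/
lemma tendsto_charFun_pow_of_bounded [IsProbabilityMeasure P] {X : ℕ → Ω → ℝ} {k : ℕ → ℕ}
    {a : ℕ → ℝ} {C V : ℝ} (hX : ∀ n, AEMeasurable (X n) P) (hC : ∀ n w, |X n w| ≤ C)
    (h0 : ∀ n, ∫ w, X n w ∂P = 0) (hV : Tendsto (fun n => ∫ w, X n w ^ 2 ∂P) atTop (𝓝 V))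
    (ha : Tendsto a atTop (𝓝 0)) (hka : Tendsto (fun n => k n * a n ^ 2) atTop (𝓝 1)) :
    Tendsto (fun n => (∫ w, Complex.exp (Complex.I * (a n * X n w : ℝ)) ∂P) ^ k n) atTop
      (𝓝 (Complex.exp (-V / 2 : ℝ))) := by
  set v : ℕ → ℝ := fun n => ∫ w, X n w ^ 2 ∂P with hv
  set φ : ℕ → ℂ := fun n => ∫ w, Complex.exp (Complex.I * (a n * X n w : ℝ)) ∂P with hφ
  set u : ℕ → ℂ := fun n => ((Real.exp (-(a n ^ 2 * v n / 2)) : ℝ) : ℂ) with hu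
  have hv0 : ∀ n, 0 ≤ v n := fun n => integral_nonneg fun w => sq_nonneg _
  have hXi : ∀ n, Integrable (X n) P := fun n =>
    Integrable.of_bound (hX n).aestronglyMeasurable C (ae_of_all _ (hC n))
  have hX2 : ∀ n, Integrable (fun w => X n w ^ 2) P := fun n =>
    Integrable.of_bound ((hX n).pow_const 2).aestronglyMeasurable (C ^ 2) (ae_of_all _ fun w => by
      rw [Real.norm_eq_abs, abs_pow]; exact pow_le_pow_left₀ (abs_nonneg _) (hC n w) 2)
  -- Second order expansion. The linear term vanishes by centring and the uniform bound C controls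
  -- the cubic remainder, so no separate Lindeberg condition appears.
  have h1 : ∀ n, ‖φ n - (1 - (a n : ℂ) ^ 2 * v n / 2)‖ ≤ 3 * (|a n| * C) ^ 3 := by
    intro n
    have e : φ n - (1 - (a n : ℂ) ^ 2 * v n / 2) = ∫ w, (Complex.exp (Complex.I * (a n * X n w : ℝ))
        - (1 + Complex.I * (a n * X n w : ℝ) - ((a n * X n w : ℝ) : ℂ) ^ 2 / 2)) ∂P := by
      have i1 := integrable_exp_I (((hX n).const_mul (a n)))
      have i2 : Integrable (fun w => Complex.I * (a n * X n w : ℝ)) P :=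
        ((hXi n).const_mul (a n)).ofReal.const_mul _
      have i3 : Integrable (fun w => ((a n * X n w : ℝ) : ℂ) ^ 2 / 2) P := by
        have : Integrable (fun w => (((a n * X n w) ^ 2 : ℝ) : ℂ)) P := by
          refine (((hX2 n).const_mul (a n ^ 2)).ofReal (𝕜 := ℂ)).congr (ae_of_all _ fun w => ?_)
          simp [mul_pow]
        simpa only [Complex.ofReal_pow] using this.div_const 2
      have i4 : Integrable (fun w => 1 + Complex.I * (a n * X n w : ℝ)) P :=
        (integrable_const _).add i2
      have i5 : Integrable (fun w => 1 + Complex.I * (a n * X n w : ℝ)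
        - ((a n * X n w : ℝ) : ℂ) ^ 2 / 2) P := i4.sub i3
      rw [integral_sub i1 i5, integral_sub i4 i3, integral_add (integrable_const _) i2,
        integral_const_mul, integral_complex_ofReal, integral_const_mul, h0 n, integral_div]
      have : ∫ w, ((a n * X n w : ℝ) : ℂ) ^ 2 ∂P = (a n : ℂ) ^ 2 * v n := by
        rw [hv, ← integral_complex_ofReal, ← integral_const_mul]
        refine integral_congr_ae (ae_of_all _ fun w => ?_)
        push_cast; ring
      rw [this]
      simp [hφ]
    rw [e]
    have := norm_integral_le_of_norm_le_const (μ := P) (C := 3 * (|a n| * C) ^ 3)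
      (f := fun w => Complex.exp (Complex.I * (a n * X n w : ℝ))
        - (1 + Complex.I * (a n * X n w : ℝ) - ((a n * X n w : ℝ) : ℂ) ^ 2 / 2))
      (ae_of_all _ fun w => (norm_exp_I_sub_quadratic_le _).trans (by
        rw [abs_mul]; gcongr; exact hC n w))
    simpa using this
  have hs0 : Tendsto (fun n => a n ^ 2 * v n / 2) atTop (𝓝 0) := by
    have := ((ha.pow 2).mul hV).div_const 2
    simpa using this
  have h2 : ∀ᶠ n in atTop, ‖u n - (1 - (a n : ℂ) ^ 2 * v n / 2)‖ ≤ (a n ^ 2 * v n / 2) ^ 2 := by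
    filter_upwards [hs0.eventually_lt_const one_pos] with n hn
    have h3 : 0 ≤ a n ^ 2 * v n / 2 := by have := hv0 n; positivity
    have := Real.abs_exp_sub_one_sub_id_le (x := -(a n ^ 2 * v n / 2)) (by
      rw [abs_neg, abs_of_nonneg h3]; exact hn.le)
    have e : u n - (1 - (a n : ℂ) ^ 2 * v n / 2)
      = ((Real.exp (-(a n ^ 2 * v n / 2)) - 1 - -(a n ^ 2 * v n / 2) : ℝ) : ℂ) := by
      simp only [hu]; push_cast; ring
    rw [e, Complex.norm_real, Real.norm_eq_abs]
    simpa using this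
  have hφ1 : ∀ n, ‖φ n‖ ≤ 1 := fun n => norm_integral_exp_le_one _
  have hu1 : ∀ n, ‖u n‖ ≤ 1 := fun n => by
    have := hv0 n
    simp only [hu, Complex.norm_real, Real.norm_eq_abs, Real.abs_exp]
    exact Real.exp_le_one_iff.2 (by have : 0 ≤ a n ^ 2 * v n / 2 := by positivity
                                    linarith)
  -- One factor is off by O(|a|³ + a⁴). Multiplied by k this is k a² times a null sequence, and k a²
  -- tends to 1.
  have h3 : Tendsto (fun n => φ n ^ k n - u n ^ k n) atTop (𝓝 0) := by
    refine squeeze_zero_norm' (a := fun n => (k n * a n ^ 2) * (3 * |a n| * C ^ 3 + a n ^ 2 * v n ^ 2 / 4)) ?_ ?_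
    · filter_upwards [h2] with n hn
      refine (norm_pow_sub_pow_le_of_norm_le_one (hφ1 n) (hu1 n) (k n)).trans ?_
      have h4 : ‖φ n - u n‖ ≤ 3 * (|a n| * C) ^ 3 + (a n ^ 2 * v n / 2) ^ 2 := by
        have := norm_sub_le_norm_sub_add_norm_sub (φ n) (1 - (a n : ℂ) ^ 2 * v n / 2) (u n)
        rw [norm_sub_rev (1 - (a n : ℂ) ^ 2 * v n / 2) (u n)] at this
        linarith [h1 n]
      calc (k n : ℝ) * ‖φ n - u n‖ ≤ k n * (3 * (|a n| * C) ^ 3 + (a n ^ 2 * v n / 2) ^ 2) := by gcongr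
        _ = _ := by rw [← sq_abs (a n)]; ring
    · have h5 : Tendsto (fun n => |a n|) atTop (𝓝 0) := by simpa using ha.abs
      have := hka.mul (((h5.const_mul 3).mul_const (C ^ 3)).add ((((ha.pow 2).mul (hV.pow 2))).div_const 4))
      simpa using this
  have h4 : Tendsto (fun n => u n ^ k n) atTop (𝓝 (Complex.exp (-V / 2 : ℝ))) := by
    have e : ∀ n, u n ^ k n = Complex.exp ((-((k n * a n ^ 2) * v n / 2) : ℝ)) := by
      intro n
      simp only [hu, Complex.ofReal_exp]
      rw [← Complex.exp_nat_mul]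
      congr 1; push_cast; ring
    simp_rw [e]
    refine (Complex.continuous_exp.tendsto _).comp ((Complex.continuous_ofReal.tendsto _).comp ?_)
    have := ((hka.mul hV).div_const 2).neg
    convert this using 2
    ring
  have := h3.add h4
  simp only [sub_add_cancel, zero_add] at this
  exact this

lemma measurable_blockSum {X : (ℤ → ℝ) → ℝ} (hX : Measurable X) (hξ : ∀ t, Measurable (ξ t))
    (c : ℕ → ℤ) (k : ℕ) :
    Measurable fun w => ∑ j ∈ Finset.range k, X (timeShift (c j) (trajectory ξ w)) :=
  Finset.measurable_fun_sum _ fun _ _ =>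
    hX.comp ((measurable_timeShift_pi _).comp (measurable_trajectory hξ))

/-- The sum of a functional over `k` adjacent blocks of length `r`. -/
def blockSum (ξ : ℤ → Ω → ℝ) (k r : ℕ) (X : (ℤ → ℝ) → ℝ) (w : Ω) : ℝ :=
  ∑ j ∈ Finset.range k, X (timeShift (r * j) (trajectory ξ w))

/-- The functional `X`, centred and scaled by `a`. -/
def centred (P : Measure Ω) (ξ : ℤ → Ω → ℝ) (a : ℝ) (X : (ℤ → ℝ) → ℝ) (x : ℤ → ℝ) : ℝ :=
  a * (X x - ∫ w, X (trajectory ξ w) ∂P)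

lemma measurable_blockSum' {X : (ℤ → ℝ) → ℝ} (hX : Measurable X) (hξ : ∀ t, Measurable (ξ t))
    (k r : ℕ) : Measurable (blockSum ξ k r X) := measurable_blockSum hX hξ _ k

lemma measurable_centred {m : MeasurableSpace (ℤ → ℝ)} {X : (ℤ → ℝ) → ℝ} (hX : Measurable X)
    (a : ℝ) : Measurable (centred P ξ a X) := (hX.sub_const _).const_mul a

omit [MeasurableSpace Ω] in
lemma blockSum_sub (k r : ℕ) (X Y : (ℤ → ℝ) → ℝ) (w : Ω) :
    blockSum ξ k r X w - blockSum ξ k r Y w = blockSum ξ k r (fun x => X x - Y x) w := by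
  simp [blockSum, Finset.sum_sub_distrib]

lemma integral_sq_sub_integral_le [IsProbabilityMeasure P] {X : Ω → ℝ} (hX : MemLp X 2 P) :
    ∫ w, (X w - ∫ w', X w' ∂P) ^ 2 ∂P ≤ ∫ w, X w ^ 2 ∂P := by
  have h1 := variance_eq_sub hX
  rw [variance_eq_integral hX.1.aemeasurable] at h1
  rw [h1]
  simp only [Pi.pow_apply]
  nlinarith [sq_nonneg (∫ w, X w ∂P)]

/-- Replacing a functional by another one that is close in `L²` hardly changes the
characteristic function of the block sum. -/
lemma norm_integral_exp_blockSum_sub_le [IsProbabilityMeasure P]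
    (hst : IsStationarySeries P ξ) (hξ : ∀ t, Measurable (ξ t)) {r : ℕ} (a : ℝ)
    {X Y : (ℤ → ℝ) → ℝ} (hX : Measurable[coordSigma (Icc 1 (r : ℤ))] X)
    (hY : Measurable[coordSigma (Icc 1 (r : ℤ))] Y)
    (hX2 : MemLp (fun w => X (trajectory ξ w)) 2 P) (hY2 : MemLp (fun w => Y (trajectory ξ w)) 2 P)
    (k : ℕ) :
    ‖∫ w, Complex.exp (Complex.I * blockSum ξ k r (centred P ξ a X) w) ∂P
      - ∫ w, Complex.exp (Complex.I * blockSum ξ k r (centred P ξ a Y) w) ∂P‖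
      ≤ 2 * √(2 * (2 * (k * a ^ 2) * (∫ w, (X (trajectory ξ w) - Y (trajectory ξ w)) ^ 2 ∂P)
        + k * (36 * alphaMixing P ξ r))) := by
  have hXp : Measurable X := hX.mono (coordSigma_le _) le_rfl
  have hYp : Measurable Y := hY.mono (coordSigma_le _) le_rfl
  -- The difference is again a centred block functional, with second moment at most a² E(X - Y)², so
  -- the bound for adjacent blocks applies to it.
  set D : (ℤ → ℝ) → ℝ := fun x => centred P ξ a X x - centred P ξ a Y x with hD
  have hDm : Measurable[coordSigma (Icc 1 (r : ℤ))] D :=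
    (measurable_centred hX a).sub (measurable_centred hY a)
  have hXY : MemLp (fun w => X (trajectory ξ w) - Y (trajectory ξ w)) 2 P := hX2.sub hY2
  have hDe : ∀ w, D (trajectory ξ w) = a * ((X (trajectory ξ w) - Y (trajectory ξ w))
      - ∫ w, (X (trajectory ξ w) - Y (trajectory ξ w)) ∂P) := by
    intro w
    rw [integral_sub (hX2.integrable (by norm_num)) (hY2.integrable (by norm_num))]
    simp only [hD, centred]; ring
  have hD2 : MemLp (fun w => D (trajectory ξ w)) 2 P := by
    simp_rw [hDe]
    exact (hXY.sub (memLp_const _)).const_mul a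
  refine (norm_integral_exp_sub_integral_exp_le
    (measurable_blockSum' (measurable_centred hXp a) hξ k r).aemeasurable
    (measurable_blockSum' (measurable_centred hYp a) hξ k r).aemeasurable).trans ?_
  simp_rw [blockSum_sub]
  refine (integral_norm_exp_sum_adjacent_sub_one_le hst hξ hDm hD2.integrable_sq ?_ k).trans ?_
  · simp_rw [hDe]
    rw [integral_const_mul, integral_sub (hXY.integrable (by norm_num)) (integrable_const _)]
    simp
  · gcongr 2 * √(2 * (?_ + _))
    have := integral_sq_sub_integral_le hXY
    simp_rw [hDe, mul_pow]
    rw [integral_const_mul]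
    have h0 : 0 ≤ (k : ℝ) * a ^ 2 := by positivity
    nlinarith

/-- Central limit theorem for block functionals of an `α`-mixing series, in terms of
characteristic functions: `Y m n` are truncated versions of `X n`, and `Z m n` are versions of
`Y m n` that disregard the end of the block. -/
theorem tendsto_integral_exp_blockSum [IsProbabilityMeasure P]
    (hst : IsStationarySeries P ξ) (hξ : ∀ t, Measurable (ξ t)) {k r l : ℕ → ℕ} {a : ℕ → ℝ}
    (hlr : ∀ n, l n ≤ r n)
    (hkr : Tendsto (fun n => k n * alphaMixing P ξ (r n)) atTop (𝓝 0))
    (hkl : Tendsto (fun n => k n * alphaMixing P ξ (l n)) atTop (𝓝 0))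
    (ha : Tendsto a atTop (𝓝 0)) (hka : Tendsto (fun n => k n * a n ^ 2) atTop (𝓝 1))
    {X : ℕ → (ℤ → ℝ) → ℝ} {Y Z : ℕ → ℕ → (ℤ → ℝ) → ℝ} {C ε V : ℕ → ℝ} {v : ℝ}
    (hX : ∀ n, Measurable[coordSigma (Icc 1 (r n : ℤ))] (X n))
    (hY : ∀ m n, Measurable[coordSigma (Icc 1 (r n : ℤ))] (Y m n))
    (hZ : ∀ m n, Measurable[coordSigma (Icc 1 ((r n - l n : ℕ) : ℤ))] (Z m n))
    (hX2 : ∀ᶠ n in atTop, MemLp (fun w => X n (trajectory ξ w)) 2 P)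
    (hYC : ∀ m n x, |Y m n x| ≤ C m) (hZC : ∀ m n x, |Z m n x| ≤ C m)
    (hXY : ∀ m, ∀ᶠ n in atTop,
      ∫ w, (X n (trajectory ξ w) - Y m n (trajectory ξ w)) ^ 2 ∂P ≤ ε m)
    (hε : Tendsto ε atTop (𝓝 0))
    (hYZ : ∀ m, Tendsto (fun n =>
      ∫ w, (Y m n (trajectory ξ w) - Z m n (trajectory ξ w)) ^ 2 ∂P) atTop (𝓝 0))
    (hV : ∀ m, Tendsto (fun n => variance (fun w => Z m n (trajectory ξ w)) P) atTop (𝓝 (V m)))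
    (hv : Tendsto V atTop (𝓝 v)) :
    Tendsto (fun n => ∫ w, Complex.exp (Complex.I * blockSum ξ (k n) (r n)
      (centred P ξ (a n) (X n)) w) ∂P) atTop (𝓝 (Complex.exp (-v / 2 : ℝ))) := by
  have hm := measurable_trajectory hξ
  have hYp : ∀ m n, Measurable (Y m n) := fun m n => (hY m n).mono (coordSigma_le _) le_rfl
  have hZp : ∀ m n, Measurable (Z m n) := fun m n => (hZ m n).mono (coordSigma_le _) le_rfl
  have hZr : ∀ m n, Measurable[coordSigma (Icc 1 (r n : ℤ))] (Z m n) := fun m n =>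
    (hZ m n).mono (coordSigma_mono (Icc_subset_Icc_right (by
      have := hlr n; push_cast [this]; omega))) le_rfl
  have hY2 : ∀ m n, MemLp (fun w => Y m n (trajectory ξ w)) 2 P := fun m n =>
    MemLp.of_bound ((hYp m n).comp hm).aestronglyMeasurable (C m) (ae_of_all _ fun w => hYC m n _)
  have hZ2 : ∀ m n, MemLp (fun w => Z m n (trajectory ξ w)) 2 P := fun m n =>
    MemLp.of_bound ((hZp m n).comp hm).aestronglyMeasurable (C m) (ae_of_all _ fun w => hZC m n _)
  set φX : ℕ → ℂ := fun n => ∫ w, Complex.exp (Complex.I * blockSum ξ (k n) (r n)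
      (centred P ξ (a n) (X n)) w) ∂P with hφX
  set φY : ℕ → ℕ → ℂ := fun m n => ∫ w, Complex.exp (Complex.I * blockSum ξ (k n) (r n)
      (centred P ξ (a n) (Y m n)) w) ∂P with hφY
  set φZ : ℕ → ℕ → ℂ := fun m n => ∫ w, Complex.exp (Complex.I * blockSum ξ (k n) (r n)
      (centred P ξ (a n) (Z m n)) w) ∂P with hφZ
  have hbound : ∀ (e : ℕ → ℝ) (e0 : ℝ), Tendsto e atTop (𝓝 e0) → Tendsto (fun n =>
      2 * √(2 * (2 * (k n * a n ^ 2) * e n + k n * (36 * alphaMixing P ξ (r n))))) atTop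
      (𝓝 (2 * √(2 * (2 * e0)))) := by
    intro e e0 he
    have h1 : Tendsto (fun n => k n * (36 * alphaMixing P ξ (r n))) atTop (𝓝 0) := by
      have := hkr.const_mul 36
      rw [mul_zero] at this
      exact this.congr fun n => by ring
    have h2 := (((((hka.const_mul 2).mul he).add h1).const_mul 2).sqrt).const_mul 2
    simpa using h2
  have hYZ' : ∀ m, Tendsto (fun n => φY m n - φZ m n) atTop (𝓝 0) := by
    intro m
    refine squeeze_zero_norm (fun n => norm_integral_exp_blockSum_sub_le hst hξ (a n)
      (hY m n) (hZr m n) (hY2 m n) (hZ2 m n) (k n)) ?_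
    have := hbound _ _ (hYZ m)
    simpa using this
  have hZlim : ∀ m, Tendsto (φZ m) atTop (𝓝 (Complex.exp (-V m / 2 : ℝ))) := by
    intro m
    set ζ : ℕ → Ω → ℝ := fun n w => Z m n (trajectory ξ w) - ∫ w, Z m n (trajectory ξ w) ∂P with hζ
    have hZi : ∀ n, Integrable (fun w => Z m n (trajectory ξ w)) P := fun n =>
      (hZ2 m n).integrable (by norm_num)
    have h1 := tendsto_charFun_pow_of_bounded (P := P) (X := ζ) (k := k) (a := a) (C := 2 * C m) (V := V m)
      (fun n => (((hZp m n).comp hm).sub_const _).aemeasurable)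
      (fun n w => by
        have h2 : |∫ w, Z m n (trajectory ξ w) ∂P| ≤ C m := by
          have := norm_integral_le_of_norm_le_const (μ := P) (C := C m)
            (f := fun w => Z m n (trajectory ξ w)) (ae_of_all _ fun w => hZC m n _)
          simpa using this
        have h3 := hZC m n (trajectory ξ w)
        rw [abs_le] at *
        constructor <;> simp only [hζ] <;> linarith [h2.1, h2.2, h3.1, h3.2])
      (fun n => by
        simp only [hζ]
        rw [integral_sub (hZi n) (integrable_const _)]; simp)
      (by
        refine (hV m).congr fun n => ?_
        rw [variance_eq_integral (X := fun w => Z m n (trajectory ξ w))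
          ((hZp m n).comp hm).aemeasurable])
      ha hka
    -- The functional Z sees only the first r - l observations of a block of length r, which leaves
    -- a gap of length l before the next block; the characteristic function factorizes up to 36 k
    -- α(l).
    have h2 : Tendsto (fun n => φZ m n
        - (∫ w, Complex.exp (Complex.I * (a n * ζ n w : ℝ)) ∂P) ^ k n) atTop (𝓝 0) := by
      refine squeeze_zero_norm (a := fun n => k n * (36 * alphaMixing P ξ (l n))) (fun n => ?_) ?_
      · have := norm_integral_exp_sum_sub_pow_le hst hξ 0 (s := r n) (b := r n - l n) (l := l n)
          (by have := hlr n; omega) (measurable_centred (hZ m n) (a n) (P := P) (ξ := ξ)) (k n)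
        simpa [hφZ, hζ, blockSum, centred] using this
      · have := hkl.const_mul 36
        rw [mul_zero] at this
        exact this.congr fun n => by ring
    have := h2.add h1
    simpa using this
  rw [Metric.tendsto_atTop]
  intro δ hδ
  have hexpV : Tendsto (fun m => Complex.exp (-V m / 2 : ℝ)) atTop (𝓝 (Complex.exp (-v / 2 : ℝ))) :=
    (Complex.continuous_exp.tendsto _).comp ((Complex.continuous_ofReal.tendsto _).comp
      (hv.neg.div_const 2))
  have hεs : Tendsto (fun m => 2 * √(2 * (2 * ε m))) atTop (𝓝 0) := by
    have := (((hε.const_mul 2).const_mul 2).sqrt).const_mul 2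
    simpa using this
  -- The truncation index m is fixed before n: it makes the limiting truncation error and the
  -- distance of the truncated variance from v small, after which n may grow.
  obtain ⟨m, hm1, hm2⟩ := ((hεs.eventually_lt_const (show 0 < δ / 4 by positivity)).and
    (Metric.tendsto_nhds.1 hexpV (δ / 4) (by positivity))).exists
  have hY1 : Tendsto (φY m) atTop (𝓝 (Complex.exp (-V m / 2 : ℝ))) := by
    have := (hYZ' m).add (hZlim m)
    simpa using this
  have hY2' := Metric.tendsto_nhds.1 hY1 (δ / 4) (by positivity)
  have hb := (hbound (fun _ => ε m) (ε m) tendsto_const_nhds).eventually_lt_const hm1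
  obtain ⟨N, hN⟩ := eventually_atTop.1 ((hY2'.and hb).and ((hXY m).and hX2))
  refine ⟨N, fun n hn => ?_⟩
  obtain ⟨⟨h1, h2⟩, h3, h4⟩ := hN n hn
  have h5 : ‖φX n - φY m n‖ < δ / 4 := by
    refine lt_of_le_of_lt ((norm_integral_exp_blockSum_sub_le hst hξ (a n) (hX n) (hY m n)
      h4 (hY2 m n) (k n)).trans ?_) h2
    gcongr
  rw [dist_eq_norm] at *
  calc ‖φX n - Complex.exp (-v / 2 : ℝ)‖ = ‖(φX n - φY m n) + (φY m n - Complex.exp (-V m / 2 : ℝ))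
        + (Complex.exp (-V m / 2 : ℝ) - Complex.exp (-v / 2 : ℝ))‖ := by congr 1; ring
    _ ≤ ‖φX n - φY m n‖ + ‖φY m n - Complex.exp (-V m / 2 : ℝ)‖
        + ‖Complex.exp (-V m / 2 : ℝ) - Complex.exp (-v / 2 : ℝ)‖ := norm_add₃_le
    _ < δ := by linarith

/-- The mass outside [-ε, ε] is bounded by an average of 1 minus the characteristic function over a
fixed interval around zero, and dominated convergence applies with bound 2. -/
lemma tendsto_measureReal_abs_gt_of_tendsto_charFun [IsProbabilityMeasure P] {S : ℕ → Ω → ℝ}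
    (hS : ∀ n, Measurable (S n))
    (h : ∀ t : ℝ, Tendsto (fun n => ∫ w, Complex.exp (Complex.I * (t * S n w : ℝ)) ∂P) atTop (𝓝 1))
    {ε : ℝ} (hε : 0 < ε) :
    Tendsto (fun n => P.real {w | ε < |S n w|}) atTop (𝓝 0) := by
  have hpr : ∀ n, IsProbabilityMeasure (P.map (S n)) := fun n =>
    Measure.isProbabilityMeasure_map (hS n).aemeasurable
  have hcf : ∀ n t, charFun (P.map (S n)) t = ∫ w, Complex.exp (Complex.I * (t * S n w : ℝ)) ∂P := by
    intro n t
    rw [charFun_apply_real, integral_map (hS n).aemeasurable (by fun_prop)]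
    refine integral_congr_ae (ae_of_all _ fun w => ?_)
    simp only
    congr 1; push_cast; ring
  have hlim : Tendsto (fun n => ∫ t in (-2 * ε⁻¹)..(2 * ε⁻¹), (1 - charFun (P.map (S n)) t)) atTop
      (𝓝 (∫ t in (-2 * ε⁻¹)..(2 * ε⁻¹), (1 - 1 : ℂ))) := by
    refine intervalIntegral.tendsto_integral_filter_of_dominated_convergence (fun _ => 2) ?_ ?_ ?_ ?_
    · exact Eventually.of_forall fun n => by fun_prop
    · refine Eventually.of_forall fun n => ae_of_all _ fun t _ => ?_
      refine (norm_sub_le _ _).trans ?_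
      have := norm_charFun_le_one (μ := P.map (S n)) t
      rw [norm_one]; linarith
    · exact intervalIntegrable_const
    · refine ae_of_all _ fun t _ => ?_
      simp_rw [hcf]
      exact (h t).const_sub 1
  have h1 : Tendsto (fun n => 2⁻¹ * ε * ‖∫ t in (-2 * ε⁻¹)..(2 * ε⁻¹), (1 - charFun (P.map (S n)) t)‖)
      atTop (𝓝 0) := by
    have := hlim.norm.const_mul (2⁻¹ * ε)
    simpa using this
  refine squeeze_zero (fun n => measureReal_nonneg) (fun n => ?_) h1
  have := measureReal_abs_gt_le_integral_charFun (μ := P.map (S n)) hε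
  rwa [map_measureReal_apply (hS n) (measurableSet_lt measurable_const (by fun_prop))] at this

/-- Weak law of large numbers for block functionals of an `α`-mixing series. -/
theorem tendsto_measureReal_blockSum_gt [IsProbabilityMeasure P]
    (hst : IsStationarySeries P ξ) (hξ : ∀ t, Measurable (ξ t)) {k r : ℕ → ℕ}
    (hk : Tendsto k atTop atTop)
    (hkr : Tendsto (fun n => k n * alphaMixing P ξ (r n)) atTop (𝓝 0))
    {X : ℕ → (ℤ → ℝ) → ℝ} {C : ℝ} (hX : ∀ n, Measurable[coordSigma (Icc 1 (r n : ℤ))] (X n))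
    (hX2 : ∀ᶠ n in atTop, MemLp (fun w => X n (trajectory ξ w)) 2 P)
    (hC : ∀ᶠ n in atTop, ∫ w, X n (trajectory ξ w) ^ 2 ∂P ≤ C) {ε : ℝ} (hε : 0 < ε) :
    Tendsto (fun n => P.real {w | ε < |blockSum ξ (k n) (r n) (centred P ξ (k n : ℝ)⁻¹ (X n)) w|})
      atTop (𝓝 0) := by
  have hXp : ∀ n, Measurable (X n) := fun n => (hX n).mono (coordSigma_le _) le_rfl
  refine tendsto_measureReal_abs_gt_of_tendsto_charFun
    (fun n => measurable_blockSum' (measurable_centred (hXp n) _) hξ _ _) (fun t => ?_) hε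
  rw [tendsto_iff_norm_sub_tendsto_zero]
  have hk0 : Tendsto (fun n => (k n : ℝ)⁻¹) atTop (𝓝 0) :=
    tendsto_inv_atTop_zero.comp (tendsto_natCast_atTop_atTop.comp hk)
  have hlim : Tendsto (fun n => 2 * √(2 * (2 * (t ^ 2 * (k n : ℝ)⁻¹) * C
      + k n * (36 * alphaMixing P ξ (r n))))) atTop (𝓝 0) := by
    have h1 : Tendsto (fun n => k n * (36 * alphaMixing P ξ (r n))) atTop (𝓝 0) := by
      have := hkr.const_mul 36
      rw [mul_zero] at this
      exact this.congr fun n => by ring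
    have h2 := ((((((hk0.const_mul (t ^ 2)).const_mul 2).mul_const C).add h1).const_mul 2).sqrt).const_mul 2
    simpa using h2
  refine squeeze_zero' (Eventually.of_forall fun n => norm_nonneg _) ?_ hlim
  filter_upwards [hX2, hC, hk.eventually_gt_atTop 0] with n h1 h2 h3
  -- Comparison with the zero functional. For averages k a² equals t²/k, so bounded second moments
  -- suffice.
  have h4 := norm_integral_exp_blockSum_sub_le hst hξ (t * (k n : ℝ)⁻¹) (hX n)
    (Y := fun _ => 0) measurable_const h1 (MemLp.zero') (k n)
  have e1 : ∀ w, blockSum ξ (k n) (r n) (centred P ξ (t * (k n : ℝ)⁻¹) fun _ => 0) w = 0 := by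
    intro w; simp [blockSum, centred]
  have e2 : ∀ w, blockSum ξ (k n) (r n) (centred P ξ (t * (k n : ℝ)⁻¹) (X n)) w
      = t * blockSum ξ (k n) (r n) (centred P ξ (k n : ℝ)⁻¹ (X n)) w := by
    intro w; simp only [blockSum, centred, Finset.mul_sum, mul_assoc]
  simp_rw [e1, e2] at h4
  simp only [Complex.ofReal_zero, mul_zero, Complex.exp_zero, integral_const, probReal_univ,
    one_smul, sub_zero] at h4
  refine h4.trans ?_
  have e3 : (k n : ℝ) * (t * (k n : ℝ)⁻¹) ^ 2 = t ^ 2 * (k n : ℝ)⁻¹ := by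
    have : (k n : ℝ) ≠ 0 := by positivity
    field_simp
  rw [e3]
  gcongr

end BlockLimits

/-! ### Order statistics -/

section OrderStatistics

/-- In a non-increasing list the entries above a level form an initial segment. -/
lemma lt_getElem_iff_lt_countP {L : List ℝ} (hL : L.Pairwise (· ≥ ·)) (a : ℝ) {i : ℕ}
    (hi : i < L.length) : a < L[i] ↔ i < L.countP (fun y => decide (a < y)) := by
  induction L generalizing i with
  | nil => simp at hi
  | cons h t ih =>
    rw [List.pairwise_cons] at hL
    by_cases hah : a < h
    · rw [List.countP_cons_of_pos (by simpa using hah)]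
      cases i with
      | zero => simp [hah]
      | succ i =>
        have := ih hL.2 (i := i) (by simpa using hi)
        simp [this]
    · rw [List.countP_cons_of_neg (by simpa using hah)]
      have h0 : t.countP (fun y => decide (a < y)) = 0 := by
        rw [List.countP_eq_zero]
        intro y hy
        have := hL.1 y hy
        simp only [decide_eq_true_eq, not_lt]
        exact le_trans this (not_lt.1 hah)
      rw [h0]
      cases i with
      | zero => simpa using not_lt.1 hah
      | succ i =>
        have hit : i < t.length := by simpa using hi
        have := hL.1 t[i] (List.getElem_mem hit)
        simp only [List.getElem_cons_succ, Nat.not_lt_zero, iff_false, not_lt]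
        exact le_trans this (not_lt.1 hah)

/-- This turns statements on order statistics, ties included, into counts of indices with large
observations. Measurability, ordering and the effect of deleting indices all follow from it. -/
lemma lt_orderStat_iff {x : ℤ → ℝ} {I : Finset ℤ} {j : ℕ} (hj : 1 ≤ j) (hjI : j ≤ I.card) (a : ℝ) :
    a < orderStat x I j ↔ j ≤ (I.filter fun t => a < x t).card := by
  have hlen : ((I.val.map x).sort (· ≥ ·)).length = I.card := by simp
  have hi : j - 1 < ((I.val.map x).sort (· ≥ ·)).length := by omega
  rw [orderStat, List.getD_eq_getElem _ _ hi,
    lt_getElem_iff_lt_countP (Multiset.pairwise_sort _ _) a hi]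
  have : ((I.val.map x).sort (· ≥ ·)).countP (fun y => decide (a < y))
      = (I.filter fun t => a < x t).card := by
    rw [← Multiset.coe_countP, Multiset.sort_eq, Multiset.countP_map]
    rfl
  rw [this]
  omega

lemma orderStat_of_card_lt {x : ℤ → ℝ} {I : Finset ℤ} {j : ℕ} (hjI : I.card < j) :
    orderStat x I j = 0 := by
  rw [orderStat, List.getD_eq_default]
  simp; omega

lemma measurable_orderStat {I : Finset ℤ} {s : Set ℤ} (hs : (I : Set ℤ) ⊆ s) {j : ℕ} (hj : 1 ≤ j) :
    Measurable[coordSigma s] fun x => orderStat x I j := by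
  by_cases hjI : j ≤ I.card
  · refine measurable_of_Ioi fun a => ?_
    have : (fun x => orderStat x I j) ⁻¹' Ioi a
        = {x | j ≤ ∑ t ∈ I, if a < x t then 1 else 0} := by
      ext x
      simp only [mem_preimage, mem_Ioi, mem_ofPred_eq, lt_orderStat_iff hj hjI, Finset.card_filter]
    rw [this]
    refine measurableSet_le measurable_const ?_
    refine Finset.measurable_fun_sum _ fun t ht => ?_
    refine Measurable.ite ?_ measurable_const measurable_const
    exact measurableSet_lt measurable_const (measurable_coord (hs ht))
  · have : (fun x => orderStat x I j) = fun _ => 0 := by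
      ext x; exact orderStat_of_card_lt (not_le.1 hjI)
    rw [this]; exact measurable_const

lemma orderStat_two_le_one {x : ℤ → ℝ} {I : Finset ℤ} (hI : 2 ≤ I.card) :
    orderStat x I 2 ≤ orderStat x I 1 := by
  refine le_of_forall_lt fun a ha => ?_
  rw [lt_orderStat_iff (by norm_num) hI] at ha
  rw [lt_orderStat_iff le_rfl (by omega)]
  omega

lemma orderStat_one_le_iff {x : ℤ → ℝ} {I : Finset ℤ} (hI : 1 ≤ I.card) (a : ℝ) :
    orderStat x I 1 ≤ a ↔ ∀ t ∈ I, x t ≤ a := by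
  rw [← not_lt, lt_orderStat_iff le_rfl hI, Nat.succ_le_iff, Finset.card_pos, Finset.not_nonempty_iff_eq_empty,
    Finset.filter_eq_empty_iff]
  simp

/-- Above any level b ≥ a the sets I and I' contain the same exceedances. As both order statistics
exceed a, they are determined by these counts. -/
lemma orderStat_eq_of_subset {x : ℤ → ℝ} {I I' : Finset ℤ} (hsub : I' ⊆ I) (hI : 2 ≤ I'.card) {a : ℝ}
    (ha : ∀ t ∈ I, t ∉ I' → x t ≤ a) (hS : a < orderStat x I 2) {j : ℕ} (hj : 1 ≤ j) (hj2 : j ≤ 2) :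
    orderStat x I j = orderStat x I' j := by
  have hcard := Finset.card_le_card hsub
  have hcount : ∀ b, a ≤ b → (I.filter fun t => b < x t) = I'.filter fun t => b < x t := by
    intro b hb
    ext t
    simp only [Finset.mem_filter]
    constructor
    · rintro ⟨h1, h2⟩
      refine ⟨?_, h2⟩
      by_contra h3
      exact absurd (ha t h1 h3) (not_le.2 (lt_of_le_of_lt hb h2))
    · rintro ⟨h1, h2⟩
      exact ⟨hsub h1, h2⟩
  have h1 : a < orderStat x I j := by
    rw [lt_orderStat_iff hj (by omega)]
    rw [lt_orderStat_iff (by norm_num) (by omega)] at hS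
    omega
  have h2 : a < orderStat x I' j := by
    rw [lt_orderStat_iff hj (by omega), ← hcount a le_rfl, ← lt_orderStat_iff hj (by omega)]
    exact h1
  refine eq_of_forall_lt_iff fun b => ?_
  rcases le_or_gt a b with hb | hb
  · rw [lt_orderStat_iff hj (by omega), lt_orderStat_iff hj (by omega), hcount b hb]
  · exact ⟨fun _ => hb.trans h2, fun _ => hb.trans h1⟩

/-- Moves block number i to the initial block by a time shift, the form in which stationarity and
the mixing bounds are stated. -/
lemma orderStat_block (x : ℤ → ℝ) (r i j : ℕ) :
    orderStat x (block r i) j = orderStat (timeShift (r * i) x) (Finset.Icc 1 (r : ℤ)) j := by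
  have h1 : block r i = (Finset.Icc 1 (r : ℤ)).map (addRightEmbedding ((r : ℤ) * i)) := by
    rw [Finset.map_add_right_Icc, block]
    congr 1 <;> ring
  rw [orderStat, orderStat, h1, Finset.map_val, Multiset.map_map]
  rfl

/-- The two largest order statistics over `I`, truncated below at `c` and scaled by `s`. -/
def topTwo (c s : ℝ) (I : Finset ℤ) (x : ℤ → ℝ) : ℝ × ℝ :=
  (max (orderStat x I 1) c / s, max (orderStat x I 2) c / s)

lemma measurable_topTwo (c s : ℝ) {I : Finset ℤ} {S : Set ℤ} (hs : (I : Set ℤ) ⊆ S) :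
    Measurable[coordSigma S] (topTwo c s I) := by
  rw [show topTwo c s I = fun x => (max (orderStat x I 1) c / s, max (orderStat x I 2) c / s) from rfl]
  refine Measurable.prodMk ?_ ?_
  · exact ((measurable_orderStat hs le_rfl).max measurable_const).div_const s
  · exact ((measurable_orderStat hs (by norm_num)).max measurable_const).div_const s

lemma blockSample_div {Ω : Type*} (ξ : ℤ → Ω → ℝ) (c s : ℝ) (n r : ℕ) (w : Ω) (i : Fin (n / r)) :
    ((blockSample ξ c n r w i).1 / s, (blockSample ξ c n r w i).2 / s)
      = topTwo c s (Finset.Icc 1 (r : ℤ)) (timeShift (r * (i : ℕ)) (trajectory ξ w)) := by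
  simp only [blockSample, blockMax, blockSnd, orderStat_block, topTwo]
  rfl

lemma sum_blockSample {Ω : Type*} (ξ : ℤ → Ω → ℝ) (c s : ℝ) (n r : ℕ) (w : Ω) (f : ℝ × ℝ → ℝ) :
    ∑ i, f ((blockSample ξ c n r w i).1 / s, (blockSample ξ c n r w i).2 / s)
      = blockSum ξ (n / r) r (fun x => f (topTwo c s (Finset.Icc 1 (r : ℤ)) x)) w := by
  simp_rw [blockSample_div]
  rw [blockSum, ← Fin.sum_univ_eq_sum_range
    (fun j => f (topTwo c s (Finset.Icc 1 (r : ℤ)) (timeShift (r * (j : ℤ)) (trajectory ξ w))))]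

lemma blockMax_zero {Ω : Type*} (ξ : ℤ → Ω → ℝ) (r : ℕ) (w : Ω) :
    blockMax ξ r 0 w = orderStat (trajectory ξ w) (Finset.Icc 1 (r : ℤ)) 1 := by
  change orderStat (trajectory ξ w) (block r 0) 1 = _
  rw [orderStat_block]
  simp [timeShift_zero]

lemma blockSnd_zero {Ω : Type*} (ξ : ℤ → Ω → ℝ) (r : ℕ) (w : Ω) :
    blockSnd ξ r 0 w = orderStat (trajectory ξ w) (Finset.Icc 1 (r : ℤ)) 2 := by
  change orderStat (trajectory ξ w) (block r 0) 2 = _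
  rw [orderStat_block]
  simp [timeShift_zero]

end OrderStatistics

/-! ### Weak limits of the block order statistics -/

section Attraction

variable {Ω : Type*} [MeasurableSpace Ω] {P : Measure Ω} [IsProbabilityMeasure P]
  {ξ : ℤ → Ω → ℝ} {ρ : ℝ → ℝ} {α₀ : ℝ} {σ : ℕ → ℝ}

lemma DomainOfAttraction.isStationarySeries (h : DomainOfAttraction P ξ ρ α₀ σ) :
    IsStationarySeries P ξ := h.stationary

/-- The unscaled pair of the two largest observations, scaled by `s`. -/
def topPair (s : ℝ) (I : Finset ℤ) (x : ℤ → ℝ) : ℝ × ℝ := (orderStat x I 1 / s, orderStat x I 2 / s)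

lemma DomainOfAttraction.tendsto_integral (h : DomainOfAttraction P ξ ρ α₀ σ)
    (φ : BoundedContinuousFunction (ℝ × ℝ) ℝ) :
    Tendsto (fun m : ℕ => ∫ w, φ (topPair (σ m) (Finset.Icc 1 (m : ℤ)) (trajectory ξ w)) ∂P) atTop
      (𝓝 (∫ p, φ p ∂(frechetWelsch ρ α₀ 1))) := by
  have h1 := (ProbabilityMeasure.tendsto_iff_forall_integral_tendsto.1 h.weak_limit.tendsto) φ
  simp only [ProbabilityMeasure.coe_mk, Measure.map_id] at h1
  refine h1.congr fun m => ?_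
  rw [integral_map (h.weak_limit.forall_aemeasurable m) φ.continuous.aestronglyMeasurable]
  simp_rw [blockMax_zero, blockSnd_zero]
  rfl

lemma DomainOfAttraction.hasWelschCDF (h : DomainOfAttraction P ξ ρ α₀ σ) :
    HasWelschCDF ρ α₀ 1 (frechetWelsch ρ α₀ 1) :=
  hasWelschCDF_frechetWelsch h.welsch h.alpha_pos one_pos

end Attraction

section WelschBasic

variable {ρ : ℝ → ℝ} {α : ℝ} {W : Measure (ℝ × ℝ)}

lemma HasWelschCDF.measure_fst_nonpos (h : HasWelschCDF ρ α 1 W) : W {p | p.1 ≤ 0} = 0 := by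
  have e : {p : ℝ × ℝ | p.1 ≤ 0} = ⋃ n : ℕ, Iic (0 : ℝ) ×ˢ Iic (n : ℝ) := by
    ext p
    simp only [mem_ofPred_eq, mem_iUnion, mem_prod, mem_Iic]
    exact ⟨fun hp => by obtain ⟨n, hn⟩ := exists_nat_ge p.2; exact ⟨n, hp, hn⟩, fun ⟨n, hn⟩ => hn.1⟩
  rw [e, measure_iUnion_null_iff]
  intro n
  rw [h.2, welschCDF, if_pos (Or.inl le_rfl), ENNReal.ofReal_zero]

lemma HasWelschCDF.measure_snd_nonpos (h : HasWelschCDF ρ α 1 W) : W {p | p.2 ≤ 0} = 0 := by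
  have e : {p : ℝ × ℝ | p.2 ≤ 0} = ⋃ n : ℕ, Iic (n : ℝ) ×ˢ Iic (0 : ℝ) := by
    ext p
    simp only [mem_ofPred_eq, mem_iUnion, mem_prod, mem_Iic]
    exact ⟨fun hp => by obtain ⟨n, hn⟩ := exists_nat_ge p.1; exact ⟨n, hn, hp⟩, fun ⟨n, hn⟩ => hn.2⟩
  rw [e, measure_iUnion_null_iff]
  intro n
  rw [h.2, welschCDF, if_pos (Or.inr le_rfl), ENNReal.ofReal_zero]

lemma HasWelschCDF.ae_pos (h : HasWelschCDF ρ α 1 W) : ∀ᵐ p ∂W, 0 < p.1 ∧ 0 < p.2 := by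
  have h1 : ∀ᵐ p ∂W, 0 < p.1 := by
    rw [ae_iff]; simpa using h.measure_fst_nonpos
  have h2 : ∀ᵐ p ∂W, 0 < p.2 := by
    rw [ae_iff]; simpa using h.measure_snd_nonpos
  filter_upwards [h1, h2] with p a b using ⟨a, b⟩

lemma HasWelschCDF.measure_fst_le_pos (h : HasWelschCDF ρ α 1 W) {x : ℝ} (hx : 0 < x) :
    0 < W {p | p.1 ≤ x} := by
  have h1 : W (Iic x ×ˢ Iic x) ≤ W {p | p.1 ≤ x} := measure_mono fun p hp => hp.1
  refine lt_of_lt_of_le ?_ h1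
  rw [h.2, welschCDF, if_neg (by simp [hx]), if_pos le_rfl]
  simp [Real.exp_pos]

end WelschBasic

/-! ### Negligibility of short blocks and of the end of a block. -/

section Attraction

variable {Ω : Type*} [MeasurableSpace Ω] {P : Measure Ω} [IsProbabilityMeasure P]
  {ξ : ℤ → Ω → ℝ} {ρ : ℝ → ℝ} {α₀ : ℝ} {σ : ℕ → ℝ}

/-- A bounded continuous function from a continuous `[0,1]`-valued function. -/
def unitBCF (f : ℝ × ℝ → ℝ) (hf : Continuous f) (h01 : ∀ p, f p ∈ Icc (0 : ℝ) 1) :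
    BoundedContinuousFunction (ℝ × ℝ) ℝ :=
  BoundedContinuousFunction.ofNormedAddCommGroup f hf 1 fun p => by
    rw [Real.norm_eq_abs, abs_of_nonneg (h01 p).1]; exact (h01 p).2

/-- A continuous ramp, equal to `1` below `0` and to `0` above `1`. -/
def ramp (u : ℝ) : ℝ := max 0 (min 1 (1 - u))

lemma ramp_mem (u : ℝ) : ramp u ∈ Icc (0 : ℝ) 1 :=
  ⟨le_max_left _ _, max_le zero_le_one (min_le_left _ _)⟩

lemma ramp_of_nonpos {u : ℝ} (h : u ≤ 0) : ramp u = 1 := by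
  rw [ramp, min_eq_left (by linarith), max_eq_right zero_le_one]

lemma ramp_of_one_le {u : ℝ} (h : 1 ≤ u) : ramp u = 0 := by
  rw [ramp, min_eq_right (by linarith), max_eq_left (by linarith)]

lemma continuous_ramp : Continuous ramp := by unfold ramp; fun_prop

lemma measurable_trajectory_orderStat (hξ : ∀ t, Measurable (ξ t)) (I : Finset ℤ) {j : ℕ}
    (hj : 1 ≤ j) : Measurable fun w => orderStat (trajectory ξ w) I j :=
  ((measurable_orderStat (subset_univ _) hj).mono (coordSigma_le univ) le_rfl).comp
    (measurable_trajectory hξ)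

/-- The limit law charges {x₁ ≤ x/2}. The ramp lies between the indicators of {x₁ ≤ x/2} and {x₁ ≤
x}, so weak convergence transfers a positive lower bound with no discussion of boundaries. -/
lemma DomainOfAttraction.exists_le_measureReal_max_le (h : DomainOfAttraction P ξ ρ α₀ σ)
    (hξ : ∀ t, Measurable (ξ t)) {x : ℝ} (hx : 0 < x) :
    ∃ p > 0, ∀ᶠ m : ℕ in atTop,
      p ≤ P.real {w | orderStat (trajectory ξ w) (Finset.Icc 1 (m : ℤ)) 1 ≤ x * σ m} := by
  have hH := h.hasWelschCDF
  set H := frechetWelsch ρ α₀ 1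
  set f : ℝ × ℝ → ℝ := fun p => ramp (2 * p.1 / x - 1) with hf
  have hfc : Continuous f := continuous_ramp.comp (by fun_prop)
  have hlim : Tendsto (fun m : ℕ => ∫ w, f (topPair (σ m) (Finset.Icc 1 (m : ℤ)) (trajectory ξ w)) ∂P)
      atTop (𝓝 (∫ p, f p ∂H)) := h.tendsto_integral (unitBCF f hfc fun p => ramp_mem _)
  have hpos : 0 < ∫ p, f p ∂H := by
    have h1 : H.real {p | p.1 ≤ x / 2} ≤ ∫ p, f p ∂H := by
      rw [← integral_indicator_one (measurableSet_le measurable_fst measurable_const)]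
      refine integral_mono_of_nonneg (ae_of_all _ fun p => indicator_nonneg (by simp) _)
        (Integrable.of_bound hfc.aestronglyMeasurable 1 (ae_of_all _ fun p => ?_))
        (ae_of_all _ fun p => ?_)
      · rw [Real.norm_eq_abs, abs_of_nonneg (ramp_mem _).1]; exact (ramp_mem _).2
      · by_cases hp : p.1 ≤ x / 2
        · have : 2 * p.1 / x - 1 ≤ 0 := by
            rw [sub_nonpos, div_le_one hx]; linarith
          simp [hf, ramp_of_nonpos this, hp]
        · simp only [indicator, mem_ofPred_eq, hp, if_false]
          exact (ramp_mem _).1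
    refine lt_of_lt_of_le ?_ h1
    rw [measureReal_def, ENNReal.toReal_pos_iff]
    exact ⟨hH.measure_fst_le_pos (by positivity), measure_lt_top _ _⟩
  refine ⟨(∫ p, f p ∂H) / 2, by positivity, ?_⟩
  filter_upwards [hlim.eventually_const_lt (half_lt_self hpos), eventually_ge_atTop 1] with m hm h1
  refine hm.le.trans ?_
  have hσ := h.sigma_pos m h1
  have hms : MeasurableSet {w | orderStat (trajectory ξ w) (Finset.Icc 1 (m : ℤ)) 1 ≤ x * σ m} :=
    measurableSet_le (measurable_trajectory_orderStat hξ _ le_rfl) measurable_const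
  rw [← integral_indicator_one hms]
  refine integral_mono_of_nonneg (ae_of_all _ fun w => (ramp_mem _).1)
    ((integrable_const (1 : ℝ)).indicator hms) (ae_of_all _ fun w => ?_)
  by_cases hw : orderStat (trajectory ξ w) (Finset.Icc 1 (m : ℤ)) 1 ≤ x * σ m
  · simp only [indicator, mem_ofPred_eq, hw, if_true]
    exact (ramp_mem _).2
  · simp only [indicator, mem_ofPred_eq, hw, if_false]
    refine (ramp_of_one_le ?_).le
    have : x ≤ orderStat (trajectory ξ w) (Finset.Icc 1 (m : ℤ)) 1 / σ m := by
      rw [le_div_iff₀ hσ]; exact (not_le.1 hw).le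
    have : 2 ≤ 2 * (orderStat (trajectory ξ w) (Finset.Icc 1 (m : ℤ)) 1 / σ m) / x := by
      rw [le_div_iff₀ hx]; linarith
    simp only [topPair]
    linarith

/-- The maximum over a short block is of smaller order than the scaling of the long block. -/
lemma DomainOfAttraction.tendsto_measureReal_max_gt (h : DomainOfAttraction P ξ ρ α₀ σ)
    (hξ : ∀ t, Measurable (ξ t)) {r l : ℕ → ℕ} (hr : Tendsto r atTop atTop)
    (hl : Tendsto l atTop atTop) (hlr : Tendsto (fun n => (l n : ℝ) / r n) atTop (𝓝 0))
    (hmix : Tendsto (fun n => (r n : ℝ) / l n * alphaMixing P ξ (l n)) atTop (𝓝 0))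
    {x : ℝ} (hx : 0 < x) :
    Tendsto (fun n => P.real {w | x * σ (r n) <
      orderStat (trajectory ξ w) (Finset.Icc 1 (l n : ℤ)) 1}) atTop (𝓝 0) := by
  obtain ⟨p, hp, hpm⟩ := h.exists_le_measureReal_max_le hξ hx
  have hmt := measurable_trajectory hξ
  set E : ℕ → Set (ℤ → ℝ) := fun n => {y | orderStat y (Finset.Icc 1 (l n : ℤ)) 1 ≤ x * σ (r n)} with hE
  -- The long block contains k windows of length l separated by gaps of length l. If q is the
  -- probability that one window stays below x σ_r, then the whole block stays below with
  -- probability at most q^k + o(1). This probability is bounded away from zero, so q^k is too, and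
  -- k → ∞ forces q → 1.
  set k : ℕ → ℕ := fun n => r n / (2 * l n) with hk
  have hEm : ∀ n, MeasurableSet[coordSigma (Icc 1 (l n : ℤ))] (E n) := fun n =>
    measurableSet_le (measurable_orderStat (by simp) le_rfl) measurable_const
  have hEp : ∀ n, MeasurableSet (E n) := fun n => coordSigma_le _ _ (hEm n)
  set q : ℕ → ℝ := fun n => P.real (trajectory ξ ⁻¹' E n) with hq
  have hfac : ∀ n, |P.real {w | ∀ j < k n, timeShift (0 + (2 * l n : ℕ) * j) (trajectory ξ w) ∈ E n}
      - q n ^ k n| ≤ k n * (36 * alphaMixing P ξ (l n)) := by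
    intro n
    have h1 := norm_integral_prod_sub_pow_le h.isStationarySeries hξ 0 (s := 2 * l n) (b := l n)
      (l := l n) (by omega) (F := (E n).indicator 1) (Measurable.indicator (f := fun _ => (1 : ℂ)) measurable_const (hEm n))
      (fun y => by by_cases hy : y ∈ E n <;> simp [hy]) (k n)
    have e1 : ∫ w, (E n).indicator (1 : (ℤ → ℝ) → ℂ) (trajectory ξ w) ∂P = q n := by
      have : (fun w => (E n).indicator (1 : (ℤ → ℝ) → ℂ) (trajectory ξ w))
          = (trajectory ξ ⁻¹' E n).indicator fun _ => 1 := by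
        ext w; simp [indicator]
      rw [this, integral_indicator_const _ (hmt (hEp n))]
      simp [hq]
    have e2 : ∫ w, ∏ j ∈ Finset.range (k n), (E n).indicator (1 : (ℤ → ℝ) → ℂ)
        (timeShift (0 + (2 * l n : ℕ) * j) (trajectory ξ w)) ∂P
        = P.real {w | ∀ j < k n, timeShift (0 + (2 * l n : ℕ) * j) (trajectory ξ w) ∈ E n} := by
      have hms : MeasurableSet {w | ∀ j < k n, timeShift (0 + (2 * l n : ℕ) * j) (trajectory ξ w) ∈ E n} := by
        have : {w | ∀ j < k n, timeShift (0 + (2 * l n : ℕ) * j) (trajectory ξ w) ∈ E n}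
          = ⋂ j : ℕ, ⋂ _ : j < k n, {w | timeShift (0 + (2 * l n : ℕ) * j) (trajectory ξ w) ∈ E n} := by
          ext w; simp
        rw [this]
        exact MeasurableSet.iInter fun j => MeasurableSet.iInter fun _ =>
          ((measurable_timeShift_pi _).comp hmt) (hEp n)
      have : (fun w => ∏ j ∈ Finset.range (k n), (E n).indicator (1 : (ℤ → ℝ) → ℂ)
          (timeShift (0 + (2 * l n : ℕ) * j) (trajectory ξ w)))
          = {w | ∀ j < k n, timeShift (0 + (2 * l n : ℕ) * j) (trajectory ξ w) ∈ E n}.indicator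
            fun _ => 1 := by
        ext w
        by_cases hw : ∀ j < k n, timeShift (0 + (2 * l n : ℕ) * j) (trajectory ξ w) ∈ E n
        · rw [indicator_of_mem (by exact hw), Finset.prod_eq_one]
          intro j hj
          rw [indicator_of_mem (hw j (Finset.mem_range.1 hj))]; rfl
        · rw [indicator_of_notMem (by exact hw)]
          push Not at hw
          obtain ⟨j, hj, hj2⟩ := hw
          exact Finset.prod_eq_zero (Finset.mem_range.2 hj) (indicator_of_notMem hj2 _)
      rw [this, integral_indicator_const _ hms]
      simp
    rw [e1, e2] at h1
    have e3 : ∀ u v : ℝ, ‖(u : ℂ) - (v : ℂ) ^ k n‖ = |u - v ^ k n| := by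
      intro u v
      rw [← Complex.ofReal_pow, ← Complex.ofReal_sub, Complex.norm_real, Real.norm_eq_abs]
    rwa [e3] at h1
  have hkα : Tendsto (fun n => k n * (36 * alphaMixing P ξ (l n))) atTop (𝓝 0) := by
    refine squeeze_zero (fun n => mul_nonneg (Nat.cast_nonneg _)
      (mul_nonneg (by norm_num) (alphaMixing_nonneg _))) (fun n => ?_)
      (by simpa using hmix.const_mul 36)
    have h1 : (k n : ℝ) ≤ r n / l n := by
      refine (Nat.cast_div_le).trans ?_
      rcases Nat.eq_zero_or_pos (l n) with h0 | h0
      · simp [h0]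
      · push_cast
        gcongr
        have : (0 : ℝ) < l n := by exact_mod_cast h0
        linarith
    have := alphaMixing_nonneg (P := P) (ξ := ξ) (l n)
    calc (k n : ℝ) * (36 * alphaMixing P ξ (l n)) ≤ r n / l n * (36 * alphaMixing P ξ (l n)) := by gcongr
      _ = _ := by ring
  have hkt : Tendsto k atTop atTop := by
    refine tendsto_atTop.2 fun b => ?_
    have h1 := hlr.eventually_lt_const (show (0 : ℝ) < 1 / (2 * b + 2) by positivity)
    filter_upwards [h1, hl.eventually_gt_atTop 0, hr.eventually_gt_atTop 0] with n h1 h2 h3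
    rw [hk, Nat.le_div_iff_mul_le (by omega)]
    have h3' : (0 : ℝ) < r n := by exact_mod_cast h3
    rw [div_lt_div_iff₀ h3' (by positivity), one_mul] at h1
    have : l n * (2 * b + 2) < r n := by exact_mod_cast h1
    nlinarith
  have hmono : ∀ n, 1 ≤ r n → 1 ≤ l n →
      P.real {w | orderStat (trajectory ξ w) (Finset.Icc 1 (r n : ℤ)) 1 ≤ x * σ (r n)}
      ≤ P.real {w | ∀ j < k n, timeShift (0 + (2 * l n : ℕ) * j) (trajectory ξ w) ∈ E n} := by
    intro n h1 h2
    refine measureReal_mono fun w hw j hj => ?_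
    rw [mem_ofPred_eq, orderStat_one_le_iff (by simpa using h1)] at hw
    change orderStat _ _ 1 ≤ _
    rw [orderStat_one_le_iff (by simpa using h2)]
    intro t ht
    refine hw _ ?_
    rw [Finset.mem_Icc] at ht ⊢
    have h3 : (j + 1) * (2 * l n) ≤ r n :=
      le_trans (Nat.mul_le_mul_right _ hj) (Nat.div_mul_le_self _ _)
    zify at h3
    push_cast
    have h4 : (0 : ℤ) ≤ 2 * l n * j := by positivity
    constructor
    · linarith [ht.1]
    · nlinarith [ht.2]
  have hqe : ∀ n, P.real {w | x * σ (r n) <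
      orderStat (trajectory ξ w) (Finset.Icc 1 (l n : ℤ)) 1} = 1 - q n := by
    intro n
    rw [hq, ← probReal_compl_eq_one_sub (hmt (hEp n))]
    congr 1
    ext w; simp [hE]
  simp_rw [hqe]
  have hlow : ∀ᶠ n in atTop, p / 2 ≤ q n ^ k n := by
    filter_upwards [hr.eventually hpm, hr.eventually_ge_atTop 1, hl.eventually_ge_atTop 1,
      hkα.eventually_lt_const (half_pos hp)] with n h1 h2 h3 h4
    have h5 := abs_le.1 (hfac n)
    linarith [hmono n h2 h3, h5.2]
  have hq0 : ∀ n, 0 ≤ q n := fun n => measureReal_nonneg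
  have hq1 : ∀ n, q n ≤ 1 := fun n => measureReal_le_one
  have hfin : Tendsto (fun n => (-Real.log (p / 2)) * (k n : ℝ)⁻¹) atTop (𝓝 0) := by
    have := (tendsto_inv_atTop_zero.comp (tendsto_natCast_atTop_atTop.comp hkt)).const_mul
      (-Real.log (p / 2))
    simpa using this
  refine squeeze_zero' (Eventually.of_forall fun n => by linarith [hq1 n]) ?_ hfin
  filter_upwards [hlow, hkt.eventually_gt_atTop 0] with n h1 h2
  -- Together with q^k ≥ p/2 this gives the rate 1 - q ≤ -log(p/2)/k.
  have h3 : q n ^ k n ≤ Real.exp (-(k n * (1 - q n))) := by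
    have : q n ≤ Real.exp (-(1 - q n)) := by
      have := Real.add_one_le_exp (-(1 - q n)); linarith
    calc q n ^ k n ≤ Real.exp (-(1 - q n)) ^ k n := pow_le_pow_left₀ (hq0 n) this _
      _ = _ := by rw [← Real.exp_nat_mul]; congr 1; ring
  have h4 := Real.log_le_log (by positivity) (h1.trans h3)
  rw [Real.log_exp] at h4
  have h5 : (0 : ℝ) < k n := by exact_mod_cast h2
  rw [← div_eq_mul_inv, le_div_iff₀ h5]
  linarith

/-- The two largest observations of a block are rarely among its last ones. -/
lemma DomainOfAttraction.tendsto_measureReal_clip (h : DomainOfAttraction P ξ ρ α₀ σ)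
    (hξ : ∀ t, Measurable (ξ t)) {r l : ℕ → ℕ} (hr : Tendsto r atTop atTop)
    (hl : Tendsto l atTop atTop) (hlr : Tendsto (fun n => (l n : ℝ) / r n) atTop (𝓝 0))
    (hmix : Tendsto (fun n => (r n : ℝ) / l n * alphaMixing P ξ (l n)) atTop (𝓝 0)) :
    Tendsto (fun n => P.real {w | ∃ j ∈ Icc 1 2,
      orderStat (trajectory ξ w) (Finset.Icc 1 (r n : ℤ)) j
        ≠ orderStat (trajectory ξ w) (Finset.Icc 1 ((r n - l n : ℕ) : ℤ)) j}) atTop (𝓝 0) := by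
  have hH := h.hasWelschCDF
  set H := frechetWelsch ρ α₀ 1
  have hmt := measurable_trajectory hξ
  -- A continuous majorant of the indicator of {y ≤ 1/(m+1)} that vanishes for y ≥ 2/(m+1). Its
  -- limiting expectation is small for large m because the limit law has a positive second
  -- coordinate.
  set f : ℕ → ℝ × ℝ → ℝ := fun m p => ramp (p.2 * (m + 1) - 1) with hf
  have hfc : ∀ m, Continuous (f m) := fun m => continuous_ramp.comp (by fun_prop)
  have hf0 : Tendsto (fun m => ∫ p, f m p ∂H) atTop (𝓝 (∫ p, (0 : ℝ) ∂H)) := by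
    refine tendsto_integral_of_dominated_convergence (fun _ => 1) (fun m => (hfc m).aestronglyMeasurable)
      (integrable_const _) (fun m => ae_of_all _ fun p => ?_) ?_
    · rw [Real.norm_eq_abs, abs_of_nonneg (ramp_mem _).1]; exact (ramp_mem _).2
    · filter_upwards [hH.ae_pos] with p hp
      refine tendsto_const_nhds.congr' ?_
      obtain ⟨N, hN⟩ := exists_nat_ge (2 / p.2)
      filter_upwards [eventually_ge_atTop N] with m hm
      refine (ramp_of_one_le ?_).symm
      have h1 : (N : ℝ) ≤ m := by exact_mod_cast hm
      rw [div_le_iff₀ hp.2] at hN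
      nlinarith [hp.2]
  rw [integral_zero] at hf0
  rw [Metric.tendsto_atTop]
  intro δ hδ
  obtain ⟨m, hm⟩ := (hf0.eventually_lt_const (half_pos hδ)).exists
  have h1 : Tendsto (fun n : ℕ => ∫ w, f m (topPair (σ (r n)) (Finset.Icc 1 (r n : ℤ))
      (trajectory ξ w)) ∂P) atTop (𝓝 (∫ p, f m p ∂H)) :=
    (h.tendsto_integral (unitBCF (f m) (hfc m) fun p => ramp_mem _)).comp hr
  have h2 := h1.eventually_lt_const hm
  set y : ℝ := 1 / (m + 1) with hy
  have hy0 : 0 < y := by positivity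
  have h3 := (h.tendsto_measureReal_max_gt hξ hr hl hlr hmix hy0).eventually_lt_const (half_pos hδ)
  have h4 : ∀ᶠ n in atTop, 2 ≤ r n - l n := by
    filter_upwards [hlr.eventually_lt_const (show (0 : ℝ) < 1 / 2 by norm_num),
      hr.eventually_ge_atTop 4] with n h1 h2
    have h3' : (0 : ℝ) < r n := by exact_mod_cast (show 0 < r n by omega)
    rw [div_lt_div_iff₀ h3' (by positivity), one_mul] at h1
    have : l n * 2 < r n := by exact_mod_cast h1
    omega
  obtain ⟨N, hN⟩ := eventually_atTop.1 ((h2.and h3).and (h4.and (hl.eventually_ge_atTop 1)))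
  refine ⟨N, fun n hn => ?_⟩
  obtain ⟨⟨g1, g2⟩, g3, g4⟩ := hN n hn
  have hσ := h.sigma_pos (r n) (by omega)
  rw [Real.dist_eq, sub_zero, abs_of_nonneg measureReal_nonneg]
  set A : Set Ω := {w | orderStat (trajectory ξ w) (Finset.Icc 1 (r n : ℤ)) 2 ≤ y * σ (r n)}
  have hA : MeasurableSet A :=
    measurableSet_le (measurable_trajectory_orderStat hξ _ (by norm_num)) measurable_const
  set Bm : Set (ℤ → ℝ) := {x | y * σ (r n) < orderStat x (Finset.Icc 1 (l n : ℤ)) 1}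
  have hBm : MeasurableSet Bm := coordSigma_le univ _
    (measurableSet_lt measurable_const (measurable_orderStat (subset_univ _) le_rfl))
  -- If the second largest value exceeds y σ_r while the last l observations do not, those
  -- observations cannot affect either order statistic.
  have hsub : {w | ∃ j ∈ Icc 1 2, orderStat (trajectory ξ w) (Finset.Icc 1 (r n : ℤ)) j
      ≠ orderStat (trajectory ξ w) (Finset.Icc 1 ((r n - l n : ℕ) : ℤ)) j}
      ⊆ A ∪ trajectory ξ ⁻¹' (timeShift ((r n - l n : ℕ) : ℤ) ⁻¹' Bm) := by
    rintro w ⟨j, hj, hne⟩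
    by_contra hw
    simp only [mem_union, not_or] at hw
    obtain ⟨hw1, hw2⟩ := hw
    refine hne (orderStat_eq_of_subset (a := y * σ (r n)) ?_ (by simpa using g3) ?_
      (not_le.1 hw1) hj.1 hj.2)
    · exact Finset.Icc_subset_Icc_right (by push_cast [show l n ≤ r n by omega]; omega)
    · intro t ht1 ht2
      have hw3 : orderStat (timeShift ((r n - l n : ℕ) : ℤ) (trajectory ξ w)) (Finset.Icc 1 (l n : ℤ)) 1
        ≤ y * σ (r n) := not_lt.1 hw2
      rw [orderStat_one_le_iff (by simpa using g4)] at hw3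
      have := hw3 (t - ((r n - l n : ℕ) : ℤ)) (by
        simp only [Finset.mem_Icc, not_and, not_le] at ht1 ht2 ⊢
        have := ht2 ht1.1
        push_cast [show l n ≤ r n by omega] at *
        omega)
      simpa [timeShift] using this
  have hAle : P.real A < δ / 2 := by
    refine lt_of_le_of_lt ?_ g1
    rw [← integral_indicator_one hA]
    refine integral_mono_of_nonneg (ae_of_all _ fun w => indicator_nonneg (by simp) _)
      (Integrable.of_bound (C := 1) ?_ (ae_of_all _ fun w => ?_)) (ae_of_all _ fun w => ?_)
    · refine ((hfc m).measurable.comp (Measurable.prodMk ?_ ?_)).aestronglyMeasurable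
      · exact (measurable_trajectory_orderStat hξ _ (by norm_num)).div_const _
      · exact (measurable_trajectory_orderStat hξ _ (by norm_num)).div_const _
    · rw [Real.norm_eq_abs]
      change |ramp _| ≤ 1
      rw [abs_of_nonneg (ramp_mem _).1]; exact (ramp_mem _).2
    · by_cases hw : w ∈ A
      · rw [indicator_of_mem hw]
        refine (ramp_of_nonpos ?_).ge
        have : orderStat (trajectory ξ w) (Finset.Icc 1 (r n : ℤ)) 2 / σ (r n) ≤ y := by
          rw [div_le_iff₀ hσ]; exact hw
        simp only [topPair]
        have h5 : y * (m + 1) = 1 := by rw [hy]; field_simp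
        nlinarith
      · rw [indicator_of_notMem hw]; exact (ramp_mem _).1
  calc _ ≤ P.real (A ∪ trajectory ξ ⁻¹' (timeShift ((r n - l n : ℕ) : ℤ) ⁻¹' Bm)) :=
        measureReal_mono hsub
    _ ≤ P.real A + P.real (trajectory ξ ⁻¹' (timeShift ((r n - l n : ℕ) : ℤ) ⁻¹' Bm)) :=
        measureReal_union_le _ _
    _ < δ := by
        rw [h.isStationarySeries.measureReal_preimage hξ _ hBm]
        have : P.real (trajectory ξ ⁻¹' Bm) < δ / 2 := g2
        linarith

end Attraction

/-! ### Truncation of functions of polynomial growth in an envelope -/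

section Envelope

/-- The envelope `1 + |log x| + |log y| + y^{-a}`. -/
def envelope (a : ℝ) (p : ℝ × ℝ) : ℝ := 1 + |Real.log p.1| + |Real.log p.2| + p.2 ^ (-a)

/-- Truncation of a real number to `[e^{-m}, e^m]`. -/
def expClamp (m : ℕ) (u : ℝ) : ℝ := max (Real.exp (-m)) (min (Real.exp m) u)

/-- Coordinatewise truncation to `[e^{-m}, e^m]`. -/
def clampPt (m : ℕ) (p : ℝ × ℝ) : ℝ × ℝ := (expClamp m p.1, expClamp m p.2)

/-- Functions on the positive quadrant, bounded by a power of the envelope. -/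
structure EnvelopeBounded (a q : ℝ) (g : ℝ × ℝ → ℝ) : Prop where
  measurable : Measurable g
  continuousOn : ContinuousOn g (Ioi 0 ×ˢ Ioi 0)
  bound : ∃ K, 0 ≤ K ∧ ∀ p : ℝ × ℝ, 0 < p.1 → 0 < p.2 → |g p| ≤ K * envelope a p ^ q

lemma one_le_envelope {a : ℝ} {p : ℝ × ℝ} (hp : 0 < p.2) : 1 ≤ envelope a p := by
  have := abs_nonneg (Real.log p.1)
  have := abs_nonneg (Real.log p.2)
  have := Real.rpow_pos_of_pos hp (-a)
  unfold envelope; linarith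

lemma measurable_envelope (a : ℝ) : Measurable (envelope a) := by
  unfold envelope; fun_prop

lemma continuous_expClamp (m : ℕ) : Continuous (expClamp m) := by unfold expClamp; fun_prop

lemma continuous_clampPt (m : ℕ) : Continuous (clampPt m) :=
  ((continuous_expClamp m).comp continuous_fst).prodMk ((continuous_expClamp m).comp continuous_snd)

lemma exp_neg_le_expClamp (m : ℕ) (u : ℝ) : Real.exp (-m) ≤ expClamp m u := le_max_left _ _

lemma expClamp_le_exp (m : ℕ) (u : ℝ) : expClamp m u ≤ Real.exp m :=
  max_le (Real.exp_le_exp.2 (by have : (0 : ℝ) ≤ m := m.cast_nonneg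
                                linarith)) (min_le_left _ _)

lemma expClamp_pos (m : ℕ) (u : ℝ) : 0 < expClamp m u :=
  (Real.exp_pos _).trans_le (exp_neg_le_expClamp m u)

lemma abs_log_expClamp_le_cast (m : ℕ) (u : ℝ) : |Real.log (expClamp m u)| ≤ m := by
  rw [abs_le]
  constructor
  · rw [Real.le_log_iff_exp_le (expClamp_pos m u)]; exact exp_neg_le_expClamp m u
  · rw [Real.log_le_iff_le_exp (expClamp_pos m u)]; exact expClamp_le_exp m u

lemma expClamp_eq_self {m : ℕ} {u : ℝ} (hu : 0 < u) (h : |Real.log u| ≤ m) : expClamp m u = u := by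
  rw [abs_le, Real.le_log_iff_exp_le hu, Real.log_le_iff_le_exp hu] at h
  rw [expClamp, min_eq_right h.2, max_eq_right h.1]

lemma abs_log_expClamp_le {m : ℕ} {u : ℝ} (hu : 0 < u) :
    |Real.log (expClamp m u)| ≤ |Real.log u| := by
  by_cases h : |Real.log u| ≤ m
  · rw [expClamp_eq_self hu h]
  · exact (abs_log_expClamp_le_cast m u).trans (not_le.1 h).le

lemma expClamp_rpow_neg_le {a : ℝ} (ha : 0 ≤ a) {m : ℕ} {u : ℝ} (hu : 0 < u) :
    expClamp m u ^ (-a) ≤ u ^ (-a) + 1 := by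
  have h1 : min 1 u ≤ expClamp m u := by
    refine le_max_of_le_right (min_le_min_right _ ?_)
    exact Real.one_le_exp (Nat.cast_nonneg m)
  have h2 : expClamp m u ^ (-a) ≤ (min 1 u) ^ (-a) :=
    Real.rpow_le_rpow_of_nonpos (lt_min one_pos hu) h1 (by linarith)
  refine h2.trans ?_
  have := Real.rpow_pos_of_pos hu (-a)
  rcases min_choice 1 u with h | h <;> rw [h]
  · rw [Real.one_rpow]; linarith
  · linarith

lemma envelope_clampPt_le {a : ℝ} (ha : 0 ≤ a) (m : ℕ) {p : ℝ × ℝ} (h1 : 0 < p.1) (h2 : 0 < p.2) :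
    envelope a (clampPt m p) ≤ 2 * envelope a p := by
  have e1 := abs_log_expClamp_le (m := m) h1
  have e2 := abs_log_expClamp_le (m := m) h2
  have e3 := expClamp_rpow_neg_le ha (m := m) h2
  have e4 := one_le_envelope (a := a) h2
  unfold envelope clampPt at *
  simp only at *
  linarith

lemma envelope_clampPt_le_const {a : ℝ} (ha : 0 ≤ a) (m : ℕ) (p : ℝ × ℝ) :
    envelope a (clampPt m p) ≤ 1 + m + m + Real.exp (m * a) := by
  have e1 := abs_log_expClamp_le_cast m p.1
  have e2 := abs_log_expClamp_le_cast m p.2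
  have e3 : expClamp m p.2 ^ (-a) ≤ Real.exp (m * a) := by
    refine (Real.rpow_le_rpow_of_nonpos (Real.exp_pos _) (exp_neg_le_expClamp m p.2)
      (by linarith)).trans_eq ?_
    rw [← Real.exp_mul]; ring_nf
  unfold envelope clampPt
  simp only
  linarith

/-- The reason for truncating at e^{-m} and e^m: truncation alters a point only where the envelope
exceeds m, so its error is controlled by moments of the envelope. -/
lemma clampPt_eq_self {a : ℝ} {m : ℕ} {p : ℝ × ℝ} (h1 : 0 < p.1) (h2 : 0 < p.2)
    (h : envelope a p ≤ m) : clampPt m p = p := by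
  have e1 := abs_nonneg (Real.log p.1)
  have e2 := abs_nonneg (Real.log p.2)
  have e3 := Real.rpow_pos_of_pos h2 (-a)
  unfold envelope at h
  ext
  · exact expClamp_eq_self h1 (by linarith)
  · exact expClamp_eq_self h2 (by linarith)

lemma EnvelopeBounded.continuous_comp_clampPt {a q : ℝ} {g : ℝ × ℝ → ℝ} (hg : EnvelopeBounded a q g)
    (m : ℕ) : Continuous (fun p => g (clampPt m p)) := by
  rw [← continuousOn_univ]
  exact hg.continuousOn.comp (continuous_clampPt m).continuousOn
    fun p _ => ⟨expClamp_pos m p.1, expClamp_pos m p.2⟩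

lemma EnvelopeBounded.exists_bound_comp_clampPt {a q : ℝ} (ha : 0 ≤ a) (hq : 0 ≤ q) {g : ℝ × ℝ → ℝ}
    (hg : EnvelopeBounded a q g) (m : ℕ) : ∃ C, ∀ p, |g (clampPt m p)| ≤ C := by
  obtain ⟨K, hK, hb⟩ := hg.bound
  refine ⟨K * (1 + m + m + Real.exp (m * a)) ^ q, fun p => ?_⟩
  refine (hb _ (expClamp_pos m p.1) (expClamp_pos m p.2)).trans ?_
  have := one_le_envelope (a := a) (p := clampPt m p) (expClamp_pos m p.2)
  gcongr
  exact envelope_clampPt_le_const ha m p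

/-- The truncation error, bounded by a small multiple of the `p`-th power of the envelope. -/
lemma EnvelopeBounded.exists_sq_sub_le {a q s : ℝ} (ha : 0 ≤ a) (hq : 0 ≤ q) (hqs : 2 * q < s)
    {g : ℝ × ℝ → ℝ} (hg : EnvelopeBounded a q g) :
    ∃ K, 0 ≤ K ∧ ∀ m : ℕ, 1 ≤ m → ∀ p : ℝ × ℝ, 0 < p.1 → 0 < p.2 →
      (g p - g (clampPt m p)) ^ 2 ≤ K * (m : ℝ) ^ (-(s - 2 * q)) * envelope a p ^ s := by
  obtain ⟨K, hK, hb⟩ := hg.bound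
  refine ⟨(K * (1 + 2 ^ q)) ^ 2, by positivity, fun m hm p h1 h2 => ?_⟩
  have hD := one_le_envelope (a := a) h2
  set D := envelope a p with hDdef
  have hm0 : (0 : ℝ) < m := by exact_mod_cast hm
  by_cases hle : D ≤ m
  · rw [clampPt_eq_self h1 h2 hle, sub_self, zero_pow two_ne_zero]
    positivity
  · have e1 : |g p - g (clampPt m p)| ≤ K * (1 + 2 ^ q) * D ^ q := by
      refine (abs_sub _ _).trans ?_
      have e2 := hb p h1 h2
      have e3 := hb (clampPt m p) (expClamp_pos m p.1) (expClamp_pos m p.2)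
      have e4 : envelope a (clampPt m p) ^ q ≤ 2 ^ q * D ^ q := by
        rw [← Real.mul_rpow (by norm_num) (by linarith)]
        have := one_le_envelope (a := a) (p := clampPt m p) (expClamp_pos m p.2)
        gcongr
        exact envelope_clampPt_le ha m h1 h2
      have e5 : K * envelope a (clampPt m p) ^ q ≤ K * (2 ^ q * D ^ q) := by gcongr
      nlinarith
    have e2 : (g p - g (clampPt m p)) ^ 2 ≤ (K * (1 + 2 ^ q)) ^ 2 * D ^ (2 * q) := by
      rw [← sq_abs, mul_comm 2 q, Real.rpow_mul (by linarith), Real.rpow_ofNat, ← mul_pow]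
      exact pow_le_pow_left₀ (abs_nonneg _) e1 2
    refine e2.trans ?_
    rw [mul_assoc]
    gcongr
    -- The Markov trick: the spare exponent s - 2q is paid for by D > m and produces the factor that
    -- decays in m.
    have e3 : (D : ℝ) ^ (-(s - 2 * q)) ≤ (m : ℝ) ^ (-(s - 2 * q)) :=
      Real.rpow_le_rpow_of_nonpos hm0 (not_le.1 hle).le (by linarith)
    calc D ^ (2 * q) = D ^ (-(s - 2 * q)) * D ^ s := by
          rw [← Real.rpow_add (by linarith)]; congr 1; ring
      _ ≤ _ := by gcongr

/-- Admits the power of the envelope itself as a test function, for the Fatou argument that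
transfers its moment to the limit law. The absolute value keeps it nonnegative off the quadrant. -/
lemma envelopeBounded_envelope (a : ℝ) {q : ℝ} (hq : 0 ≤ q) :
    EnvelopeBounded a q (fun p => |envelope a p| ^ q) where
  measurable := (measurable_envelope a).abs.pow_const q
  continuousOn := by
    have h1 : ContinuousOn (envelope a) (Ioi 0 ×ˢ Ioi 0) := by
      unfold envelope
      refine ContinuousOn.add (ContinuousOn.add (continuousOn_const.add ?_) ?_) ?_
      · exact (continuousOn_fst.log fun p hp => (show 0 < p.1 from hp.1).ne').abs
      · exact (continuousOn_snd.log fun p hp => (show 0 < p.2 from hp.2).ne').abs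
      · exact continuousOn_snd.rpow_const fun p hp => Or.inl (show 0 < p.2 from hp.2).ne'
    exact h1.abs.rpow_const fun p hp => Or.inr hq
  bound := ⟨1, zero_le_one, fun p h1 h2 => by
    have := one_le_envelope (a := a) h2
    rw [one_mul, abs_of_nonneg (by positivity), abs_of_nonneg (by linarith)]⟩

end Envelope

/-! ### Uniform moments of the envelope from the integrability condition. -/

section Moments

variable {Ω : Type*} [MeasurableSpace Ω] {P : Measure Ω} [IsProbabilityMeasure P]
  {ξ : ℤ → Ω → ℝ} {ρ : ℝ → ℝ} {α₀ : ℝ} {σ : ℕ → ℝ}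

/-- Since y ≤ x, both logarithms lie between log y ≥ -y^(-a)/a and the positive part of log x. Hence
the right tail of the maximum and the left tail of the second largest value control the whole
envelope. The factor κ absorbs a change of truncation level. -/
lemma envelope_le_of_le {a x y x1 y1 κ : ℝ} (ha : 0 < a) (hy : 0 < y) (hyx : y ≤ x) (hκ : 1 ≤ κ)
    (hx1 : x ≤ κ * x1) (hx10 : 0 < x1) (hy10 : 0 < y1) (hy1 : κ⁻¹ * y1 ≤ y) :
    envelope a (x, y) ≤ (1 + 2 * (Real.log κ + 1) + (2 / a + 1) * κ ^ a) *
      (1 + (Ioi (Real.exp 1)).indicator Real.log x1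
        + (Iic (Real.exp 1)).indicator (fun x => x ^ (-a)) y1) := by
  have hx : 0 < x := hy.trans_le hyx
  set A := max (Real.log x) 0 with hA
  set B := y ^ (-a) with hB
  have hB0 : 0 < B := Real.rpow_pos_of_pos hy _
  have hA0 : 0 ≤ A := le_max_right _ _
  set L := (Ioi (Real.exp 1)).indicator Real.log x1 with hL
  set N := (Iic (Real.exp 1)).indicator (fun x => x ^ (-a)) y1 with hN
  have hL0 : 0 ≤ L := by
    rw [hL]; refine indicator_nonneg (fun z hz => ?_) _
    exact Real.log_nonneg (le_trans (Real.one_le_exp zero_le_one) (mem_Ioi.1 hz).le)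
  have hN0 : 0 ≤ N := by
    rw [hN, indicator]; split_ifs
    · positivity
    · exact le_rfl
  have hlogκ : 0 ≤ Real.log κ := Real.log_nonneg hκ
  have hneg : -Real.log y ≤ B / a := by
    rw [le_div_iff₀ ha]
    have := Real.log_le_sub_one_of_pos hB0
    rw [hB, Real.log_rpow hy] at this
    nlinarith
  have hBa : 0 ≤ B / a := by positivity
  have hlogyx : Real.log y ≤ Real.log x := Real.log_le_log hy hyx
  have hxA : Real.log x ≤ A := le_max_left _ _
  have h1 : |Real.log x| ≤ A + B / a := by rw [abs_le]; constructor <;> linarith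
  have h2 : |Real.log y| ≤ A + B / a := by rw [abs_le]; constructor <;> linarith
  have hA1 : A ≤ Real.log κ + 1 + L := by
    refine max_le ?_ (by linarith)
    have : Real.log x ≤ Real.log κ + Real.log x1 := by
      rw [← Real.log_mul (by positivity) hx10.ne']
      exact Real.log_le_log hx hx1
    have h3 : Real.log x1 ≤ 1 + L := by
      by_cases h : x1 ∈ Ioi (Real.exp 1)
      · rw [hL, indicator_of_mem h]; linarith
      · rw [hL, indicator_of_notMem h, add_zero, Real.log_le_iff_le_exp hx10]
        exact not_lt.1 h
    linarith
  have hκ0 : 0 < κ := by linarith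
  have hB1 : B ≤ κ ^ a * (1 + N) := by
    have h3 : B ≤ (κ⁻¹ * y1) ^ (-a) :=
      Real.rpow_le_rpow_of_nonpos (by positivity) hy1 (by linarith)
    rw [Real.mul_rpow (by positivity) hy10.le, Real.inv_rpow hκ0.le, Real.rpow_neg hκ0.le, inv_inv] at h3
    refine h3.trans ?_
    gcongr
    by_cases h : y1 ∈ Iic (Real.exp 1)
    · rw [hN, indicator_of_mem h]; linarith
    · rw [hN, indicator_of_notMem h, add_zero]
      refine Real.rpow_le_one_of_one_le_of_nonpos ?_ (by linarith)
      exact le_trans (Real.one_le_exp zero_le_one) (not_le.1 h).le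
  have hκa : 0 < κ ^ a := Real.rpow_pos_of_pos hκ0 _
  have hE : envelope a (x, y) ≤ 1 + 2 * A + (2 / a + 1) * B := by
    have : (2 / a + 1) * B = 2 * (B / a) + B := by ring
    unfold envelope; simp only; rw [this]; linarith
  have hB2 : (2 / a + 1) * B ≤ (2 / a + 1) * (κ ^ a * (1 + N)) := by gcongr
  have hc0 : 0 ≤ (2 / a + 1) * κ ^ a := by positivity
  refine hE.trans ?_
  nlinarith [mul_nonneg hlogκ hL0, mul_nonneg hlogκ hN0, mul_nonneg hc0 hL0, mul_nonneg hc0 hN0]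

lemma one_add_add_rpow_le {s u v : ℝ} (hs : 0 ≤ s) (hu : 0 ≤ u) (hv : 0 ≤ v) :
    (1 + u + v) ^ s ≤ 3 ^ s * (1 + u ^ s + v ^ s) := by
  have h1 : 1 + u + v ≤ 3 * max 1 (max u v) := by
    have := le_max_left 1 (max u v)
    have := (le_max_left u v).trans (le_max_right 1 (max u v))
    have := (le_max_right u v).trans (le_max_right 1 (max u v))
    linarith
  have hu' := Real.rpow_nonneg hu s
  have hv' := Real.rpow_nonneg hv s
  calc (1 + u + v) ^ s ≤ (3 * max 1 (max u v)) ^ s := by gcongr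
    _ = 3 ^ s * (max 1 (max u v)) ^ s := Real.mul_rpow (by norm_num) (by positivity)
    _ ≤ _ := by
      gcongr
      rcases max_choice 1 (max u v) with h | h <;> rw [h]
      · rw [Real.one_rpow]; linarith
      · rcases max_choice u v with h | h <;> rw [h] <;> linarith

lemma IntegrabilityCondition.exists_moment_bound {a ω : ℝ}
    (h : IntegrabilityCondition P ξ σ a ω) (hω : 0 < ω) (ha : 0 < a) (hσ : ∀ m, 1 ≤ m → 0 < σ m)
    (hξ : ∀ t, Measurable (ξ t)) {c : ℝ} (hc : 0 < c) :
    ∃ s C : ℝ, 2 < s ∧ ∀ᶠ m : ℕ in atTop,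
      Integrable (fun w => envelope a (topTwo c (σ m) (Finset.Icc 1 (m : ℤ)) (trajectory ξ w)) ^ s) P ∧
      ∫ w, envelope a (topTwo c (σ m) (Finset.Icc 1 (m : ℤ)) (trajectory ξ w)) ^ s ∂P ≤ C := by
  obtain ⟨ν, hν, hM, hS⟩ := h
  have hν0 : 0 < ν := lt_trans (by positivity) hν
  have hs0 : 0 ≤ 2 + ν := by linarith
  obtain ⟨b1, hb1, hb1'⟩ := exists_between hM
  obtain ⟨b2, hb2, hb2'⟩ := exists_between hS
  -- With this κ, max(u, c) ≤ κ max(u, 1) and κ⁻¹ max(u, 1) ≤ max(u, c) for every real u. This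
  -- passes from truncation at 1, as in the condition, to truncation at c.
  set κ : ℝ := max (max c c⁻¹) 1 with hκ
  set K : ℝ := 1 + 2 * (Real.log κ + 1) + (2 / a + 1) * κ ^ a with hK
  have hκ1 : 1 ≤ κ := le_max_right _ _
  have hκ0 : 0 < κ := by linarith
  have hcκ : c ≤ κ := (le_max_left _ _).trans (le_max_left _ _)
  have hcκ' : κ⁻¹ ≤ c := inv_le_of_inv_le₀ hc ((le_max_right _ _).trans (le_max_left _ _))
  have hK0 : 0 ≤ K := by
    have := Real.log_nonneg hκ1
    positivity
  set bd : ℝ≥0∞ := ENNReal.ofReal (K ^ (2 + ν) * 3 ^ (2 + ν)) * (1 + b1 + b2) with hbd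
  have hbdt : bd < ∞ := ENNReal.mul_lt_top ENNReal.ofReal_lt_top
    (ENNReal.add_lt_top.2 ⟨ENNReal.add_lt_top.2 ⟨ENNReal.one_lt_top, hb1'⟩, hb2'⟩)
  refine ⟨2 + ν, bd.toReal, by linarith, ?_⟩
  -- Blocks of length at least 2 are required: otherwise the second order statistic is the default
  -- value 0 and may exceed the maximum.
  filter_upwards [eventually_lt_of_limsup_lt hb1, eventually_lt_of_limsup_lt hb2,
    eventually_ge_atTop 2] with m h1 h2 h3
  have hσm := hσ m (by omega)
  set x1 : Ω → ℝ := fun w => max (blockMax ξ m 0 w) 1 / σ m with hx1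
  set y1 : Ω → ℝ := fun w => max (blockSnd ξ m 0 w) 1 / σ m with hy1
  set L : Ω → ℝ := fun w => (Ioi (Real.exp 1)).indicator Real.log (x1 w) with hL
  set N : Ω → ℝ := fun w => (Iic (Real.exp 1)).indicator (fun x => x ^ (-a)) (y1 w) with hN
  set E : Ω → ℝ := fun w => envelope a (topTwo c (σ m) (Finset.Icc 1 (m : ℤ)) (trajectory ξ w)) with hE
  have hx10 : ∀ w, 0 < x1 w := fun w => div_pos (lt_max_of_lt_right one_pos) hσm
  have hy10 : ∀ w, 0 < y1 w := fun w => div_pos (lt_max_of_lt_right one_pos) hσm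
  have hL0 : ∀ w, 0 ≤ L w := fun w => by
    rw [hL]; refine indicator_nonneg (fun z hz => ?_) _
    exact Real.log_nonneg (le_trans (Real.one_le_exp zero_le_one) (mem_Ioi.1 hz).le)
  have hN0 : ∀ w, 0 ≤ N w := fun w => by
    have := hy10 w
    simp only [hN, indicator]; split_ifs
    · positivity
    · exact le_rfl
  have hmeas : ∀ j, 1 ≤ j → Measurable fun w => orderStat (trajectory ξ w) (Finset.Icc 1 (m : ℤ)) j :=
    fun j hj => measurable_trajectory_orderStat hξ _ hj
  have hmaxmul : ∀ u : ℝ, max u c ≤ κ * max u 1 := by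
    intro u
    refine max_le ?_ ?_
    · rcases le_total u 0 with hu | hu
      · exact hu.trans (by positivity)
      · nlinarith [le_max_left u 1]
    · nlinarith [le_max_right u 1]
  have hmaxmul' : ∀ u : ℝ, κ⁻¹ * max u 1 ≤ max u c := by
    intro u
    have hi : κ⁻¹ ≤ 1 := inv_le_one_of_one_le₀ hκ1
    have hi0 : 0 < κ⁻¹ := inv_pos.2 hκ0
    rcases le_total u 1 with hu | hu
    · rw [max_eq_right hu, mul_one]; exact hcκ'.trans (le_max_right _ _)
    · rw [max_eq_left hu]
      exact le_trans (by nlinarith) (le_max_left u c)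
  have hEpt : ∀ w, E w ≤ K * (1 + L w + N w) := by
    intro w
    have hI : 2 ≤ (Finset.Icc 1 (m : ℤ)).card := by simpa using h3
    refine envelope_le_of_le ha ?_ ?_ hκ1 ?_ (hx10 w) (hy10 w) ?_
    · exact div_pos (lt_max_of_lt_right hc) hσm
    · gcongr; exact orderStat_two_le_one hI
    · simp only [hx1, blockMax_zero, ← mul_div_assoc]
      gcongr; exact hmaxmul _
    · simp only [hy1, blockSnd_zero, ← mul_div_assoc]
      gcongr; exact hmaxmul' _
  have hE1 : ∀ w, 1 ≤ E w := fun w => one_le_envelope (div_pos (lt_max_of_lt_right hc) hσm)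
  have hEm : Measurable fun w => E w ^ (2 + ν) :=
    ((measurable_envelope a).comp (((hmeas 1 le_rfl).max measurable_const).div_const _ |>.prodMk
      (((hmeas 2 (by norm_num)).max measurable_const).div_const _))).pow_const _
  have hEs : ∀ w, E w ^ (2 + ν) ≤ K ^ (2 + ν) * 3 ^ (2 + ν) * (1 + L w ^ (2 + ν) + N w ^ (2 + ν)) := by
    intro w
    have e1 := hE1 w
    have e2 := hL0 w
    have e3 := hN0 w
    calc E w ^ (2 + ν) ≤ (K * (1 + L w + N w)) ^ (2 + ν) := by gcongr; exact hEpt w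
      _ = K ^ (2 + ν) * (1 + L w + N w) ^ (2 + ν) := Real.mul_rpow hK0 (by positivity)
      _ ≤ K ^ (2 + ν) * (3 ^ (2 + ν) * (1 + L w ^ (2 + ν) + N w ^ (2 + ν))) := by
          gcongr; exact one_add_add_rpow_le hs0 e2 e3
      _ = _ := by ring
  have hx1m : Measurable x1 := by
    simp only [hx1, blockMax_zero]; exact ((hmeas 1 le_rfl).max measurable_const).div_const _
  have hy1m : Measurable y1 := by
    simp only [hy1, blockSnd_zero]; exact ((hmeas 2 (by norm_num)).max measurable_const).div_const _
  have hLm : Measurable L := (Real.measurable_log.indicator measurableSet_Ioi).comp hx1m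
  have hNm : Measurable N :=
    ((measurable_id.pow_const (-a)).indicator measurableSet_Iic).comp hy1m
  have hlint : ∫⁻ w, ENNReal.ofReal (E w ^ (2 + ν)) ∂P ≤ bd := by
    calc ∫⁻ w, ENNReal.ofReal (E w ^ (2 + ν)) ∂P
        ≤ ∫⁻ w, ENNReal.ofReal (K ^ (2 + ν) * 3 ^ (2 + ν)) * (1 + ENNReal.ofReal (L w ^ (2 + ν))
            + ENNReal.ofReal (N w ^ (2 + ν))) ∂P := by
          refine lintegral_mono fun w => ?_
          have e2 := hL0 w
          have e3 := hN0 w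
          rw [← ENNReal.ofReal_one, ← ENNReal.ofReal_add (by positivity) (by positivity),
            ← ENNReal.ofReal_add (by positivity) (by positivity), ← ENNReal.ofReal_mul (by positivity)]
          exact ENNReal.ofReal_le_ofReal (hEs w)
      _ = ENNReal.ofReal (K ^ (2 + ν) * 3 ^ (2 + ν)) * (1 + ∫⁻ w, ENNReal.ofReal (L w ^ (2 + ν)) ∂P
            + ∫⁻ w, ENNReal.ofReal (N w ^ (2 + ν)) ∂P) := by
          rw [lintegral_const_mul, lintegral_add_right, lintegral_add_right, lintegral_one, measure_univ]
          all_goals fun_prop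
      _ ≤ bd := by
          rw [hbd]
          gcongr
  have hnn : 0 ≤ᵐ[P] fun w => E w ^ (2 + ν) := ae_of_all _ fun w =>
    Real.rpow_nonneg (by linarith [hE1 w]) _
  refine ⟨⟨hEm.aestronglyMeasurable, ?_⟩, ?_⟩
  · rw [hasFiniteIntegral_iff_ofReal hnn]
    exact hlint.trans_lt hbdt
  · rw [integral_eq_lintegral_of_nonneg_ae hnn hEm.aestronglyMeasurable]
    exact ENNReal.toReal_mono hbdt.ne hlint

end Moments

/-! ### Limit theorems for averages over blocks -/

/-! ### Convergence in probability as convergence along a filter. -/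

section ProbFilter

variable {Ω : Type*} [MeasurableSpace Ω]

/-- The filter of the sets `A ⊆ ℕ × Ω` whose `n`-th sections have probability tending to one. -/
def probFilter (P : Measure Ω) : Filter (ℕ × Ω) where
  sets := {A | Tendsto (fun n => P {w | (n, w) ∉ A}) atTop (𝓝 0)}
  univ_sets := by simp
  sets_of_superset := by
    intro A B hA hAB
    exact tendsto_of_tendsto_of_tendsto_of_le_of_le tendsto_const_nhds hA (fun _ => zero_le)
      fun n => measure_mono fun w hw hwA => hw (hAB hwA)
  inter_sets := by
    intro A B hA hB
    refine tendsto_of_tendsto_of_tendsto_of_le_of_le tendsto_const_nhds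
      (by simpa using hA.add hB) (fun _ => zero_le) fun n => ?_
    refine (measure_mono ?_).trans (measure_union_le _ _)
    intro w hw
    simp only [mem_inter_iff, not_and_or, mem_ofPred_eq, mem_union] at hw ⊢
    exact hw

/-- Along this filter, limits and `=o` express convergence in probability, so the deterministic
calculus of limits and asymptotic relations can be used for random sequences. -/
lemma eventually_probFilter {P : Measure Ω} {p : ℕ × Ω → Prop} :
    (∀ᶠ q in probFilter P, p q) ↔ Tendsto (fun n => P {w | ¬ p (n, w)}) atTop (𝓝 0) := Iff.rfl

lemma tendsto_fst_probFilter (P : Measure Ω) :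
    Tendsto Prod.fst (probFilter P) atTop := by
  rw [tendsto_atTop]
  intro N
  rw [eventually_probFilter]
  refine tendsto_const_nhds.congr' ?_
  filter_upwards [eventually_ge_atTop N] with n hn
  simp [hn]

lemma tendsto_probFilter_of_measureReal {P : Measure Ω} [IsProbabilityMeasure P] {X : ℕ → Ω → ℝ}
    (h : ∀ ε > 0, Tendsto (fun n => P.real {w | ε < |X n w|}) atTop (𝓝 0)) :
    Tendsto (fun q : ℕ × Ω => X q.1 q.2) (probFilter P) (𝓝 0) := by
  rw [Metric.tendsto_nhds]
  intro ε hε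
  rw [eventually_probFilter]
  have h1 := h (ε / 2) (half_pos hε)
  rw [← ENNReal.tendsto_toReal_iff (fun n => measure_ne_top _ _) (by simp), ENNReal.toReal_zero]
  refine squeeze_zero (fun n => ENNReal.toReal_nonneg) (fun n => ?_) h1
  refine measureReal_mono fun w hw => ?_
  simp only [mem_ofPred_eq, dist_zero_right, Real.norm_eq_abs, not_lt] at hw ⊢
  linarith

end ProbFilter

/-! ### Limit theorems for averages of functions bounded by the envelope. -/

section Setting

variable {Ω : Type*} [MeasurableSpace Ω] {P : Measure Ω} [IsProbabilityMeasure P]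
  {ξ : ℤ → Ω → ℝ} {ρ : ℝ → ℝ} {α₀ : ℝ} {σ : ℕ → ℝ} {r : ℕ → ℕ} {a c s : ℝ}

/-- The consequences of the assumptions that the limit theorems for block averages rest on. -/
structure BlockSetting (P : Measure Ω) [IsProbabilityMeasure P] (ξ : ℤ → Ω → ℝ) (ρ : ℝ → ℝ)
    (α₀ : ℝ) (σ : ℕ → ℝ) (r : ℕ → ℕ) (a c s : ℝ) : Prop where
  meas : ∀ t, Measurable (ξ t)
  doa : DomainOfAttraction P ξ ρ α₀ σ
  r_tendsto : Tendsto r atTop atTop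
  k_tendsto : Tendsto (fun n => n / r n) atTop atTop
  mix_r : Tendsto (fun n => ((n / r n : ℕ) : ℝ) * alphaMixing P ξ (r n)) atTop (𝓝 0)
  gap : ∃ l : ℕ → ℕ, (∀ n, l n ≤ r n) ∧ Tendsto l atTop atTop ∧
    Tendsto (fun n => (l n : ℝ) / r n) atTop (𝓝 0) ∧
    Tendsto (fun n => ((n / r n : ℕ) : ℝ) * alphaMixing P ξ (l n)) atTop (𝓝 0) ∧
    Tendsto (fun n => (r n : ℝ) / l n * alphaMixing P ξ (l n)) atTop (𝓝 0)
  a_pos : 0 < a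
  c_pos : 0 < c
  two_lt : 2 < s
  moment : ∃ C, ∀ᶠ m : ℕ in atTop,
    Integrable (fun w => envelope a (topTwo c (σ m) (Finset.Icc 1 (m : ℤ)) (trajectory ξ w)) ^ s) P ∧
    ∫ w, envelope a (topTwo c (σ m) (Finset.Icc 1 (m : ℤ)) (trajectory ξ w)) ^ s ∂P ≤ C

lemma abs_integral_le_sqrt {Ω : Type*} [MeasurableSpace Ω] {P : Measure Ω} [IsProbabilityMeasure P]
    {X : Ω → ℝ} (hX : MemLp X 2 P) : |∫ w, X w ∂P| ≤ √(∫ w, X w ^ 2 ∂P) := by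
  refine Real.abs_le_sqrt ?_
  have := variance_nonneg X P
  rw [variance_eq_sub hX] at this
  simp only [Pi.pow_apply] at this
  linarith

lemma tendsto_of_approx {ι : Type*} {l : Filter ι} {u : ι → ℝ} {v : ℕ → ι → ℝ} {L : ℝ} {M e : ℕ → ℝ}
    (huv : ∀ m, ∀ᶠ i in l, |u i - v m i| ≤ e m) (hv : ∀ m, Tendsto (v m) l (𝓝 (M m)))
    (hM : Tendsto M atTop (𝓝 L)) (he : Tendsto e atTop (𝓝 0)) : Tendsto u l (𝓝 L) := by
  rw [Metric.tendsto_nhds]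
  intro ε hε
  obtain ⟨m, h1, h2⟩ := ((he.eventually_lt_const (show 0 < ε / 3 by positivity)).and
    (Metric.tendsto_nhds.1 hM (ε / 3) (by positivity))).exists
  filter_upwards [huv m, Metric.tendsto_nhds.1 (hv m) (ε / 3) (by positivity)] with i h3 h4
  rw [Real.dist_eq] at *
  calc |u i - L| = |(u i - v m i) + (v m i - M m) + (M m - L)| := by congr 1; ring
    _ ≤ |u i - v m i| + |v m i - M m| + |M m - L| := abs_add_three _ _ _
    _ < ε := by linarith

namespace BlockSetting

lemma welsch (S : BlockSetting P ξ ρ α₀ σ r a c s) : HasWelschCDF ρ α₀ 1 (frechetWelsch ρ α₀ 1) :=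
  S.doa.hasWelschCDF

/-- The scaled and truncated pair of the two largest observations of the first block. -/
def _root_.blockPt (σ : ℕ → ℝ) (r : ℕ → ℕ) (c : ℝ) (n : ℕ) (x : ℤ → ℝ) : ℝ × ℝ :=
  topTwo c (σ (r n)) (Finset.Icc 1 (r n : ℤ)) x

lemma sigma_pos (S : BlockSetting P ξ ρ α₀ σ r a c s) : ∀ᶠ n in atTop, 0 < σ (r n) := by
  filter_upwards [S.r_tendsto.eventually_ge_atTop 1] with n hn using S.doa.sigma_pos _ hn

lemma blockPt_pos (S : BlockSetting P ξ ρ α₀ σ r a c s) {n : ℕ} (h : 0 < σ (r n)) (x : ℤ → ℝ) :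
    0 < (blockPt σ r c n x).1 ∧ 0 < (blockPt σ r c n x).2 :=
  ⟨div_pos (lt_max_of_lt_right S.c_pos) h, div_pos (lt_max_of_lt_right S.c_pos) h⟩

lemma measurable_blockPt (σ : ℕ → ℝ) (r : ℕ → ℕ) (c : ℝ) (n : ℕ) :
    Measurable[coordSigma (Icc 1 (r n : ℤ))] (blockPt σ r c n) :=
  measurable_topTwo c _ (by simp)

lemma measurable_blockPt_traj (S : BlockSetting P ξ ρ α₀ σ r a c s) (n : ℕ) :
    Measurable fun w => blockPt σ r c n (trajectory ξ w) :=
  ((measurable_blockPt σ r c n).mono (coordSigma_le _) le_rfl).comp (measurable_trajectory S.meas)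

lemma moment_blockPt (S : BlockSetting P ξ ρ α₀ σ r a c s) : ∃ C, 0 ≤ C ∧ ∀ᶠ n in atTop,
    Integrable (fun w => envelope a (blockPt σ r c n (trajectory ξ w)) ^ s) P ∧
    ∫ w, envelope a (blockPt σ r c n (trajectory ξ w)) ^ s ∂P ≤ C := by
  obtain ⟨C, hC⟩ := S.moment
  refine ⟨max C 0, le_max_right _ _, ?_⟩
  filter_upwards [S.r_tendsto.eventually hC] with n hn
  exact ⟨hn.1, hn.2.trans (le_max_left _ _)⟩

lemma tendsto_integral_clampPt (S : BlockSetting P ξ ρ α₀ σ r a c s) {q : ℝ} (hq : 0 ≤ q)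
    {g : ℝ × ℝ → ℝ} (hg : EnvelopeBounded a q g) (m : ℕ) :
    Tendsto (fun n => ∫ w, g (clampPt m (blockPt σ r c n (trajectory ξ w))) ∂P) atTop
      (𝓝 (∫ p, g (clampPt m p) ∂(frechetWelsch ρ α₀ 1))) := by
  obtain ⟨C, hC⟩ := hg.exists_bound_comp_clampPt S.a_pos.le hq m
  have h1 := (S.doa.tendsto_integral (BoundedContinuousFunction.ofNormedAddCommGroup
    (fun p => g (clampPt m p)) (hg.continuous_comp_clampPt m) C hC)).comp S.r_tendsto
  refine Tendsto.congr' ?_ h1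
  have h2 : Tendsto (fun n => c / σ (r n)) atTop (𝓝 0) :=
    (S.doa.sigma_tendsto.comp S.r_tendsto).const_div_atTop c
  filter_upwards [h2.eventually_lt_const (Real.exp_pos (-(m : ℝ))), S.sigma_pos] with n h3 h4
  -- Once c/σ_r < e^{-m}, the truncation at e^{-m} absorbs the maximum with c. The domain of
  -- attraction condition, which concerns the pair without c, then applies.
  have h5 : ∀ u, expClamp m (max u c / σ (r n)) = expClamp m (u / σ (r n)) := by
    intro u
    rw [← max_div_div_right h4.le, expClamp, expClamp]
    have : c / σ (r n) ≤ Real.exp m := h3.le.trans (Real.exp_le_exp.2 (by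
      have : (0 : ℝ) ≤ m := m.cast_nonneg
      linarith))
    rw [min_max_distrib_left, min_eq_right this, max_comm (min _ _), ← max_assoc, max_eq_left h3.le]
  simp only [Function.comp, BoundedContinuousFunction.coe_ofNormedAddCommGroup, clampPt, blockPt,
    topTwo, topPair, h5]

/-- Truncated powers are bounded and continuous, so their expectations converge and inherit the
uniform moment bound; Fatou's lemma removes the truncation under the limit law. -/
lemma integrable_envelope_welsch (S : BlockSetting P ξ ρ α₀ σ r a c s) :
    Integrable (fun p => envelope a p ^ s) (frechetWelsch ρ α₀ 1) := by
  have hs := S.two_lt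
  have ha := S.a_pos
  obtain ⟨C, hC0, hC⟩ := S.moment_blockPt
  set H := frechetWelsch ρ α₀ 1
  have hg := envelopeBounded_envelope a (q := s) (by linarith)
  have h1 : ∀ m : ℕ, ∫ p, |envelope a (clampPt m p)| ^ s ∂H ≤ 2 ^ s * C := by
    intro m
    refine le_of_tendsto (S.tendsto_integral_clampPt (by linarith) hg m) ?_
    filter_upwards [hC, S.sigma_pos] with n hn hσ
    calc ∫ w, |envelope a (clampPt m (blockPt σ r c n (trajectory ξ w)))| ^ s ∂P
        ≤ ∫ w, 2 ^ s * envelope a (blockPt σ r c n (trajectory ξ w)) ^ s ∂P := by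
          refine integral_mono_of_nonneg (ae_of_all _ fun w => by positivity) (hn.1.const_mul _)
            (ae_of_all _ fun w => ?_)
          have hp := S.blockPt_pos hσ (trajectory ξ w)
          have e1 := one_le_envelope (a := a) hp.2
          have e2 := one_le_envelope (a := a)
            (p := clampPt m (blockPt σ r c n (trajectory ξ w))) (expClamp_pos m _)
          simp only
          rw [← Real.mul_rpow (by norm_num) (by linarith), abs_of_nonneg (by linarith)]
          gcongr
          exact envelope_clampPt_le ha.le m hp.1 hp.2
      _ ≤ 2 ^ s * C := by rw [integral_const_mul]; gcongr; exact hn.2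
  have hF : ∫⁻ p, ENNReal.ofReal (envelope a p ^ s) ∂H ≤ ENNReal.ofReal (2 ^ s * C) := by
    calc ∫⁻ p, ENNReal.ofReal (envelope a p ^ s) ∂H
        = ∫⁻ p, liminf (fun m : ℕ => ENNReal.ofReal (|envelope a (clampPt m p)| ^ s)) atTop ∂H := by
          refine lintegral_congr_ae ?_
          filter_upwards [S.welsch.ae_pos] with p hp
          refine (Tendsto.liminf_eq ?_).symm
          refine tendsto_const_nhds.congr' ?_
          obtain ⟨N, hN⟩ := exists_nat_ge (envelope a p)
          filter_upwards [eventually_ge_atTop N] with m hm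
          have h2 : envelope a p ≤ m := hN.trans (by exact_mod_cast hm)
          rw [clampPt_eq_self hp.1 hp.2 h2, abs_of_nonneg (by
            have := one_le_envelope (a := a) hp.2; linarith)]
      _ ≤ liminf (fun m : ℕ => ∫⁻ p, ENNReal.ofReal (|envelope a (clampPt m p)| ^ s) ∂H) atTop := by
          refine lintegral_liminf_le fun m => ?_
          exact (hg.continuous_comp_clampPt m).measurable.ennreal_ofReal
      _ ≤ ENNReal.ofReal (2 ^ s * C) := by
          refine liminf_le_of_frequently_le' (Eventually.frequently (Eventually.of_forall fun m => ?_))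
          obtain ⟨K, hK⟩ := hg.exists_bound_comp_clampPt ha.le (by linarith) m
          rw [← ofReal_integral_eq_lintegral_ofReal
            (Integrable.of_bound (hg.continuous_comp_clampPt m).aestronglyMeasurable K
              (ae_of_all _ hK)) (ae_of_all _ fun p => by positivity)]
          exact ENNReal.ofReal_le_ofReal (h1 m)
  have hm : Measurable fun p => envelope a p ^ s := (measurable_envelope a).pow_const s
  refine ⟨hm.aestronglyMeasurable, ?_⟩
  rw [hasFiniteIntegral_iff_ofReal]
  · exact hF.trans_lt ENNReal.ofReal_lt_top
  · filter_upwards [S.welsch.ae_pos] with p hp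
    exact Real.rpow_nonneg (by have := one_le_envelope (a := a) hp.2; linarith) _

lemma _root_.EnvelopeBounded.exists_sq_le {q : ℝ} (hqs : 2 * q ≤ s)
    {g : ℝ × ℝ → ℝ} (hg : EnvelopeBounded a q g) :
    ∃ K, 0 ≤ K ∧ ∀ p : ℝ × ℝ, 0 < p.1 → 0 < p.2 → g p ^ 2 ≤ K * envelope a p ^ s := by
  obtain ⟨K, hK, hb⟩ := hg.bound
  refine ⟨K ^ 2, by positivity, fun p h1 h2 => ?_⟩
  have e1 := one_le_envelope (a := a) h2
  calc g p ^ 2 = |g p| ^ 2 := (sq_abs _).symm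
    _ ≤ (K * envelope a p ^ q) ^ 2 := by gcongr; exact hb p h1 h2
    _ = K ^ 2 * envelope a p ^ (2 * q) := by
        rw [mul_pow, mul_comm 2 q, Real.rpow_mul (by linarith), Real.rpow_ofNat]
    _ ≤ K ^ 2 * envelope a p ^ s := by gcongr

lemma memLp_welsch (S : BlockSetting P ξ ρ α₀ σ r a c s) {q : ℝ} (hq : 0 ≤ q) (hqs : 2 * q < s)
    {g : ℝ × ℝ → ℝ} (hg : EnvelopeBounded a q g) : MemLp g 2 (frechetWelsch ρ α₀ 1) := by
  obtain ⟨K, hK, hb⟩ := hg.exists_sq_le hqs.le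
  rw [memLp_two_iff_integrable_sq hg.measurable.aestronglyMeasurable]
  refine (S.integrable_envelope_welsch.const_mul K).mono' (hg.measurable.pow_const 2).aestronglyMeasurable ?_
  filter_upwards [S.welsch.ae_pos] with p hp
  rw [Real.norm_eq_abs, abs_of_nonneg (sq_nonneg _)]
  exact hb p hp.1 hp.2

lemma memLp_blockPt (S : BlockSetting P ξ ρ α₀ σ r a c s) {q : ℝ} (hq : 0 ≤ q) (hqs : 2 * q < s)
    {g : ℝ × ℝ → ℝ} (hg : EnvelopeBounded a q g) : ∃ C, 0 ≤ C ∧ ∀ᶠ n in atTop,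
      MemLp (fun w => g (blockPt σ r c n (trajectory ξ w))) 2 P ∧
      ∫ w, g (blockPt σ r c n (trajectory ξ w)) ^ 2 ∂P ≤ C := by
  obtain ⟨K, hK, hb⟩ := hg.exists_sq_le hqs.le
  obtain ⟨C, hC0, hC⟩ := S.moment_blockPt
  refine ⟨K * C, by positivity, ?_⟩
  filter_upwards [hC, S.sigma_pos] with n hn hσ
  have hm : Measurable fun w => g (blockPt σ r c n (trajectory ξ w)) :=
    hg.measurable.comp (S.measurable_blockPt_traj n)
  have hpt : ∀ w, g (blockPt σ r c n (trajectory ξ w)) ^ 2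
      ≤ K * envelope a (blockPt σ r c n (trajectory ξ w)) ^ s := fun w =>
    hb _ (S.blockPt_pos hσ _).1 (S.blockPt_pos hσ _).2
  constructor
  · rw [memLp_two_iff_integrable_sq hm.aestronglyMeasurable]
    refine (hn.1.const_mul K).mono' (hm.pow_const 2).aestronglyMeasurable (ae_of_all _ fun w => ?_)
    rw [Real.norm_eq_abs, abs_of_nonneg (sq_nonneg _)]
    exact hpt w
  · refine (integral_mono_of_nonneg (ae_of_all _ fun w => sq_nonneg _) (hn.1.const_mul K)
      (ae_of_all _ hpt)).trans ?_
    rw [integral_const_mul]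
    gcongr; exact hn.2

/-- Truncation is uniformly good in `L²`. -/
lemma exists_truncation_bound (S : BlockSetting P ξ ρ α₀ σ r a c s) {q : ℝ} (hq : 0 ≤ q)
    (hqs : 2 * q < s) {g : ℝ × ℝ → ℝ} (hg : EnvelopeBounded a q g) :
    ∃ e : ℕ → ℝ, Tendsto e atTop (𝓝 0) ∧ ∀ m, ∀ᶠ n in atTop,
      ∫ w, (g (blockPt σ r c n (trajectory ξ w))
        - g (clampPt (m + 1) (blockPt σ r c n (trajectory ξ w)))) ^ 2 ∂P ≤ e m := by
  obtain ⟨K, hK, hb⟩ := hg.exists_sq_sub_le S.a_pos.le hq hqs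
  obtain ⟨C, hC0, hC⟩ := S.moment_blockPt
  refine ⟨fun m => K * ((m + 1 : ℕ) : ℝ) ^ (-(s - 2 * q)) * C, ?_, fun m => ?_⟩
  · have h1 := (tendsto_rpow_neg_atTop (show 0 < s - 2 * q by linarith)).comp
      (tendsto_natCast_atTop_atTop.comp (tendsto_add_atTop_nat 1))
    have := (h1.const_mul K).mul_const C
    simpa using this
  · filter_upwards [hC, S.sigma_pos] with n hn hσ
    refine (integral_mono_of_nonneg (ae_of_all _ fun w => sq_nonneg _) (hn.1.const_mul _)
      (ae_of_all _ fun w => hb (m + 1) (by omega) _ (S.blockPt_pos hσ _).1 (S.blockPt_pos hσ _).2)).trans ?_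
    rw [integral_const_mul]
    gcongr
    exact hn.2

lemma memLp_clampPt (S : BlockSetting P ξ ρ α₀ σ r a c s) {q : ℝ} (hq : 0 ≤ q)
    {g : ℝ × ℝ → ℝ} (hg : EnvelopeBounded a q g) (m n : ℕ) :
    MemLp (fun w => g (clampPt m (blockPt σ r c n (trajectory ξ w)))) 2 P := by
  obtain ⟨K, hK⟩ := hg.exists_bound_comp_clampPt S.a_pos.le hq m
  exact MemLp.of_bound ((hg.continuous_comp_clampPt m).measurable.comp
    (S.measurable_blockPt_traj n)).aestronglyMeasurable K (ae_of_all _ fun w => hK _)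

/-- First and second moments are handled together, so that variances of truncated functions can be
assembled from them. A multiple of the s-th power of the envelope dominates. -/
lemma tendsto_integral_pow_clampPt_welsch (S : BlockSetting P ξ ρ α₀ σ r a c s) {q : ℝ} (hq : 0 ≤ q)
    (hqs : 2 * q < s) {g : ℝ × ℝ → ℝ} (hg : EnvelopeBounded a q g) {j : ℕ} (hj : j ≤ 2) :
    Tendsto (fun m : ℕ => ∫ p, g (clampPt m p) ^ j ∂(frechetWelsch ρ α₀ 1)) atTop
      (𝓝 (∫ p, g p ^ j ∂(frechetWelsch ρ α₀ 1))) := by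
  obtain ⟨K, hK, hb⟩ := hg.bound
  refine tendsto_integral_of_dominated_convergence
    (fun p => (1 + (K * 2 ^ q) ^ 2) * envelope a p ^ s)
    (fun m => ((hg.continuous_comp_clampPt m).pow j).aestronglyMeasurable)
    (S.integrable_envelope_welsch.const_mul _) (fun m => ?_) ?_
  · filter_upwards [S.welsch.ae_pos] with p hp
    have e1 := one_le_envelope (a := a) hp.2
    have e2 := one_le_envelope (a := a) (p := clampPt m p) (expClamp_pos m _)
    have e3 : |g (clampPt m p)| ≤ K * 2 ^ q * envelope a p ^ q := by
      refine (hb _ (expClamp_pos m _) (expClamp_pos m _)).trans ?_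
      rw [mul_assoc, ← Real.mul_rpow (by norm_num) (by linarith)]
      gcongr
      exact envelope_clampPt_le S.a_pos.le m hp.1 hp.2
    have e4 : |g (clampPt m p)| ^ j ≤ 1 + |g (clampPt m p)| ^ 2 := by
      have := abs_nonneg (g (clampPt m p))
      interval_cases j
      · simp only [pow_zero]; nlinarith
      · nlinarith
      · linarith
    have e5 : (1 : ℝ) ≤ envelope a p ^ s := Real.one_le_rpow e1 (by linarith [S.two_lt])
    have e6 : (envelope a p ^ q) ^ 2 ≤ envelope a p ^ s := by
      rw [← Real.rpow_natCast, ← Real.rpow_mul (by linarith)]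
      refine Real.rpow_le_rpow_of_exponent_le e1 ?_
      push_cast; linarith
    rw [Real.norm_eq_abs, abs_pow]
    calc |g (clampPt m p)| ^ j ≤ 1 + |g (clampPt m p)| ^ 2 := e4
      _ ≤ 1 + (K * 2 ^ q * envelope a p ^ q) ^ 2 := by gcongr
      _ = 1 + (K * 2 ^ q) ^ 2 * (envelope a p ^ q) ^ 2 := by ring
      _ ≤ envelope a p ^ s + (K * 2 ^ q) ^ 2 * envelope a p ^ s := by gcongr
      _ = _ := by ring
  · filter_upwards [S.welsch.ae_pos] with p hp
    refine tendsto_const_nhds.congr' ?_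
    obtain ⟨N, hN⟩ := exists_nat_ge (envelope a p)
    filter_upwards [eventually_ge_atTop N] with m hm
    rw [clampPt_eq_self hp.1 hp.2 (hN.trans (by exact_mod_cast hm))]

/-- Convergence of moments for unbounded functions: the L² truncation error is small uniformly in
large blocks, so the limits in the truncation level and in n may be exchanged. -/
lemma tendsto_integral_blockPt (S : BlockSetting P ξ ρ α₀ σ r a c s) {q : ℝ} (hq : 0 ≤ q)
    (hqs : 2 * q < s) {g : ℝ × ℝ → ℝ} (hg : EnvelopeBounded a q g) :
    Tendsto (fun n => ∫ w, g (blockPt σ r c n (trajectory ξ w)) ∂P) atTop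
      (𝓝 (∫ p, g p ∂(frechetWelsch ρ α₀ 1))) := by
  obtain ⟨e, he, hb⟩ := S.exists_truncation_bound hq hqs hg
  obtain ⟨C, -, hC⟩ := S.memLp_blockPt hq hqs hg
  have hM := (S.tendsto_integral_pow_clampPt_welsch hq hqs hg (j := 1) (by norm_num)).comp
    (tendsto_add_atTop_nat 1)
  simp only [pow_one, Function.comp_def] at hM
  refine tendsto_of_approx (e := fun m => √(e m)) (fun m => ?_)
    (fun m => S.tendsto_integral_clampPt hq hg (m + 1)) hM (by simpa using he.sqrt)
  filter_upwards [hb m, hC] with n hn hL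
  have h2 := S.memLp_clampPt hq hg (m + 1) n
  rw [← integral_sub (hL.1.integrable (by norm_num)) (h2.integrable (by norm_num))]
  exact (abs_integral_le_sqrt (hL.1.sub h2)).trans (Real.sqrt_le_sqrt hn)

set_option maxHeartbeats 1000000 in
/-- Law of large numbers for block averages. -/
theorem tendsto_average (S : BlockSetting P ξ ρ α₀ σ r a c s) {q : ℝ} (hq : 0 ≤ q)
    (hqs : 2 * q < s) {g : ℝ × ℝ → ℝ} (hg : EnvelopeBounded a q g) :
    Tendsto (fun z : ℕ × Ω => ((z.1 / r z.1 : ℕ) : ℝ)⁻¹ *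
      blockSum ξ (z.1 / r z.1) (r z.1) (fun x => g (blockPt σ r c z.1 x)) z.2) (probFilter P)
      (𝓝 (∫ p, g p ∂(frechetWelsch ρ α₀ 1))) := by
  obtain ⟨C, -, hC⟩ := S.memLp_blockPt hq hqs hg
  have h0 : ∀ ε > 0, Tendsto (fun n => P.real {w | ε < |blockSum ξ (n / r n) (r n) (centred P ξ
      (((n / r n : ℕ) : ℝ)⁻¹) (fun x => g (blockPt σ r c n x))) w|}) atTop (𝓝 0) := by
    intro ε hε
    exact tendsto_measureReal_blockSum_gt
      S.doa.isStationarySeries S.meas S.k_tendsto S.mix_r (C := C)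
      (X := fun n x => g (blockPt σ r c n x))
      (fun n => hg.measurable.comp (measurable_blockPt σ r c n))
      (hC.mono fun n h => h.1) (hC.mono fun n h => h.2) hε
  have h1 := tendsto_probFilter_of_measureReal h0
  -- The average is a centred block sum, which vanishes in probability, plus a deterministic
  -- expectation, which converges.
  have h2 := (S.tendsto_integral_blockPt hq hqs hg).comp (tendsto_fst_probFilter P)
  have h3 := h1.add h2
  rw [zero_add] at h3
  refine Tendsto.congr' ?_ h3
  filter_upwards [(tendsto_fst_probFilter P).eventually (S.k_tendsto.eventually_gt_atTop 0)] with z hz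
  have hz' : ((z.1 / r z.1 : ℕ) : ℝ) ≠ 0 := by positivity
  simp only [blockSum, centred, Function.comp]
  rw [← Finset.mul_sum, Finset.sum_sub_distrib, Finset.sum_const, Finset.card_range, nsmul_eq_mul]
  field_simp
  ring

set_option maxHeartbeats 1000000 in
/-- Central limit theorem for block averages, in terms of characteristic functions. -/
theorem tendsto_integral_exp (S : BlockSetting P ξ ρ α₀ σ r a c s) {q : ℝ} (hq : 0 ≤ q)
    (hqs : 2 * q < s) {g : ℝ × ℝ → ℝ} (hg : EnvelopeBounded a q g) {b : ℕ → ℝ}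
    (hb : Tendsto b atTop (𝓝 0))
    (hkb : Tendsto (fun n => ((n / r n : ℕ) : ℝ) * b n ^ 2) atTop (𝓝 1)) :
    Tendsto (fun n => ∫ w, Complex.exp (Complex.I * blockSum ξ (n / r n) (r n)
      (centred P ξ (b n) (fun x => g (blockPt σ r c n x))) w) ∂P) atTop
      (𝓝 (Complex.exp (-variance g (frechetWelsch ρ α₀ 1) / 2 : ℝ))) := by
  obtain ⟨e, he, heb⟩ := S.exists_truncation_bound hq hqs hg
  obtain ⟨C, -, hC⟩ := S.memLp_blockPt hq hqs hg
  obtain ⟨l, hl1, hl2, hl3, hl4, hl5⟩ := S.gap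
  set H := frechetWelsch ρ α₀ 1 with hH
  have hmt := measurable_trajectory S.meas
  choose K hK using fun m : ℕ => hg.exists_bound_comp_clampPt S.a_pos.le hq (m + 1)
  -- The level is m + 1 because the truncation estimate needs a level of at least 1. Z is the same
  -- function of the order statistics of the block without its last l observations.
  set Y : ℕ → ℕ → (ℤ → ℝ) → ℝ := fun m n x => g (clampPt (m + 1) (blockPt σ r c n x)) with hY
  set Z : ℕ → ℕ → (ℤ → ℝ) → ℝ := fun m n x =>
    g (clampPt (m + 1) (topTwo c (σ (r n)) (Finset.Icc 1 ((r n - l n : ℕ) : ℤ)) x)) with hZ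
  have hYm : ∀ m n, Measurable[coordSigma (Icc 1 (r n : ℤ))] (Y m n) := fun m n =>
    (hg.continuous_comp_clampPt (m + 1)).measurable.comp (measurable_blockPt σ r c n)
  have hZm : ∀ m n, Measurable[coordSigma (Icc 1 ((r n - l n : ℕ) : ℤ))] (Z m n) := fun m n =>
    (hg.continuous_comp_clampPt (m + 1)).measurable.comp (measurable_topTwo c _ (by simp))
  have hY2 : ∀ m n, MemLp (fun w => Y m n (trajectory ξ w)) 2 P := fun m n =>
    S.memLp_clampPt hq hg (m + 1) n
  have hZt : ∀ m n, Measurable fun w => Z m n (trajectory ξ w) := fun m n =>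
    ((hZm m n).mono (coordSigma_le _) le_rfl).comp hmt
  have hYt : ∀ m n, Measurable fun w => Y m n (trajectory ξ w) := fun m n =>
    ((hYm m n).mono (coordSigma_le _) le_rfl).comp hmt
  have hZ2 : ∀ m n, MemLp (fun w => Z m n (trajectory ξ w)) 2 P := fun m n =>
    MemLp.of_bound (hZt m n).aestronglyMeasurable (K m) (ae_of_all _ fun w => hK m _)
  set A : ℕ → Set Ω := fun n => {w | ∃ j ∈ Icc 1 2,
      orderStat (trajectory ξ w) (Finset.Icc 1 (r n : ℤ)) j
        ≠ orderStat (trajectory ξ w) (Finset.Icc 1 ((r n - l n : ℕ) : ℤ)) j} with hA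
  have hAm : ∀ n, MeasurableSet (A n) := by
    intro n
    have : A n = ⋃ j ∈ Icc 1 2, {w | orderStat (trajectory ξ w) (Finset.Icc 1 (r n : ℤ)) j
        ≠ orderStat (trajectory ξ w) (Finset.Icc 1 ((r n - l n : ℕ) : ℤ)) j} := by
      ext w; simp [hA]
    rw [this]
    refine MeasurableSet.biUnion (to_countable _) fun j hj => ?_
    exact (measurableSet_eq_fun (measurable_trajectory_orderStat S.meas _ hj.1)
      (measurable_trajectory_orderStat S.meas _ hj.1)).compl
  have hAl : Tendsto (fun n => P.real (A n)) atTop (𝓝 0) :=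
    S.doa.tendsto_measureReal_clip S.meas S.r_tendsto hl2 hl3 hl5
  have hYZ : ∀ m, Tendsto (fun n =>
      ∫ w, (Y m n (trajectory ξ w) - Z m n (trajectory ξ w)) ^ 2 ∂P) atTop (𝓝 0) := by
    intro m
    refine squeeze_zero (fun n => integral_nonneg fun w => sq_nonneg _)
      -- Y and Z coincide off the event A that clipping changes an order statistic, and both are
      -- bounded by K.
      (g := fun n => (2 * K m) ^ 2 * P.real (A n)) (fun n => ?_) (by simpa using hAl.const_mul _)
    have e1 : (2 * K m) ^ 2 * P.real (A n) = ∫ w, (A n).indicator (fun _ => (2 * K m) ^ 2) w ∂P := by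
      rw [integral_indicator_const _ (hAm n), smul_eq_mul, mul_comm]
    rw [e1]
    refine integral_mono_of_nonneg (ae_of_all _ fun w => sq_nonneg _)
      ((integrable_const _).indicator (hAm n)) (ae_of_all _ fun w => ?_)
    by_cases hw : w ∈ A n
    · rw [indicator_of_mem hw]
      simp only
      rw [← sq_abs]
      refine pow_le_pow_left₀ (abs_nonneg _) ((abs_sub _ _).trans ?_) 2
      have h1 := hK m (blockPt σ r c n (trajectory ξ w))
      have h2 := hK m (topTwo c (σ (r n)) (Finset.Icc 1 ((r n - l n : ℕ) : ℤ)) (trajectory ξ w))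
      simp only [hY, hZ]
      linarith
    · rw [indicator_of_notMem hw]
      simp only [hA, mem_ofPred_eq, not_exists, not_and, not_not] at hw
      have h1 := hw 1 (by simp)
      have h2 := hw 2 (by simp)
      simp only [hY, hZ, blockPt, topTwo, h1, h2, sub_self]
      norm_num
  have hYm1 : ∀ m, Tendsto (fun n => ∫ w, Y m n (trajectory ξ w) ∂P) atTop
      (𝓝 (∫ p, g (clampPt (m + 1) p) ∂H)) := fun m => S.tendsto_integral_clampPt hq hg (m + 1)
  have hg2 : EnvelopeBounded a (2 * q) (fun p => g p ^ 2) := by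
    obtain ⟨K, hK, hb⟩ := hg.bound
    refine ⟨hg.measurable.pow_const 2, hg.continuousOn.pow 2, K ^ 2, by positivity, fun p h1 h2 => ?_⟩
    have e1 := one_le_envelope (a := a) h2
    rw [abs_pow, mul_comm 2 q, Real.rpow_mul (by linarith), Real.rpow_ofNat, ← mul_pow]
    exact pow_le_pow_left₀ (abs_nonneg _) (hb p h1 h2) 2
  have hYm2 : ∀ m, Tendsto (fun n => ∫ w, Y m n (trajectory ξ w) ^ 2 ∂P) atTop
      (𝓝 (∫ p, g (clampPt (m + 1) p) ^ 2 ∂H)) := fun m =>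
    S.tendsto_integral_clampPt (by linarith) hg2 (m + 1)
  have hsq : ∀ m, Tendsto (fun n => √(∫ w, (Y m n (trajectory ξ w) - Z m n (trajectory ξ w)) ^ 2 ∂P))
      atTop (𝓝 0) := fun m => by simpa using (hYZ m).sqrt
  have hZ1 : ∀ m, Tendsto (fun n => ∫ w, Z m n (trajectory ξ w) ∂P) atTop
      (𝓝 (∫ p, g (clampPt (m + 1) p) ∂H)) := by
    intro m
    have h1 : Tendsto (fun n => ∫ w, Y m n (trajectory ξ w) ∂P - ∫ w, Z m n (trajectory ξ w) ∂P)
        atTop (𝓝 0) := by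
      refine squeeze_zero_norm (fun n => ?_) (hsq m)
      rw [← integral_sub ((hY2 m n).integrable (by norm_num)) ((hZ2 m n).integrable (by norm_num))]
      exact abs_integral_le_sqrt ((hY2 m n).sub (hZ2 m n))
    have := (hYm1 m).sub h1
    simpa using this
  have hZ2' : ∀ m, Tendsto (fun n => ∫ w, Z m n (trajectory ξ w) ^ 2 ∂P) atTop
      (𝓝 (∫ p, g (clampPt (m + 1) p) ^ 2 ∂H)) := by
    intro m
    have h1 : Tendsto (fun n => ∫ w, Y m n (trajectory ξ w) ^ 2 ∂P - ∫ w, Z m n (trajectory ξ w) ^ 2 ∂P)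
        atTop (𝓝 0) := by
      refine squeeze_zero_norm (a := fun n => (2 * K m) * √(∫ w, (Y m n (trajectory ξ w) - Z m n (trajectory ξ w)) ^ 2 ∂P))
        (fun n => ?_) (by simpa using (hsq m).const_mul (2 * K m))
      have hd := (hY2 m n).sub (hZ2 m n)
      rw [← integral_sub (hY2 m n).integrable_sq (hZ2 m n).integrable_sq]
      refine (norm_integral_le_integral_norm _).trans ?_
      have h3 : ∫ w, ‖Y m n (trajectory ξ w) ^ 2 - Z m n (trajectory ξ w) ^ 2‖ ∂P
          ≤ ∫ w, 2 * K m * |Y m n (trajectory ξ w) - Z m n (trajectory ξ w)| ∂P := by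
        refine integral_mono_of_nonneg (ae_of_all _ fun w => norm_nonneg _)
          ((hd.integrable (by norm_num)).abs.const_mul _) (ae_of_all _ fun w => ?_)
        simp only [Real.norm_eq_abs]
        rw [sq_sub_sq, abs_mul]
        gcongr
        refine (abs_add_le _ _).trans ?_
        have h1 := hK m (blockPt σ r c n (trajectory ξ w))
        have h2 := hK m (topTwo c (σ (r n)) (Finset.Icc 1 ((r n - l n : ℕ) : ℤ)) (trajectory ξ w))
        simp only [hY, hZ]
        linarith
      refine h3.trans ?_
      have hK0 : 0 ≤ K m := (abs_nonneg _).trans (hK m 0)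
      rw [integral_const_mul]
      gcongr
      have h4 := abs_integral_le_sqrt (X := fun w => |Y m n (trajectory ξ w) - Z m n (trajectory ξ w)|)
        hd.abs
      simp only [sq_abs] at h4
      exact (le_abs_self _).trans h4
    have := (hYm2 m).sub h1
    simpa using this
  have hgc2 : ∀ m, MemLp (fun p => g (clampPt (m + 1) p)) 2 H := fun m =>
    MemLp.of_bound (hg.continuous_comp_clampPt (m + 1)).aestronglyMeasurable (K m)
      (ae_of_all _ fun w => hK m _)
  refine tendsto_integral_exp_blockSum S.doa.isStationarySeries S.meas hl1 S.mix_r hl4 hb hkb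
    (X := fun n x => g (blockPt σ r c n x)) (Y := Y) (Z := Z) (C := K) (ε := e)
    (V := fun m => variance (fun p => g (clampPt (m + 1) p)) H)
    (fun n => hg.measurable.comp (measurable_blockPt σ r c n)) hYm hZm (hC.mono fun n h => h.1)
    (fun m n x => hK m _) (fun m n x => hK m _) heb he hYZ (fun m => ?_) ?_
  · have e1 : ∀ n, variance (fun w => Z m n (trajectory ξ w)) P
        = ∫ w, Z m n (trajectory ξ w) ^ 2 ∂P - (∫ w, Z m n (trajectory ξ w) ∂P) ^ 2 := fun n =>
      variance_eq_sub (hZ2 m n)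
    have e2 : variance (fun p => g (clampPt (m + 1) p)) H
        = ∫ p, g (clampPt (m + 1) p) ^ 2 ∂H - (∫ p, g (clampPt (m + 1) p) ∂H) ^ 2 :=
      variance_eq_sub (hgc2 m)
    simp_rw [e1, e2]
    exact (hZ2' m).sub ((hZ1 m).pow 2)
  · have e2 : ∀ m, variance (fun p => g (clampPt (m + 1) p)) H
        = ∫ p, g (clampPt (m + 1) p) ^ 2 ∂H - (∫ p, g (clampPt (m + 1) p) ^ 1 ∂H) ^ 2 := fun m => by
      simp only [pow_one]; exact variance_eq_sub (hgc2 m)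
    have e3 : variance g H = ∫ p, g p ^ 2 ∂H - (∫ p, g p ^ 1 ∂H) ^ 2 := by
      simp only [pow_one]; exact variance_eq_sub (S.memLp_welsch hq hqs hg)
    simp_rw [e2]
    rw [e3]
    exact ((S.tendsto_integral_pow_clampPt_welsch hq hqs hg le_rfl).comp (tendsto_add_atTop_nat 1)).sub
      (((S.tendsto_integral_pow_clampPt_welsch hq hqs hg (j := 1) (by norm_num)).comp
        (tendsto_add_atTop_nat 1)).pow 2)

end BlockSetting

end Setting

/-! ### The functions entering the likelihood equations -/

section EnvelopeFunctions

variable {a q : ℝ} {g h : ℝ × ℝ → ℝ}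

lemma EnvelopeBounded.add (hg : EnvelopeBounded a q g) (hh : EnvelopeBounded a q h) :
    EnvelopeBounded a q (fun p => g p + h p) := by
  obtain ⟨K, hK, hb⟩ := hg.bound
  obtain ⟨L, hL, hb'⟩ := hh.bound
  refine ⟨hg.measurable.add hh.measurable, hg.continuousOn.add hh.continuousOn, K + L,
    by positivity, fun p h1 h2 => ?_⟩
  rw [add_mul]
  exact (abs_add_le _ _).trans (add_le_add (hb p h1 h2) (hb' p h1 h2))

lemma EnvelopeBounded.const_mul (hg : EnvelopeBounded a q g) (t : ℝ) :
    EnvelopeBounded a q (fun p => t * g p) := by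
  obtain ⟨K, hK, hb⟩ := hg.bound
  refine ⟨hg.measurable.const_mul t, continuousOn_const.mul hg.continuousOn, |t| * K,
    by positivity, fun p h1 h2 => ?_⟩
  rw [abs_mul, mul_assoc]
  exact mul_le_mul_of_nonneg_left (hb p h1 h2) (abs_nonneg t)

lemma envelopeBounded_zero : EnvelopeBounded a q (fun _ => 0) :=
  ⟨measurable_const, continuousOn_const, 0, le_rfl, fun p _ _ => by simp⟩

lemma EnvelopeBounded.sum {ι : Type*} (s : Finset ι) {f : ι → ℝ × ℝ → ℝ}
    (hf : ∀ i ∈ s, EnvelopeBounded a q (f i)) : EnvelopeBounded a q (fun p => ∑ i ∈ s, f i p) := by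
  classical
  induction s using Finset.induction_on with
  | empty => simpa using envelopeBounded_zero
  | insert i s hi ih =>
    simp only [Finset.sum_insert hi]
    exact (hf i (by simp)).add (ih fun j hj => hf j (by simp [hj]))

lemma abs_pow_le_exp {e : ℝ} (he : 0 < e) (t : ℝ) (j : ℕ) :
    |t| ^ j ≤ j.factorial / e ^ j * Real.exp (e * |t|) := by
  have h1 := Real.pow_div_factorial_le_exp (e * |t|) (by positivity) j
  rw [div_le_iff₀ (by positivity), mul_pow] at h1
  rw [div_mul_eq_mul_div, le_div_iff₀ (by positivity)]
  linarith

lemma rpow_neg_mul_abs_log_pow_le {b d : ℝ} (hb : 0 < b) (hbd : b < d) (j : ℕ) :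
    ∃ K, 0 ≤ K ∧ ∀ y : ℝ, 0 < y → y ^ (-b) * |Real.log y| ^ j ≤ K * (1 + y ^ (-d)) := by
  -- The power of the logarithm is traded for e^{e|log y|}. For y ≥ 1 this is absorbed by y^(-b) as
  -- e ≤ b, and for y ≤ 1 by the surplus y^(-(d - b)) as e ≤ d - b.
  set e := min b (d - b) with he
  have he0 : 0 < e := lt_min hb (by linarith)
  have he1 : e ≤ b := min_le_left _ _
  have he2 : e ≤ d - b := min_le_right _ _
  refine ⟨j.factorial / e ^ j, by positivity, fun y hy => ?_⟩
  have h1 := abs_pow_le_exp he0 (Real.log y) j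
  have h2 : y ^ (-b) * Real.exp (e * |Real.log y|) ≤ 1 + y ^ (-d) := by
    rw [Real.rpow_def_of_pos hy, Real.rpow_def_of_pos hy, ← Real.exp_add]
    rcases le_total 0 (Real.log y) with h | h
    · rw [abs_of_nonneg h]
      have : Real.exp (Real.log y * -b + e * Real.log y) ≤ 1 := Real.exp_le_one_iff.2 (by nlinarith)
      have := Real.exp_pos (Real.log y * -d)
      linarith
    · rw [abs_of_nonpos h]
      have : Real.exp (Real.log y * -b + e * -Real.log y) ≤ Real.exp (Real.log y * -d) :=
        Real.exp_le_exp.2 (by nlinarith)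
      linarith
  calc y ^ (-b) * |Real.log y| ^ j
      ≤ y ^ (-b) * (j.factorial / e ^ j * Real.exp (e * |Real.log y|)) := by gcongr
    _ = j.factorial / e ^ j * (y ^ (-b) * Real.exp (e * |Real.log y|)) := by ring
    _ ≤ j.factorial / e ^ j * (1 + y ^ (-d)) := by gcongr

lemma envelope_ge {p : ℝ × ℝ} (h2 : 0 < p.2) :
    p.2 ^ (-a) ≤ envelope a p ∧ |Real.log p.2| ≤ envelope a p ∧ |Real.log p.1| ≤ envelope a p := by
  have := abs_nonneg (Real.log p.1)
  have := abs_nonneg (Real.log p.2)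
  have := Real.rpow_pos_of_pos h2 (-a)
  unfold envelope
  refine ⟨?_, ?_, ?_⟩ <;> linarith

lemma continuousOn_log_snd : ContinuousOn (fun p : ℝ × ℝ => Real.log p.2) (Ioi 0 ×ˢ Ioi 0) :=
  continuousOn_snd.log fun p hp => (show 0 < p.2 from hp.2).ne'

lemma continuousOn_log_fst : ContinuousOn (fun p : ℝ × ℝ => Real.log p.1) (Ioi 0 ×ˢ Ioi 0) :=
  continuousOn_fst.log fun p hp => (show 0 < p.1 from hp.1).ne'

lemma continuousOn_rpow_snd (b : ℝ) :
    ContinuousOn (fun p : ℝ × ℝ => p.2 ^ b) (Ioi 0 ×ˢ Ioi 0) :=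
  continuousOn_snd.rpow_const fun p hp => Or.inl (show 0 < p.2 from hp.2).ne'

/-- The margin b < q a, available for exponents slightly beyond a when q > 1, pays for any power of
the logarithm. Thus derivatives in the exponent obey the same limit theorems as the function itself.
-/
lemma envelopeBounded_rpow_mul_log_pow {b : ℝ} (hq : 0 ≤ q) (hb : 0 < b) (hbq : b < q * a) (j : ℕ) :
    EnvelopeBounded a q (fun p => p.2 ^ (-b) * Real.log p.2 ^ j) := by
  obtain ⟨K, hK, hKb⟩ := rpow_neg_mul_abs_log_pow_le hb hbq j
  refine ⟨by fun_prop, (continuousOn_rpow_snd _).mul (continuousOn_log_snd.pow j), 2 * K,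
    by positivity, fun p h1 h2 => ?_⟩
  have e1 := one_le_envelope (a := a) h2
  have hp := Real.rpow_nonneg h2.le (-b)
  rw [abs_mul, abs_pow, abs_of_nonneg hp]
  refine (hKb _ h2).trans ?_
  have h3 : (1 : ℝ) ≤ envelope a p ^ q := Real.one_le_rpow e1 hq
  have h4 : p.2 ^ (-(q * a)) ≤ envelope a p ^ q := by
    rw [show -(q * a) = -a * q by ring, Real.rpow_mul h2.le]
    exact Real.rpow_le_rpow (Real.rpow_nonneg h2.le _) (envelope_ge h2).1 hq
  nlinarith

lemma EnvelopeBounded.of_le_envelope (hq : 1 ≤ q) (hm : Measurable g)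
    (hc : ContinuousOn g (Ioi 0 ×ˢ Ioi 0))
    (hb : ∀ p : ℝ × ℝ, 0 < p.1 → 0 < p.2 → |g p| ≤ envelope a p) : EnvelopeBounded a q g := by
  refine ⟨hm, hc, 1, zero_le_one, fun p h1 h2 => (hb p h1 h2).trans ?_⟩
  rw [one_mul]
  exact Real.self_le_rpow_of_one_le (one_le_envelope h2) hq

lemma envelopeBounded_log_snd (hq : 1 ≤ q) : EnvelopeBounded a q (fun p => Real.log p.2) :=
  .of_le_envelope hq (by fun_prop) continuousOn_log_snd fun _ _ h => (envelope_ge h).2.1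

lemma envelopeBounded_log_fst (hq : 1 ≤ q) : EnvelopeBounded a q (fun p => Real.log p.1) :=
  .of_le_envelope hq (by fun_prop) continuousOn_log_fst fun _ _ h => (envelope_ge h).2.2

lemma envelopeBounded_fct (ha : 0 < a) (hq : 1 < q) (j : Fin 4) :
    EnvelopeBounded a q (fct a j) := by
  have hqa : a < q * a := by nlinarith
  fin_cases j
  · simpa [fct] using envelopeBounded_rpow_mul_log_pow (by linarith) ha hqa 1
  · simpa [fct] using envelopeBounded_rpow_mul_log_pow (by linarith) ha hqa 0
  · exact envelopeBounded_log_snd hq.le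
  · exact envelopeBounded_log_fst hq.le

end EnvelopeFunctions

/-! ### Weak convergence of the empirical process -/

section EmpiricalProcess

variable {Ω : Type*} [MeasurableSpace Ω] {P : Measure Ω} [IsProbabilityMeasure P]
  {ξ : ℤ → Ω → ℝ} {ρ : ℝ → ℝ} {α₀ : ℝ} {σ : ℕ → ℝ} {r : ℕ → ℕ} {a c s ω : ℝ}

lemma div_le_cast_div (n r : ℕ) : ((n / r : ℕ) : ℝ) ≤ (n : ℝ) / r := Nat.cast_div_le

/-- The normalization uses n/r, whereas the sums run over ⌊n/r⌋ blocks. -/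
lemma tendsto_div_div_floor (hr : Tendsto r atTop atTop) (hk : Tendsto (fun n => n / r n) atTop atTop) :
    Tendsto (fun n : ℕ => ((n : ℝ) / r n) / ((n / r n : ℕ) : ℝ)) atTop (𝓝 1) := by
  have h1 : Tendsto (fun n : ℕ => 1 + (((n / r n : ℕ) : ℝ))⁻¹) atTop (𝓝 (1 + 0)) :=
    (tendsto_inv_atTop_zero.comp (tendsto_natCast_atTop_atTop.comp hk)).const_add 1
  rw [add_zero] at h1
  refine tendsto_of_tendsto_of_tendsto_of_le_of_le' tendsto_const_nhds h1 ?_ ?_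
  · filter_upwards [hk.eventually_gt_atTop 0] with n hn
    rw [le_div_iff₀ (by exact_mod_cast hn), one_mul]
    exact Nat.cast_div_le
  · filter_upwards [hk.eventually_gt_atTop 0, hr.eventually_gt_atTop 0] with n hn hrn
    have hn' : (0 : ℝ) < ((n / r n : ℕ) : ℝ) := by exact_mod_cast hn
    have hr' : (0 : ℝ) < r n := by exact_mod_cast hrn
    rw [div_le_iff₀ hn', add_mul, one_mul, inv_mul_cancel₀ hn'.ne', div_le_iff₀ hr']
    have : n < (n / r n + 1) * r n := by
      rw [mul_comm]; exact Nat.lt_mul_div_succ n hrn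
    exact_mod_cast this.le

lemma BlockSetting.of_assumptions (hξ : ∀ t, Measurable (ξ t)) (hr : Tendsto r atTop atTop)
    (hk : Tendsto (fun n => n / r n) atTop atTop) (hdoa : DomainOfAttraction P ξ ρ α₀ σ)
    (hmix : AlphaMixingRate P ξ r ω) (ha : 0 < a) (hmom : IntegrabilityCondition P ξ σ a ω)
    (hc : 0 < c) : ∃ s, BlockSetting P ξ ρ α₀ σ r a c s := by
  obtain ⟨s, C, hs, hC⟩ := hmom.exists_moment_bound hmix.omega_pos ha hdoa.sigma_pos hξ hc
  obtain ⟨l, hl1, hl2, hl3, hl4⟩ := hmix.exists_gap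
  have hle : ∀ᶠ n in atTop, l n ≤ r n := by
    filter_upwards [hl2.eventually_lt_const one_pos, hr.eventually_gt_atTop 0] with n hn hrn
    rw [div_lt_one (by exact_mod_cast hrn)] at hn
    exact_mod_cast hn.le
  -- `BlockSetting` asks for gaps no longer than the block at every n, so the given gaps are
  -- replaced by their minimum with r, which changes only finitely many of them.
  have hmin : ∀ᶠ n in atTop, min (l n) (r n) = l n := hle.mono fun n h => min_eq_left h
  refine ⟨s, hξ, hdoa, hr, hk, ?_, ⟨fun n => min (l n) (r n), fun n => min_le_right _ _, ?_, ?_, ?_, ?_⟩,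
    ha, hc, hs, C, hC⟩
  · refine squeeze_zero' (Eventually.of_forall fun n =>
      mul_nonneg (Nat.cast_nonneg _) (alphaMixing_nonneg _)) ?_ hmix.rate
    filter_upwards [hk.eventually_ge_atTop 1] with n hn
    refine mul_le_mul_of_nonneg_right ?_ (alphaMixing_nonneg _)
    have h1 : (1 : ℝ) ≤ (n : ℝ) / r n := le_trans (by exact_mod_cast hn) (div_le_cast_div n (r n))
    exact (div_le_cast_div n (r n)).trans
      (Real.self_le_rpow_of_one_le h1 (by linarith [hmix.omega_pos]))
  · exact hl1.congr' (hmin.mono fun n h => h.symm)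
  · exact hl2.congr' (hmin.mono fun n h => by simp only [h])
  · have h3 : Tendsto (fun n => ((n / r n : ℕ) : ℝ) * alphaMixing P ξ (l n)) atTop (𝓝 0) :=
      squeeze_zero (fun n => mul_nonneg (Nat.cast_nonneg _) (alphaMixing_nonneg _))
        (fun n => mul_le_mul_of_nonneg_right (div_le_cast_div n (r n)) (alphaMixing_nonneg _)) hl3
    exact h3.congr' (hmin.mono fun n h => by simp only [h])
  · exact hl4.congr' (hmin.mono fun n h => by simp only [h])

/-- When every second largest value exceeds both truncation levels, neither truncation acts. This
passes from the level in the bias condition to an arbitrary one. -/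
lemma blockSample_eventually_eq (hr : Tendsto r atTop atTop) (hdiv : AllDiverge P ξ r) (hc : 0 < c) {c' : ℝ} :
    ∀ᶠ z in probFilter P, blockSample ξ c z.1 (r z.1) z.2 = blockSample ξ c' z.1 (r z.1) z.2 := by
  have h := hdiv (max c c') (lt_max_of_lt_left hc)
  rw [eventually_probFilter]
  refine tendsto_of_tendsto_of_tendsto_of_le_of_le' tendsto_const_nhds h
    (Eventually.of_forall fun _ => zero_le) ?_
  filter_upwards [hr.eventually_ge_atTop 2] with n hn
  refine measure_mono fun w hw => ?_
  by_contra hcon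
  simp only [mem_ofPred_eq, not_exists, not_and, not_le] at hw hcon
  refine hw (funext fun i => ?_)
  have h2 := hcon i i.2
  have h1 : blockSnd ξ (r n) i w ≤ blockMax ξ (r n) i w := by
    refine orderStat_two_le_one ?_
    simp only [block, Int.card_Icc]
    have : ((i : ℤ) + 1) * (r n) + 1 - ((i : ℤ) * r n + 1) = r n := by ring
    rw [this]; simpa using hn
  have h3 := le_max_left c c'
  have h4 := le_max_right c c'
  simp only [blockSample]
  rw [max_eq_left (by linarith), max_eq_left (by linarith), max_eq_left (by linarith),
    max_eq_left (by linarith)]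

lemma measurable_fct (a : ℝ) (j : Fin 4) : Measurable (fct a j) := by
  fin_cases j
  · exact (show Measurable fun p : ℝ × ℝ => p.2 ^ (-a) * Real.log p.2 by fun_prop)
  · exact (show Measurable fun p : ℝ × ℝ => p.2 ^ (-a) by fun_prop)
  · exact (show Measurable fun p : ℝ × ℝ => Real.log p.2 by fun_prop)
  · exact (show Measurable fun p : ℝ × ℝ => Real.log p.1 by fun_prop)

lemma measurable_blockSample (hξ : ∀ t, Measurable (ξ t)) (c : ℝ) (n r : ℕ) (i : Fin (n / r)) :
    Measurable fun w => blockSample ξ c n r w i :=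
  ((measurable_trajectory_orderStat hξ (block r i) le_rfl).max measurable_const).prodMk
    ((measurable_trajectory_orderStat hξ (block r i) (by norm_num)).max measurable_const)

lemma measurable_empVector (hξ : ∀ t, Measurable (ξ t)) (c : ℝ) (n : ℕ) :
    Measurable (empVector ξ ρ α₀ σ r c n) := by
  refine (PiLp.continuous_toLp 2 _).measurable.comp (measurable_pi_lambda _ fun j => ?_)
  unfold empProcess
  refine ((Measurable.const_mul (Finset.measurable_sum _ fun i _ => ?_) _).sub_const _).const_mul _
  have h := measurable_blockSample hξ c n (r n) i
  exact (measurable_fct _ j).comp ((h.fst.div_const _).prodMk (h.snd.div_const _))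

/-- Cramér–Wold: the variance in the one-dimensional limit theorem is the quadratic form in the
Gaussian characteristic function. -/
lemma variance_sum_mul_fct {H : Measure (ℝ × ℝ)} [IsProbabilityMeasure H] (a : ℝ)
    (hf : ∀ j, MemLp (fct a j) 2 H) (t : Fin 4 → ℝ) :
    variance (fun p => ∑ j, t j * fct a j p) H
      = t ⬝ᵥ (Matrix.of fun i j => covariance (fct a i) (fct a j) H).mulVec t := by
  rw [variance_fun_sum' (fun j _ => (hf j).const_mul (t j))]
  simp only [dotProduct, Matrix.mulVec, Finset.mul_sum, Matrix.of_apply]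
  refine Finset.sum_congr rfl fun i _ => Finset.sum_congr rfl fun j _ => ?_
  rw [covariance_const_mul_left, covariance_const_mul_right]
  ring

lemma posSemidef_covariance_fct {H : Measure (ℝ × ℝ)} [IsProbabilityMeasure H] (a : ℝ)
    (hf : ∀ j, MemLp (fct a j) 2 H) :
    (Matrix.of fun i j => covariance (fct a i) (fct a j) H).PosSemidef := by
  refine Matrix.PosSemidef.of_dotProduct_mulVec_nonneg ?_ fun t => ?_
  · ext i j
    simp [covariance_comm (fct a j)]
  · rw [star_trivial, ← variance_sum_mul_fct a hf]
    exact variance_nonneg _ _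

/-- A projection of W_n is a block sum centred at its own mean, plus a deterministic bias. The first
obeys the central limit theorem and the second converges by the bias condition. -/
lemma inner_empVector_eq (n : ℕ)
    (hn : 0 < n / r n)
    (hi : ∀ j, Integrable (fun w => fct (alphaOne (ρ 0) α₀) j (blockPt σ r c n (trajectory ξ w))) P)
    (t : EuclideanSpace ℝ (Fin 4)) (w : Ω) :
    inner ℝ (empVector ξ ρ α₀ σ r c n w) t
      = blockSum ξ (n / r n) (r n) (centred P ξ (√((n : ℝ) / r n) / ((n / r n : ℕ) : ℝ))
          (fun x => ∑ j, t j * fct (alphaOne (ρ 0) α₀) j (blockPt σ r c n x))) w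
        + ∑ j, t j * (√((n : ℝ) / r n) * ((∫ w, fct (alphaOne (ρ 0) α₀) j
            (blockPt σ r c n (trajectory ξ w)) ∂P)
          - ∫ p, fct (alphaOne (ρ 0) α₀) j p ∂(frechetWelsch ρ α₀ 1))) := by
  have hk : ((n / r n : ℕ) : ℝ) ≠ 0 := by positivity
  simp only [empVector, PiLp.inner_apply, empProcess, sum_blockSample, RCLike.inner_apply,
    conj_trivial]
  rw [show blockSum ξ (n / r n) (r n) (centred P ξ (√((n : ℝ) / r n) / ((n / r n : ℕ) : ℝ))
          (fun x => ∑ j, t j * fct (alphaOne (ρ 0) α₀) j (blockPt σ r c n x))) w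
      = ∑ j, t j * (√((n : ℝ) / r n) * (((n / r n : ℕ) : ℝ)⁻¹ * blockSum ξ (n / r n) (r n)
          (fun x => fct (alphaOne (ρ 0) α₀) j (blockPt σ r c n x)) w
        - ∫ w, fct (alphaOne (ρ 0) α₀) j (blockPt σ r c n (trajectory ξ w)) ∂P)) from ?_]
  · rw [← Finset.sum_add_distrib]
    refine Finset.sum_congr rfl fun j _ => ?_
    simp only [blockPt]
    ring
  · simp only [blockSum, centred]
    rw [integral_finsetSum _ fun j _ => (hi j).const_mul (t j)]
    simp only [integral_const_mul]
    rw [← Finset.mul_sum, Finset.sum_sub_distrib, Finset.sum_comm, Finset.sum_const,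
      Finset.card_range, nsmul_eq_mul, Finset.mul_sum (s := Finset.univ), ← Finset.sum_sub_distrib,
      Finset.mul_sum]
    refine Finset.sum_congr rfl fun j _ => ?_
    rw [← Finset.mul_sum]
    field_simp

/-- The exponent in the envelope condition that is used for all functions. -/
lemma BlockSetting.exists_exponent (S : BlockSetting P ξ ρ α₀ σ r a c s) :
    ∃ q, 1 < q ∧ 2 * q < s :=
  -- The midpoint of 1 and s/2: above 1 to absorb logarithms, below s/2 to retain more than second
  -- moments.
  ⟨(1 + s / 2) / 2, by linarith [S.two_lt], by linarith [S.two_lt]⟩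

/-- By Lévy's continuity theorem it suffices to treat characteristic functions. The bias contributes
the factor exp(i⟨t, B⟩), the centred block sum the Gaussian factor. -/
theorem tendstoInDistribution_empVector {B : Fin 4 → ℝ}
    (S : BlockSetting P ξ ρ α₀ σ r (alphaOne (ρ 0) α₀) c s)
    (hB : ∀ j : Fin 4, Tendsto (fun n : ℕ => √((n : ℝ) / r n) *
      ((∫ w, fct (alphaOne (ρ 0) α₀) j (max (blockMax ξ (r n) 0 w) c / σ (r n),
          max (blockSnd ξ (r n) 0 w) c / σ (r n)) ∂P)
        - ∫ p, fct (alphaOne (ρ 0) α₀) j p ∂(frechetWelsch ρ α₀ 1))) atTop (𝓝 (B j))) :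
    TendstoInDistribution (fun n => empVector ξ ρ α₀ σ r c n) atTop id (fun _ => P)
      (multivariateGaussian (WithLp.toLp 2 B) (sigmaDB ρ α₀)) := by
  obtain ⟨q, hq1, hqs⟩ := S.exists_exponent
  have hE := fun j => envelopeBounded_fct S.a_pos hq1 j
  have hL2 : ∀ j, MemLp (fct (alphaOne (ρ 0) α₀) j) 2 (frechetWelsch ρ α₀ 1) := fun j =>
    S.memLp_welsch (by linarith) hqs (hE j)
  refine ⟨fun n => (measurable_empVector S.meas c n).aemeasurable, aemeasurable_id, ?_⟩
  refine ProbabilityMeasure.tendsto_iff_tendsto_charFun.2 fun t => ?_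
  simp only [ProbabilityMeasure.coe_mk, Measure.map_id]
  have hpsd : (sigmaDB ρ α₀).PosSemidef := posSemidef_covariance_fct _ hL2
  rw [charFun_multivariateGaussian hpsd]
  have hg : EnvelopeBounded (alphaOne (ρ 0) α₀) q
      (fun p => ∑ j, t j * fct (alphaOne (ρ 0) α₀) j p) :=
    EnvelopeBounded.sum _ fun j _ => (hE j).const_mul (t j)
  set b : ℕ → ℝ := fun n => √((n : ℝ) / r n) / ((n / r n : ℕ) : ℝ) with hbdef
  -- Here k b² equals (n/r)/⌊n/r⌋.
  have hkb : Tendsto (fun n => ((n / r n : ℕ) : ℝ) * b n ^ 2) atTop (𝓝 1) := by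
    refine (tendsto_div_div_floor S.r_tendsto S.k_tendsto).congr' ?_
    filter_upwards [S.k_tendsto.eventually_gt_atTop 0] with n hn
    have hn' : ((n / r n : ℕ) : ℝ) ≠ 0 := by positivity
    simp only [hbdef]
    rw [div_pow, Real.sq_sqrt (by positivity)]
    field_simp
  have hb : Tendsto b atTop (𝓝 0) := by
    have h1 : Tendsto (fun n => √((((n / r n : ℕ) : ℝ))⁻¹ * (((n / r n : ℕ) : ℝ) * b n ^ 2))) atTop (𝓝 √(0 * 1)) :=
      ((tendsto_inv_atTop_zero.comp (tendsto_natCast_atTop_atTop.comp S.k_tendsto)).mul hkb).sqrt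
    rw [zero_mul, Real.sqrt_zero] at h1
    refine h1.congr' ?_
    filter_upwards [S.k_tendsto.eventually_gt_atTop 0] with n hn
    have hn' : ((n / r n : ℕ) : ℝ) ≠ 0 := by positivity
    rw [inv_mul_cancel_left₀ hn', Real.sqrt_sq (by positivity)]
  have h1 := S.tendsto_integral_exp (by linarith) hqs hg hb hkb
  rw [variance_sum_mul_fct _ hL2] at h1
  have h2 : Tendsto (fun n : ℕ => ∑ j, t j * (√((n : ℝ) / r n) * ((∫ w, fct (alphaOne (ρ 0) α₀) j
            (blockPt σ r c n (trajectory ξ w)) ∂P)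
          - ∫ p, fct (alphaOne (ρ 0) α₀) j p ∂(frechetWelsch ρ α₀ 1)))) atTop (𝓝 (∑ j, t j * B j)) := by
    refine tendsto_finsetSum _ fun j _ => ((hB j).congr fun n => ?_).const_mul (t j)
    simp only [blockMax_zero, blockSnd_zero]
    rfl
  have h3 := (Complex.continuous_exp.tendsto _).comp
    ((Complex.continuous_ofReal.tendsto _).comp h2 |>.mul_const Complex.I)
  have h4 := h3.mul h1
  have hInt : ∀ᶠ n in atTop, ∀ j, Integrable (fun w =>
      fct (alphaOne (ρ 0) α₀) j (blockPt σ r c n (trajectory ξ w))) P := by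
    rw [eventually_all]
    intro j
    obtain ⟨C, -, hC⟩ := S.memLp_blockPt (by linarith) hqs (hE j)
    exact hC.mono fun n hn => hn.1.integrable (by norm_num)
  refine (h4.congr' ?_).trans (le_of_eq ?_)
  · filter_upwards [hInt, S.k_tendsto.eventually_gt_atTop 0] with n hn hkn
    rw [charFun_apply, integral_map (measurable_empVector S.meas c n).aemeasurable
      (by fun_prop), Function.comp, Function.comp, ← integral_const_mul]
    refine integral_congr_ae (ae_of_all _ fun w => ?_)
    simp only
    rw [inner_empVector_eq n hkn hn t w, ← Complex.exp_add]
    congr 1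
    push_cast
    ring
  · congr 1
    rw [← Complex.exp_add]
    congr 1
    simp only [PiLp.inner_apply, RCLike.inner_apply, conj_trivial, sigmaDB]
    push_cast
    rw [sub_eq_add_neg, neg_div]
    congr 2
    refine Finset.sum_congr rfl fun j _ => by ring

end EmpiricalProcess

/-! ### The likelihood equation -/

section Likelihood

variable {k : ℕ} {z : Fin k → ℝ × ℝ}

/-- The sums `∑ y_i^{-b} (log y_i)^j`. -/
def powSum (z : Fin k → ℝ × ℝ) (j : ℕ) (b : ℝ) : ℝ := ∑ i, (z i).2 ^ (-b) * Real.log (z i).2 ^ j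

/-- The sum of the logarithms of all observations. -/
def logSum (z : Fin k → ℝ × ℝ) : ℝ := ∑ i, (Real.log (z i).1 + Real.log (z i).2)

/-- The derivative of the profile log-likelihood, divided by the sample size. -/
def score (z : Fin k → ℝ × ℝ) (a : ℝ) : ℝ :=
  2 / a + 2 * (powSum z 1 a / powSum z 0 a) - logSum z / k

/-- The profile log-likelihood. -/
def profile (z : Fin k → ℝ × ℝ) (a : ℝ) : ℝ :=
  2 * k * Real.log a + 2 * k * Real.log (2 * k / powSum z 0 a) - 2 * k - (a + 1) * logSum z

/-- The maximizer of the log-likelihood in the scale parameter, for given shape. -/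
def profileScale (z : Fin k → ℝ × ℝ) (a : ℝ) : ℝ := (2 * k / powSum z 0 a) ^ (1 / a)

lemma powSum_zero_pos (hk : 0 < k) (hz : ∀ i, 0 < (z i).1 ∧ 0 < (z i).2) (b : ℝ) :
    0 < powSum z 0 b := by
  have : Nonempty (Fin k) := ⟨⟨0, hk⟩⟩
  exact Finset.sum_pos (fun i _ => by simpa using Real.rpow_pos_of_pos (hz i).2 _)
    Finset.univ_nonempty

lemma hasDerivAt_powSum (hz : ∀ i, 0 < (z i).1 ∧ 0 < (z i).2) (j : ℕ) (b : ℝ) :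
    HasDerivAt (powSum z j) (-powSum z (j + 1) b) b := by
  unfold powSum
  rw [← Finset.sum_neg_distrib]
  refine HasDerivAt.fun_sum fun i _ => ?_
  have h1 := ((hasDerivAt_neg b).const_rpow (hz i).2).mul_const (Real.log (z i).2 ^ j)
  refine h1.congr_deriv ?_
  ring

/-- Cauchy–Schwarz with weights y^(-b): the weighted variance of log y is nonnegative. -/
lemma powSum_one_sq_le (hz : ∀ i, 0 < (z i).1 ∧ 0 < (z i).2) (b : ℝ) :
    powSum z 1 b ^ 2 ≤ powSum z 0 b * powSum z 2 b := by
  refine Finset.sum_sq_le_sum_mul_sum_of_sq_le_mul _ (fun i _ => ?_) (fun i _ => ?_) fun i _ => ?_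
  · have := Real.rpow_nonneg (hz i).2.le (-b); positivity
  · have := Real.rpow_nonneg (hz i).2.le (-b); positivity
  · exact le_of_eq (by ring)

lemma hasDerivAt_score (hk : 0 < k) (hz : ∀ i, 0 < (z i).1 ∧ 0 < (z i).2) {a : ℝ} (ha : 0 < a) :
    HasDerivAt (score z)
      (-2 / a ^ 2 - 2 * ((powSum z 0 a * powSum z 2 a - powSum z 1 a ^ 2) / powSum z 0 a ^ 2)) a := by
  have h0 := (powSum_zero_pos hk hz a).ne'
  have h1 := ((hasDerivAt_powSum hz 1 a).div (hasDerivAt_powSum hz 0 a) h0).const_mul 2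
  have h2 := (hasDerivAt_inv ha.ne').const_mul 2
  refine ((h2.add h1).sub_const (logSum z / k)).congr_deriv ?_ |>.congr_of_eventuallyEq ?_
  · ring
  · exact Eventually.of_forall fun x => by simp [score, div_eq_mul_inv]

/-- The derivative is at most -2/a², as the remaining term is minus twice a weighted variance of log
y. Hence the score has at most one zero. -/
lemma strictAntiOn_score (hk : 0 < k) (hz : ∀ i, 0 < (z i).1 ∧ 0 < (z i).2) :
    StrictAntiOn (score z) (Ioi 0) := by
  refine strictAntiOn_of_deriv_neg (convex_Ioi 0)
    (fun a ha => (hasDerivAt_score hk hz ha).continuousAt.continuousWithinAt) fun a ha => ?_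
  rw [interior_Ioi] at ha
  have ha' : 0 < a := ha
  rw [(hasDerivAt_score hk hz ha).deriv]
  have h1 := powSum_one_sq_le hz a
  have h2 : 0 ≤ (powSum z 0 a * powSum z 2 a - powSum z 1 a ^ 2) / powSum z 0 a ^ 2 :=
    div_nonneg (by linarith) (sq_nonneg _)
  have h3 : -2 / a ^ 2 < 0 := div_neg_of_neg_of_pos (by norm_num) (by positivity)
  linarith

lemma hasDerivAt_profile (hk : 0 < k) (hz : ∀ i, 0 < (z i).1 ∧ 0 < (z i).2) {a : ℝ} (ha : 0 < a) :
    HasDerivAt (profile z) (k * score z a) a := by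
  have h0 := powSum_zero_pos hk hz a
  have hk' : (k : ℝ) ≠ 0 := by positivity
  have h1 := ((hasDerivAt_const a (2 * (k : ℝ))).div (hasDerivAt_powSum hz 0 a) h0.ne').log
    (by simp only [Pi.div_apply]; positivity)
  have h2 := (((Real.hasDerivAt_log ha.ne').const_mul (2 * (k : ℝ))).add
    (h1.const_mul (2 * (k : ℝ)))).sub_const (2 * (k : ℝ))
  have h3 := h2.sub (((hasDerivAt_id a).add_const 1).mul_const (logSum z))
  refine h3.congr_deriv ?_
  simp only [score, Pi.div_apply]
  field_simp
  ring

lemma logLik_eq (hz : ∀ i, 0 < (z i).1 ∧ 0 < (z i).2) (a : ℝ) {s : ℝ} :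
    logLik z a s = 2 * k * Real.log a + 2 * k * a * Real.log s - (a + 1) * logSum z
      - s ^ a * powSum z 0 a := by
  rw [logLik, logSum, powSum, Finset.mul_sum, Finset.mul_sum, sub_sub, ← Finset.sum_add_distrib]
  congr 1
  refine Finset.sum_congr rfl fun i _ => ?_
  rw [Real.log_mul (hz i).1.ne' (hz i).2.ne']
  simp

lemma profileScale_pos (hk : 0 < k) (hz : ∀ i, 0 < (z i).1 ∧ 0 < (z i).2) (a : ℝ) :
    0 < profileScale z a := by
  have := powSum_zero_pos hk hz a
  unfold profileScale; positivity

lemma logLik_profileScale (hk : 0 < k) (hz : ∀ i, 0 < (z i).1 ∧ 0 < (z i).2) {a : ℝ} (ha : 0 < a) :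
    logLik z a (profileScale z a) = profile z a := by
  have h0 := powSum_zero_pos hk hz a
  rw [logLik_eq hz, profile, profileScale, ← Real.rpow_mul (by positivity), one_div,
    inv_mul_cancel₀ ha.ne', Real.rpow_one, div_mul_cancel₀ _ h0.ne', Real.log_rpow (by positivity)]
  field_simp
  ring

/-- With u = s^a ∑ y^(-a) / (2k) the deficit is 2k(u - 1 - log u), which is nonnegative and vanishes
only at u = 1. -/
lemma logLik_le_profile (hk : 0 < k) (hz : ∀ i, 0 < (z i).1 ∧ 0 < (z i).2) {a s : ℝ}
    (ha : 0 < a) (hs : 0 < s) :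
    logLik z a s ≤ profile z a ∧ (logLik z a s = profile z a → s = profileScale z a) := by
  have h0 := powSum_zero_pos hk hz a
  have hk' : (0 : ℝ) < k := by positivity
  set u := s ^ a * powSum z 0 a / (2 * k) with hu
  have hu0 : 0 < u := by positivity
  have hlog : Real.log u = a * Real.log s - Real.log (2 * k / powSum z 0 a) := by
    rw [hu, Real.log_div (by positivity) (by positivity), Real.log_div (by positivity) (by positivity),
      Real.log_mul (by positivity) (by positivity), Real.log_rpow hs]
    ring
  have hdiff : profile z a - logLik z a s = 2 * k * (u - 1 - Real.log u) := by
    rw [logLik_eq hz, profile, hlog, hu]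
    field_simp
    ring
  constructor
  · have := Real.log_le_sub_one_of_pos hu0
    nlinarith
  · intro h
    have hu1 : u = 1 := by
      by_contra hne
      have := Real.log_lt_sub_one_of_pos hu0 hne
      have : 0 < 2 * k * (u - 1 - Real.log u) := mul_pos (by positivity) (by linarith)
      linarith
    rw [hu, div_eq_one_iff_eq (by positivity)] at hu1
    rw [profileScale, ← hu1, mul_div_cancel_right₀ _ h0.ne', ← Real.rpow_mul hs.le, mul_one_div_cancel ha.ne',
      Real.rpow_one]

lemma IsMLE.score_eq_zero (hk : 0 < k) (hz : ∀ i, 0 < (z i).1 ∧ 0 < (z i).2) {θ : ℝ × ℝ}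
    (h : IsMLE z θ) : score z θ.1 = 0 := by
  obtain ⟨h1, h2, h3⟩ := h
  have hmax : IsLocalMax (profile z) θ.1 := by
    filter_upwards [Ioi_mem_nhds h1] with a ha
    rw [← logLik_profileScale hk hz ha]
    exact (h3 a _ ha (profileScale_pos hk hz a)).trans (logLik_le_profile hk hz h1 h2).1
  have := hmax.hasDerivAt_eq_zero (hasDerivAt_profile hk hz h1)
  have hk' : (k : ℝ) ≠ 0 := by positivity
  simpa [hk'] using this

/-- The profile likelihood has derivative k times the score. Strict decrease makes it rise before
the zero and fall after it, so a zero of the score yields a global maximum; conversely a maximizer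
must be a zero of the score, and its scale is forced. -/
lemma isMLE_iff (hk : 0 < k) (hz : ∀ i, 0 < (z i).1 ∧ 0 < (z i).2) {a : ℝ} (ha : 0 < a)
    (hs : score z a = 0) (θ : ℝ × ℝ) : IsMLE z θ ↔ θ = (a, profileScale z a) := by
  have hanti := strictAntiOn_score hk hz
  constructor
  · intro h
    have h1 : θ.1 = a := hanti.injOn h.1 ha (by rw [h.score_eq_zero hk hz, hs])
    have h2 := logLik_le_profile hk hz h.1 h.2.1
    have h3 := h.2.2 θ.1 _ h.1 (profileScale_pos hk hz θ.1)
    rw [logLik_profileScale hk hz h.1] at h3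
    have h4 := h2.2 (le_antisymm h2.1 h3)
    exact Prod.ext h1 (by rw [h4, h1])
  · rintro rfl
    refine ⟨ha, profileScale_pos hk hz a, fun b s hb hs' => ?_⟩
    refine (logLik_le_profile hk hz hb hs').1.trans ?_
    simp only
    rw [logLik_profileScale hk hz ha]
    have hk' : (0 : ℝ) < k := by positivity
    have hc : ∀ x, 0 < x → ContinuousAt (profile z) x := fun x hx =>
      (hasDerivAt_profile hk hz hx).continuousAt
    rcases le_total b a with hba | hab
    · refine monotoneOn_of_deriv_nonneg (convex_Icc b a)
        (fun x hx => (hc x (hb.trans_le hx.1)).continuousWithinAt) (fun x hx => ?_) (fun x hx => ?_)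
        (left_mem_Icc.2 hba) (right_mem_Icc.2 hba) hba
      · rw [interior_Icc] at hx
        exact (hasDerivAt_profile hk hz (hb.trans hx.1)).differentiableAt.differentiableWithinAt
      · rw [interior_Icc] at hx
        rw [(hasDerivAt_profile hk hz (hb.trans hx.1)).deriv]
        have := hanti (hb.trans hx.1) ha hx.2
        rw [hs] at this
        positivity
    · refine antitoneOn_of_deriv_nonpos (convex_Icc a b)
        (fun x hx => (hc x (ha.trans_le hx.1)).continuousWithinAt) (fun x hx => ?_) (fun x hx => ?_)
        (left_mem_Icc.2 hab) (right_mem_Icc.2 hab) hab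
      · rw [interior_Icc] at hx
        exact (hasDerivAt_profile hk hz (ha.trans hx.1)).differentiableAt.differentiableWithinAt
      · rw [interior_Icc] at hx
        rw [(hasDerivAt_profile hk hz (ha.trans hx.1)).deriv]
        have := hanti ha (ha.trans hx.1) hx.1
        rw [hs] at this
        exact mul_nonpos_of_nonneg_of_nonpos hk'.le this.le

lemma mle_eq_of_score_eq_zero (hk : 0 < k) (hz : ∀ i, 0 < (z i).1 ∧ 0 < (z i).2) {a : ℝ}
    (ha : 0 < a) (hs : score z a = 0) :
    (∃! θ, IsMLE z θ) ∧ mle z = (a, profileScale z a) := by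
  have h := isMLE_iff hk hz ha hs
  have hex : ∃! θ, IsMLE z θ := ⟨_, (h _).2 rfl, fun θ hθ => (h θ).1 hθ⟩
  refine ⟨hex, ?_⟩
  rw [mle, dif_pos hex]
  exact (h _).1 hex.choose_spec.1

lemma existsUnique_isMLE_iff (hk : 0 < k) (hz : ∀ i, 0 < (z i).1 ∧ 0 < (z i).2) :
    (∃! θ, IsMLE z θ) ↔ ∃ a, 0 < a ∧ score z a = 0 :=
  ⟨fun ⟨θ, h, _⟩ => ⟨θ.1, h.1, h.score_eq_zero hk hz⟩,
    fun ⟨_, ha, hs⟩ => (mle_eq_of_score_eq_zero hk hz ha hs).1⟩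

lemma exists_score_eq_zero (hk : 0 < k) (hz : ∀ i, 0 < (z i).1 ∧ 0 < (z i).2) {a b : ℝ}
    (ha : 0 < a) (hab : a ≤ b) (h1 : 0 ≤ score z a) (h2 : score z b ≤ 0) :
    ∃ x ∈ Icc a b, score z x = 0 :=
  intermediate_value_Icc' hab (fun x hx =>
    (hasDerivAt_score hk hz (ha.trans_le hx.1)).continuousAt.continuousWithinAt) ⟨h2, h1⟩

/-! ### Scale equivariance of the estimator. -/

section Scaling

/-- The sample, divided by `s`. -/
def scaleSample (s : ℝ) (z : Fin k → ℝ × ℝ) : Fin k → ℝ × ℝ := fun i => ((z i).1 / s, (z i).2 / s)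

lemma scaleSample_pos {s : ℝ} (hs : 0 < s) (hz : ∀ i, 0 < (z i).1 ∧ 0 < (z i).2) (i : Fin k) :
    0 < (scaleSample s z i).1 ∧ 0 < (scaleSample s z i).2 :=
  ⟨div_pos (hz i).1 hs, div_pos (hz i).2 hs⟩

lemma powSum_scaleSample_zero {s : ℝ} (hs : 0 < s) (hz : ∀ i, 0 < (z i).1 ∧ 0 < (z i).2) (b : ℝ) :
    powSum (scaleSample s z) 0 b = s ^ b * powSum z 0 b := by
  simp only [powSum, scaleSample, Finset.mul_sum, pow_zero, mul_one]
  refine Finset.sum_congr rfl fun i _ => ?_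
  rw [Real.div_rpow (hz i).2.le hs.le, Real.rpow_neg hs.le, div_inv_eq_mul, mul_comm]

lemma powSum_scaleSample_one {s : ℝ} (hs : 0 < s) (hz : ∀ i, 0 < (z i).1 ∧ 0 < (z i).2) (b : ℝ) :
    powSum (scaleSample s z) 1 b = s ^ b * (powSum z 1 b - Real.log s * powSum z 0 b) := by
  simp only [powSum, scaleSample, Finset.mul_sum, pow_zero, mul_one, pow_one, ← Finset.sum_sub_distrib]
  refine Finset.sum_congr rfl fun i _ => ?_
  rw [Real.div_rpow (hz i).2.le hs.le, Real.rpow_neg hs.le, div_inv_eq_mul,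
    Real.log_div (hz i).2.ne' hs.ne']
  ring

lemma logSum_scaleSample {s : ℝ} (hs : 0 < s) (hz : ∀ i, 0 < (z i).1 ∧ 0 < (z i).2) :
    logSum (scaleSample s z) = logSum z - k * (2 * Real.log s) := by
  have : (k : ℝ) * (2 * Real.log s) = ∑ _i : Fin k, 2 * Real.log s := by simp
  rw [logSum, logSum, this, ← Finset.sum_sub_distrib]
  refine Finset.sum_congr rfl fun i _ => ?_
  simp only [scaleSample]
  rw [Real.log_div (hz i).1.ne' hs.ne', Real.log_div (hz i).2.ne' hs.ne']
  ring

/-- The ratio of power sums changes by -log s and the mean of log(xy) by -2 log s, and these cancel.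
The estimator can therefore be studied on the sample divided by the unknown scale. -/
lemma score_scaleSample (hk : 0 < k) {s : ℝ} (hs : 0 < s) (hz : ∀ i, 0 < (z i).1 ∧ 0 < (z i).2)
    (a : ℝ) : score (scaleSample s z) a = score z a := by
  have h0 := (powSum_zero_pos hk hz a).ne'
  have hk' : (k : ℝ) ≠ 0 := by positivity
  have hsa := (Real.rpow_pos_of_pos hs a).ne'
  rw [score, score, powSum_scaleSample_zero hs hz, powSum_scaleSample_one hs hz,
    logSum_scaleSample hs hz]
  field_simp
  ring

lemma profileScale_scaleSample (hk : 0 < k) {s : ℝ} (hs : 0 < s)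
    (hz : ∀ i, 0 < (z i).1 ∧ 0 < (z i).2) {a : ℝ} (ha : 0 < a) :
    profileScale (scaleSample s z) a = profileScale z a / s := by
  have h0 := powSum_zero_pos hk hz a
  rw [profileScale, profileScale, powSum_scaleSample_zero hs hz, mul_comm (s ^ a), ← div_div,
    Real.div_rpow (by positivity) (by positivity), ← Real.rpow_mul hs.le, mul_one_div_cancel ha.ne',
    Real.rpow_one]

/-- The estimator is located by the signs of the score of a rescaled sample. -/
lemma mle_of_score_sign (hk : 0 < k) {s : ℝ} (hs : 0 < s) (hz : ∀ i, 0 < (z i).1 ∧ 0 < (z i).2)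
    {a b : ℝ} (ha : 0 < a) (hab : a ≤ b) (h1 : 0 ≤ score (scaleSample s z) a)
    (h2 : score (scaleSample s z) b ≤ 0) :
    (∃! θ, IsMLE z θ) ∧ (mle z).1 ∈ Icc a b ∧ score (scaleSample s z) (mle z).1 = 0 ∧
      (mle z).2 / s = profileScale (scaleSample s z) (mle z).1 := by
  obtain ⟨x, hx, hx0⟩ := exists_score_eq_zero hk (scaleSample_pos hs hz) ha hab h1 h2
  have hx0' := hx0
  rw [score_scaleSample hk hs hz] at hx0'
  have hxp : 0 < x := ha.trans_le hx.1
  obtain ⟨h3, h4⟩ := mle_eq_of_score_eq_zero hk hz hxp hx0'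
  rw [h4]
  exact ⟨h3, hx, hx0, (profileScale_scaleSample hk hs hz hxp).symm⟩

end Scaling

/-! ### Measurability of the estimator. -/

section Measurability

variable {Ω : Type*} [MeasurableSpace Ω] {Z : Ω → Fin k → ℝ × ℝ}

lemma measurable_powSum_comp (hZ : ∀ i, Measurable fun w => Z w i) (j : ℕ) {f : Ω → ℝ}
    (hf : Measurable f) : Measurable fun w => powSum (Z w) j (f w) := by
  unfold powSum
  refine Finset.measurable_sum _ fun i _ => ?_
  have h := (hZ i).snd
  exact (h.pow hf.neg).mul ((Real.measurable_log.comp h).pow_const j)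

lemma measurable_score_comp (hZ : ∀ i, Measurable fun w => Z w i) (a : ℝ) :
    Measurable fun w => score (Z w) a := by
  unfold score logSum
  have h1 := measurable_powSum_comp hZ 1 (measurable_const (a := a))
  have h0 := measurable_powSum_comp hZ 0 (measurable_const (a := a))
  refine (((h1.div h0).const_mul 2).const_add _).sub (Measurable.div_const ?_ _)
  exact Finset.measurable_sum _ fun i _ =>
    (Real.measurable_log.comp (hZ i).fst).add (Real.measurable_log.comp (hZ i).snd)

/-- The estimator is a measurable function of the sample. -/
theorem measurable_mle_comp (hZ : ∀ i, Measurable fun w => Z w i)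
    (hpos : ∀ w i, 0 < (Z w i).1 ∧ 0 < (Z w i).2) : Measurable fun w => mle (Z w) := by
  classical
  rcases Nat.eq_zero_or_pos k with rfl | hk
  · have : (fun w => mle (Z w)) = fun _ => mle (fun i : Fin 0 => i.elim0) := by
      funext w
      congr 1
      exact Subsingleton.elim _ _
    rw [this]; exact measurable_const
  set E : Set Ω := {w | ∃! θ, IsMLE (Z w) θ} with hE
  -- By strict monotonicity and continuity a zero exists exactly when the score changes sign, in the
  -- weak sense, between two positive rationals. This makes existence a countable union of
  -- measurable conditions.
  have hEeq : E = ⋃ a : ℚ, ⋃ b : ℚ, {w | 0 < (a : ℝ) ∧ (a : ℝ) ≤ b ∧ 0 ≤ score (Z w) a ∧ score (Z w) b ≤ 0} := by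
    ext w
    simp only [hE, mem_ofPred_eq, mem_iUnion, existsUnique_isMLE_iff hk (hpos w)]
    constructor
    · rintro ⟨x, hx, hx0⟩
      obtain ⟨a, ha0, hax⟩ := exists_rat_btwn hx
      obtain ⟨b, hb, -⟩ := exists_rat_btwn (show x < x + 1 by linarith)
      have h1 := strictAntiOn_score hk (hpos w) ha0 hx hax
      have h2 := strictAntiOn_score hk (hpos w) hx (hx.trans hb) hb
      exact ⟨a, b, ha0, by linarith, by linarith, by linarith⟩
    · rintro ⟨a, b, h1, h2, h3, h4⟩
      obtain ⟨x, hx, hx0⟩ := exists_score_eq_zero hk (hpos w) h1 h2 h3 h4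
      exact ⟨x, h1.trans_le hx.1, hx0⟩
  have hEm : MeasurableSet E := by
    rw [hEeq]
    refine MeasurableSet.iUnion fun a => MeasurableSet.iUnion fun b => ?_
    exact (MeasurableSet.const _).inter ((MeasurableSet.const _).inter
      ((measurableSet_le measurable_const (measurable_score_comp hZ a)).inter
        (measurableSet_le (measurable_score_comp hZ b) measurable_const)))
  have hoff : ∀ w, w ∉ E → mle (Z w) = 0 := fun w hw => by
    have hw' : ¬ ∃! θ, IsMLE (Z w) θ := hw
    rw [mle, dif_neg hw']
  have hon : ∀ w, w ∈ E → 0 < (mle (Z w)).1 ∧ score (Z w) (mle (Z w)).1 = 0 ∧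
      mle (Z w) = ((mle (Z w)).1, profileScale (Z w) (mle (Z w)).1) := fun w hw => by
    obtain ⟨x, hx, hx0⟩ := (existsUnique_isMLE_iff hk (hpos w)).1 hw
    have := (mle_eq_of_score_eq_zero hk (hpos w) hx hx0).2
    rw [this]
    exact ⟨hx, hx0, rfl⟩
  have h1 : Measurable fun w => (mle (Z w)).1 := by
    refine measurable_of_Iic fun t => ?_
    -- As the score decreases through its zero, the zero is at most t exactly when the score at t is
    -- nonpositive. Off E the estimator has the default value 0, which accounts for the second set.
    have : (fun w => (mle (Z w)).1) ⁻¹' Iic t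
        = (E ∩ {w | 0 < t ∧ score (Z w) t ≤ 0}) ∪ (Eᶜ ∩ {w | 0 ≤ t}) := by
      ext w
      simp only [mem_preimage, mem_Iic, mem_union, mem_inter_iff, mem_ofPred_eq, mem_compl_iff]
      by_cases hw : w ∈ E
      · obtain ⟨h1, h2, -⟩ := hon w hw
        simp only [hw, true_and, not_true_eq_false, false_and, or_false]
        constructor
        · intro h
          refine ⟨h1.trans_le h, ?_⟩
          rw [← h2]
          exact (strictAntiOn_score hk (hpos w)).antitoneOn h1 (h1.trans_le h) h
        · rintro ⟨ht, hs⟩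
          by_contra hlt
          have := strictAntiOn_score hk (hpos w) ht h1 (not_le.1 hlt)
          linarith
      · simp [hw, hoff w hw]
    rw [this]
    exact (hEm.inter ((MeasurableSet.const _).inter
      (measurableSet_le (measurable_score_comp hZ t) measurable_const))).union
      (hEm.compl.inter (MeasurableSet.const _))
  have h2 : Measurable fun w => (mle (Z w)).2 := by
    have : (fun w => (mle (Z w)).2) = fun w =>
        if w ∈ E then (2 * k / powSum (Z w) 0 (mle (Z w)).1) ^ (1 / (mle (Z w)).1) else 0 := by
      funext w
      split_ifs with hw
      · exact congrArg Prod.snd (hon w hw).2.2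
      · rw [hoff w hw]; rfl
    rw [this]
    exact Measurable.ite hEm ((measurable_const.div (measurable_powSum_comp hZ 0 h1)).pow
      (measurable_const.div h1)) measurable_const
  exact h1.prodMk h2

end Measurability

end Likelihood

/-! ### The delta method along a filter -/

section DeltaMethod

open Asymptotics

/-- Taylor's estimate from two mean value inequalities; the constant R in place of R/2 is enough. -/
lemma abs_sub_sub_le_of_second_deriv {f f' f'' : ℝ → ℝ} {x₀ x η R : ℝ}
    (hf : ∀ y, |y - x₀| ≤ η → HasDerivAt f (f' y) y)
    (hf' : ∀ y, |y - x₀| ≤ η → HasDerivAt f' (f'' y) y) (hR : ∀ y, |y - x₀| ≤ η → |f'' y| ≤ R)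
    (hx : |x - x₀| ≤ η) : |f x - f x₀ - f' x₀ * (x - x₀)| ≤ R * (x - x₀) ^ 2 := by
  have hsub : ∀ y ∈ uIcc x₀ x, |y - x₀| ≤ |x - x₀| := fun y hy => abs_sub_left_of_mem_uIcc hy
  have h1 : ∀ y ∈ uIcc x₀ x, |f' y - f' x₀| ≤ R * |x - x₀| := by
    intro y hy
    have := (convex_uIcc x₀ x).norm_image_sub_le_of_norm_hasDerivWithin_le (f := f') (f' := f'') (C := R)
      (fun u hu => (hf' u ((hsub u hu).trans hx)).hasDerivWithinAt)
      (fun u hu => hR u ((hsub u hu).trans hx)) left_mem_uIcc hy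
    refine this.trans ?_
    have hR0 : 0 ≤ R := (abs_nonneg _).trans (hR x hx)
    exact mul_le_mul_of_nonneg_left (hsub y hy) hR0
  have h2 := (convex_uIcc x₀ x).norm_image_sub_le_of_norm_hasDerivWithin_le
    (f := fun y => f y - f' x₀ * (y - x₀)) (f' := fun y => f' y - f' x₀) (C := R * |x - x₀|)
    (fun u hu => by
      have := ((hf u ((hsub u hu).trans hx)).sub (((hasDerivAt_id u).sub_const x₀).const_mul (f' x₀)))
      rw [mul_one] at this
      exact this.hasDerivWithinAt)
    (fun u hu => h1 u hu) left_mem_uIcc right_mem_uIcc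
  simp only [sub_self, mul_zero, sub_zero, Real.norm_eq_abs] at h2
  calc |f x - f x₀ - f' x₀ * (x - x₀)| = |f x - f' x₀ * (x - x₀) - f x₀| := by congr 1; ring
    _ ≤ R * |x - x₀| * |x - x₀| := h2
    _ = R * (x - x₀) ^ 2 := by rw [mul_assoc, ← sq, sq_abs]

/-- Linearization of the solution of a likelihood equation and of the plug-in scale. -/
theorem isLittleO_of_likelihood_equation {ι : Type*} {l : Filter ι} {a p q p' q' L : ι → ℝ}
    {α p₀ q₀ t₀ L₀ D : ℝ} (hα : 0 < α) (hp₀ : 0 < p₀)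
    (ha : Tendsto a l (𝓝 α)) (hp : Tendsto p l (𝓝 p₀)) (hq : Tendsto q l (𝓝 q₀))
    (hp' : (fun i => p' i - p i + q₀ * (a i - α)) =o[l] fun i => a i - α)
    (hq' : (fun i => q' i - q i + t₀ * (a i - α)) =o[l] fun i => a i - α)
    (heq : ∀ᶠ i in l, 2 / a i + 2 * (q' i / p' i) = L i) (h₀ : 2 / α + 2 * (q₀ / p₀) = L₀)
    (hD : D = -2 / α ^ 2 - 2 * t₀ / p₀ + 2 * q₀ ^ 2 / p₀ ^ 2) (hD0 : D ≠ 0) :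
    ((fun i => (a i - α) - (-2 / p₀ * (q i - q₀) + 2 * q₀ / p₀ ^ 2 * (p i - p₀) + (L i - L₀)) / D)
      =o[l] fun i => |q i - q₀| + |p i - p₀| + |L i - L₀|) ∧
    ((fun i => (2 / p' i) ^ (1 / a i) - (2 / p₀) ^ (1 / α) - (2 / p₀) ^ (1 / α) *
        ((-Real.log (2 / p₀) / α ^ 2 + q₀ / (α * p₀)) *
          ((-2 / p₀ * (q i - q₀) + 2 * q₀ / p₀ ^ 2 * (p i - p₀) + (L i - L₀)) / D)
          - (p i - p₀) / (α * p₀)))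
      =o[l] fun i => |q i - q₀| + |p i - p₀| + |L i - L₀|) := by
  -- The size of the input errors. The unknown δ = a - α also enters the remainders, so these are
  -- first measured against E = |δ| + e.
  set e : ι → ℝ := fun i => |q i - q₀| + |p i - p₀| + |L i - L₀| with he
  set δ : ι → ℝ := fun i => a i - α with hδ
  set E : ι → ℝ := fun i => |δ i| + e i with hE
  set lin : ι → ℝ := fun i => -2 / p₀ * (q i - q₀) + 2 * q₀ / p₀ ^ 2 * (p i - p₀) + (L i - L₀) with hlin
  have he0 : ∀ i, 0 ≤ e i := fun i => by positivity
  have hO : ∀ f : ι → ℝ, (∀ i, |f i| ≤ E i) → f =O[l] E := fun f hf =>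
    IsBigO.of_bound 1 (Eventually.of_forall fun i => by
      rw [one_mul, Real.norm_eq_abs, Real.norm_eq_abs]
      exact (hf i).trans (le_abs_self _))
  have hOe : ∀ f : ι → ℝ, (∀ i, |f i| ≤ e i) → f =O[l] e := fun f hf =>
    IsBigO.of_bound 1 (Eventually.of_forall fun i => by
      rw [one_mul, Real.norm_eq_abs, Real.norm_eq_abs]
      exact (hf i).trans (le_abs_self _))
  have hδE : δ =O[l] E := hO _ fun i => by simp only [hE]; linarith [he0 i]
  have hqe : (fun i => q i - q₀) =O[l] e := hOe _ fun i => by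
    simp only [he]; linarith [abs_nonneg (p i - p₀), abs_nonneg (L i - L₀)]
  have hpe : (fun i => p i - p₀) =O[l] e := hOe _ fun i => by
    simp only [he]; linarith [abs_nonneg (q i - q₀), abs_nonneg (L i - L₀)]
  have hLe : (fun i => L i - L₀) =O[l] e := hOe _ fun i => by
    simp only [he]; linarith [abs_nonneg (p i - p₀), abs_nonneg (q i - q₀)]
  have heE : e =O[l] E := hO _ fun i => by
    rw [abs_of_nonneg (he0 i)]; simp only [hE]; linarith [abs_nonneg (δ i)]
  have hδ0 : Tendsto δ l (𝓝 0) := by simpa [hδ] using ha.sub_const α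
  have hp'E := hp'.trans_isBigO hδE
  have hq'E := hq'.trans_isBigO hδE
  have hup : (fun i => p' i - p₀) =O[l] E := by
    have := (hp'E.isBigO.sub (hδE.const_mul_left q₀)).add (hpe.trans heE)
    refine this.congr_left fun i => ?_
    simp only [hδ]; ring
  have huq : (fun i => q' i - q₀) =O[l] E := by
    have := (hq'E.isBigO.sub (hδE.const_mul_left t₀)).add (hqe.trans heE)
    refine this.congr_left fun i => ?_
    simp only [hδ]; ring
  have htp' : Tendsto p' l (𝓝 p₀) := by
    have h1 := hp'.trans_tendsto hδ0
    have h2 := (h1.add hp).sub (hδ0.const_mul q₀)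
    simp only [zero_add, mul_zero, sub_zero] at h2
    refine h2.congr fun i => ?_
    simp only [hδ]; ring
  have htq' : Tendsto q' l (𝓝 q₀) := by
    have h1 := hq'.trans_tendsto hδ0
    have h2 := (h1.add hq).sub (hδ0.const_mul t₀)
    simp only [zero_add, mul_zero, sub_zero] at h2
    refine h2.congr fun i => ?_
    simp only [hδ]; ring
  have hx : Tendsto (fun i => (a i, p' i, q' i)) l (𝓝 (α, p₀, q₀)) :=
    ha.prodMk_nhds (htp'.prodMk_nhds htq')
  have hxE : (fun i => (a i, p' i, q' i) - (α, p₀, q₀)) =O[l] E :=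
    (hδE.prod_left (hup.prod_left huq)).congr_left fun i => by simp [hδ]
  set A := ContinuousLinearMap.fst ℝ ℝ (ℝ × ℝ)
  set A' := (ContinuousLinearMap.fst ℝ ℝ ℝ).comp (ContinuousLinearMap.snd ℝ ℝ (ℝ × ℝ))
  set A'' := (ContinuousLinearMap.snd ℝ ℝ ℝ).comp (ContinuousLinearMap.snd ℝ ℝ (ℝ × ℝ))
  have hA : HasFDerivAt A A (α, p₀, q₀) := A.hasFDerivAt
  have hA' : HasFDerivAt A' A' (α, p₀, q₀) := A'.hasFDerivAt
  have hA'' : HasFDerivAt A'' A'' (α, p₀, q₀) := A''.hasFDerivAt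
  -- Differentiability of (a, p, q) ↦ 2/a + 2q/p at (α, p₀, q₀). With p and q moving with slopes -q₀
  -- and -t₀ along a, the total slope in a is D, by which one divides.
  have h1 : (fun i => δ i - lin i / D) =o[l] E := by
    have hF := (((hasDerivAt_inv hα.ne').comp_hasFDerivAt (α, p₀, q₀) hA).const_mul 2).add
      ((hA''.mul ((hasDerivAt_inv hp₀.ne').comp_hasFDerivAt (α, p₀, q₀) hA')).const_mul 2)
    have h2 := (hF.isLittleO.comp_tendsto hx).trans_isBigO hxE
    have h3 := (h2.add ((hq'E.const_mul_left (2 / p₀)).sub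
      (hp'E.const_mul_left (2 * q₀ / p₀ ^ 2)))).const_mul_left (-1 / D)
    refine h3.congr' ?_ EventuallyEq.rfl
    filter_upwards [heq] with i hi
    have e1 : 2 * (a i)⁻¹ + 2 * (q' i * (p' i)⁻¹) = L i := by rw [← hi]; ring
    have e2 : 2 * α⁻¹ + 2 * (q₀ * p₀⁻¹) = L₀ := by rw [← h₀]; ring
    have hDD : δ i - lin i / D = (-1 / D) * (lin i - D * δ i) := by field_simp; ring
    rw [hDD]
    congr 1
    simp only [Function.comp, A, A', A'', Pi.add_apply, Pi.mul_apply, add_apply,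
      smul_apply, ContinuousLinearMap.comp_apply, ContinuousLinearMap.coe_fst',
      ContinuousLinearMap.coe_snd', Prod.fst_sub, Prod.snd_sub, smul_eq_mul, hlin]
    rw [e1, e2, hD]
    simp only [hδ]
    field_simp
    ring
  have hlinO : lin =O[l] e :=
    ((hqe.const_mul_left _).add (hpe.const_mul_left _)).add hLe
  -- Bootstrap: the remainder is eventually at most half of |δ| + e, so |δ| can be absorbed on the
  -- left and is itself O(e).
  have hEe : E =O[l] e := by
    have h2 : δ =O[l] e := by
      have h3 := (hlinO.const_mul_left (1 / D)).bound
      obtain ⟨C, hC⟩ := h3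
      have h4 := h1.bound (show (0 : ℝ) < 1 / 2 by norm_num)
      refine IsBigO.of_bound (2 * C + 1) ?_
      filter_upwards [hC, h4] with i hi hi'
      simp only [Real.norm_eq_abs] at hi hi' ⊢
      rw [abs_of_nonneg (he0 i)] at hi ⊢
      have hEi : |E i| = |δ i| + e i := by
        simp only [hE]; rw [abs_of_nonneg (by linarith [abs_nonneg (δ i), he0 i])]
      rw [hEi] at hi'
      have h5 : |δ i| ≤ |δ i - lin i / D| + |1 / D * lin i| := by
        have := abs_add_le (δ i - lin i / D) (1 / D * lin i)
        rwa [show δ i - lin i / D + 1 / D * lin i = δ i by ring] at this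
      linarith
    have h3 : (fun i => |δ i|) =O[l] e := h2.abs_left
    exact h3.add (isBigO_refl e l)
  refine ⟨h1.trans_isBigO hEe, ?_⟩
  -- The scale is exp(a⁻¹ log(2/p)). Its derivative is applied to the total increment of p', which
  -- combines the input error p - p₀ with the shift -q₀ δ.
  have hG := ((((hasDerivAt_inv hp₀.ne').comp_hasFDerivAt (α, p₀, q₀) hA').const_mul 2).log
      (by simp [A', hp₀.ne'])).mul
    ((hasDerivAt_inv hα.ne').comp_hasFDerivAt (α, p₀, q₀) hA) |>.exp
  have h2 := (hG.isLittleO.comp_tendsto hx).trans_isBigO hxE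
  set s₁ := (2 / p₀) ^ (1 / α) with hs₁
  have h3 := ((h2.add (h1.const_mul_left (s₁ * (-Real.log (2 / p₀) / α ^ 2 + q₀ / (α * p₀))))).sub
    (hp'E.const_mul_left (s₁ / (α * p₀)))).trans_isBigO hEe
  refine h3.congr' ?_ EventuallyEq.rfl
  filter_upwards [htp'.eventually_const_lt hp₀] with i hi
  have e1 : Real.exp (Real.log (2 * (p' i)⁻¹) * (a i)⁻¹) = (2 / p' i) ^ (1 / a i) := by
    rw [Real.rpow_def_of_pos (by positivity), div_eq_mul_inv, one_div]
  have e2 : Real.exp (Real.log (2 * p₀⁻¹) * α⁻¹) = s₁ := by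
    rw [hs₁, Real.rpow_def_of_pos (by positivity), div_eq_mul_inv, one_div]
  simp only [Function.comp, A, A', Pi.mul_apply, add_apply,
    smul_apply, ContinuousLinearMap.comp_apply, ContinuousLinearMap.coe_fst',
    ContinuousLinearMap.coe_snd', Prod.fst_sub, Prod.snd_sub, smul_eq_mul]
  rw [e1, e2, ← div_eq_mul_inv 2 p₀]
  simp only [hδ, hlin]
  field_simp
  ring

end DeltaMethod

/-! ### Marginals of the Fréchet–Welsch distribution -/

section Marginals

/-- The mixture of the Gamma distributions with shapes `1` and `2`. -/
def gammaMix (ρ₀ : ℝ) : Measure ℝ :=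
  (volume.restrict (Ioi 0)).withDensity
    fun v => ENNReal.ofReal (((1 - ρ₀) + ρ₀ * v) * Real.exp (-v))

variable {ρ₀ : ℝ}

lemma hasDerivAt_gammaMix_tail (ρ₀ v : ℝ) :
    HasDerivAt (fun v => -(Real.exp (-v) * (1 + ρ₀ * v))) (((1 - ρ₀) + ρ₀ * v) * Real.exp (-v)) v := by
  have h := (((hasDerivAt_neg v).exp).mul (((hasDerivAt_id v).const_mul ρ₀).const_add 1)).neg
  refine h.congr_deriv ?_
  simp only [id]
  ring

lemma tendsto_gammaMix_tail (ρ₀ : ℝ) :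
    Tendsto (fun v => -(Real.exp (-v) * (1 + ρ₀ * v))) atTop (𝓝 0) := by
  have h1 := Real.tendsto_exp_neg_atTop_nhds_zero
  have h2 := Real.tendsto_pow_mul_exp_neg_atTop_nhds_zero 1
  have h3 := (h1.add (h2.const_mul ρ₀)).neg
  simp only [mul_zero, add_zero, neg_zero] at h3
  refine h3.congr fun v => ?_
  ring

lemma gammaMix_density_nonneg (h0 : 0 ≤ ρ₀) (h1 : ρ₀ ≤ 1) {v : ℝ} (hv : 0 ≤ v) :
    0 ≤ ((1 - ρ₀) + ρ₀ * v) * Real.exp (-v) :=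
  mul_nonneg (add_nonneg (by linarith) (by positivity)) (Real.exp_pos _).le

/-- This tail is the marginal cdf of Y at y expressed in u = y^(-α), which identifies the law of
Y^(-α). -/
lemma gammaMix_Ici (h0 : 0 ≤ ρ₀) (h1 : ρ₀ ≤ 1) {u : ℝ} (hu : 0 ≤ u) :
    gammaMix ρ₀ (Ici u) = ENNReal.ofReal (Real.exp (-u) * (1 + ρ₀ * u)) := by
  have hnn : ∀ x ∈ Ioi u, 0 ≤ ((1 - ρ₀) + ρ₀ * x) * Real.exp (-x) := fun x hx =>
    gammaMix_density_nonneg h0 h1 (hu.trans (le_of_lt hx))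
  have hI := integral_Ioi_of_hasDerivAt_of_nonneg' (fun x _ => hasDerivAt_gammaMix_tail ρ₀ x) hnn
    (tendsto_gammaMix_tail ρ₀) (a := u)
  have hint := integrableOn_Ioi_deriv_of_nonneg' (fun x _ => hasDerivAt_gammaMix_tail ρ₀ x) hnn
    (tendsto_gammaMix_tail ρ₀) (a := u)
  rw [gammaMix, withDensity_apply _ measurableSet_Ici, Measure.restrict_restrict measurableSet_Ici,
    show (volume.restrict (Ici u ∩ Ioi 0)) = (volume : Measure ℝ).restrict (Ioi u) from ?_]
  · rw [← ofReal_integral_eq_lintegral_ofReal hint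
      ((ae_restrict_mem measurableSet_Ioi).mono hnn), hI]
    congr 1; ring
  · rw [Measure.restrict_congr_set (Ioi_ae_eq_Ici.symm.inter (ae_eq_refl (Ioi (0 : ℝ))) :
      (Ici u ∩ Ioi 0 : Set ℝ) =ᵐ[volume] (Ioi u ∩ Ioi 0 : Set ℝ))]
    rw [inter_eq_left.2 (Ioi_subset_Ioi hu)]

lemma gammaMix_compl_Ioi : gammaMix ρ₀ (Iic 0) = 0 := by
  rw [gammaMix, withDensity_apply _ measurableSet_Iic, Measure.restrict_restrict measurableSet_Iic,
    show Iic (0 : ℝ) ∩ Ioi 0 = ∅ by ext; simp]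
  simp

lemma ae_pos_gammaMix : ∀ᵐ v ∂gammaMix ρ₀, 0 < v := by
  rw [ae_iff]
  rw [show {a : ℝ | ¬ 0 < a} = Iic 0 by ext; simp]
  exact gammaMix_compl_Ioi

lemma isProbabilityMeasure_gammaMix (h0 : 0 ≤ ρ₀) (h1 : ρ₀ ≤ 1) :
    IsProbabilityMeasure (gammaMix ρ₀) := by
  refine ⟨?_⟩
  rw [← measure_congr (s := Ici (0 : ℝ)) ?_, gammaMix_Ici h0 h1 le_rfl]
  · simp
  · rw [eventuallyEq_univ]
    filter_upwards [ae_pos_gammaMix] with v hv using hv.le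

lemma integral_gammaMix (h0 : 0 ≤ ρ₀) (h1 : ρ₀ ≤ 1) (g : ℝ → ℝ) :
    ∫ v, g v ∂gammaMix ρ₀ = ∫ v in Ioi 0, ((1 - ρ₀) + ρ₀ * v) * Real.exp (-v) * g v := by
  rw [gammaMix, integral_withDensity_eq_integral_toReal_smul (by fun_prop)
    (ae_of_all _ fun _ => ENNReal.ofReal_lt_top)]
  refine setIntegral_congr_fun measurableSet_Ioi fun v hv => ?_
  simp only [smul_eq_mul]
  rw [ENNReal.toReal_ofReal (gammaMix_density_nonneg h0 h1 (le_of_lt hv))]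

lemma integrable_gammaMix_iff (h0 : 0 ≤ ρ₀) (h1 : ρ₀ ≤ 1) {g : ℝ → ℝ} :
    Integrable g (gammaMix ρ₀) ↔
      IntegrableOn (fun v => ((1 - ρ₀) + ρ₀ * v) * Real.exp (-v) * g v) (Ioi 0) := by
  rw [gammaMix, integrable_withDensity_iff_integrable_smul' (by fun_prop)
    (ae_of_all _ fun _ => ENNReal.ofReal_lt_top), IntegrableOn]
  refine integrable_congr ?_
  filter_upwards [ae_restrict_mem measurableSet_Ioi] with v hv
  simp only [smul_eq_mul]
  rw [ENNReal.toReal_ofReal (gammaMix_density_nonneg h0 h1 (le_of_lt hv))]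

lemma gammaMix_exp_mul_log {s : ℝ} :
    EqOn (fun v => ((1 - ρ₀) + ρ₀ * v) * Real.exp (-v) * Real.exp (s * Real.log v))
      (fun v => (1 - ρ₀) * (Real.exp (-v) * v ^ ((s + 1) - 1))
        + ρ₀ * (Real.exp (-v) * v ^ ((s + 2) - 1))) (Ioi 0) := by
  intro v hv
  have hv' : 0 < v := hv
  simp only
  rw [mul_comm s, ← Real.rpow_def_of_pos hv', show s + 2 - 1 = s + 1 by ring, add_sub_cancel_right,
    Real.rpow_add hv', Real.rpow_one]
  ring

lemma mem_integrableExpSet_log (h0 : 0 ≤ ρ₀) (h1 : ρ₀ ≤ 1) {s : ℝ} (hs : -1 < s) :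
    s ∈ integrableExpSet Real.log (gammaMix ρ₀) := by
  change Integrable _ _
  rw [integrable_gammaMix_iff h0 h1]
  refine IntegrableOn.congr_fun ?_ gammaMix_exp_mul_log.symm measurableSet_Ioi
  exact ((Real.GammaIntegral_convergent (by linarith)).const_mul _).add
    ((Real.GammaIntegral_convergent (by linarith)).const_mul _)

lemma mem_interior_integrableExpSet_log (h0 : 0 ≤ ρ₀) (h1 : ρ₀ ≤ 1) {s : ℝ} (hs : -1 < s) :
    s ∈ interior (integrableExpSet Real.log (gammaMix ρ₀)) :=
  mem_interior.2 ⟨Ioi (-1), fun _ h => mem_integrableExpSet_log h0 h1 h, isOpen_Ioi, hs⟩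

/-- Reading Υ as the moment generating function of log V makes it smooth on (-1, ∞), with
derivatives equal to the moments E[V^s (log V)^j]; differentiation under the integral comes with the
theory of generating functions. -/
lemma mgf_log_gammaMix (h0 : 0 ≤ ρ₀) (h1 : ρ₀ ≤ 1) {s : ℝ} (hs : -1 < s) :
    mgf Real.log (gammaMix ρ₀) s = Upsilon ρ₀ s := by
  rw [mgf, integral_gammaMix h0 h1, setIntegral_congr_fun measurableSet_Ioi gammaMix_exp_mul_log,
    integral_add ((Real.GammaIntegral_convergent (by linarith)).const_mul _)
      ((Real.GammaIntegral_convergent (by linarith)).const_mul _),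
    integral_const_mul, integral_const_mul, ← Real.Gamma_eq_integral (by linarith),
    ← Real.Gamma_eq_integral (by linarith), Upsilon]
  ring

lemma mgf_log_gammaMix_eventuallyEq (h0 : 0 ≤ ρ₀) (h1 : ρ₀ ≤ 1) {s : ℝ} (hs : -1 < s) :
    Upsilon ρ₀ =ᶠ[𝓝 s] mgf Real.log (gammaMix ρ₀) := by
  filter_upwards [Ioi_mem_nhds hs] with x hx using (mgf_log_gammaMix h0 h1 hx).symm

lemma iteratedDeriv_Upsilon (h0 : 0 ≤ ρ₀) (h1 : ρ₀ ≤ 1) {s : ℝ} (hs : -1 < s) (j : ℕ) :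
    ∫ v, Real.log v ^ j * Real.exp (s * Real.log v) ∂gammaMix ρ₀ = iteratedDeriv j (Upsilon ρ₀) s := by
  have h2 := iteratedDeriv_mgf (mem_interior_integrableExpSet_log h0 h1 hs) j
  rw [← h2, ((mgf_log_gammaMix_eventuallyEq h0 h1 hs).iteratedDeriv_eq j)]

lemma hasDerivAt_iteratedDeriv_Upsilon (h0 : 0 ≤ ρ₀) (h1 : ρ₀ ≤ 1) {s : ℝ} (hs : -1 < s) (j : ℕ) :
    HasDerivAt (iteratedDeriv j (Upsilon ρ₀)) (iteratedDeriv (j + 1) (Upsilon ρ₀) s) s := by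
  have h2 := hasDerivAt_iteratedDeriv_mgf (mem_interior_integrableExpSet_log h0 h1 hs) j
  rw [← iteratedDeriv_mgf (mem_interior_integrableExpSet_log h0 h1 hs),
    ← ((mgf_log_gammaMix_eventuallyEq h0 h1 hs).iteratedDeriv_eq (j + 1))] at h2
  refine h2.congr_of_eventuallyEq ?_
  filter_upwards [Ioi_mem_nhds hs] with x hx
  exact (mgf_log_gammaMix_eventuallyEq h0 h1 hx).iteratedDeriv_eq j

lemma integrable_log_pow_mul_exp (h0 : 0 ≤ ρ₀) (h1 : ρ₀ ≤ 1) {s : ℝ} (hs : -1 < s) (j : ℕ) :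
    Integrable (fun v => Real.log v ^ j * Real.exp (s * Real.log v)) (gammaMix ρ₀) :=
  integrable_pow_mul_exp_of_mem_interior_integrableExpSet (mem_interior_integrableExpSet_log h0 h1 hs) j

lemma iteratedDeriv_Upsilon_one (ρ₀ s : ℝ) : iteratedDeriv 1 (Upsilon ρ₀) s = deriv (Upsilon ρ₀) s := by
  rw [iteratedDeriv_one]

lemma iteratedDeriv_Upsilon_two (ρ₀ s : ℝ) :
    iteratedDeriv 2 (Upsilon ρ₀) s = deriv (deriv (Upsilon ρ₀)) s := by
  rw [iteratedDeriv_succ, iteratedDeriv_one]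

/-- The law of `Z^{-α}` when the cdf of `Z` is a marginal cdf of a Fréchet–Welsch distribution. -/
lemma map_rpow_eq_gammaMix {E : Type*} [MeasurableSpace E] {H : Measure E} [IsProbabilityMeasure H]
    {Z : E → ℝ} (hZ : Measurable Z) (hpos : ∀ᵐ p ∂H, 0 < Z p) {α : ℝ} (hα : 0 < α)
    (h0 : 0 ≤ ρ₀) (h1 : ρ₀ ≤ 1)
    (hcdf : ∀ z, 0 < z → H {p | Z p ≤ z} = ENNReal.ofReal (Real.exp (-z ^ (-α)) * (1 + ρ₀ * z ^ (-α)))) :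
    H.map (fun p => Z p ^ (-α)) = gammaMix ρ₀ := by
  have := isProbabilityMeasure_gammaMix h0 h1
  have hm : Measurable fun p => Z p ^ (-α) := hZ.pow_const _
  have := Measure.isProbabilityMeasure_map (μ := H) hm.aemeasurable
  refine Measure.ext_of_Ici _ _ fun u => ?_
  rw [Measure.map_apply hm measurableSet_Ici]
  rcases le_or_gt u 0 with hu | hu
  · have e1 : H ((fun p => Z p ^ (-α)) ⁻¹' Ici u) = 1 := by
      rw [← mem_ae_iff_prob_eq_one (hm measurableSet_Ici)]
      filter_upwards [hpos] with p hp
      exact hu.trans (Real.rpow_pos_of_pos hp _).le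
    have e2 : gammaMix ρ₀ (Ici u) = 1 := by
      rw [← mem_ae_iff_prob_eq_one measurableSet_Ici]
      filter_upwards [ae_pos_gammaMix] with p hp
      exact hu.trans hp.le
    rw [e1, e2]
  · rw [gammaMix_Ici h0 h1 hu.le]
    have e : (u ^ (-(1 / α))) ^ (-α) = u := by
      rw [← Real.rpow_mul hu.le, neg_mul_neg, one_div, inv_mul_cancel₀ hα.ne', Real.rpow_one]
    have h2 := hcdf (u ^ (-(1 / α))) (Real.rpow_pos_of_pos hu _)
    rw [e] at h2
    rw [← h2]
    refine measure_congr ?_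
    filter_upwards [hpos] with p hp
    refine propext ?_
    change u ≤ Z p ^ (-α) ↔ Z p ≤ u ^ (-(1 / α))
    nth_rw 1 [← e]
    exact Real.rpow_le_rpow_iff_of_neg (Real.rpow_pos_of_pos hu _) hp (by linarith)

variable {ρ : ℝ → ℝ} {α : ℝ} {W : Measure (ℝ × ℝ)}

lemma HasWelschCDF.measure_fst_le (h : HasWelschCDF ρ α 1 W) {x : ℝ} (hx : 0 < x) :
    W {p | p.1 ≤ x} = ENNReal.ofReal (Real.exp (-x ^ (-α))) := by
  have e : {p : ℝ × ℝ | p.1 ≤ x} = ⋃ n : ℕ, Iic x ×ˢ Iic (x + n) := by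
    ext p
    simp only [mem_ofPred_eq, mem_iUnion, mem_prod, mem_Iic]
    exact ⟨fun hp => by obtain ⟨n, hn⟩ := exists_nat_ge p.2; exact ⟨n, hp, by linarith⟩,
      fun ⟨n, hn⟩ => hn.1⟩
  have hmono : Monotone fun n : ℕ => (Iic x ×ˢ Iic (x + n) : Set (ℝ × ℝ)) := fun m n hmn =>
    prod_mono le_rfl (Iic_subset_Iic.2 (by gcongr))
  rw [e]
  refine tendsto_nhds_unique (tendsto_measure_iUnion_atTop hmono) (tendsto_const_nhds.congr fun n => ?_)
  have hn : (0 : ℝ) ≤ n := n.cast_nonneg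
  rw [Function.comp, h.2, welschCDF, if_neg (by push Not; exact ⟨hx, by linarith⟩),
    if_pos (by linarith), div_one]

/-- Let x → ∞ in the joint cdf: (y/x)^α → 0, and the Lipschitz property of ρ gives continuity at 0.
-/
lemma HasWelschCDF.measure_snd_le (h : HasWelschCDF ρ α 1 W) (hρ : IsWelschFunction ρ) (hα : 0 < α)
    {y : ℝ} (hy : 0 < y) :
    W {p | p.2 ≤ y} = ENNReal.ofReal (Real.exp (-y ^ (-α)) * (1 + ρ 0 * y ^ (-α))) := by
  have e : {p : ℝ × ℝ | p.2 ≤ y} = ⋃ n : ℕ, Iic (y + n) ×ˢ Iic y := by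
    ext p
    simp only [mem_ofPred_eq, mem_iUnion, mem_prod, mem_Iic]
    exact ⟨fun hp => by obtain ⟨n, hn⟩ := exists_nat_ge p.1; exact ⟨n, by linarith, hp⟩,
      fun ⟨n, hn⟩ => hn.2⟩
  have hmono : Monotone fun n : ℕ => (Iic (y + n) ×ˢ Iic y : Set (ℝ × ℝ)) := fun m n hmn =>
    prod_mono (Iic_subset_Iic.2 (by gcongr)) le_rfl
  rw [e]
  refine tendsto_nhds_unique (tendsto_measure_iUnion_atTop hmono) ?_
  have h1 : Tendsto (fun n : ℕ => (y / (y + n)) ^ α) atTop (𝓝 0) := by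
    have h2 : Tendsto (fun n : ℕ => y / (y + n)) atTop (𝓝 0) :=
      (tendsto_atTop_add_const_left _ y tendsto_natCast_atTop_atTop).const_div_atTop y
    have := h2.rpow_const (p := α) (Or.inr hα.le)
    rwa [Real.zero_rpow hα.ne'] at this
  have hmem : ∀ n : ℕ, (y / (y + n)) ^ α ∈ Icc (0 : ℝ) 1 := fun n => by
    have hn : (0 : ℝ) ≤ n := n.cast_nonneg
    exact ⟨by positivity, Real.rpow_le_one (by positivity) (by rw [div_le_one (by positivity)]; linarith) hα.le⟩
  have h3 : Tendsto (fun n : ℕ => ρ ((y / (y + n)) ^ α)) atTop (𝓝 (ρ 0)) :=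
    (hρ.lipschitz.continuousOn 0 (by simp)).tendsto.comp
      (tendsto_nhdsWithin_iff.2 ⟨h1, Eventually.of_forall hmem⟩)
  have h4 := ENNReal.tendsto_ofReal (((h3.mul_const (y ^ (-α))).const_add 1).const_mul (Real.exp (-y ^ (-α))))
  refine h4.congr' ?_
  filter_upwards [eventually_ge_atTop 1] with n hn
  have hn : (1 : ℝ) ≤ n := by exact_mod_cast hn
  rw [Function.comp, h.2, welschCDF, if_neg (by push Not; exact ⟨by linarith, hy⟩),
    if_neg (by linarith), div_one]

lemma IsWelschFunction.apply_zero_mem (hρ : IsWelschFunction ρ) : 0 ≤ ρ 0 ∧ ρ 0 ≤ 1 :=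
  hρ.mapsTo (by simp)

lemma HasWelschCDF.map_snd (h : HasWelschCDF ρ α 1 W) (hρ : IsWelschFunction ρ) (hα : 0 < α) :
    W.map (fun p => p.2 ^ (-α)) = gammaMix (ρ 0) := by
  have := h.1
  exact map_rpow_eq_gammaMix measurable_snd (h.ae_pos.mono fun _ hp => hp.2) hα
    hρ.apply_zero_mem.1 hρ.apply_zero_mem.2 fun z hz => h.measure_snd_le hρ hα hz

lemma HasWelschCDF.map_fst (h : HasWelschCDF ρ α 1 W) (hα : 0 < α) :
    W.map (fun p => p.1 ^ (-α)) = gammaMix 0 := by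
  have := h.1
  refine map_rpow_eq_gammaMix measurable_fst (h.ae_pos.mono fun _ hp => hp.1) hα
    le_rfl zero_le_one fun z hz => ?_
  rw [h.measure_fst_le hz]
  simp

/-- Substitute V = Z^(-α), so that Z^(-b) = V^(b/α) and log Z = -log V / α. -/
lemma integral_rpow_mul_log_pow_of_map {E : Type*} [MeasurableSpace E] {H : Measure E} {Z : E → ℝ}
    (hZ : Measurable Z) (hpos : ∀ᵐ p ∂H, 0 < Z p) (hα : 0 < α) (h0 : 0 ≤ ρ₀) (h1 : ρ₀ ≤ 1)
    (hmap : H.map (fun p => Z p ^ (-α)) = gammaMix ρ₀) {b : ℝ} (hb : -α < b) (j : ℕ) :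
    ∫ p, Z p ^ (-b) * Real.log (Z p) ^ j ∂H
      = (-1 / α) ^ j * iteratedDeriv j (Upsilon ρ₀) (b / α) := by
  have hs : -1 < b / α := by rw [lt_div_iff₀ hα]; linarith
  rw [← iteratedDeriv_Upsilon h0 h1 hs, ← hmap, integral_map (hZ.pow_const _).aemeasurable
    (Measurable.aestronglyMeasurable (by fun_prop)), ← integral_const_mul]
  refine integral_congr_ae ?_
  filter_upwards [hpos] with p hp
  rw [Real.log_rpow hp, Real.rpow_def_of_pos hp, ← mul_assoc, ← mul_pow,
    show -1 / α * (-α * Real.log (Z p)) = Real.log (Z p) by field_simp,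
    show b / α * (-α * Real.log (Z p)) = Real.log (Z p) * -b by field_simp]
  ring

lemma HasWelschCDF.integral_snd (h : HasWelschCDF ρ α 1 W) (hρ : IsWelschFunction ρ) (hα : 0 < α)
    {b : ℝ} (hb : -α < b) (j : ℕ) :
    ∫ p, p.2 ^ (-b) * Real.log p.2 ^ j ∂W
      = (-1 / α) ^ j * iteratedDeriv j (Upsilon (ρ 0)) (b / α) :=
  integral_rpow_mul_log_pow_of_map measurable_snd (h.ae_pos.mono fun _ hp => hp.2) hα
    hρ.apply_zero_mem.1 hρ.apply_zero_mem.2 (h.map_snd hρ hα) hb j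

lemma HasWelschCDF.integral_fst (h : HasWelschCDF ρ α 1 W) (hα : 0 < α)
    {b : ℝ} (hb : -α < b) (j : ℕ) :
    ∫ p, p.1 ^ (-b) * Real.log p.1 ^ j ∂W
      = (-1 / α) ^ j * iteratedDeriv j (Upsilon 0) (b / α) :=
  integral_rpow_mul_log_pow_of_map measurable_fst (h.ae_pos.mono fun _ hp => hp.1) hα
    le_rfl zero_le_one (h.map_fst hα) hb j

end Marginals

/-! ### The zero of `Π` -/

section Varpi

variable {ρ₀ : ℝ}

lemma Upsilon_pos (h0 : 0 ≤ ρ₀) (h1 : ρ₀ ≤ 1) {s : ℝ} (hs : -1 < s) : 0 < Upsilon ρ₀ s := by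
  have a1 := Real.Gamma_pos_of_pos (show 0 < s + 1 by linarith)
  have a2 := Real.Gamma_pos_of_pos (show 0 < s + 2 by linarith)
  unfold Upsilon
  rcases eq_or_lt_of_le h0 with h | h
  · rw [← h]; simpa using a1
  · have : 0 ≤ (1 - ρ₀) * Real.Gamma (s + 1) := mul_nonneg (by linarith) a1.le
    have := mul_pos h a2
    linarith

lemma hasDerivAt_Upsilon (h0 : 0 ≤ ρ₀) (h1 : ρ₀ ≤ 1) {s : ℝ} (hs : -1 < s) :
    HasDerivAt (Upsilon ρ₀) (deriv (Upsilon ρ₀) s) s := by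
  have := hasDerivAt_iteratedDeriv_Upsilon h0 h1 hs 0
  rwa [iteratedDeriv_zero, zero_add, iteratedDeriv_Upsilon_one] at this

lemma hasDerivAt_deriv_Upsilon (h0 : 0 ≤ ρ₀) (h1 : ρ₀ ≤ 1) {s : ℝ} (hs : -1 < s) :
    HasDerivAt (deriv (Upsilon ρ₀)) (deriv (deriv (Upsilon ρ₀)) s) s := by
  have := hasDerivAt_iteratedDeriv_Upsilon h0 h1 hs 1
  rwa [iteratedDeriv_one, iteratedDeriv_Upsilon_two] at this

/-- Log-convexity of `Υ`. -/
lemma deriv_Upsilon_sq_le (h0 : 0 ≤ ρ₀) (h1 : ρ₀ ≤ 1) {s : ℝ} (hs : -1 < s) :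
    deriv (Upsilon ρ₀) s ^ 2 ≤ deriv (deriv (Upsilon ρ₀)) s * Upsilon ρ₀ s := by
  have hU := Upsilon_pos h0 h1 hs
  -- The mean of log V under the law tilted by V^s. The integral below is Υ(s) times the variance of
  -- log V under that law.
  set c := deriv (Upsilon ρ₀) s / Upsilon ρ₀ s with hc
  have hi := fun j => integrable_log_pow_mul_exp h0 h1 hs j
  have hm := fun j => iteratedDeriv_Upsilon h0 h1 hs j
  have h : 0 ≤ ∫ v, (Real.log v - c) ^ 2 * Real.exp (s * Real.log v) ∂gammaMix ρ₀ :=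
    integral_nonneg fun v => by positivity
  have e : ∫ v, (Real.log v - c) ^ 2 * Real.exp (s * Real.log v) ∂gammaMix ρ₀
      = deriv (deriv (Upsilon ρ₀)) s - 2 * c * deriv (Upsilon ρ₀) s + c ^ 2 * Upsilon ρ₀ s := by
    have h2 : Integrable (fun v => Real.log v ^ 2 * Real.exp (s * Real.log v)
        - 2 * c * (Real.log v ^ 1 * Real.exp (s * Real.log v))) (gammaMix ρ₀) :=
      (hi 2).sub ((hi 1).const_mul _)
    rw [← iteratedDeriv_Upsilon_two, ← iteratedDeriv_Upsilon_one,
      show Upsilon ρ₀ s = iteratedDeriv 0 (Upsilon ρ₀) s by simp, ← hm, ← hm, ← hm,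
      ← integral_const_mul, ← integral_const_mul, ← integral_sub (hi 2) ((hi 1).const_mul _),
      ← integral_add h2 ((hi 0).const_mul _)]
    refine integral_congr_ae (ae_of_all _ fun v => ?_)
    simp only
    ring
  rw [e] at h
  have e2 : deriv (deriv (Upsilon ρ₀)) s - 2 * c * deriv (Upsilon ρ₀) s + c ^ 2 * Upsilon ρ₀ s
      = (deriv (deriv (Upsilon ρ₀)) s * Upsilon ρ₀ s - deriv (Upsilon ρ₀) s ^ 2) / Upsilon ρ₀ s := by
    rw [hc]; field_simp; ring
  rw [e2] at h
  by_contra hcon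
  have := div_neg_of_neg_of_pos (sub_neg.2 (not_le.1 hcon)) hU
  linarith

lemma hasDerivAt_Upsilon_ratio (h0 : 0 ≤ ρ₀) (h1 : ρ₀ ≤ 1) {s : ℝ} (hs : -1 < s) :
    HasDerivAt (fun s => deriv (Upsilon ρ₀) s / Upsilon ρ₀ s)
      ((deriv (deriv (Upsilon ρ₀)) s * Upsilon ρ₀ s - deriv (Upsilon ρ₀) s ^ 2) / Upsilon ρ₀ s ^ 2) s := by
  refine ((hasDerivAt_deriv_Upsilon h0 h1 hs).div (hasDerivAt_Upsilon h0 h1 hs)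
    (Upsilon_pos h0 h1 hs).ne').congr_deriv ?_
  ring

lemma monotoneOn_Upsilon_ratio (h0 : 0 ≤ ρ₀) (h1 : ρ₀ ≤ 1) :
    MonotoneOn (fun s => deriv (Upsilon ρ₀) s / Upsilon ρ₀ s) (Ioi (-1)) := by
  refine monotoneOn_of_deriv_nonneg (convex_Ioi _)
    (fun s hs => (hasDerivAt_Upsilon_ratio h0 h1 hs).continuousAt.continuousWithinAt)
    (fun s hs => ?_) fun s hs => ?_
  · rw [interior_Ioi] at hs
    exact (hasDerivAt_Upsilon_ratio h0 h1 hs).differentiableAt.differentiableWithinAt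
  · rw [interior_Ioi] at hs
    rw [(hasDerivAt_Upsilon_ratio h0 h1 hs).deriv]
    exact div_nonneg (by linarith [deriv_Upsilon_sq_le h0 h1 hs]) (sq_nonneg _)

lemma continuousOn_PiFun (h0 : 0 ≤ ρ₀) (h1 : ρ₀ ≤ 1) : ContinuousOn (PiFun ρ₀) (Ioi 0) := by
  intro y hy
  have hy' : 0 < y := hy
  have h2 := (hasDerivAt_Upsilon_ratio h0 h1 (show -1 < y by linarith)).continuousAt
  have h3 : ContinuousAt (fun y : ℝ => 1 / y) y := continuousAt_const.div continuousAt_id hy'.ne'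
  exact (((h3.sub h2).add continuousAt_const).sub continuousAt_const).continuousWithinAt

lemma strictAntiOn_PiFun (h0 : 0 ≤ ρ₀) (h1 : ρ₀ ≤ 1) : StrictAntiOn (PiFun ρ₀) (Ioi 0) := by
  intro x hx y hy hxy
  have hx' : 0 < x := hx
  have hy' : 0 < y := hy
  have h2 := monotoneOn_Upsilon_ratio h0 h1 (show x ∈ Ioi (-1) by simp; linarith)
    (show y ∈ Ioi (-1) by simp; linarith) hxy.le
  have h3 : 1 / y < 1 / x := one_div_lt_one_div_of_lt hx' hxy
  simp only at h2
  unfold PiFun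
  linarith

/-- The functional equation of Γ gives Υ(s+1) ≥ (s+1) Υ(s). Hence log Υ has mean slope at least
log(s+1) on [s, s+1], and by convexity its slope at the right end is no smaller. This makes Π
negative for large arguments. -/
lemma log_le_Upsilon_ratio (h0 : 0 ≤ ρ₀) (h1 : ρ₀ ≤ 1) {s : ℝ} (hs : 0 ≤ s) :
    Real.log (s + 1) ≤ deriv (Upsilon ρ₀) (s + 1) / Upsilon ρ₀ (s + 1) := by
  have hpos : ∀ x, s ≤ x → 0 < Upsilon ρ₀ x := fun x hx => Upsilon_pos h0 h1 (by linarith)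
  have hd : ∀ x, s ≤ x → HasDerivAt (fun x => Real.log (Upsilon ρ₀ x))
      (deriv (Upsilon ρ₀) x / Upsilon ρ₀ x) x := fun x hx =>
    (hasDerivAt_Upsilon h0 h1 (by linarith)).log (hpos x hx).ne'
  obtain ⟨x, hx, hx2⟩ := exists_hasDerivAt_eq_slope (fun x => Real.log (Upsilon ρ₀ x))
    (fun x => deriv (Upsilon ρ₀) x / Upsilon ρ₀ x) (show s < s + 1 by linarith)
    (fun x hx => (hd x hx.1).continuousAt.continuousWithinAt) fun x hx => hd x hx.1.le
  have h2 := monotoneOn_Upsilon_ratio h0 h1 (show x ∈ Ioi (-1) by simp; linarith [hx.1])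
    (show s + 1 ∈ Ioi (-1) by simp; linarith) hx.2.le
  simp only at h2
  refine le_trans ?_ h2
  rw [hx2, add_sub_cancel_left, div_one, ← Real.log_div (hpos _ (by linarith)).ne' (hpos s le_rfl).ne']
  refine Real.log_le_log (by linarith) ?_
  rw [le_div_iff₀ (hpos s le_rfl), Upsilon, Upsilon, show s + 1 + 2 = (s + 2) + 1 by ring,
    show s + 1 + 1 = (s + 1) + 1 by ring, Real.Gamma_add_one (show s + 2 ≠ 0 by linarith),
    Real.Gamma_add_one (show s + 1 ≠ 0 by linarith)]
  have a2 := Real.Gamma_pos_of_pos (show 0 < s + 2 by linarith)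
  nlinarith [mul_nonneg h0 a2.le]

lemma exists_PiFun_eq_zero (h0 : 0 ≤ ρ₀) (h1 : ρ₀ ≤ 1) : ∃ y, 0 < y ∧ PiFun ρ₀ y = 0 := by
  have hγ := Real.one_half_lt_eulerMascheroniConstant
  have hγ1 := Real.eulerMascheroniConstant_lt_two_thirds
  set h : ℝ → ℝ := fun s => deriv (Upsilon ρ₀) s / Upsilon ρ₀ s with hh
  -- At y = 1/C the term 1/y = C dominates: the ratio is at most h(1) by monotonicity, and the
  -- summand 1 outweighs γ < 2/3.
  set C := |h 1| + 1 with hC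
  have hC1 : 1 ≤ C := by linarith [abs_nonneg (h 1)]
  have hsmall : 0 ≤ PiFun ρ₀ (1 / C) := by
    have h2 : h (1 / C) ≤ h 1 := monotoneOn_Upsilon_ratio h0 h1
      (show 1 / C ∈ Ioi (-1) by
        have : 0 < 1 / C := by positivity
        simp only [mem_Ioi]; linarith) (by simp) (by rw [div_le_one (by linarith)]; exact hC1)
    have h3 : 1 / (1 / C) = C := by simp
    unfold PiFun
    rw [h3]
    have := le_abs_self (h 1)
    simp only [hh] at h2 this hC
    linarith
  -- At e² the logarithmic derivative of Υ is at least 2, which beats 1/y ≤ 1 and ρ₀/2 ≤ 1/2.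
  have hlarge : PiFun ρ₀ (Real.exp 2) ≤ 0 := by
    have he : 3 ≤ Real.exp 2 := by linarith [Real.add_one_le_exp 2]
    have h2 := log_le_Upsilon_ratio h0 h1 (show 0 ≤ Real.exp 2 - 1 by linarith)
    rw [sub_add_cancel, Real.log_exp] at h2
    have h3 : 1 / Real.exp 2 ≤ 1 := by rw [div_le_one (by positivity)]; linarith
    unfold PiFun
    linarith
  have hle : 1 / C ≤ Real.exp 2 := by
    have : 1 / C ≤ 1 := by rw [div_le_one (by linarith)]; exact hC1
    linarith [Real.add_one_le_exp 2]
  have hCpos : 0 < 1 / C := by positivity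
  obtain ⟨y, hy, hy0⟩ := intermediate_value_Icc' hle
    ((continuousOn_PiFun h0 h1).mono fun x hx => hCpos.trans_le hx.1) ⟨hlarge, hsmall⟩
  exact ⟨y, hCpos.trans_le hy.1, hy0⟩

lemma varpi_eq_of_PiFun_eq_zero (h0 : 0 ≤ ρ₀) (h1 : ρ₀ ≤ 1) {y : ℝ} (hy : 0 < y)
    (h : PiFun ρ₀ y = 0) : varpi ρ₀ = y := by
  have : {y : ℝ | 0 < y ∧ PiFun ρ₀ y = 0} = {y} := by
    ext x
    simp only [mem_ofPred_eq, mem_singleton_iff]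
    refine ⟨fun hx => (strictAntiOn_PiFun h0 h1).injOn hx.1 hy (hx.2.trans h.symm), ?_⟩
    rintro rfl
    exact ⟨hy, h⟩
  rw [varpi, this, csInf_singleton]

lemma varpi_spec (h0 : 0 ≤ ρ₀) (h1 : ρ₀ ≤ 1) : 0 < varpi ρ₀ ∧ PiFun ρ₀ (varpi ρ₀) = 0 := by
  obtain ⟨y, hy, hy0⟩ := exists_PiFun_eq_zero h0 h1
  rw [varpi_eq_of_PiFun_eq_zero h0 h1 hy hy0]
  exact ⟨hy, hy0⟩

lemma alphaOne_pos (h0 : 0 ≤ ρ₀) (h1 : ρ₀ ≤ 1) {α₀ : ℝ} (hα : 0 < α₀) : 0 < alphaOne ρ₀ α₀ :=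
  mul_pos (varpi_spec h0 h1).1 hα

lemma alphaOne_div {α₀ : ℝ} (hα : 0 < α₀) : alphaOne ρ₀ α₀ / α₀ = varpi ρ₀ := by
  rw [alphaOne, mul_div_cancel_right₀ _ hα.ne']

/-- Log-convexity of Υ again. Negativity is the nondegeneracy that lets the likelihood equation be
solved to first order. -/
lemma psiDot_neg (h0 : 0 ≤ ρ₀) (h1 : ρ₀ ≤ 1) {α₀ : ℝ} (hα : 0 < α₀) : psiDot ρ₀ α₀ < 0 := by
  have hv := (varpi_spec h0 h1).1
  have hs : -1 < varpi ρ₀ := by linarith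
  have hU := Upsilon_pos h0 h1 hs
  have h2 := deriv_Upsilon_sq_le h0 h1 hs
  have ha := alphaOne_pos h0 h1 hα
  unfold psiDot
  have h3 : -2 / alphaOne ρ₀ α₀ ^ 2 < 0 := div_neg_of_neg_of_pos (by norm_num) (by positivity)
  have h4 : 0 ≤ 2 * (deriv (deriv (Upsilon ρ₀)) (varpi ρ₀) * Upsilon ρ₀ (varpi ρ₀)
        - deriv (Upsilon ρ₀) (varpi ρ₀) ^ 2) / (α₀ ^ 2 * Upsilon ρ₀ (varpi ρ₀) ^ 2) :=
    div_nonneg (by linarith) (by positivity)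
  linarith

lemma Real.deriv_Gamma_add_one {x : ℝ} (hx : 0 < x) :
    deriv Real.Gamma (x + 1) = Real.Gamma x + x * deriv Real.Gamma x := by
  have hd : DifferentiableAt ℝ Real.Gamma x := Real.differentiableAt_Gamma fun m => by
    have : (0 : ℝ) ≤ m := m.cast_nonneg
    linarith
  have h1 : HasDerivAt (fun x => x * Real.Gamma x) (1 * Real.Gamma x + x * deriv Real.Gamma x) x :=
    (hasDerivAt_id x).mul hd.hasDerivAt
  rw [one_mul] at h1
  rw [← deriv_comp_add_const Real.Gamma 1 x, ← h1.deriv]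
  refine EventuallyEq.deriv_eq ?_
  filter_upwards [Ioi_mem_nhds hx] with y hy
  exact Real.Gamma_add_one (ne_of_gt hy)

lemma Real.deriv_Gamma_one : deriv Real.Gamma 1 = -Real.eulerMascheroniConstant := by
  rw [Real.eulerMascheroniConstant_eq_neg_deriv, neg_neg]

lemma deriv_Upsilon {s : ℝ} (hs : -1 < s) :
    deriv (Upsilon ρ₀) s = ρ₀ * deriv Real.Gamma (s + 2) + (1 - ρ₀) * deriv Real.Gamma (s + 1) := by
  have hd : ∀ x : ℝ, 0 < x → DifferentiableAt ℝ Real.Gamma x := fun x hx =>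
    Real.differentiableAt_Gamma fun m => by
      have : (0 : ℝ) ≤ m := m.cast_nonneg
      linarith
  have h2 := ((hd (s + 2) (by linarith)).hasDerivAt.comp_add_const s 2).const_mul ρ₀
  have h1 := ((hd (s + 1) (by linarith)).hasDerivAt.comp_add_const s 1).const_mul (1 - ρ₀)
  exact (h2.add h1).deriv

lemma deriv_Upsilon_zero (ρ₀ : ℝ) : deriv (Upsilon ρ₀) 0 = ρ₀ - Real.eulerMascheroniConstant := by
  rw [deriv_Upsilon (by norm_num), zero_add, zero_add, show (2 : ℝ) = 1 + 1 by norm_num,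
    Real.deriv_Gamma_add_one one_pos, Real.deriv_Gamma_one, Real.Gamma_one]
  ring

end Varpi

/-! ### Expansion of the estimator -/

section Expansion

open Asymptotics

variable {Ω : Type*} [MeasurableSpace Ω] {P : Measure Ω} [IsProbabilityMeasure P]
  {ξ : ℤ → Ω → ℝ} {ρ : ℝ → ℝ} {α₀ : ℝ} {σ : ℕ → ℝ} {r : ℕ → ℕ} {a c s : ℝ}

/-- The block sample of size `n / r n`, divided by the scale `σ (r n)`. -/
def scaledBlocks (ξ : ℤ → Ω → ℝ) (σ : ℕ → ℝ) (r : ℕ → ℕ) (c : ℝ) (z : ℕ × Ω) :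
    Fin (z.1 / r z.1) → ℝ × ℝ :=
  scaleSample (σ (r z.1)) (blockSample ξ c z.1 (r z.1) z.2)

lemma blockSample_pos (ξ : ℤ → Ω → ℝ) (hc : 0 < c) (n r : ℕ) (w : Ω) (i : Fin (n / r)) :
    0 < (blockSample ξ c n r w i).1 ∧ 0 < (blockSample ξ c n r w i).2 :=
  ⟨lt_max_of_lt_right hc, lt_max_of_lt_right hc⟩

lemma sum_scaledBlocks (f : ℝ × ℝ → ℝ) (z : ℕ × Ω) :
    ∑ i, f (scaledBlocks ξ σ r c z i)
      = blockSum ξ (z.1 / r z.1) (r z.1) (fun x => f (blockPt σ r c z.1 x)) z.2 :=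
  sum_blockSample ξ c (σ (r z.1)) z.1 (r z.1) z.2 f

namespace BlockSetting

lemma tendsto_average_scaledBlocks (S : BlockSetting P ξ ρ α₀ σ r a c s) {q : ℝ} (hq : 0 ≤ q)
    (hqs : 2 * q < s) {g : ℝ × ℝ → ℝ} (hg : EnvelopeBounded a q g) :
    Tendsto (fun z : ℕ × Ω => (∑ i, g (scaledBlocks ξ σ r c z i)) / ((z.1 / r z.1 : ℕ) : ℝ))
      (probFilter P) (𝓝 (∫ p, g p ∂(frechetWelsch ρ α₀ 1))) := by
  refine (S.tendsto_average hq hqs hg).congr fun z => ?_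
  rw [sum_scaledBlocks, div_eq_inv_mul]

lemma tendsto_powSum (S : BlockSetting P ξ ρ α₀ σ r a c s) {q : ℝ} (hq : 1 < q)
    (hqs : 2 * q < s) (j : ℕ) {b : ℝ} (hb : 0 < b) (hbq : b < q * a) :
    Tendsto (fun z : ℕ × Ω => powSum (scaledBlocks ξ σ r c z) j b / ((z.1 / r z.1 : ℕ) : ℝ))
      (probFilter P) (𝓝 ((-1 / α₀) ^ j * iteratedDeriv j (Upsilon (ρ 0)) (b / α₀))) := by
  have hα := S.doa.alpha_pos
  rw [← S.welsch.integral_snd S.doa.welsch hα (by linarith) j]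
  have h := S.tendsto_average_scaledBlocks (by linarith) hqs
    (envelopeBounded_rpow_mul_log_pow (by linarith) hb hbq j)
  exact h

lemma tendsto_average_log_snd (S : BlockSetting P ξ ρ α₀ σ r a c s) {q : ℝ} (hq : 1 < q)
    (hqs : 2 * q < s) :
    Tendsto (fun z : ℕ × Ω => (∑ i, Real.log (scaledBlocks ξ σ r c z i).2) / ((z.1 / r z.1 : ℕ) : ℝ))
      (probFilter P) (𝓝 ((Real.eulerMascheroniConstant - ρ 0) / α₀)) := by
  have hα := S.doa.alpha_pos
  have h := S.welsch.integral_snd S.doa.welsch hα (b := 0) (by linarith) 1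
  simp only [neg_zero, Real.rpow_zero, one_mul, pow_one, zero_div, iteratedDeriv_Upsilon_one,
    deriv_Upsilon_zero] at h
  rw [show (Real.eulerMascheroniConstant - ρ 0) / α₀
    = -1 / α₀ * (ρ 0 - Real.eulerMascheroniConstant) by ring, ← h]
  have h2 := S.tendsto_average_scaledBlocks (by linarith) hqs (envelopeBounded_log_snd hq.le)
  exact h2

lemma tendsto_average_log_fst (S : BlockSetting P ξ ρ α₀ σ r a c s) {q : ℝ} (hq : 1 < q)
    (hqs : 2 * q < s) :
    Tendsto (fun z : ℕ × Ω => (∑ i, Real.log (scaledBlocks ξ σ r c z i).1) / ((z.1 / r z.1 : ℕ) : ℝ))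
      (probFilter P) (𝓝 (Real.eulerMascheroniConstant / α₀)) := by
  have hα := S.doa.alpha_pos
  have h := S.welsch.integral_fst hα (b := 0) (by linarith) 1
  simp only [neg_zero, Real.rpow_zero, one_mul, pow_one, zero_div, iteratedDeriv_Upsilon_one,
    deriv_Upsilon_zero] at h
  rw [show Real.eulerMascheroniConstant / α₀
    = -1 / α₀ * (0 - Real.eulerMascheroniConstant) by ring, ← h]
  have h2 := S.tendsto_average_scaledBlocks (by linarith) hqs (envelopeBounded_log_fst hq.le)
  exact h2

lemma tendsto_logSum (S : BlockSetting P ξ ρ α₀ σ r a c s) {q : ℝ} (hq : 1 < q) (hqs : 2 * q < s) :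
    Tendsto (fun z : ℕ × Ω => logSum (scaledBlocks ξ σ r c z) / ((z.1 / r z.1 : ℕ) : ℝ))
      (probFilter P) (𝓝 ((2 * Real.eulerMascheroniConstant - ρ 0) / α₀)) := by
  have h := (S.tendsto_average_log_fst hq hqs).add (S.tendsto_average_log_snd hq hqs)
  rw [show Real.eulerMascheroniConstant / α₀ + (Real.eulerMascheroniConstant - ρ 0) / α₀
    = (2 * Real.eulerMascheroniConstant - ρ 0) / α₀ by ring] at h
  refine h.congr fun z => ?_
  rw [logSum, Finset.sum_add_distrib, add_div]

lemma eventually_card_pos (S : BlockSetting P ξ ρ α₀ σ r a c s) :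
    ∀ᶠ z in probFilter P, 0 < z.1 / r z.1 ∧ 0 < σ (r z.1) :=
  (tendsto_fst_probFilter P).eventually ((S.k_tendsto.eventually_gt_atTop 0).and S.sigma_pos)

lemma scaledBlocks_pos (S : BlockSetting P ξ ρ α₀ σ r a c s) {z : ℕ × Ω} (h : 0 < σ (r z.1))
    (i : Fin (z.1 / r z.1)) : 0 < (scaledBlocks ξ σ r c z i).1 ∧ 0 < (scaledBlocks ξ σ r c z i).2 :=
  scaleSample_pos h (blockSample_pos ξ S.c_pos _ _ _) i

/-- The reason for the definition of α₁: it is the zero of the limiting score, since Π vanishes at ϖ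
= α₁/α₀. -/
lemma tendsto_score (S : BlockSetting P ξ ρ α₀ σ r a c s) {q : ℝ} (hq : 1 < q)
    (hqs : 2 * q < s) {b : ℝ} (hb : 0 < b) (hbq : b < q * a) :
    Tendsto (fun z : ℕ × Ω => score (scaledBlocks ξ σ r c z) b)
      (probFilter P) (𝓝 (2 / α₀ * PiFun (ρ 0) (b / α₀))) := by
  have hα := S.doa.alpha_pos
  have h01 := S.doa.welsch.apply_zero_mem
  have hU := Upsilon_pos h01.1 h01.2 (show -1 < b / α₀ by linarith [div_pos hb hα])
  have h0 := S.tendsto_powSum hq hqs 0 hb hbq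
  have h1 := S.tendsto_powSum hq hqs 1 hb hbq
  simp only [pow_zero, one_mul, iteratedDeriv_zero, pow_one, iteratedDeriv_one] at h0 h1
  have h2 := (((h1.div h0 hU.ne').const_mul 2).const_add (2 / b)).sub (S.tendsto_logSum hq hqs)
  have e : 2 / α₀ * PiFun (ρ 0) (b / α₀) = 2 / b + 2 * (-1 / α₀ * deriv (Upsilon (ρ 0)) (b / α₀)
      / Upsilon (ρ 0) (b / α₀)) - (2 * Real.eulerMascheroniConstant - ρ 0) / α₀ := by
    unfold PiFun
    field_simp
    ring
  rw [e]
  refine h2.congr' ?_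
  filter_upwards [S.eventually_card_pos] with z hz
  have hk : ((z.1 / r z.1 : ℕ) : ℝ) ≠ 0 := by
    have := hz.1
    positivity
  have := powSum_zero_pos hz.1 (S.scaledBlocks_pos hz.2) b
  simp only [Pi.div_apply]
  rw [score, div_div_div_cancel_right₀ hk]

/-- Location of the estimator, with probability tending to one. -/
lemma eventually_mle (S : BlockSetting P ξ ρ α₀ σ r (alphaOne (ρ 0) α₀) c s) {η : ℝ} (hη : 0 < η) :
    ∀ᶠ z in probFilter P, (∃! θ, IsMLE (blockSample ξ c z.1 (r z.1) z.2) θ) ∧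
      |(mle (blockSample ξ c z.1 (r z.1) z.2)).1 - alphaOne (ρ 0) α₀| ≤ η ∧
      score (scaledBlocks ξ σ r c z) (mle (blockSample ξ c z.1 (r z.1) z.2)).1 = 0 ∧
      (mle (blockSample ξ c z.1 (r z.1) z.2)).2 / σ (r z.1)
        = profileScale (scaledBlocks ξ σ r c z) (mle (blockSample ξ c z.1 (r z.1) z.2)).1 := by
  obtain ⟨q, hq, hqs⟩ := S.exists_exponent
  have hα := S.doa.alpha_pos
  have h01 := S.doa.welsch.apply_zero_mem
  obtain ⟨hv, hv0⟩ := varpi_spec h01.1 h01.2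
  set a := alphaOne (ρ 0) α₀ with ha
  have ha0 : 0 < a := S.a_pos
  have hav : a / α₀ = varpi (ρ 0) := alphaOne_div hα
  -- Small enough that a - d is positive and a + d stays below q a, where the law of large numbers
  -- for power sums is available.
  set d := min η (min (a / 2) ((q - 1) * a / 2)) with hd
  have hqa : 0 < (q - 1) * a := mul_pos (by linarith) ha0
  have hd0 : 0 < d := lt_min hη (lt_min (by positivity) (by positivity))
  have hd1 : d ≤ a / 2 := (min_le_right _ _).trans (min_le_left _ _)
  have hd2 : d ≤ (q - 1) * a / 2 := (min_le_right _ _).trans (min_le_right _ _)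
  have h1 : 0 < 2 / α₀ * PiFun (ρ 0) ((a - d) / α₀) := by
    refine mul_pos (by positivity) ?_
    refine lt_of_eq_of_lt (hv0.symm.trans (congrArg _ hav.symm)) ?_
    exact strictAntiOn_PiFun h01.1 h01.2 (div_pos (by linarith) hα) (div_pos ha0 hα)
      (by gcongr; linarith)
  have h2 : 2 / α₀ * PiFun (ρ 0) ((a + d) / α₀) < 0 := by
    refine mul_neg_of_pos_of_neg (by positivity) ?_
    refine lt_of_lt_of_eq ?_ ((congrArg _ hav).trans hv0)
    exact strictAntiOn_PiFun h01.1 h01.2 (div_pos ha0 hα) (div_pos (by linarith) hα)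
      (by gcongr; linarith)
  filter_upwards [S.eventually_card_pos,
    (S.tendsto_score hq hqs (show 0 < a - d by linarith) (by nlinarith)).eventually_const_lt h1,
    (S.tendsto_score hq hqs (show 0 < a + d by linarith) (by nlinarith)).eventually_lt_const h2]
    with z hz h3 h4
  obtain ⟨e1, e2, e3, e4⟩ := mle_of_score_sign hz.1 hz.2 (blockSample_pos ξ S.c_pos _ _ _)
    (show 0 < a - d by linarith) (by linarith) h3.le h4.le
  refine ⟨e1, ?_, e3, e4⟩
  rw [abs_le]
  have : d ≤ η := min_le_left _ _
  exact ⟨by linarith [e2.1], by linarith [e2.2]⟩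

lemma tendsto_mle_fst (S : BlockSetting P ξ ρ α₀ σ r (alphaOne (ρ 0) α₀) c s) :
    Tendsto (fun z : ℕ × Ω => (mle (blockSample ξ c z.1 (r z.1) z.2)).1) (probFilter P)
      (𝓝 (alphaOne (ρ 0) α₀)) := by
  rw [Metric.tendsto_nhds]
  intro ε hε
  filter_upwards [S.eventually_mle (half_pos hε)] with z hz
  rw [Real.dist_eq]
  linarith [hz.2.1]

end BlockSetting

/-- Uniformity in the exponent at no cost: y^(-b) is at most the sum of its values at the two end
exponents, and |log y|^j ≤ 1 + (log y)⁴. Four averages at fixed exponents thus control a whole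
interval. -/
lemma abs_powSum_le {k : ℕ} {z : Fin k → ℝ × ℝ} (hz : ∀ i, 0 < (z i).1 ∧ 0 < (z i).2) {j : ℕ}
    (hj : j ≤ 4) {b a η : ℝ} (hb : |b - a| ≤ η) :
    |powSum z j b| ≤ powSum z 0 (a - η) + powSum z 0 (a + η) + powSum z 4 (a - η)
      + powSum z 4 (a + η) := by
  unfold powSum
  rw [← Finset.sum_add_distrib, ← Finset.sum_add_distrib, ← Finset.sum_add_distrib]
  refine (Finset.abs_sum_le_sum_abs _ _).trans (Finset.sum_le_sum fun i _ => ?_)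
  have hy := (hz i).2
  set y := (z i).2
  set t := Real.log y
  rw [abs_le] at hb
  have e1 : y ^ (-b) ≤ y ^ (-(a - η)) + y ^ (-(a + η)) := by
    have p1 := Real.rpow_pos_of_pos hy (-(a - η))
    have p2 := Real.rpow_pos_of_pos hy (-(a + η))
    rcases le_total 1 y with h | h
    · have := Real.rpow_le_rpow_of_exponent_le h (show -b ≤ -(a - η) by linarith)
      linarith
    · have := Real.rpow_le_rpow_of_exponent_ge hy h (show -(a + η) ≤ -b by linarith)
      linarith
  have e2 : |t| ^ j ≤ 1 + t ^ 4 := by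
    have h4 : t ^ 4 = |t| ^ 4 := by
      rw [show (4 : ℕ) = 2 * 2 by norm_num, pow_mul, pow_mul, sq_abs]
    rw [h4]
    rcases le_total 1 |t| with h | h
    · have := pow_le_pow_right₀ h hj
      linarith
    · have := pow_le_one₀ (n := j) (abs_nonneg t) h
      have : 0 ≤ |t| ^ 4 := by positivity
      linarith
  rw [abs_mul, abs_pow, abs_of_pos (Real.rpow_pos_of_pos hy _)]
  calc y ^ (-b) * |t| ^ j ≤ (y ^ (-(a - η)) + y ^ (-(a + η))) * (1 + t ^ 4) := by
        gcongr
    _ = _ := by ring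

namespace BlockSetting

lemma exists_powSum_bound (S : BlockSetting P ξ ρ α₀ σ r (alphaOne (ρ 0) α₀) c s) :
    ∃ η R, 0 < η ∧ ∀ᶠ z in probFilter P, ∀ j ≤ 4, ∀ b, |b - alphaOne (ρ 0) α₀| ≤ η →
      |powSum (scaledBlocks ξ σ r c z) j b / ((z.1 / r z.1 : ℕ) : ℝ)| ≤ R := by
  obtain ⟨q, hq, hqs⟩ := S.exists_exponent
  set a := alphaOne (ρ 0) α₀ with ha
  have ha0 : 0 < a := S.a_pos
  set d := min (a / 2) ((q - 1) * a / 2) with hd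
  have hqa : 0 < (q - 1) * a := mul_pos (by linarith) ha0
  have hd0 : 0 < d := lt_min (by positivity) (by positivity)
  have hd1 : d ≤ a / 2 := min_le_left _ _
  have hd2 : d ≤ (q - 1) * a / 2 := min_le_right _ _
  have h := fun j : ℕ => S.tendsto_powSum hq hqs j (b := a - d) (by linarith) (by nlinarith)
  have h' := fun j : ℕ => S.tendsto_powSum hq hqs j (b := a + d) (by linarith) (by nlinarith)
  have hT := (((h 0).add (h' 0)).add (h 4)).add (h' 4)
  obtain ⟨R, hR⟩ : ∃ R, ∀ᶠ z : ℕ × Ω in probFilter P,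
      powSum (scaledBlocks ξ σ r c z) 0 (a - d) / ((z.1 / r z.1 : ℕ) : ℝ)
        + powSum (scaledBlocks ξ σ r c z) 0 (a + d) / ((z.1 / r z.1 : ℕ) : ℝ)
        + powSum (scaledBlocks ξ σ r c z) 4 (a - d) / ((z.1 / r z.1 : ℕ) : ℝ)
        + powSum (scaledBlocks ξ σ r c z) 4 (a + d) / ((z.1 / r z.1 : ℕ) : ℝ) ≤ R :=
    ⟨_, hT.eventually_le_const (lt_add_one _)⟩
  refine ⟨d, R, hd0, ?_⟩
  filter_upwards [S.eventually_card_pos, hR] with z hz h1 j hj b hb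
  refine le_trans ?_ h1
  have hk : (0 : ℝ) < ((z.1 / r z.1 : ℕ) : ℝ) := by exact_mod_cast hz.1
  rw [abs_div, abs_of_pos hk, ← add_div, ← add_div, ← add_div]
  gcongr
  exact abs_powSum_le (S.scaledBlocks_pos hz.2) hj hb

/-- Taylor expansion in the exponent at the random point α̂. The second derivative is bounded on an
interval that contains α̂ with probability tending to one, and the random slope may be replaced by
its limit. -/
lemma isLittleO_powSum (S : BlockSetting P ξ ρ α₀ σ r (alphaOne (ρ 0) α₀) c s) {j : ℕ} (hj : j ≤ 2)
    {t : ℝ} (ht : Tendsto (fun z : ℕ × Ω =>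
      powSum (scaledBlocks ξ σ r c z) (j + 1) (alphaOne (ρ 0) α₀) / ((z.1 / r z.1 : ℕ) : ℝ))
      (probFilter P) (𝓝 t)) :
    (fun z : ℕ × Ω => powSum (scaledBlocks ξ σ r c z) j (mle (blockSample ξ c z.1 (r z.1) z.2)).1
          / ((z.1 / r z.1 : ℕ) : ℝ)
        - powSum (scaledBlocks ξ σ r c z) j (alphaOne (ρ 0) α₀) / ((z.1 / r z.1 : ℕ) : ℝ)
        + t * ((mle (blockSample ξ c z.1 (r z.1) z.2)).1 - alphaOne (ρ 0) α₀))
      =o[probFilter P] fun z => (mle (blockSample ξ c z.1 (r z.1) z.2)).1 - alphaOne (ρ 0) α₀ := by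
  obtain ⟨η, R, hη, hR⟩ := S.exists_powSum_bound
  set a := alphaOne (ρ 0) α₀ with ha
  set δ : ℕ × Ω → ℝ := fun z => (mle (blockSample ξ c z.1 (r z.1) z.2)).1 - a with hδ
  have hδ0 : Tendsto δ (probFilter P) (𝓝 0) := by
    have := S.tendsto_mle_fst.sub_const a
    rwa [← ha, sub_self] at this
  set T : ℕ × Ω → ℝ := fun z => powSum (scaledBlocks ξ σ r c z) (j + 1) a / ((z.1 / r z.1 : ℕ) : ℝ) with hT
  have h1 : (fun z : ℕ × Ω => powSum (scaledBlocks ξ σ r c z) j (mle (blockSample ξ c z.1 (r z.1) z.2)).1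
          / ((z.1 / r z.1 : ℕ) : ℝ)
        - powSum (scaledBlocks ξ σ r c z) j a / ((z.1 / r z.1 : ℕ) : ℝ) + T z * δ z)
      =O[probFilter P] fun z => δ z ^ 2 := by
    refine IsBigO.of_bound R ?_
    filter_upwards [S.eventually_card_pos, hR, S.eventually_mle hη] with z hz hRz hm
    set k : ℝ := ((z.1 / r z.1 : ℕ) : ℝ) with hk
    have hder := fun (i : ℕ) (b : ℝ) => hasDerivAt_powSum (S.scaledBlocks_pos hz.2) i b
    have h2 := abs_sub_sub_le_of_second_deriv (f := fun b => powSum (scaledBlocks ξ σ r c z) j b / k)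
      (f' := fun b => -powSum (scaledBlocks ξ σ r c z) (j + 1) b / k)
      (f'' := fun b => powSum (scaledBlocks ξ σ r c z) (j + 1 + 1) b / k) (x₀ := a)
      (x := (mle (blockSample ξ c z.1 (r z.1) z.2)).1) (η := η) (R := R)
      (fun b _ => (hder j b).div_const k)
      (fun b _ => by simpa using ((hder (j + 1) b).neg.div_const k))
      (fun b hb => hRz (j + 1 + 1) (by omega) b hb) hm.2.1
    rw [Real.norm_eq_abs, Real.norm_eq_abs, abs_of_nonneg (sq_nonneg (δ z))]
    refine le_trans (le_of_eq ?_) h2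
    congr 1
    simp only [hT, hδ]
    ring
  have h2 : (fun z => δ z ^ 2) =o[probFilter P] δ := by
    have : (fun z => δ z * δ z) =o[probFilter P] fun z => 1 * δ z :=
      ((isLittleO_one_iff ℝ).2 hδ0).mul_isBigO (isBigO_refl δ _)
    simpa [sq] using this
  have h3 : (fun z => (t - T z) * δ z) =o[probFilter P] δ := by
    have h4 : Tendsto (fun z => t - T z) (probFilter P) (𝓝 0) := by simpa using ht.const_sub t
    have : (fun z => (t - T z) * δ z) =o[probFilter P] fun z => 1 * δ z :=
      ((isLittleO_one_iff ℝ).2 h4).mul_isBigO (isBigO_refl δ _)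
    simpa using this
  refine ((h1.trans_isLittleO h2).add h3).congr_left fun z => ?_
  ring

end BlockSetting

end Expansion

/-! ### The estimation error as a linear image of the empirical vector. -/

section Linearization

open Asymptotics

variable {Ω : Type*} [MeasurableSpace Ω] {P : Measure Ω} [IsProbabilityMeasure P]
  {ξ : ℤ → Ω → ℝ} {ρ : ℝ → ℝ} {ρ₀ α₀ : ℝ} {σ : ℕ → ℝ} {r : ℕ → ℕ} {a c s : ℝ}

/-- The rows of M are the coefficients in `isLittleO_of_likelihood_equation` at p₀ = Υ, q₀ = -Υ'/α₀
and D = Ψ̇; this row is the one for the shape. -/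
lemma applyMat_matM_zero (h0 : 0 ≤ ρ₀) (h1 : ρ₀ ≤ 1) (hα : 0 < α₀) (v : EuclideanSpace ℝ (Fin 4)) :
    applyMat (matM ρ₀ α₀) v 0 = (-2 / Upsilon ρ₀ (varpi ρ₀) * v 0
      + 2 * (-1 / α₀ * deriv (Upsilon ρ₀) (varpi ρ₀)) / Upsilon ρ₀ (varpi ρ₀) ^ 2 * v 1
      + (v 2 + v 3)) / psiDot ρ₀ α₀ := by
  have hv := (varpi_spec h0 h1).1
  have hU := (Upsilon_pos h0 h1 (show -1 < varpi ρ₀ by linarith)).ne'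
  have hD := (psiDot_neg h0 h1 hα).ne
  simp only [applyMat, matM, Matrix.mulVec, dotProduct, Fin.sum_univ_four]
  simp only [Matrix.of_apply, Matrix.cons_val', Matrix.cons_val]
  field_simp
  ring

lemma applyMat_matM_one (h0 : 0 ≤ ρ₀) (h1 : ρ₀ ≤ 1) (hα : 0 < α₀) (v : EuclideanSpace ℝ (Fin 4)) :
    applyMat (matM ρ₀ α₀) v 1 = (2 / Upsilon ρ₀ (varpi ρ₀)) ^ (1 / alphaOne ρ₀ α₀) *
      ((-Real.log (2 / Upsilon ρ₀ (varpi ρ₀)) / alphaOne ρ₀ α₀ ^ 2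
        + (-1 / α₀ * deriv (Upsilon ρ₀) (varpi ρ₀)) / (alphaOne ρ₀ α₀ * Upsilon ρ₀ (varpi ρ₀)))
      * ((-2 / Upsilon ρ₀ (varpi ρ₀) * v 0
      + 2 * (-1 / α₀ * deriv (Upsilon ρ₀) (varpi ρ₀)) / Upsilon ρ₀ (varpi ρ₀) ^ 2 * v 1
      + (v 2 + v 3)) / psiDot ρ₀ α₀) - v 1 / (alphaOne ρ₀ α₀ * Upsilon ρ₀ (varpi ρ₀))) := by
  have hv := (varpi_spec h0 h1).1
  have hU := Upsilon_pos h0 h1 (show -1 < varpi ρ₀ by linarith)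
  have hU' := hU.ne'
  have hD := (psiDot_neg h0 h1 hα).ne
  have ha := (alphaOne_pos h0 h1 hα).ne'
  have e1 : (Upsilon ρ₀ (varpi ρ₀) / 2) ^ (-1 / alphaOne ρ₀ α₀)
      = (2 / Upsilon ρ₀ (varpi ρ₀)) ^ (1 / alphaOne ρ₀ α₀) := by
    rw [neg_div, Real.rpow_neg (by positivity), ← Real.inv_rpow (by positivity), inv_div]
  have e2 : (Upsilon ρ₀ (varpi ρ₀) / 2) ^ (-1 / alphaOne ρ₀ α₀ - 1)
      = (2 / Upsilon ρ₀ (varpi ρ₀)) ^ (1 / alphaOne ρ₀ α₀) * (2 / Upsilon ρ₀ (varpi ρ₀)) := by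
    rw [Real.rpow_sub_one (by positivity), e1, div_eq_mul_inv _ (_ / _), inv_div]
  have e3 : Real.log (Upsilon ρ₀ (varpi ρ₀) / 2) = -Real.log (2 / Upsilon ρ₀ (varpi ρ₀)) := by
    rw [← Real.log_inv, inv_div]
  simp only [applyMat, matM, Matrix.mulVec, dotProduct, Fin.sum_univ_four]
  simp only [Matrix.of_apply, Matrix.cons_val', Matrix.cons_val, e1, e2, e3]
  field_simp
  ring

lemma integral_fct_zero (S : BlockSetting P ξ ρ α₀ σ r a c s) (ha : 0 < a) :
    ∫ p, fct a 0 p ∂(frechetWelsch ρ α₀ 1) = -1 / α₀ * deriv (Upsilon (ρ 0)) (a / α₀) := by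
  have h := S.welsch.integral_snd S.doa.welsch S.doa.alpha_pos (b := a)
    (by linarith [S.doa.alpha_pos]) 1
  simpa [fct, iteratedDeriv_one] using h

lemma integral_fct_one (S : BlockSetting P ξ ρ α₀ σ r a c s) (ha : 0 < a) :
    ∫ p, fct a 1 p ∂(frechetWelsch ρ α₀ 1) = Upsilon (ρ 0) (a / α₀) := by
  have h := S.welsch.integral_snd S.doa.welsch S.doa.alpha_pos (b := a)
    (by linarith [S.doa.alpha_pos]) 0
  simpa [fct] using h

lemma integral_fct_two_add_three (S : BlockSetting P ξ ρ α₀ σ r a c s) :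
    ∫ p, fct a 2 p ∂(frechetWelsch ρ α₀ 1) + ∫ p, fct a 3 p ∂(frechetWelsch ρ α₀ 1)
      = (2 * Real.eulerMascheroniConstant - ρ 0) / α₀ := by
  have hα := S.doa.alpha_pos
  have h1 := S.welsch.integral_snd S.doa.welsch hα (b := 0) (by linarith) 1
  have h2 := S.welsch.integral_fst hα (b := 0) (by linarith) 1
  simp only [neg_zero, Real.rpow_zero, one_mul, pow_one, zero_div, iteratedDeriv_Upsilon_one,
    deriv_Upsilon_zero] at h1 h2
  have e1 : ∫ p, fct a 2 p ∂(frechetWelsch ρ α₀ 1) = ∫ p, Real.log p.2 ∂(frechetWelsch ρ α₀ 1) := rfl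
  have e2 : ∫ p, fct a 3 p ∂(frechetWelsch ρ α₀ 1) = ∫ p, Real.log p.1 ∂(frechetWelsch ρ α₀ 1) := rfl
  rw [e1, e2, h1, h2]
  ring

omit [MeasurableSpace Ω] in
lemma empVector_apply (n : ℕ) (w : Ω) (j : Fin 4) :
    empVector ξ ρ α₀ σ r c n w j = √((n : ℝ) / r n) *
      ((∑ i, fct (alphaOne (ρ 0) α₀) j (scaledBlocks ξ σ r c (n, w) i)) / ((n / r n : ℕ) : ℝ)
        - ∫ p, fct (alphaOne (ρ 0) α₀) j p ∂(frechetWelsch ρ α₀ 1)) := by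
  rw [div_eq_inv_mul (∑ i, _) _]; rfl

lemma norm_le_abs_add_abs (x : EuclideanSpace ℝ (Fin 2)) : ‖x‖ ≤ |x 0| + |x 1| := by
  rw [EuclideanSpace.norm_eq, Fin.sum_univ_two, Real.norm_eq_abs, Real.norm_eq_abs]
  rw [Real.sqrt_le_iff]
  refine ⟨by positivity, ?_⟩
  nlinarith [mul_nonneg (abs_nonneg (x 0)) (abs_nonneg (x 1))]

/-- The estimation error is linear in the empirical process, up to a relative error that vanishes. -/
theorem BlockSetting.eventually_norm_sub_le
    (S : BlockSetting P ξ ρ α₀ σ r (alphaOne (ρ 0) α₀) c s) {ε : ℝ} (hε : 0 < ε) :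
    ∀ᶠ z in probFilter P, ‖estimationError ξ (ρ 0) α₀ σ r c z.1 z.2
        - applyMat (matM (ρ 0) α₀) (empVector ξ ρ α₀ σ r c z.1 z.2)‖
      ≤ ε * ‖empVector ξ ρ α₀ σ r c z.1 z.2‖ := by
  obtain ⟨q, hq, hqs⟩ := S.exists_exponent
  have hα := S.doa.alpha_pos
  obtain ⟨h0, h1⟩ := S.doa.welsch.apply_zero_mem
  obtain ⟨hv, hv0⟩ := varpi_spec h0 h1
  have ha0 : 0 < alphaOne (ρ 0) α₀ := S.a_pos
  have hav : alphaOne (ρ 0) α₀ / α₀ = varpi (ρ 0) := alphaOne_div hα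
  have hI0 := integral_fct_zero S ha0
  have hI1 := integral_fct_one S ha0
  have hI2 := integral_fct_two_add_three S
  have hT := fun j : ℕ => S.tendsto_powSum hq hqs j ha0 (show alphaOne (ρ 0) α₀ < q * alphaOne (ρ 0) α₀ by nlinarith)
  rw [hav] at hI0 hI1
  simp only [hav] at hT
  set a := alphaOne (ρ 0) α₀ with ha
  set U := Upsilon (ρ 0) (varpi (ρ 0)) with hU
  set U' := deriv (Upsilon (ρ 0)) (varpi (ρ 0)) with hU'
  set U'' := deriv (deriv (Upsilon (ρ 0))) (varpi (ρ 0)) with hU''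
  have hUpos : 0 < U := Upsilon_pos h0 h1 (by linarith)
  have hT0 := hT 0
  have hT1 := hT 1
  have hT2 := hT 2
  simp only [pow_zero, one_mul, iteratedDeriv_zero, pow_one, iteratedDeriv_one,
    iteratedDeriv_Upsilon_two] at hT0 hT1 hT2
  have hD : psiDot (ρ 0) α₀ = -2 / a ^ 2 - 2 * ((-1 / α₀) ^ 2 * U'') / U
      + 2 * (-1 / α₀ * U') ^ 2 / U ^ 2 := by
    rw [psiDot, ← ha, ← hU, ← hU', ← hU'']
    field_simp
    ring
  -- The likelihood equation of the limit law, which is Π(ϖ) = 0 up to the factor 2/α₀.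
  have hzero : 2 / a + 2 * (-1 / α₀ * U' / U) = (2 * Real.eulerMascheroniConstant - ρ 0) / α₀ := by
    have h2 : 2 / α₀ * PiFun (ρ 0) (varpi (ρ 0)) = 0 := by rw [hv0, mul_zero]
    rw [PiFun, ← hU, ← hU', ← hav] at h2
    rw [← sub_eq_zero]
    refine Eq.trans ?_ h2
    field_simp
    ring
  have heq : ∀ᶠ z in probFilter P,
      2 / (mle (blockSample ξ c z.1 (r z.1) z.2)).1
        + 2 * ((powSum (scaledBlocks ξ σ r c z) 1 (mle (blockSample ξ c z.1 (r z.1) z.2)).1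
            / ((z.1 / r z.1 : ℕ) : ℝ))
          / (powSum (scaledBlocks ξ σ r c z) 0 (mle (blockSample ξ c z.1 (r z.1) z.2)).1
            / ((z.1 / r z.1 : ℕ) : ℝ)))
        = logSum (scaledBlocks ξ σ r c z) / ((z.1 / r z.1 : ℕ) : ℝ) := by
    filter_upwards [S.eventually_mle one_pos, S.eventually_card_pos] with z hz hk
    have h3 := hz.2.2.1
    have hk' : ((z.1 / r z.1 : ℕ) : ℝ) ≠ 0 := by
      have := hk.1
      positivity
    rw [score] at h3
    rw [div_div_div_cancel_right₀ hk']
    linarith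
  obtain ⟨hL1, hL2⟩ := isLittleO_of_likelihood_equation ha0 hUpos S.tendsto_mle_fst hT0 hT1
    (S.isLittleO_powSum (by norm_num) hT1) (S.isLittleO_powSum (by norm_num) hT2) heq hzero hD
    (psiDot_neg h0 h1 hα).ne
  -- Two coordinates, each with an error multiplied by at most 4‖W‖, share ε.
  have hε8 : 0 < ε / 8 := by positivity
  filter_upwards [hL1.bound hε8, hL2.bound hε8, S.eventually_mle one_pos, S.eventually_card_pos]
    with z h3 h4 h5 h6
  obtain ⟨n, w⟩ := z
  simp only at h3 h4 h5 h6
  have hk' : ((n / r n : ℕ) : ℝ) ≠ 0 := by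
    have := h6.1
    positivity
  set v := √((n : ℝ) / r n) with hvdef
  have hv0' : 0 ≤ v := Real.sqrt_nonneg _
  set W := empVector ξ ρ α₀ σ r c n w with hW
  set Zs := scaledBlocks ξ σ r c (n, w) with hZs
  set k : ℝ := ((n / r n : ℕ) : ℝ) with hk
  have hW0 : W 0 = v * (powSum Zs 1 a / k - -1 / α₀ * U') := by
    have e : powSum Zs 1 a = ∑ i, fct a 0 (Zs i) := by simp [powSum, fct]
    rw [hW, empVector_apply, ← ha, hI0, e]
  have hW1 : W 1 = v * (powSum Zs 0 a / k - U) := by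
    have e : powSum Zs 0 a = ∑ i, fct a 1 (Zs i) := by simp [powSum, fct]
    rw [hW, empVector_apply, ← ha, hI1, e]
  have hW2 : W 2 + W 3 = v * (logSum Zs / k - (2 * Real.eulerMascheroniConstant - ρ 0) / α₀) := by
    have e : logSum Zs / k = (∑ i, fct a 2 (Zs i)) / k + (∑ i, fct a 3 (Zs i)) / k := by
      rw [logSum, Finset.sum_add_distrib, add_div, add_comm]
      rfl
    rw [hW, empVector_apply, empVector_apply, ← ha, ← hI2, e]
    ring
  have hWn : ∀ j, |W j| ≤ ‖W‖ := fun j => by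
    rw [← Real.norm_eq_abs]; exact PiLp.norm_apply_le W j
  set e := |powSum Zs 1 a / k - -1 / α₀ * U'| + |powSum Zs 0 a / k - U|
    + |logSum Zs / k - (2 * Real.eulerMascheroniConstant - ρ 0) / α₀| with he
  -- The third input error involves W 2 + W 3, so altogether four entries of W occur.
  have hve : v * e ≤ 4 * ‖W‖ := by
    have e1 : v * e = |W 0| + |W 1| + |W 2 + W 3| := by
      rw [hW0, hW1, hW2, abs_mul, abs_mul, abs_mul, abs_of_nonneg hv0', he]
      ring
    rw [e1]
    have := abs_add_le (W 2) (W 3)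
    linarith [hWn 0, hWn 1, hWn 2, hWn 3]
  have he0 : 0 ≤ e := by positivity
  rw [Real.norm_eq_abs, Real.norm_eq_abs, abs_of_nonneg he0] at h3 h4
  refine (norm_le_abs_add_abs _).trans ?_
  have hc0 : (estimationError ξ (ρ 0) α₀ σ r c n w - applyMat (matM (ρ 0) α₀) W) 0
      = v * ((mle (blockSample ξ c n (r n) w)).1 - a
        - (-2 / U * (powSum Zs 1 a / k - -1 / α₀ * U')
          + 2 * (-1 / α₀ * U') / U ^ 2 * (powSum Zs 0 a / k - U)
          + (logSum Zs / k - (2 * Real.eulerMascheroniConstant - ρ 0) / α₀)) / psiDot (ρ 0) α₀) := by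
    rw [PiLp.sub_apply, applyMat_matM_zero h0 h1 hα, hW2, hW0, hW1]
    simp only [estimationError, PiLp.smul_apply, smul_eq_mul, ← hU, ← hU', ← ha, ← hvdef,
      Matrix.cons_val_zero]
    ring
  have hc1 : (estimationError ξ (ρ 0) α₀ σ r c n w - applyMat (matM (ρ 0) α₀) W) 1
      = v * ((2 / (powSum Zs 0 (mle (blockSample ξ c n (r n) w)).1 / k))
          ^ (1 / (mle (blockSample ξ c n (r n) w)).1) - (2 / U) ^ (1 / a) - (2 / U) ^ (1 / a) *
          ((-Real.log (2 / U) / a ^ 2 + -1 / α₀ * U' / (a * U)) *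
        ((-2 / U * (powSum Zs 1 a / k - -1 / α₀ * U')
          + 2 * (-1 / α₀ * U') / U ^ 2 * (powSum Zs 0 a / k - U)
          + (logSum Zs / k - (2 * Real.eulerMascheroniConstant - ρ 0) / α₀)) / psiDot (ρ 0) α₀)
          - (powSum Zs 0 a / k - U) / (a * U))) := by
    have e1 : 2 / (powSum Zs 0 (mle (blockSample ξ c n (r n) w)).1 / k)
        = 2 * k / powSum Zs 0 (mle (blockSample ξ c n (r n) w)).1 := by
      rw [div_div_eq_mul_div]
    rw [PiLp.sub_apply, applyMat_matM_one h0 h1 hα, hW2, hW0, hW1, e1]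
    have e2 := h5.2.2.2
    rw [profileScale] at e2
    simp only [estimationError, PiLp.smul_apply, smul_eq_mul, ← hU, ← hU', ← ha, ← hvdef,
      Matrix.cons_val_one, Matrix.cons_val_fin_one, e2, sOne]
    ring
  rw [hc0, hc1, abs_mul, abs_mul, abs_of_nonneg hv0']
  have f1 := mul_le_mul_of_nonneg_left h3 hv0'
  have f2 := mul_le_mul_of_nonneg_left h4 hv0'
  have f3 : v * (ε / 8 * e) = ε / 8 * (v * e) := by ring
  rw [f3] at f1 f2
  have f4 : ε / 8 * (v * e) ≤ ε / 8 * (4 * ‖W‖) := by gcongr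
  have f5 := norm_nonneg W
  linarith

end Linearization

/-! ### From relative error bounds to the limit law. -/

section MainConclusion

variable {Ω : Type*} [MeasurableSpace Ω] {P : Measure Ω} [IsProbabilityMeasure P]

/-- A weakly convergent sequence is bounded in probability: the limit law is tight, and the
portmanteau inequality for closed sets passes this on. -/
lemma exists_eventually_measure_norm_lt {E : Type*} [NormedAddCommGroup E] [MeasurableSpace E]
    [BorelSpace E] [CompleteSpace E] [SecondCountableTopology E] {X : ℕ → Ω → E} {μ : Measure E} [IsProbabilityMeasure μ]
    (h : TendstoInDistribution X atTop id (fun _ => P) μ) {ε : ℝ≥0∞} (hε : 0 < ε) :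
    ∃ R : ℝ, 0 < R ∧ ∀ᶠ n in atTop, P {w | R ≤ ‖X n w‖} < ε := by
  have h1 := tendsto_measure_norm_gt_of_isTightMeasureSet (isTightMeasureSet_singleton (μ := μ))
  simp only [mem_singleton_iff, iSup_iSup_eq_left] at h1
  obtain ⟨R, hR, hR0⟩ := ((h1.eventually_lt_const hε).and (eventually_ge_atTop 0)).exists
  -- The shift by 1 places a closed set {‖x‖ ≥ R + 1} inside {‖x‖ > R}, where the limit law has
  -- little mass.
  refine ⟨R + 1, by linarith, ?_⟩
  have hF : IsClosed {x : E | R + 1 ≤ ‖x‖} := isClosed_le continuous_const continuous_norm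
  have h2 := ProbabilityMeasure.limsup_measure_closed_le_of_tendsto h.tendsto hF
  have h3 : μ {x : E | R + 1 ≤ ‖x‖} < ε :=
    lt_of_le_of_lt (measure_mono fun x (hx : R + 1 ≤ ‖x‖) => show R < ‖x‖ by linarith) hR
  simp only [ProbabilityMeasure.coe_mk, Measure.map_id] at h2
  filter_upwards [eventually_lt_of_limsup_lt (h2.trans_lt h3)] with n hn
  rwa [Measure.map_apply_of_aemeasurable (h.forall_aemeasurable n) hF.measurableSet] at hn

/-- A vanishing relative error multiplied by a sequence bounded in probability tends to zero in
probability. -/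
lemma tendstoInMeasure_zero_of_norm_le {E F : Type*} [NormedAddCommGroup E] [MeasurableSpace E]
    [BorelSpace E] [CompleteSpace E] [SecondCountableTopology E] [NormedAddCommGroup F] {X : ℕ → Ω → E} {μ : Measure E} [IsProbabilityMeasure μ]
    (h : TendstoInDistribution X atTop id (fun _ => P) μ) {D : ℕ → Ω → F}
    (hD : ∀ ε > 0, ∀ᶠ z in probFilter P, ‖D z.1 z.2‖ ≤ ε * ‖X z.1 z.2‖) :
    TendstoInMeasure P D atTop (fun _ => 0) := by
  rw [tendstoInMeasure_iff_norm]
  intro δ hδ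
  rw [ENNReal.tendsto_nhds_zero]
  intro ε hε
  obtain ⟨R, hR, hR2⟩ := exists_eventually_measure_norm_lt h (ENNReal.half_pos hε.ne')
  have h1 := eventually_probFilter.1 (hD (δ / (2 * R)) (by positivity))
  filter_upwards [hR2, h1.eventually_lt_const (ENNReal.half_pos hε.ne')] with n h2 h3
  calc P {w | δ ≤ ‖D n w - 0‖}
      ≤ P ({w | R ≤ ‖X n w‖} ∪ {w | ¬ ‖D n w‖ ≤ δ / (2 * R) * ‖X n w‖}) := by
        refine measure_mono fun w hw => ?_
        by_contra hcon
        simp only [mem_union, mem_ofPred_eq, not_or, not_le, not_lt, sub_zero] at hw hcon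
        have h4 : δ / (2 * R) * ‖X n w‖ ≤ δ / (2 * R) * R := by
          gcongr
          exact hcon.1.le
        have h5 : δ / (2 * R) * R = δ / 2 := by field_simp
        linarith [hcon.2]
    _ ≤ _ := measure_union_le _ _
    _ ≤ ε / 2 + ε / 2 := add_le_add h2.le h3.le
    _ = ε := ENNReal.add_halves ε

omit [IsProbabilityMeasure P] in
lemma tendstoInMeasure_congr_probFilter {F : Type*} [NormedAddCommGroup F] {D D' : ℕ → Ω → F}
    (h : TendstoInMeasure P D atTop (fun _ => 0))
    (hD : ∀ᶠ z in probFilter P, D' z.1 z.2 = D z.1 z.2) :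
    TendstoInMeasure P D' atTop (fun _ => 0) := by
  rw [tendstoInMeasure_iff_norm] at h ⊢
  intro ε hε
  have h1 := (h ε hε).add (eventually_probFilter.1 hD)
  rw [add_zero] at h1
  refine tendsto_of_tendsto_of_tendsto_of_le_of_le tendsto_const_nhds h1 (fun _ => zero_le) fun n => ?_
  refine (measure_mono fun w hw => ?_).trans (measure_union_le _ _)
  by_cases hw' : D' n w = D n w
  · left
    simpa only [mem_ofPred_eq, hw'] using hw
  · exact Or.inr hw'

variable {ξ : ℤ → Ω → ℝ} {ρ : ℝ → ℝ} {α₀ : ℝ} {σ : ℕ → ℝ} {r : ℕ → ℕ} {B : Fin 4 → ℝ} {c s : ℝ}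

lemma continuous_applyMat (M : Matrix (Fin 2) (Fin 4) ℝ) : Continuous (applyMat M) := by
  refine (PiLp.continuous_toLp 2 fun _ : Fin 2 => ℝ).comp ?_
  exact continuous_const.matrix_mulVec (PiLp.continuous_ofLp 2 fun _ : Fin 4 => ℝ)

lemma measurable_estimationError (hξ : ∀ t, Measurable (ξ t)) (hc : 0 < c) (ρ₀ α₀ : ℝ) (n : ℕ) :
    Measurable (estimationError ξ ρ₀ α₀ σ r c n) := by
  have h : Measurable fun w => mle (blockSample ξ c n (r n) w) :=
    measurable_mle_comp (measurable_blockSample hξ c n (r n)) (blockSample_pos ξ hc n (r n))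
  have h2 : Measurable fun w => (!₂[(mle (blockSample ξ c n (r n) w)).1 - alphaOne ρ₀ α₀,
      (mle (blockSample ξ c n (r n) w)).2 / σ (r n) - sOne ρ₀ α₀] : EuclideanSpace ℝ (Fin 2)) := by
    refine (PiLp.continuous_toLp 2 fun _ : Fin 2 => ℝ).measurable.comp
      (measurable_pi_iff.2 fun j => ?_)
    fin_cases j
    · exact h.fst.sub_const _
    · exact (h.snd.div_const _).sub_const _
  exact h2.const_smul (√((n : ℝ) / r n))

omit [MeasurableSpace Ω] in
lemma estimationError_congr {c' : ℝ} {n : ℕ} {w : Ω}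
    (h : blockSample ξ c n (r n) w = blockSample ξ c' n (r n) w) (ρ₀ α₀ : ℝ) :
    estimationError ξ ρ₀ α₀ σ r c n w = estimationError ξ ρ₀ α₀ σ r c' n w := by
  rw [estimationError, estimationError, h]

omit [MeasurableSpace Ω] in
lemma empVector_congr {c' : ℝ} {n : ℕ} {w : Ω}
    (h : blockSample ξ c n (r n) w = blockSample ξ c' n (r n) w) :
    empVector ξ ρ α₀ σ r c n w = empVector ξ ρ α₀ σ r c' n w := by
  rw [empVector, empVector, h]

lemma BlockSetting.tendstoInMeasure_linearization
    (S : BlockSetting P ξ ρ α₀ σ r (alphaOne (ρ 0) α₀) c s) {μ : Measure (EuclideanSpace ℝ (Fin 4))}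
    [IsProbabilityMeasure μ]
    (h : TendstoInDistribution (fun n => empVector ξ ρ α₀ σ r c n) atTop id (fun _ => P) μ) :
    TendstoInMeasure P (fun n w => estimationError ξ (ρ 0) α₀ σ r c n w
        - applyMat (matM (ρ 0) α₀) (empVector ξ ρ α₀ σ r c n w)) atTop (fun _ => 0) :=
  tendstoInMeasure_zero_of_norm_le h fun _ hε => S.eventually_norm_sub_le hε

/-- The linear expansion and the limit law of the estimation error, for one truncation level. -/
theorem BlockSetting.tendstoInDistribution_estimationError
    (S : BlockSetting P ξ ρ α₀ σ r (alphaOne (ρ 0) α₀) c s) {μ : Measure (EuclideanSpace ℝ (Fin 4))}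
    [IsProbabilityMeasure μ]
    (h : TendstoInDistribution (fun n => empVector ξ ρ α₀ σ r c n) atTop id (fun _ => P) μ) :
    TendstoInDistribution (fun n => estimationError ξ (ρ 0) α₀ σ r c n) atTop
      (applyMat (matM (ρ 0) α₀)) (fun _ => P) μ :=
  tendstoInDistribution_of_tendstoInMeasure_sub
    (X := fun n => applyMat (matM (ρ 0) α₀) ∘ empVector ξ ρ α₀ σ r c n) _ _
    (h.continuous_comp (g := applyMat (matM (ρ 0) α₀)) (continuous_applyMat _))
    (S.tendstoInMeasure_linearization h) fun n => (measurable_estimationError S.meas S.c_pos _ _ n).aemeasurable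

/-- The expansion and the limit law are established at the level c₀ of the bias condition and
carried over to c, because the two samples agree with probability tending to one. Existence and
uniqueness hold at level c directly. -/
theorem pseudoMLE_asymptotics (hξ : ∀ t, Measurable (ξ t)) {ω : ℝ}
    (hr : Tendsto r atTop atTop) (hk : Tendsto (fun n => n / r n) atTop atTop)
    (hdoa : DomainOfAttraction P ξ ρ α₀ σ)
    (hdiv : AllDiverge P ξ r)
    (hmix : AlphaMixingRate P ξ r ω)
    (hmom : IntegrabilityCondition P ξ σ (alphaOne (ρ 0) α₀) ω)
    (hbias : BiasCondition P ξ ρ α₀ σ r B) (hc : 0 < c) :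
    Tendsto (fun n => P {w | ¬ ∃! θ, IsMLE (blockSample ξ c n (r n) w) θ}) atTop (𝓝 0) ∧
    TendstoInMeasure P
      (fun n w => estimationError ξ (ρ 0) α₀ σ r c n w
        - applyMat (matM (ρ 0) α₀) (empVector ξ ρ α₀ σ r c n w)) atTop (fun _ => 0) ∧
    TendstoInDistribution (fun n => estimationError ξ (ρ 0) α₀ σ r c n) atTop
      (applyMat (matM (ρ 0) α₀)) (fun _ => P)
      (multivariateGaussian (WithLp.toLp 2 B) (sigmaDB ρ α₀)) := by
  obtain ⟨c₀, hc₀, hB⟩ := hbias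
  obtain ⟨h0, h1⟩ := hdoa.welsch.apply_zero_mem
  have ha := alphaOne_pos h0 h1 hdoa.alpha_pos
  obtain ⟨s, S⟩ := BlockSetting.of_assumptions hξ hr hk hdoa hmix ha hmom hc
  obtain ⟨s₀, S₀⟩ := BlockSetting.of_assumptions hξ hr hk hdoa hmix ha hmom hc₀
  have hW := tendstoInDistribution_empVector S₀ hB
  have hcc := blockSample_eventually_eq (c' := c₀) hr hdiv hc
  refine ⟨?_, ?_, ?_⟩
  · exact eventually_probFilter.1 ((S.eventually_mle one_pos).mono fun z hz => hz.1)
  · refine tendstoInMeasure_congr_probFilter (S₀.tendstoInMeasure_linearization hW) ?_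
    filter_upwards [hcc] with z hz
    rw [estimationError_congr hz, empVector_congr hz]
  · refine tendstoInDistribution_of_tendstoInMeasure_sub _ _
      (S₀.tendstoInDistribution_estimationError hW) ?_
      fun n => (measurable_estimationError hξ hc _ _ n).aemeasurable
    have h0 : TendstoInMeasure P (fun (_ : ℕ) (_ : Ω) => (0 : EuclideanSpace ℝ (Fin 2))) atTop
        (fun _ => 0) := by
      rw [tendstoInMeasure_iff_norm]
      intro ε hε
      simp [hε.not_ge]
    refine tendstoInMeasure_congr_probFilter h0 ?_
    filter_upwards [hcc] with z hz
    simp only [Pi.sub_apply]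
    rw [estimationError_congr hz, sub_self]

end MainConclusion

/-! ### Derivatives of the Gamma function at small integers -/

section GammaDerivatives

lemma iteratedDeriv_Upsilon_zero_eq (j : ℕ) (s : ℝ) :
    iteratedDeriv j (Upsilon 0) s = iteratedDeriv j Real.Gamma (s + 1) := by
  have h : Upsilon 0 = fun s => Real.Gamma (s + 1) := by funext s; simp [Upsilon]
  rw [h, iteratedDeriv_comp_add_const]

lemma iteratedDeriv_Upsilon_one_eq (j : ℕ) (s : ℝ) :
    iteratedDeriv j (Upsilon 1) s = iteratedDeriv j Real.Gamma (s + 2) := by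
  have h : Upsilon 1 = fun s => Real.Gamma (s + 2) := by funext s; simp [Upsilon]
  rw [h, iteratedDeriv_comp_add_const]

lemma Real.hasDerivAt_iteratedDeriv_Gamma {x : ℝ} (hx : 0 < x) (j : ℕ) :
    HasDerivAt (iteratedDeriv j Real.Gamma) (iteratedDeriv (j + 1) Real.Gamma x) x := by
  have h := hasDerivAt_iteratedDeriv_Upsilon (ρ₀ := 0) le_rfl zero_le_one
    (show -1 < x - 1 by linarith) j
  have h2 := h.comp_sub_const x 1
  rw [iteratedDeriv_Upsilon_zero_eq, sub_add_cancel] at h2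
  refine h2.congr_of_eventuallyEq (Eventually.of_forall fun y => ?_)
  simp only [iteratedDeriv_Upsilon_zero_eq, sub_add_cancel]

lemma Real.iteratedDeriv_one_Gamma_add_one {x : ℝ} (hx : 0 < x) :
    iteratedDeriv 1 Real.Gamma (x + 1) = Real.Gamma x + x * iteratedDeriv 1 Real.Gamma x := by
  rw [iteratedDeriv_one, Real.deriv_Gamma_add_one hx]

lemma Real.iteratedDeriv_two_Gamma_add_one {x : ℝ} (hx : 0 < x) :
    iteratedDeriv 2 Real.Gamma (x + 1)
      = 2 * iteratedDeriv 1 Real.Gamma x + x * iteratedDeriv 2 Real.Gamma x := by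
  have h1 := (Real.hasDerivAt_iteratedDeriv_Gamma (show 0 < x + 1 by linarith) 1).comp_add_const x 1
  have h2 := ((Real.hasDerivAt_iteratedDeriv_Gamma hx 0).add
    ((hasDerivAt_id x).mul (Real.hasDerivAt_iteratedDeriv_Gamma hx 1)))
  have h3 := h1.unique (h2.congr_of_eventuallyEq ?_)
  · rw [h3]
    simp only [id]
    ring
  · filter_upwards [lt_mem_nhds hx] with y hy
    simpa using Real.iteratedDeriv_one_Gamma_add_one hy

/-- The reflection formula cleared of denominators, so that it holds on a neighbourhood of 0 and can
be differentiated there. -/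
lemma Real.Gamma_one_add_mul_Gamma_one_sub_mul_sin {x : ℝ} (hx : |x| < 1) :
    Real.Gamma (1 + x) * Real.Gamma (1 - x) * Real.sin (Real.pi * x) = Real.pi * x := by
  rcases eq_or_ne x 0 with rfl | h0
  · simp
  have hs : Real.sin (Real.pi * x) ≠ 0 := by
    intro h
    obtain ⟨n, hn⟩ := Real.sin_eq_zero_iff.1 h
    have hx' : x = n := by
      rw [mul_comm] at hn
      exact (mul_left_cancel₀ Real.pi_ne_zero hn).symm
    rw [hx'] at hx h0
    have : |n| < 1 := by exact_mod_cast hx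
    exact h0 (by rw [Int.abs_lt_one_iff.1 this]; simp)
  rw [add_comm 1 x, Real.Gamma_add_one h0, mul_assoc x, Real.Gamma_mul_Gamma_one_sub,
    mul_assoc, div_mul_cancel₀ _ hs, mul_comm]

lemma eqOn_zero_deriv {f f' : ℝ → ℝ} {U : Set ℝ} (hU : IsOpen U) (h0 : ∀ x ∈ U, f x = 0)
    (h : ∀ x ∈ U, HasDerivAt f (f' x) x) : ∀ x ∈ U, f' x = 0 := fun x hx =>
  ((h x hx).congr_of_eventuallyEq (f₁ := fun _ => 0) (by
    filter_upwards [hU.mem_nhds hx] with y hy using (h0 y hy).symm)).unique (hasDerivAt_const x 0)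

/-- Differentiate Γ(1+x) Γ(1-x) sin(πx) = πx three times and set x = 0. The sine vanishes to first
order, so second derivatives of Γ at 1 survive in the third derivative, together with the cubic
coefficient of the sine, which yields π²/6. -/
lemma Real.iteratedDeriv_two_Gamma_one :
    iteratedDeriv 2 Real.Gamma 1 = Real.eulerMascheroniConstant ^ 2 + Real.pi ^ 2 / 6 := by
  set G := fun j => iteratedDeriv j Real.Gamma with hG
  set S := fun x => Real.sin (Real.pi * x) with hS
  set C := fun x => Real.cos (Real.pi * x) with hC
  have hp : ∀ j, ∀ x ∈ Ioo (-1 : ℝ) 1, HasDerivAt (fun x => G j (1 + x)) (G (j + 1) (1 + x)) x :=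
    fun j x hx =>
      (Real.hasDerivAt_iteratedDeriv_Gamma (show 0 < 1 + x by linarith [hx.1]) j).comp_const_add 1 x
  have hm : ∀ j, ∀ x ∈ Ioo (-1 : ℝ) 1, HasDerivAt (fun x => G j (1 - x)) (-G (j + 1) (1 - x)) x :=
    fun j x hx =>
      (Real.hasDerivAt_iteratedDeriv_Gamma (show 0 < 1 - x by linarith [hx.2]) j).comp_const_sub 1 x
  have hs : ∀ x, HasDerivAt S (Real.pi * C x) x := fun x => by
    have := ((hasDerivAt_id x).const_mul Real.pi).sin
    refine this.congr_deriv ?_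
    simp only [hC, id]; ring
  have hc : ∀ x, HasDerivAt C (-Real.pi * S x) x := fun x => by
    have := ((hasDerivAt_id x).const_mul Real.pi).cos
    refine this.congr_deriv ?_
    simp only [hS, id]; ring
  have e0 : ∀ x ∈ Ioo (-1 : ℝ) 1, G 0 (1 + x) * G 0 (1 - x) * S x - Real.pi * x = 0 := fun x hx => by
    simp only [hG, iteratedDeriv_zero, hS]
    rw [Real.Gamma_one_add_mul_Gamma_one_sub_mul_sin (abs_lt.2 hx), sub_self]
  have e1 : ∀ x ∈ Ioo (-1 : ℝ) 1, (G 1 (1 + x) * G 0 (1 - x) - G 0 (1 + x) * G 1 (1 - x)) * S x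
      + Real.pi * (G 0 (1 + x) * G 0 (1 - x)) * C x - Real.pi = 0 :=
    eqOn_zero_deriv isOpen_Ioo e0 fun x hx =>
      ((((hp 0 x hx).mul (hm 0 x hx)).mul (hs x)).sub
        ((hasDerivAt_id x).const_mul Real.pi)).congr_deriv (by simp only [Pi.mul_apply]; ring)
  have e2 : ∀ x ∈ Ioo (-1 : ℝ) 1, (G 2 (1 + x) * G 0 (1 - x) - 2 * (G 1 (1 + x) * G 1 (1 - x))
      + G 0 (1 + x) * G 2 (1 - x)) * S x
      + 2 * Real.pi * (G 1 (1 + x) * G 0 (1 - x) - G 0 (1 + x) * G 1 (1 - x)) * C x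
      - Real.pi ^ 2 * (G 0 (1 + x) * G 0 (1 - x)) * S x = 0 :=
    eqOn_zero_deriv isOpen_Ioo e1 fun x hx =>
      ((((((hp 1 x hx).mul (hm 0 x hx)).sub ((hp 0 x hx).mul (hm 1 x hx))).mul (hs x)).add
        ((((hp 0 x hx).mul (hm 0 x hx)).const_mul Real.pi).mul (hc x))).sub_const
        Real.pi).congr_deriv (by simp only [Pi.mul_apply, Pi.sub_apply]; ring)
  have e3 := eqOn_zero_deriv isOpen_Ioo e2 fun x hx =>
      ((((((hp 2 x hx).mul (hm 0 x hx)).sub (((hp 1 x hx).mul (hm 1 x hx)).const_mul 2)).add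
        ((hp 0 x hx).mul (hm 2 x hx))).mul (hs x)).add
        (((((hp 1 x hx).mul (hm 0 x hx)).sub ((hp 0 x hx).mul (hm 1 x hx))).const_mul
        (2 * Real.pi)).mul (hc x))).sub
        ((((hp 0 x hx).mul (hm 0 x hx)).const_mul (Real.pi ^ 2)).mul (hs x))
  have h := e3 0 (by norm_num)
  have g0 : G 0 1 = 1 := by simp [hG]
  have g1 : G 1 1 = -Real.eulerMascheroniConstant := by
    simp only [hG]
    rw [iteratedDeriv_one, Real.deriv_Gamma_one]
  have hS0 : S 0 = 0 := by simp [hS]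
  have hC0 : C 0 = 1 := by simp [hC]
  simp only [Pi.mul_apply, Pi.sub_apply, Pi.add_apply, add_zero, sub_zero, hS0, hC0, g0, g1] at h
  have h6 : Real.pi * (6 * (G 2 1 - Real.eulerMascheroniConstant ^ 2) - Real.pi ^ 2) = 0 := by
    linear_combination h
  have h7 := (mul_eq_zero.1 h6).resolve_left Real.pi_ne_zero
  change G 2 1 = _
  linarith

lemma Real.iteratedDeriv_Gamma_two : iteratedDeriv 1 Real.Gamma 2 = 1 - Real.eulerMascheroniConstant ∧
    iteratedDeriv 2 Real.Gamma 2 = Real.eulerMascheroniConstant ^ 2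
      - 2 * Real.eulerMascheroniConstant + Real.pi ^ 2 / 6 := by
  have h1 : iteratedDeriv 1 Real.Gamma 1 = -Real.eulerMascheroniConstant := by
    rw [iteratedDeriv_one, Real.deriv_Gamma_one]
  rw [show (2 : ℝ) = 1 + 1 by norm_num, Real.iteratedDeriv_one_Gamma_add_one one_pos,
    Real.iteratedDeriv_two_Gamma_add_one one_pos, h1, Real.iteratedDeriv_two_Gamma_one,
    Real.Gamma_one]
  constructor <;> ring

lemma Real.Gamma_three : Real.Gamma 3 = 2 := by
  rw [show (3 : ℝ) = 2 + 1 by norm_num, Real.Gamma_add_one two_ne_zero, Real.Gamma_two, mul_one]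

lemma Real.Gamma_four : Real.Gamma 4 = 6 := by
  rw [show (4 : ℝ) = 3 + 1 by norm_num, Real.Gamma_add_one three_ne_zero, Real.Gamma_three]
  norm_num

lemma Real.iteratedDeriv_Gamma_three :
    iteratedDeriv 1 Real.Gamma 3 = 3 - 2 * Real.eulerMascheroniConstant ∧
    iteratedDeriv 2 Real.Gamma 3 = 2 - 6 * Real.eulerMascheroniConstant
      + 2 * Real.eulerMascheroniConstant ^ 2 + Real.pi ^ 2 / 3 := by
  obtain ⟨h1, h2⟩ := Real.iteratedDeriv_Gamma_two
  rw [show (3 : ℝ) = 2 + 1 by norm_num, Real.iteratedDeriv_one_Gamma_add_one two_pos,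
    Real.iteratedDeriv_two_Gamma_add_one two_pos, h1, h2, Real.Gamma_two]
  constructor <;> ring

lemma Real.iteratedDeriv_Gamma_four :
    iteratedDeriv 1 Real.Gamma 4 = 11 - 6 * Real.eulerMascheroniConstant ∧
    iteratedDeriv 2 Real.Gamma 4 = 12 - 22 * Real.eulerMascheroniConstant
      + 6 * Real.eulerMascheroniConstant ^ 2 + Real.pi ^ 2 := by
  obtain ⟨h1, h2⟩ := Real.iteratedDeriv_Gamma_three
  rw [show (4 : ℝ) = 3 + 1 by norm_num, Real.iteratedDeriv_one_Gamma_add_one three_pos,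
    Real.iteratedDeriv_two_Gamma_add_one three_pos, h1, h2, Real.Gamma_three]
  constructor <;> ring

end GammaDerivatives

/-! ### Explicit constants for ρ₀ = 1. -/

section Independent

lemma Upsilon_one_zero : iteratedDeriv 0 (Upsilon 1) 0 = 1 ∧
    iteratedDeriv 1 (Upsilon 1) 0 = 1 - Real.eulerMascheroniConstant ∧
    iteratedDeriv 2 (Upsilon 1) 0 = Real.eulerMascheroniConstant ^ 2
      - 2 * Real.eulerMascheroniConstant + Real.pi ^ 2 / 6 := by
  simp only [iteratedDeriv_Upsilon_one_eq, zero_add, iteratedDeriv_zero, Real.Gamma_two, true_and]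
  exact Real.iteratedDeriv_Gamma_two

lemma Upsilon_one_one : iteratedDeriv 0 (Upsilon 1) 1 = 2 ∧
    iteratedDeriv 1 (Upsilon 1) 1 = 3 - 2 * Real.eulerMascheroniConstant ∧
    iteratedDeriv 2 (Upsilon 1) 1 = 2 - 6 * Real.eulerMascheroniConstant
      + 2 * Real.eulerMascheroniConstant ^ 2 + Real.pi ^ 2 / 3 := by
  simp only [iteratedDeriv_Upsilon_one_eq, show (1 : ℝ) + 2 = 3 by norm_num, iteratedDeriv_zero,
    Real.Gamma_three, true_and]
  exact Real.iteratedDeriv_Gamma_three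

lemma Upsilon_one_two : iteratedDeriv 0 (Upsilon 1) 2 = 6 ∧
    iteratedDeriv 1 (Upsilon 1) 2 = 11 - 6 * Real.eulerMascheroniConstant ∧
    iteratedDeriv 2 (Upsilon 1) 2 = 12 - 22 * Real.eulerMascheroniConstant
      + 6 * Real.eulerMascheroniConstant ^ 2 + Real.pi ^ 2 := by
  simp only [iteratedDeriv_Upsilon_one_eq, show (2 : ℝ) + 2 = 4 by norm_num, iteratedDeriv_zero,
    Real.Gamma_four, true_and]
  exact Real.iteratedDeriv_Gamma_four

lemma varpi_one : varpi 1 = 1 := by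
  refine varpi_eq_of_PiFun_eq_zero zero_le_one le_rfl one_pos ?_
  obtain ⟨h0, h1, -⟩ := Upsilon_one_one
  rw [iteratedDeriv_zero] at h0
  rw [iteratedDeriv_one] at h1
  rw [PiFun, h0, h1]
  ring

lemma alphaOne_one (α₀ : ℝ) : alphaOne 1 α₀ = α₀ := by rw [alphaOne, varpi_one, one_mul]

lemma sOne_one (α₀ : ℝ) : sOne 1 α₀ = 1 := by
  have h0 := Upsilon_one_one.1
  rw [iteratedDeriv_zero] at h0
  rw [sOne, varpi_one, h0, div_self two_ne_zero, Real.one_rpow]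

lemma psiDot_one {α₀ : ℝ} (hα : 0 < α₀) : psiDot 1 α₀ = -((2 * Real.pi ^ 2 - 3) / (6 * α₀ ^ 2)) := by
  obtain ⟨h0, h1, h2⟩ := Upsilon_one_one
  rw [iteratedDeriv_zero] at h0
  rw [iteratedDeriv_Upsilon_one] at h1
  rw [iteratedDeriv_Upsilon_two] at h2
  rw [psiDot, varpi_one, alphaOne_one, h0, h1, h2]
  field_simp
  ring

lemma matM_one {α₀ : ℝ} (hα : 0 < α₀) : matM 1 α₀ = matMIid α₀ := by
  obtain ⟨h0, h1, -⟩ := Upsilon_one_one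
  rw [iteratedDeriv_zero] at h0
  rw [iteratedDeriv_Upsilon_one] at h1
  have hD := psiDot_one hα
  have hpi : 2 * Real.pi ^ 2 - 3 ≠ 0 := by nlinarith [Real.pi_gt_three]
  ext i j
  simp only [matM, matMIid, varpi_one, alphaOne_one, h0, h1, hD, div_self (two_ne_zero (α := ℝ)), Real.one_rpow,
    Real.log_one, Matrix.smul_apply]
  fin_cases i <;> fin_cases j <;> simp <;> field_simp <;> ring

end Independent

/-! ### The Fréchet–Welsch distribution for independent observations -/

section IndependentLaw

lemma measure_ext_of_Iic_prod {μ ν : Measure (ℝ × ℝ)} [IsProbabilityMeasure μ] [IsProbabilityMeasure ν]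
    (h : ∀ x y, μ (Iic x ×ˢ Iic y) = ν (Iic x ×ˢ Iic y)) : μ = ν := by
  have hspan : IsCountablySpanning (range (Iic : ℝ → Set ℝ)) := by
    refine ⟨fun n : ℕ => Iic (n : ℝ), fun n => ⟨n, rfl⟩, ?_⟩
    ext x
    obtain ⟨n, hn⟩ := exists_nat_ge x
    simp only [mem_iUnion, mem_Iic, mem_univ, iff_true]
    exact ⟨n, hn⟩
  have hgen : MeasurableSpace.generateFrom (range (Iic : ℝ → Set ℝ)) = (inferInstance : MeasurableSpace ℝ) :=
    ((BorelSpace.measurable_eq (α := ℝ)).trans (borel_eq_generateFrom_Iic ℝ)).symm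
  refine ext_of_generate_finite _ (generateFrom_eq_prod hgen hgen hspan hspan).symm
    (isPiSystem_Iic.prod isPiSystem_Iic) ?_ (by simp)
  rintro _ ⟨_, ⟨x, rfl⟩, _, ⟨y, rfl⟩, rfl⟩
  exact h x y

lemma isProbabilityMeasure_restrict_Ioo : IsProbabilityMeasure ((volume : Measure ℝ).restrict (Ioo 0 1)) :=
  ⟨by simp⟩

/-- The map taking independent `v` and `b`, with `v` of Gamma law and `b` uniform, to the limit of
the two largest of many independent observations. -/
def gammaPair (α : ℝ) (z : ℝ × ℝ) : ℝ × ℝ :=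
  (Real.exp (-(Real.log z.1 + Real.log z.2) / α), Real.exp (-Real.log z.1 / α))

lemma measurable_gammaPair (α : ℝ) : Measurable (gammaPair α) := by
  unfold gammaPair
  fun_prop

lemma exp_le_iff_rpow_le {α v x : ℝ} (hα : 0 < α) (hv : 0 < v) (hx : 0 < x) :
    Real.exp (-Real.log v / α) ≤ x ↔ x ^ (-α) ≤ v := by
  rw [← Real.le_log_iff_exp_le hx, Real.rpow_def_of_pos hx, ← Real.le_log_iff_exp_le hv,
    div_le_iff₀ hα]
  constructor <;> intro h <;> linarith

/-- The Gamma density v e^{-v} cancels the denominator, and (v - u) e^{-v} has the primitive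
-e^{-v}(1 + v - u). -/
lemma setLIntegral_gammaMix_one {u m : ℝ} (hu : 0 < u) (hm : u ≤ m) :
    ∫⁻ v in Ici m, ENNReal.ofReal (1 - u / v) ∂gammaMix 1
      = ENNReal.ofReal (Real.exp (-m) * (1 + m - u)) := by
  have hd : ∀ v : ℝ, HasDerivAt (fun v => -(Real.exp (-v) * (1 + v - u))) ((v - u) * Real.exp (-v)) v :=
    fun v => (((hasDerivAt_neg v).exp).mul (((hasDerivAt_id v).const_add 1).sub_const u)).neg.congr_deriv
      (by simp only [id]; ring)
  have ht : Tendsto (fun v => -(Real.exp (-v) * (1 + v - u))) atTop (𝓝 0) := by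
    have h1 := Real.tendsto_exp_neg_atTop_nhds_zero.const_mul (1 - u)
    have h2 := Real.tendsto_pow_mul_exp_neg_atTop_nhds_zero 1
    have h3 := (h1.add h2).neg
    simp only [mul_zero, add_zero, neg_zero] at h3
    refine h3.congr fun v => ?_
    ring
  have hnn : ∀ x ∈ Ioi m, 0 ≤ (x - u) * Real.exp (-x) := fun x hx =>
    mul_nonneg (by have : m < x := hx; linarith) (Real.exp_pos _).le
  have hI := integral_Ioi_of_hasDerivAt_of_nonneg' (fun x _ => hd x) hnn ht (a := m)
  have hint := integrableOn_Ioi_deriv_of_nonneg' (fun x _ => hd x) hnn ht (a := m)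
  have hsub : Ioi m ∩ Ioi 0 = Ioi m := inter_eq_left.2 (Ioi_subset_Ioi (hu.le.trans hm))
  rw [gammaMix, restrict_withDensity measurableSet_Ici, Measure.restrict_restrict measurableSet_Ici,
    Measure.restrict_congr_set (Ioi_ae_eq_Ici.symm.inter (ae_eq_refl (Ioi (0 : ℝ))) :
      (Ici m ∩ Ioi 0 : Set ℝ) =ᵐ[volume] (Ioi m ∩ Ioi 0 : Set ℝ)), hsub,
    lintegral_withDensity_eq_lintegral_mul _ (by fun_prop) (by fun_prop)]
  have e : ∫⁻ v in Ioi m, ((fun v => ENNReal.ofReal (((1 - 1) + 1 * v) * Real.exp (-v))) *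
      fun v => ENNReal.ofReal (1 - u / v)) v
      = ∫⁻ v in Ioi m, ENNReal.ofReal ((v - u) * Real.exp (-v)) := by
    refine setLIntegral_congr_fun measurableSet_Ioi fun v hv => ?_
    have hv0 : 0 < v := hu.trans_le (hm.trans (le_of_lt hv))
    simp only [Pi.mul_apply]
    rw [← ENNReal.ofReal_mul (by positivity)]
    congr 1
    field_simp
    ring
  rw [e, ← ofReal_integral_eq_lintegral_ofReal hint ((ae_restrict_mem measurableSet_Ioi).mono hnn), hI]
  congr 1
  ring

lemma volume_section {u v : ℝ} (hu : 0 < u) (hv : 0 < v) :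
    ((volume : Measure ℝ).restrict (Ioo 0 1)) {b | u ≤ v * b} = ENNReal.ofReal (1 - u / v) := by
  have hset : {b | u ≤ v * b} = Ici (u / v) := by
    ext b
    simp only [mem_ofPred_eq, mem_Ici]
    rw [div_le_iff₀ hv, mul_comm]
  have h2 : Ici (u / v) ∩ Ioo 0 1 = Ico (u / v) 1 := by
    have : 0 < u / v := by positivity
    ext b
    simp only [mem_inter_iff, mem_Ici, mem_Ioo, mem_Ico]
    exact ⟨fun h => ⟨h.1, h.2.2⟩, fun h => ⟨h.1, this.trans_le h.1, h.2⟩⟩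
  rw [hset, Measure.restrict_apply measurableSet_Ici, h2, Real.volume_Ico]

/-- Given v, the event asks for v ≥ y^(-α) and b ≥ x^(-α)/v. The latter has conditional probability
1 - x^(-α)/v when v ≥ x^(-α) and zero otherwise, whence the maximum as lower limit of integration.
-/
lemma prod_gammaPair_preimage {α x y : ℝ} (hα : 0 < α) (hx : 0 < x) (hy : 0 < y) :
    ((gammaMix 1).prod ((volume : Measure ℝ).restrict (Ioo 0 1))) (gammaPair α ⁻¹' (Iic x ×ˢ Iic y))
      = ENNReal.ofReal (Real.exp (-max (x ^ (-α)) (y ^ (-α)))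
        * (1 + max (x ^ (-α)) (y ^ (-α)) - x ^ (-α))) := by
  have hu : 0 < x ^ (-α) := Real.rpow_pos_of_pos hx _
  rw [Measure.prod_apply (measurable_gammaPair α (measurableSet_Iic.prod measurableSet_Iic)),
    ← setLIntegral_gammaMix_one hu (le_max_left _ (y ^ (-α))), ← lintegral_indicator measurableSet_Ici]
  refine lintegral_congr_ae ?_
  filter_upwards [ae_pos_gammaMix] with v hv
  have hae : (Prod.mk v ⁻¹' (gammaPair α ⁻¹' (Iic x ×ˢ Iic y)) : Set ℝ)
      =ᵐ[(volume : Measure ℝ).restrict (Ioo 0 1)] {b | x ^ (-α) ≤ v * b ∧ y ^ (-α) ≤ v} := by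
    filter_upwards [ae_restrict_mem measurableSet_Ioo] with b hb
    refine propext ?_
    change gammaPair α (v, b) ∈ Iic x ×ˢ Iic y ↔ _
    rw [mem_prod, mem_Iic, mem_Iic, gammaPair, ← Real.log_mul hv.ne' hb.1.ne',
      exp_le_iff_rpow_le hα (mul_pos hv hb.1) hx, exp_le_iff_rpow_le hα hv hy]
    rfl
  rw [measure_congr hae]
  by_cases ht : y ^ (-α) ≤ v
  · simp only [ht, and_true]
    rw [volume_section hu hv]
    by_cases huv : x ^ (-α) ≤ v
    · rw [indicator_of_mem (show v ∈ Ici _ from max_le huv ht)]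
    · rw [indicator_of_notMem (show v ∉ Ici _ from fun h => huv ((le_max_left _ _).trans h)), ENNReal.ofReal_eq_zero]
      have : 1 ≤ x ^ (-α) / v := by
        rw [one_le_div hv]
        exact (not_le.1 huv).le
      linarith
  · simp only [ht, and_false]
    rw [indicator_of_notMem (show v ∉ Ici _ from fun h => ht ((le_max_right _ _).trans h))]
    simp

variable {ρ : ℝ → ℝ} {α : ℝ} {W : Measure (ℝ × ℝ)}

/-- For ρ(η) = 1 - η the second branch of the cdf is e^{-t}(1 + t - u) with t = y^(-α) and u =
x^(-α), because (y/x)^α t = u. This matches the cdf of the constructed pair. -/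
lemma HasWelschCDF.eq_map_gammaPair (h : HasWelschCDF ρ α 1 W) (hρ : ∀ η ∈ Icc (0 : ℝ) 1, ρ η = 1 - η)
    (hα : 0 < α) :
    W = ((gammaMix 1).prod ((volume : Measure ℝ).restrict (Ioo 0 1))).map (gammaPair α) := by
  have := h.1
  have := isProbabilityMeasure_restrict_Ioo
  have := isProbabilityMeasure_gammaMix (ρ₀ := 1) zero_le_one le_rfl
  have := Measure.isProbabilityMeasure_map (measurable_gammaPair α).aemeasurable
    (μ := (gammaMix 1).prod ((volume : Measure ℝ).restrict (Ioo 0 1)))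
  refine measure_ext_of_Iic_prod fun x y => ?_
  rw [h.2, Measure.map_apply (measurable_gammaPair α) (measurableSet_Iic.prod measurableSet_Iic), welschCDF]
  split_ifs with h1 h2
  · rw [ENNReal.ofReal_zero]
    symm
    convert measure_empty (μ := (gammaMix 1).prod ((volume : Measure ℝ).restrict (Ioo 0 1)))
    rw [eq_empty_iff_forall_notMem]
    rintro z ⟨hz1, hz2⟩
    have e1 : 0 < (gammaPair α z).1 := Real.exp_pos _
    have e2 : 0 < (gammaPair α z).2 := Real.exp_pos _
    have hz1' : (gammaPair α z).1 ≤ x := hz1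
    have hz2' : (gammaPair α z).2 ≤ y := hz2
    rcases h1 with h1 | h1 <;> linarith
  · push Not at h1
    have hle : y ^ (-α) ≤ x ^ (-α) := Real.rpow_le_rpow_of_nonpos h1.1 h2 (neg_nonpos.2 hα.le)
    rw [prod_gammaPair_preimage hα h1.1 h1.2, max_eq_left hle, div_one]
    congr 1
    ring
  · push Not at h1 h2
    have hle : x ^ (-α) ≤ y ^ (-α) := Real.rpow_le_rpow_of_nonpos h1.2 h2.le (neg_nonpos.2 hα.le)
    rw [prod_gammaPair_preimage hα h1.1 h1.2, max_eq_right hle, div_one,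
      hρ _ ⟨Real.rpow_nonneg (by have := h1.1; have := h1.2; positivity) _,
        Real.rpow_le_one (by have := h1.1; have := h1.2; positivity) ((div_le_one h1.1).2 h2.le) hα.le⟩]
    congr 2
    have e : (y / x) ^ α * y ^ (-α) = x ^ (-α) := by
      rw [Real.div_rpow h1.2.le h1.1.le, Real.rpow_neg h1.2.le, Real.rpow_neg h1.1.le]
      have := (Real.rpow_pos_of_pos h1.2 α).ne'
      have := (Real.rpow_pos_of_pos h1.1 α).ne'
      field_simp
    linear_combination -e

/-- In this representation Y depends on v only, whereas log X - log Y = -log b / α depends on b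
only. -/
lemma HasWelschCDF.covariance_log_ratio_eq_zero (h : HasWelschCDF ρ α 1 W)
    (hρ : ∀ η ∈ Icc (0 : ℝ) 1, ρ η = 1 - η) (hα : 0 < α) {g : ℝ → ℝ} (hg : Measurable g)
    (hg2 : MemLp (fun p : ℝ × ℝ => g p.2) 2 W)
    (hl2 : MemLp (fun p : ℝ × ℝ => Real.log p.1 - Real.log p.2) 2 W) :
    covariance (fun p : ℝ × ℝ => g p.2) (fun p => Real.log p.1 - Real.log p.2) W = 0 := by
  have := isProbabilityMeasure_restrict_Ioo
  have := isProbabilityMeasure_gammaMix (ρ₀ := 1) zero_le_one le_rfl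
  rw [h.eq_map_gammaPair hρ hα] at hg2 hl2 ⊢
  rw [covariance_map hg2.1 hl2.1 (measurable_gammaPair α).aemeasurable]
  have hg3 := hg2.comp_of_map (measurable_gammaPair α).aemeasurable
  have hl3 := hl2.comp_of_map (measurable_gammaPair α).aemeasurable
  refine IndepFun.covariance_eq_zero ?_ hg3 hl3
  have e1 : ((fun p : ℝ × ℝ => Real.log p.1 - Real.log p.2) ∘ gammaPair α)
      = fun z : ℝ × ℝ => -Real.log z.2 / α := by
    funext z
    simp only [Function.comp, gammaPair, Real.log_exp]
    ring
  rw [e1]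
  exact indepFun_prod (X := fun v => g (Real.exp (-Real.log v / α)))
    (Y := fun b => -Real.log b / α) (by fun_prop) (by fun_prop)

/-- Products of functions of this form are of the same form, with exponents and powers of the
logarithm added, so one moment formula yields all covariances. -/
lemma HasWelschCDF.covariance_snd (h : HasWelschCDF ρ α 1 W) (hρ : IsWelschFunction ρ) (hα : 0 < α)
    {b b' : ℝ} (hb : 0 ≤ b) (hb' : 0 ≤ b') {j j' : ℕ}
    (h2 : MemLp (fun p : ℝ × ℝ => p.2 ^ (-b) * Real.log p.2 ^ j) 2 W)
    (h2' : MemLp (fun p : ℝ × ℝ => p.2 ^ (-b') * Real.log p.2 ^ j') 2 W) :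
    covariance (fun p : ℝ × ℝ => p.2 ^ (-b) * Real.log p.2 ^ j)
      (fun p => p.2 ^ (-b') * Real.log p.2 ^ j') W
      = (-1 / α) ^ (j + j') * (iteratedDeriv (j + j') (Upsilon (ρ 0)) ((b + b') / α)
        - iteratedDeriv j (Upsilon (ρ 0)) (b / α) * iteratedDeriv j' (Upsilon (ρ 0)) (b' / α)) := by
  have := h.1
  rw [covariance_eq_sub h2 h2', h.integral_snd hρ hα (by linarith), h.integral_snd hρ hα (by linarith)]
  have e : ∫ p, ((fun p : ℝ × ℝ => p.2 ^ (-b) * Real.log p.2 ^ j)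
      * fun p : ℝ × ℝ => p.2 ^ (-b') * Real.log p.2 ^ j') p ∂W
      = ∫ p, p.2 ^ (-(b + b')) * Real.log p.2 ^ (j + j') ∂W := by
    refine integral_congr_ae ?_
    filter_upwards [h.ae_pos] with p hp
    simp only [Pi.mul_apply]
    rw [neg_add, Real.rpow_add hp.2, pow_add]
    ring
  rw [e, h.integral_snd hρ hα (by linarith), pow_add]
  ring

lemma HasWelschCDF.variance_log_fst (h : HasWelschCDF ρ α 1 W) (hα : 0 < α)
    (h2 : MemLp (fun p : ℝ × ℝ => Real.log p.1) 2 W) :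
    covariance (fun p : ℝ × ℝ => Real.log p.1) (fun p => Real.log p.1) W = Real.pi ^ 2 / 6 / α ^ 2 := by
  have := h.1
  have m1 := h.integral_fst hα (b := 0) (by linarith) 1
  have m2 := h.integral_fst hα (b := 0) (by linarith) 2
  simp only [neg_zero, Real.rpow_zero, one_mul, zero_div, pow_one, iteratedDeriv_Upsilon_zero_eq,
    zero_add, Real.iteratedDeriv_two_Gamma_one] at m1 m2
  rw [iteratedDeriv_one, Real.deriv_Gamma_one] at m1
  rw [covariance_eq_sub h2 h2, m1]
  have e : ∫ p, ((fun p : ℝ × ℝ => Real.log p.1) * fun p : ℝ × ℝ => Real.log p.1) p ∂W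
      = ∫ p, Real.log p.1 ^ 2 ∂W := by
    simp only [Pi.mul_apply, sq]
  rw [e, m2]
  field_simp
  ring

theorem sigma_iid {ρ : ℝ → ℝ} (hW : IsWelschFunction ρ) (hρ : ∀ η ∈ Icc (0 : ℝ) 1, ρ η = 1 - η)
    (hα : 0 < α) (h2 : ∀ j, MemLp (fct α j) 2 (frechetWelsch ρ α 1)) :
    (Matrix.of fun i j => covariance (fct α i) (fct α j) (frechetWelsch ρ α 1)) = sigmaIid α := by
  have h := hasWelschCDF_frechetWelsch hW hα one_pos
  have hρ0 : ρ 0 = 1 := by rw [hρ 0 (by simp), sub_zero]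
  have f0 : fct α 0 = fun p => p.2 ^ (-α) * Real.log p.2 ^ 1 := by simp [fct]
  have f1 : fct α 1 = fun p => p.2 ^ (-α) * Real.log p.2 ^ 0 := by simp [fct]
  have f2 : fct α 2 = fun p => p.2 ^ (-(0 : ℝ)) * Real.log p.2 ^ 1 := by simp [fct]
  have f3 : fct α 3 = fun p => Real.log p.1 := by simp [fct]
  have f2' : fct α 2 = fun p => Real.log p.2 := by simp [fct]
  obtain ⟨-, u01, u02⟩ := Upsilon_one_zero
  obtain ⟨u10, u11, u12⟩ := Upsilon_one_one
  obtain ⟨u20, u21, u22⟩ := Upsilon_one_two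
  have haa : (α + α) / α = 2 := by field_simp; norm_num
  have ha1 : α / α = 1 := div_self hα.ne'
  have hs := fun (b b' : ℝ) (hb : 0 ≤ b) (hb' : 0 ≤ b') (j j' : ℕ) =>
    h.covariance_snd hW hα hb hb' (j := j) (j' := j')
  have c00 := hs α α hα.le hα.le 1 1 (f0 ▸ h2 0) (f0 ▸ h2 0)
  have c01 := hs α α hα.le hα.le 1 0 (f0 ▸ h2 0) (f1 ▸ h2 1)
  have c02 := hs α 0 hα.le le_rfl 1 1 (f0 ▸ h2 0) (f2 ▸ h2 2)
  have c11 := hs α α hα.le hα.le 0 0 (f1 ▸ h2 1) (f1 ▸ h2 1)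
  have c12 := hs α 0 hα.le le_rfl 0 1 (f1 ▸ h2 1) (f2 ▸ h2 2)
  have c22 := hs 0 0 le_rfl le_rfl 1 1 (f2 ▸ h2 2) (f2 ▸ h2 2)
  rw [← f0] at c00
  rw [← f0, ← f1] at c01
  rw [← f0, ← f2] at c02
  rw [← f1] at c11
  rw [← f1, ← f2] at c12
  rw [← f2] at c22
  simp only [hρ0, haa, ha1, add_zero, zero_add, zero_div, Nat.reduceAdd, u01, u02, u10, u11, u12,
    u20, u21, u22] at c00 c01 c02 c11 c12 c22
  have hd : fct α 3 = fct α 2 + fun p => Real.log p.1 - Real.log p.2 := by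
    funext p
    simp [fct]
  have hl2 : MemLp (fun p : ℝ × ℝ => Real.log p.1 - Real.log p.2) 2 (frechetWelsch ρ α 1) := by
    have := (h2 3).sub (h2 2)
    rwa [f3, f2'] at this
  -- By independence of Y and the log-ratio, log x may be replaced by log y in a covariance with any
  -- function of y; this is why the last two columns of Σ agree in the first three rows.
  have hc3 : ∀ (g : ℝ → ℝ) (i : Fin 4), Measurable g → fct α i = (fun p => g p.2) →
      covariance (fct α i) (fct α 3) (frechetWelsch ρ α 1)
        = covariance (fct α i) (fct α 2) (frechetWelsch ρ α 1) := fun g i hg hi => by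
    rw [hd, covariance_add_right (h2 i) (h2 2) hl2]
    have hz := h.covariance_log_ratio_eq_zero hρ hα hg (hi ▸ h2 i) hl2
    rw [← hi] at hz
    rw [hz, add_zero]
  have c03 := hc3 (fun y => y ^ (-α) * Real.log y) 0 (by fun_prop) (by simp [fct])
  have c13 := hc3 (fun y => y ^ (-α)) 1 (by fun_prop) (by simp [fct])
  have c23 := hc3 (fun y => Real.log y) 2 (by fun_prop) (by simp [fct])
  have c33 := h.variance_log_fst hα (f3 ▸ h2 3)
  rw [← f3] at c33
  rw [c02] at c03
  rw [c12] at c13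
  rw [c22] at c23
  have c10 := (covariance_comm (fct α 1) (fct α 0)).trans c01
  have c20 := (covariance_comm (fct α 2) (fct α 0)).trans c02
  have c21 := (covariance_comm (fct α 2) (fct α 1)).trans c12
  have c30 := (covariance_comm (fct α 3) (fct α 0)).trans c03
  have c31 := (covariance_comm (fct α 3) (fct α 1)).trans c13
  have c32 := (covariance_comm (fct α 3) (fct α 2)).trans c23
  ext i j
  rw [Matrix.of_apply, sigmaIid]
  simp only [Matrix.smul_apply]
  fin_cases i <;> fin_cases j <;>
    simp [c00, c01, c02, c03, c10, c11, c12, c13, c20, c21, c22, c23, c30, c31, c32, c33] <;>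
    field_simp <;> ring

end IndependentLaw

end

theorem mainTheorem2 {Ω : Type*} [MeasurableSpace Ω] (P : Measure Ω) [IsProbabilityMeasure P]
    (ξ : ℤ → Ω → ℝ) (hξ : ∀ t, Measurable (ξ t))
    (ρ : ℝ → ℝ) (α₀ : ℝ) (σ : ℕ → ℝ) (r : ℕ → ℕ) (ω : ℝ) (B : Fin 4 → ℝ)
    (hr : Tendsto r atTop atTop) (hk : Tendsto (fun n => n / r n) atTop atTop)
    (hdoa : DomainOfAttraction P ξ ρ α₀ σ)
    (hdiv : AllDiverge P ξ r)
    (hmix : AlphaMixingRate P ξ r ω)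
    (hmom : IntegrabilityCondition P ξ σ (alphaOne (ρ 0) α₀) ω)
    (hbias : BiasCondition P ξ ρ α₀ σ r B)
    (c : ℝ) (hc : 0 < c) :
    Tendsto (fun n => P {w | ¬ ∃! θ, IsMLE (blockSample ξ c n (r n) w) θ}) atTop (𝓝 0) ∧
    TendstoInMeasure P
      (fun n w => estimationError ξ (ρ 0) α₀ σ r c n w
        - applyMat (matM (ρ 0) α₀) (empVector ξ ρ α₀ σ r c n w)) atTop (fun _ => 0) ∧
    TendstoInDistribution (fun n => estimationError ξ (ρ 0) α₀ σ r c n) atTop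
      (applyMat (matM (ρ 0) α₀)) (fun _ => P)
      (multivariateGaussian (WithLp.toLp 2 B) (sigmaDB ρ α₀)) ∧
    ((∀ η ∈ Icc (0 : ℝ) 1, ρ η = 1 - η) →
      alphaOne (ρ 0) α₀ = α₀ ∧ sOne (ρ 0) α₀ = 1 ∧ sigmaDB ρ α₀ = sigmaIid α₀ ∧
        matM (ρ 0) α₀ = matMIid α₀) := by
  obtain ⟨h1, h2, h3⟩ := pseudoMLE_asymptotics hξ hr hk hdoa hdiv hmix hmom hbias hc
  refine ⟨h1, h2, h3, fun hρ => ?_⟩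
  have hρ0 : ρ 0 = 1 := by rw [hρ 0 (by simp), sub_zero]
  have hα := hdoa.alpha_pos
  have ha : alphaOne (ρ 0) α₀ = α₀ := by rw [hρ0, alphaOne_one]
  refine ⟨ha, by rw [hρ0, sOne_one], ?_, by rw [hρ0, matM_one hα]⟩
  -- Only needed for square integrability of the four functions under the limit law, which the
  -- covariance computation requires.
  obtain ⟨s, S⟩ := BlockSetting.of_assumptions hξ hr hk hdoa hmix (ha.symm ▸ hα) hmom hc
  obtain ⟨q, hq, hqs⟩ := S.exists_exponent
  rw [ha] at S
  rw [sigmaDB, ha]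
  exact sigma_iid hdoa.welsch hρ hα fun j =>
    S.memLp_welsch (by linarith) hqs (envelopeBounded_fct hα hq j)
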